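/- Let $n\ge 0$, let $G\subset \mathrm{SL}_n(\mathbb C)$ be a finite subgroup, and let $Y$ be a separated scheme of finite type over $\mathbb C$, smooth of dimension $n$. Let $R=\mathbb C[x_1,\dots,x_n]$, so that $\mathbb C^n=\operatorname{Spec}R$, let $G$ act linearly on $\mathbb C^n$ and trivially on $Y$, and let $\pi\colon Y\times\mathbb C^n\to Y$ be the projection. The functor $\pi_*$ identifies quasi-coherent $G$-equivariant sheaves on $Y\times\mathbb C^n$ with quasi-coherent sheaves of $(R\rtimes G)\otimes_{\mathbb C}\mathcal O_Y$-modules. A *gnat-family* on $Y\times\mathbb C^n$ is a coherent $G$-equivariant sheaf $\mathcal F$ on $Y\times\mathbb C^n$, flat over $Y$, such that for every closed point $y\in Y$ the $G$-sheaf $\mathcal F|_{\{y\}\times\mathbb C^n}$ has space of global sections isomorphic to the regular representation of $G$ and is supported, as a set, on a single $G$-orbit. A *dual gnat-family* $\tilde{\mathcal F}$ of $\mathcal F$ is a gnat-family with an isomorphism of $(R\rtimes G)\otimes_{\mathbb C}\mathcal O_Y$-modules $\pi_*\tilde{\mathcal F}\cong \mathcal Hom_Y(\pi_*\mathcal F,\mathcal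 O_Y)$, where $(g\cdot\alpha)(s)=\alpha(g^{-1}s)$ and $(r\cdot\alpha)(s)=\alpha(rs)$ for $g\in G$, $r\in R$. Let $\mathcal F^\vee=\mathbf R\mathcal Hom_{Y\times\mathbb C^n}(\mathcal F,\mathcal O_{Y\times\mathbb C^n})$ be the derived dual in the derived category of $G$-equivariant sheaves on $Y\times\mathbb C^n$. **Proposition 2.1.** Let $\mathcal F$ be a gnat-family on $Y\times\mathbb C^n$. Then a dual gnat-family $\tilde{\mathcal F}$ of $\mathcal F$ exists, and for every such $\tilde{\mathcal F}$, viewed as a complex concentrated in degree $0$, there is an isomorphism $$\mathcal F^\vee[n]\;\cong\;\tilde{\mathcal F}$$ in the derived category of $G$-equivariant sheaves on $Y\times\mathbb C^n$. -/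

import Mathlib

open CategoryTheory Limits AlgebraicGeometry

universe u w

namespace EquivSheaf
noncomputable section

section Grothendieck
variable (X : Scheme.{u})

instance : AB5OfSize.{u, u} X.PresheafOfModules where
  ofShape J _ _ :=
    HasExactColimitsOfShape.domain_of_functor J (PresheafOfModules.toPresheaf _)

instance : AB5OfSize.{u, u} X.Modules where
  ofShape J _ _ :=
    (PresheafOfModules.sheafificationAdjunction (𝟙 X.ringCatSheaf.obj)).hasExactColimitsOfShape J

instance : HasSeparator X.Modules := by
  let F := PresheafOfModules.sheafification.{u} (𝟙 X.ringCatSheaf.obj)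
  let adj := PresheafOfModules.sheafificationAdjunction.{u} (𝟙 X.ringCatSheaf.obj)
  have h : (ObjectProperty.ofObj (C := X.Modules) (fun U : X.Opens ↦ F.obj
      ((PresheafOfModules.free _).obj (yoneda.obj U)))).IsSeparating := by
    intro M N f g hfg
    apply (SheafOfModules.forget _ ⋙ PresheafOfModules.restrictScalars
      (𝟙 X.ringCatSheaf.obj)).map_injective
    refine PresheafOfModules.freeYoneda.isSeparating _ _ _ ?_
    rintro _ ⟨U⟩ a
    apply (adj.homEquiv _ _).symm.injective
    exact (adj.homEquiv_naturality_right_symm a f).trans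
      ((hfg _ (ObjectProperty.ofObj_apply _ U) ((adj.homEquiv _ _).symm a)).trans
        (adj.homEquiv_naturality_right_symm a g).symm)
  exact ⟨_, h.isSeparator_coproduct⟩

instance : IsGrothendieckAbelian.{u} X.Modules where

end Grothendieck

section Equivariant

variable {X : Scheme.{u}} {G : Type} [Group G] (a : G →* End X)

/-- Direct image along the automorphism of `X` by which `g` acts. -/
abbrev push (g : G) : X.Modules ⥤ X.Modules := Scheme.Modules.pushforward (a g)

/-- The canonical isomorphism `M ≅ 1_* M`. -/
def pushOne : 𝟭 X.Modules ≅ push a 1 :=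
  (Scheme.Modules.pushforwardId X).symm ≪≫ Scheme.Modules.pushforwardCongr (map_one a).symm

/-- The canonical isomorphism `g_* h_* M ≅ (gh)_* M`. -/
def pushMul (g h : G) : push a h ⋙ push a g ≅ push a (g * h) :=
  Scheme.Modules.pushforwardComp (a h) (a g) ≪≫
    Scheme.Modules.pushforwardCongr (map_mul a g h).symm

lemma preimage_one (U : X.Opens) : (a 1) ⁻¹ᵁ U = U := by
  rw [map_one]; rfl

lemma preimage_mul (g h : G) (U : X.Opens) :
    (a (g * h)) ⁻¹ᵁ U = (a h) ⁻¹ᵁ ((a g) ⁻¹ᵁ U) := by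
  rw [map_mul]; rfl

lemma pushOne_app (M : X.Modules) (U : X.Opens) :
    ((pushOne a).hom.app M).app U = M.presheaf.map (eqToHom (preimage_one a U)).op := by
  rw [pushOne, Iso.trans_hom, NatTrans.comp_app, Scheme.Modules.Hom.comp_app]
  exact Category.id_comp _

lemma pushMul_app (g h : G) (M : X.Modules) (U : X.Opens) :
    ((pushMul a g h).hom.app M).app U =
      M.presheaf.map (eqToHom (preimage_mul a g h U)).op := by
  rw [pushMul, Iso.trans_hom, NatTrans.comp_app, Scheme.Modules.Hom.comp_app]
  exact Category.id_comp _

/-- A `G`-equivariant sheaf of `𝒪_X`-modules. -/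
structure GSheaf where
  sheaf : X.Modules
  act (g : G) : sheaf ⟶ (push a g).obj sheaf
  act_one : act 1 = (pushOne a).hom.app sheaf
  act_mul (g h : G) :
    act (g * h) = act g ≫ (push a g).map (act h) ≫ (pushMul a g h).hom.app sheaf

namespace GSheaf

variable {a}

@[ext]
structure Hom (M N : GSheaf a) where
  hom : M.sheaf ⟶ N.sheaf
  comm (g : G) : M.act g ≫ (push a g).map hom = hom ≫ N.act g := by cat_disch


instance : Category (GSheaf a) where
  Hom := Hom
  id M := { hom := 𝟙 _ }
  comp f g := { hom := f.hom ≫ g.hom, comm := fun x ↦ by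
                  rw [Functor.map_comp, reassoc_of% f.comm, g.comm, Category.assoc] }

@[simp] lemma id_hom (M : GSheaf a) : Hom.hom (𝟙 M) = 𝟙 M.sheaf := rfl
@[simp] lemma comp_hom {M N P : GSheaf a} (f : M ⟶ N) (g : N ⟶ P) :
    (f ≫ g).hom = f.hom ≫ g.hom := rfl

@[ext] lemma hom_ext {M N : GSheaf a} {f g : M ⟶ N} (h : f.hom = g.hom) : f = g := Hom.ext h

instance {M N : GSheaf a} : Zero (M ⟶ N) := ⟨{ hom := 0, comm := by simp }⟩
instance {M N : GSheaf a} : Add (M ⟶ N) :=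
  ⟨fun f g ↦ Hom.mk (f.hom + g.hom) fun x ↦ by
    rw [Functor.map_add, Preadditive.comp_add, Preadditive.add_comp, f.comm, g.comm]⟩
instance {M N : GSheaf a} : Neg (M ⟶ N) :=
  ⟨fun f ↦ Hom.mk (-f.hom) fun x ↦ by
    rw [Functor.map_neg, Preadditive.comp_neg, Preadditive.neg_comp, f.comm]⟩

@[simp] lemma zero_hom {M N : GSheaf a} : (0 : M ⟶ N).hom = 0 := rfl
@[simp] lemma add_hom {M N : GSheaf a} (f g : M ⟶ N) : (f + g).hom = f.hom + g.hom := rfl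
@[simp] lemma neg_hom {M N : GSheaf a} (f : M ⟶ N) : (-f).hom = -f.hom := rfl

instance {M N : GSheaf a} : AddCommGroup (M ⟶ N) where
  add_assoc _ _ _ := by ext1; simp [add_assoc]
  zero_add _ := by ext1; simp
  add_zero _ := by ext1; simp
  add_comm _ _ := by ext1; simp [add_comm]
  neg_add_cancel _ := by ext1; simp
  nsmul := nsmulRec
  zsmul := zsmulRec

instance : Preadditive (GSheaf a) where
  add_comp _ _ _ _ _ _ := by ext1; simp
  comp_add _ _ _ _ _ _ := by ext1; simp

variable (a) in
/-- Forget the equivariant structure. -/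
@[simps] def forget : GSheaf a ⥤ X.Modules where
  obj M := M.sheaf
  map f := f.hom

instance : (forget a).Additive where
instance : (forget a).Faithful where
  map_injective h := hom_ext h

instance : (forget a).ReflectsIsomorphisms where
  reflects {M N} f hf := by
    have : IsIso f.hom := hf
    refine ⟨⟨⟨inv f.hom, fun g ↦ ?_⟩, ?_, ?_⟩⟩
    · rw [Functor.map_inv, IsIso.comp_inv_eq, Category.assoc, f.comm, IsIso.inv_hom_id_assoc]
    · ext1; simp
    · ext1; simp

section Limits
variable {J : Type} [Category.{0} J] (D : J ⥤ GSheaf a)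

section Cones
variable {D} (c : Cone (D ⋙ forget a))

/-- The projections of a cone on the underlying diagram of sheaves. -/
def coneProj (j : J) : c.pt ⟶ (D.obj j).sheaf := c.π.app j

lemma coneProj_w {i j : J} (f : i ⟶ j) : coneProj c i ≫ (D.map f).hom = coneProj c j := c.w f

/-- Auxiliary cone for the equivariant structure on a limit. -/
def actCone (g : G) : Cone ((D ⋙ forget a) ⋙ push a g) where
  pt := c.pt
  π := { app := fun j ↦ coneProj c j ≫ (D.obj j).act g
         naturality := fun i j f ↦ by
           have : coneProj c j ≫ (D.obj j).act g =
             (coneProj c i ≫ (D.obj i).act g) ≫ (push a g).map (D.map f).hom := by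
             rw [Category.assoc, (D.map f).comm, reassoc_of% @coneProj_w]
           exact (Category.id_comp _).trans this }

variable {c} (hc : IsLimit c)

/-- The equivariant structure on a limit. -/
def limAct (g : G) : c.pt ⟶ (push a g).obj c.pt :=
  (isLimitOfPreserves (push a g) hc).lift (actCone c g)

lemma limAct_proj (g : G) (j : J) :
    limAct hc g ≫ (push a g).map (coneProj c j) = coneProj c j ≫ (D.obj j).act g :=
  (isLimitOfPreserves (push a g) hc).fac (actCone c g) j

lemma lim_hom_ext (hc : IsLimit c) (g : G) {P : X.Modules} {u v : P ⟶ (push a g).obj c.pt}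
    (h : ∀ j, u ≫ (push a g).map (coneProj c j) = v ≫ (push a g).map (coneProj c j)) : u = v :=
  (isLimitOfPreserves (push a g) hc).hom_ext h

/-- The limit of a diagram of equivariant sheaves. -/
def limitObj : GSheaf a where
  sheaf := c.pt
  act := limAct hc
  act_one := by
    refine lim_hom_ext hc _ fun j ↦ ?_
    rw [limAct_proj, (D.obj j).act_one]
    exact (pushOne a).hom.naturality (coneProj c j)
  act_mul g h := by
    refine lim_hom_ext hc _ fun j ↦ ?_
    have e3 := (pushMul a g h).hom.naturality (coneProj c j)
    rw [limAct_proj, (D.obj j).act_mul, Category.assoc, Category.assoc, ← e3,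
      Functor.comp_map, ← Functor.map_comp_assoc, limAct_proj, Functor.map_comp_assoc,
      reassoc_of% @limAct_proj]

/-- The limit cone of a diagram of equivariant sheaves. -/
def limitCone : Cone D where
  pt := limitObj hc
  π := { app := fun j ↦ Hom.mk (coneProj c j) fun g ↦ limAct_proj hc g j
         naturality := fun i j f ↦ by
           ext1
           exact (Category.id_comp _).trans (coneProj_w c f).symm }

/-- The morphism to a limit induced by a cone of equivariant sheaves. -/
def limLift (s : Cone D) : s.pt.sheaf ⟶ c.pt := hc.lift ((forget a).mapCone s)

lemma limLift_proj (s : Cone D) (j : J) : limLift hc s ≫ coneProj c j = (s.π.app j).hom :=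
  hc.fac _ j

lemma limLift_comm (s : Cone D) (g : G) :
    s.pt.act g ≫ (push a g).map (limLift hc s) = limLift hc s ≫ limAct hc g := by
  refine lim_hom_ext hc _ fun j ↦ ?_
  rw [Category.assoc, Category.assoc, ← Functor.map_comp, limLift_proj, limAct_proj,
    reassoc_of% @limLift_proj]
  exact (s.π.app j).comm g

/-- `limitCone` is a limit. -/
def isLimitLimitCone : IsLimit (limitCone hc) where
  lift s := Hom.mk (limLift hc s) (limLift_comm hc s)
  fac s j := by
    ext1
    exact hc.fac _ j
  uniq s m hm := by
    ext1
    exact hc.uniq ((forget a).mapCone s) m.hom fun j ↦ congrArg Hom.hom (hm j)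

end Cones

instance : HasLimitsOfShape J (GSheaf a) where
  has_limit D := ⟨⟨_, isLimitLimitCone (limit.isLimit (D ⋙ forget a))⟩⟩

instance : PreservesLimitsOfShape J (forget a) where
  preservesLimit {D} := preservesLimit_of_preserves_limit_cone
    (isLimitLimitCone (limit.isLimit (D ⋙ forget a))) (limit.isLimit (D ⋙ forget a))

section Cocones
variable {D} (c : Cocone (D ⋙ forget a))

/-- The inclusions of a cocone on the underlying diagram of sheaves. -/
def coconeIncl (j : J) : (D.obj j).sheaf ⟶ c.pt := c.ι.app j

lemma coconeIncl_w {i j : J} (f : i ⟶ j) : (D.map f).hom ≫ coconeIncl c j = coconeIncl c i :=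
  c.w f

/-- Auxiliary cocone for the equivariant structure on a colimit. -/
def actCocone (g : G) : Cocone (D ⋙ forget a) where
  pt := (push a g).obj c.pt
  ι := { app := fun j ↦ (D.obj j).act g ≫ (push a g).map (coconeIncl c j)
         naturality := fun i j f ↦ by
           have : (D.map f).hom ≫ (D.obj j).act g ≫ (push a g).map (coconeIncl c j) =
             (D.obj i).act g ≫ (push a g).map (coconeIncl c i) := by
             rw [← reassoc_of% @Hom.comm, ← Functor.map_comp, coconeIncl_w]
           exact this.trans (Category.comp_id _).symm }

variable {c} (hc : IsColimit c)

/-- The equivariant structure on a colimit. -/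
def colimAct (g : G) : c.pt ⟶ (push a g).obj c.pt := hc.desc (actCocone c g)

lemma incl_colimAct (g : G) (j : J) :
    coconeIncl c j ≫ colimAct hc g = (D.obj j).act g ≫ (push a g).map (coconeIncl c j) :=
  hc.fac (actCocone c g) j

lemma colim_hom_ext (hc : IsColimit c) {P : X.Modules} {u v : c.pt ⟶ P}
    (h : ∀ j, coconeIncl c j ≫ u = coconeIncl c j ≫ v) : u = v :=
  hc.hom_ext h

/-- The colimit of a diagram of equivariant sheaves. -/
def colimitObj : GSheaf a where
  sheaf := c.pt
  act := colimAct hc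
  act_one := by
    refine colim_hom_ext hc fun j ↦ ?_
    rw [incl_colimAct, (D.obj j).act_one]
    exact ((pushOne a).hom.naturality (coconeIncl c j)).symm
  act_mul g h := by
    refine colim_hom_ext hc fun j ↦ ?_
    have e3 := (pushMul a g h).hom.naturality (coconeIncl c j)
    rw [incl_colimAct, reassoc_of% @incl_colimAct, (D.obj j).act_mul, Category.assoc, Category.assoc,
      ← e3, Functor.comp_map, ← Functor.map_comp_assoc, ← Functor.map_comp_assoc, incl_colimAct]

/-- The colimit cocone of a diagram of equivariant sheaves. -/
def colimitCocone : Cocone D where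
  pt := colimitObj hc
  ι := { app := fun j ↦ Hom.mk (coconeIncl c j) fun g ↦ (incl_colimAct hc g j).symm
         naturality := fun i j f ↦ by
           ext1
           exact (coconeIncl_w c f).trans (Category.comp_id _).symm }

/-- The morphism from a colimit induced by a cocone of equivariant sheaves. -/
def colimDesc (s : Cocone D) : c.pt ⟶ s.pt.sheaf := hc.desc ((forget a).mapCocone s)

lemma incl_colimDesc (s : Cocone D) (j : J) :
    coconeIncl c j ≫ colimDesc hc s = (s.ι.app j).hom :=
  hc.fac _ j

lemma colimDesc_comm (s : Cocone D) (g : G) :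
    colimAct hc g ≫ (push a g).map (colimDesc hc s) = colimDesc hc s ≫ s.pt.act g := by
  refine colim_hom_ext hc fun j ↦ ?_
  rw [reassoc_of% @incl_colimAct, ← Functor.map_comp, incl_colimDesc, reassoc_of% @incl_colimDesc]
  exact (s.ι.app j).comm g

/-- `colimitCocone` is a colimit. -/
def isColimitColimitCocone : IsColimit (colimitCocone hc) where
  desc s := Hom.mk (colimDesc hc s) (colimDesc_comm hc s)
  fac s j := by
    ext1
    exact hc.fac _ j
  uniq s m hm := by
    ext1
    exact hc.uniq ((forget a).mapCocone s) m.hom fun j ↦ congrArg Hom.hom (hm j)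

end Cocones

instance : HasColimitsOfShape J (GSheaf a) where
  has_colimit D := ⟨⟨_, isColimitColimitCocone (colimit.isColimit (D ⋙ forget a))⟩⟩

instance : PreservesColimitsOfShape J (forget a) where
  preservesColimit {D} := preservesColimit_of_preserves_colimit_cocone
    (isColimitColimitCocone (colimit.isColimit (D ⋙ forget a)))
    (colimit.isColimit (D ⋙ forget a))

end Limits

instance : HasFiniteLimits (GSheaf a) := ⟨fun _ ↦ inferInstance⟩
instance : HasFiniteColimits (GSheaf a) := ⟨fun _ ↦ inferInstance⟩
instance : PreservesFiniteLimits (forget a) := ⟨fun _ ↦ inferInstance⟩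
instance : PreservesFiniteColimits (forget a) := ⟨fun _ ↦ inferInstance⟩

instance : Abelian (GSheaf a) := by
  have (M N : GSheaf a) (f : M ⟶ N) : IsIso (Abelian.coimageImageComparison f) := by
    rw [← isIso_iff_of_reflects_iso _ (forget a)]
    have e := Abelian.PreservesCoimage.hom_coimageImageComparison (forget a) f
    rw [← Iso.comp_inv_eq] at e
    rw [← e]
    infer_instance
  exact Abelian.ofCoimageImageComparisonIsIso

end GSheaf

section EnoughInjectives

lemma pushOne_inv_app (M : X.Modules) (U : X.Opens) :
    ((pushOne a).inv.app M).app U = M.presheaf.map (eqToHom (preimage_one a U).symm).op := by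
  rw [pushOne, Iso.trans_inv, NatTrans.comp_app, Scheme.Modules.Hom.comp_app]
  exact Category.comp_id _

lemma pushMul_inv_app (g h : G) (M : X.Modules) (U : X.Opens) :
    ((pushMul a g h).inv.app M).app U =
      M.presheaf.map (eqToHom (preimage_mul a g h U).symm).op := by
  rw [pushMul, Iso.trans_inv, NatTrans.comp_app, Scheme.Modules.Hom.comp_app]
  exact Category.comp_id _

/-- Direct images along equal group elements agree. -/
def pushCongr {g h : G} (e : g = h) : push a g ≅ push a h :=
  Scheme.Modules.pushforwardCongr (congrArg a e)

lemma pushCongr_app {g h : G} (e : g = h) (M : X.Modules) (U : X.Opens) :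
    ((pushCongr a e).hom.app M).app U = M.presheaf.map (eqToHom (show (a h) ⁻¹ᵁ U = (a g) ⁻¹ᵁ U by rw [e])).op := rfl

lemma pushCongr_refl (g : G) (M : X.Modules) : (pushCongr a (rfl : g = g)).hom.app M = 𝟙 _ := by
  ext U : 1
  rw [pushCongr_app]
  exact M.presheaf.map_id _

lemma push_assoc (h k g : G) (M : X.Modules) :
    (pushCongr a (mul_assoc h k g)).hom.app M ≫ (pushMul a h (k * g)).inv.app M ≫
      (push a h).map ((pushMul a k g).inv.app M) ≫ (pushMul a h k).hom.app ((push a g).obj M) =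
    (pushMul a (h * k) g).inv.app M := by
  ext U : 1
  simp only [Scheme.Modules.Hom.comp_app, pushCongr_app, pushMul_inv_app, pushMul_app,
    Scheme.Modules.pushforward_map_app]
  erw [← M.presheaf.map_comp, ← M.presheaf.map_comp, ← M.presheaf.map_comp]
  rfl

lemma push_one_mul (g : G) (M : X.Modules) :
    (pushCongr a (one_mul g).symm).hom.app M ≫ (pushMul a 1 g).inv.app M =
    (pushOne a).hom.app ((push a g).obj M) := by
  ext U : 1
  simp only [Scheme.Modules.Hom.comp_app, pushCongr_app, pushMul_inv_app, pushOne_app]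
  erw [← M.presheaf.map_comp]
  rfl

namespace GSheaf
variable {a}

/-- The product of all translates of a sheaf. -/
abbrev coindSheaf (a : G →* End X) (M : X.Modules) : X.Modules := ∏ᶜ fun g ↦ (push a g).obj M

abbrev coindProj (a : G →* End X) (M : X.Modules) (g : G) : coindSheaf a M ⟶ (push a g).obj M := Pi.π _ g

lemma coindProj_congr (M : X.Modules) {g h : G} (e : g = h) :
    coindProj a M g ≫ (pushCongr a e).hom.app M = coindProj a M h := by
  subst e
  rw [pushCongr_refl, Category.comp_id]

/-- A direct image of a product is a product. -/
def isLimitPushCoind (M : X.Modules) (h : G) :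
    IsLimit ((push a h).mapCone (limit.cone (Discrete.functor fun g ↦ (push a g).obj M))) :=
  isLimitOfPreserves (push a h) (limit.isLimit _)

lemma coind_hom_ext (M : X.Modules) (h : G) {P : X.Modules}
    {u v : P ⟶ (push a h).obj (coindSheaf a M)}
    (H : ∀ g, u ≫ (push a h).map (coindProj a M g) = v ≫ (push a h).map (coindProj a M g)) : u = v :=
  (isLimitPushCoind M h).hom_ext fun ⟨g⟩ ↦ H g

def coindAct (M : X.Modules) (h : G) : coindSheaf a M ⟶ (push a h).obj (coindSheaf a M) :=
  (isLimitPushCoind M h).lift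
    { pt := coindSheaf a M
      π := Discrete.natTrans fun g ↦ coindProj a M (h * g.as) ≫ (pushMul a h g.as).inv.app M }

lemma coindAct_proj (M : X.Modules) (h g : G) :
    coindAct M h ≫ (push a h).map (coindProj a M g) =
      coindProj a M (h * g) ≫ (pushMul a h g).inv.app M :=
  (isLimitPushCoind M h).fac _ ⟨g⟩

/-- The equivariant sheaf coinduced from a sheaf of modules. -/
def coind (a : G →* End X) (M : X.Modules) : GSheaf a where
  sheaf := coindSheaf a M
  act := coindAct M
  act_one := by
    refine coind_hom_ext M _ fun g ↦ ?_
    have e := (pushOne a).hom.naturality (coindProj a M g)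
    rw [← e, coindAct_proj, Functor.id_map, ← push_one_mul, ← Category.assoc, coindProj_congr]
  act_mul h k := by
    refine coind_hom_ext M _ fun g ↦ ?_
    have e := (pushMul a h k).hom.naturality (coindProj a M g)
    rw [Category.assoc, Category.assoc, ← e, Functor.comp_map, ← Functor.map_comp_assoc,
      coindAct_proj, coindAct_proj, Functor.map_comp_assoc, reassoc_of% @coindAct_proj, ← push_assoc,
      ← Category.assoc, coindProj_congr]

/-- The sheaf morphism underlying Frobenius reciprocity. -/
def toCoindHom (N : GSheaf a) {M : X.Modules} (φ : N.sheaf ⟶ M) : N.sheaf ⟶ coindSheaf a M :=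
  Pi.lift fun g ↦ N.act g ≫ (push a g).map φ

lemma toCoindHom_proj (N : GSheaf a) {M : X.Modules} (φ : N.sheaf ⟶ M) (g : G) :
    toCoindHom N φ ≫ coindProj a M g = N.act g ≫ (push a g).map φ := limit.lift_π _ _

lemma toCoindHom_comm (N : GSheaf a) {M : X.Modules} (φ : N.sheaf ⟶ M) (h : G) :
    N.act h ≫ (push a h).map (toCoindHom N φ) = toCoindHom N φ ≫ coindAct M h := by
  refine coind_hom_ext M _ fun g ↦ ?_
  have e2 := (pushMul a h g).hom.naturality φ
  have e3 := toCoindHom_proj N φ (h * g)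
  have e4 : (pushMul a h g).hom.app M ≫ (pushMul a h g).inv.app M = 𝟙 _ :=
    Iso.hom_inv_id_app _ _
  rw [Functor.comp_map] at e2
  rw [Category.assoc, Category.assoc, ← Functor.map_comp, toCoindHom_proj, coindAct_proj,
    reassoc_of% e3, N.act_mul, Category.assoc, Category.assoc, ← reassoc_of% e2, e4,
    Functor.map_comp]
  congr 2

/-- Frobenius reciprocity. -/
def toCoind (N : GSheaf a) {M : X.Modules} (φ : N.sheaf ⟶ M) : N ⟶ coind a M :=
  Hom.mk (toCoindHom N φ) (toCoindHom_comm N φ)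

/-- Evaluation at the neutral element. -/
def coindEval (M : X.Modules) : coindSheaf a M ⟶ M :=
  coindProj a M 1 ≫ (pushOne a).inv.app M

lemma toCoind_eval (N : GSheaf a) {M : X.Modules} (φ : N.sheaf ⟶ M) :
    toCoindHom N φ ≫ coindEval M = φ := by
  have e := (pushOne a).hom.naturality φ
  have e1 := toCoindHom_proj N φ 1
  have e4 : (pushOne a).hom.app M ≫ (pushOne a).inv.app M = 𝟙 _ := Iso.hom_inv_id_app _ _
  rw [Functor.id_map] at e
  rw [coindEval, reassoc_of% e1, N.act_one, ← reassoc_of% e, e4]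
  exact Category.comp_id _

/-- The sheaf morphism underlying a morphism to a coinduced sheaf. -/
def coindHom {N : GSheaf a} {M : X.Modules} (ψ : N ⟶ coind a M) : N.sheaf ⟶ coindSheaf a M :=
  ψ.hom

lemma eq_toCoindHom (N : GSheaf a) {M : X.Modules} (ψ : N ⟶ coind a M) :
    coindHom ψ = toCoindHom N (coindHom ψ ≫ coindEval M) := by
  refine Pi.hom_ext _ _ fun g ↦ ?_
  have e := toCoindHom_proj N (coindHom ψ ≫ coindEval M) g
  refine Eq.trans ?_ e.symm
  have e1 : N.act g ≫ (push a g).map (coindHom ψ) = coindHom ψ ≫ coindAct M g := ψ.comm g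
  rw [Functor.map_comp, reassoc_of% e1, coindEval, Functor.map_comp, reassoc_of% @coindAct_proj]
  have e2 : (pushMul a g 1).inv.app M ≫ (push a g).map ((pushOne a).inv.app M) =
      (pushCongr a (mul_one g)).hom.app M := by
    ext U : 1
    rw [Scheme.Modules.Hom.comp_app, pushCongr_app, pushMul_inv_app,
      Scheme.Modules.pushforward_map_app, pushOne_inv_app]
    erw [← M.presheaf.map_comp]
    rfl
  rw [e2, coindProj_congr]

lemma toCoind_comp {N N' : GSheaf a} {M : X.Modules} (f : N ⟶ N') (φ : N'.sheaf ⟶ M) :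
    f ≫ toCoind N' φ = toCoind N (f.hom ≫ φ) := by
  ext1
  have e := eq_toCoindHom N (f ≫ toCoind N' φ)
  have e1 : coindHom (f ≫ toCoind N' φ) = f.hom ≫ toCoindHom N' φ := rfl
  rw [e1, Category.assoc, toCoind_eval] at e
  exact e

lemma eq_toCoind (N : GSheaf a) {M : X.Modules} (ψ : N ⟶ coind a M) :
    ψ = toCoind N (coindHom ψ ≫ coindEval M) := by
  ext1
  exact eq_toCoindHom N ψ

instance : EnoughInjectives (GSheaf a) where
  presentation N := by
    let I := Injective.under N.sheaf
    have hI : Injective (coind a I) := ⟨fun {M M'} ψ f _ ↦ by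
      have : Mono f.hom := inferInstanceAs (Mono ((forget a).map f))
      obtain ⟨φ, hφ⟩ := Injective.factors (coindHom ψ ≫ coindEval I) f.hom
      exact ⟨toCoind M' φ, by rw [toCoind_comp, hφ, ← eq_toCoind]⟩⟩
    have hm : Mono (toCoind N (Injective.ι N.sheaf)) := by
      apply (forget a).mono_of_mono_map
      have : Mono (toCoindHom N (Injective.ι N.sheaf) ≫ coindEval I) := by
        rw [toCoind_eval]; infer_instance
      exact mono_of_mono (toCoindHom N (Injective.ι N.sheaf)) (coindEval I)
    exact ⟨⟨coind a I, hI, _, hm⟩⟩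

end GSheaf
end EnoughInjectives

end Equivariant

section InternalHom

variable {X : Scheme.{u}}

/-- Restriction of sections. -/
def res (M : X.Modules) {V U : X.Opens} (h : V ≤ U) : Γ(M, U) →+ Γ(M, V) :=
  (M.presheaf.map (homOfLE h).op).hom

/-- Restriction of functions. -/
def resO {V U : X.Opens} (h : V ≤ U) : Γ(X, U) →+* Γ(X, V) :=
  (X.presheaf.map (homOfLE h).op).hom

lemma res_self (M : X.Modules) {U : X.Opens} (h : U ≤ U) (s : Γ(M, U)) : res M h s = s :=
  ConcreteCategory.congr_hom (M.presheaf.map_id (.op U)) s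

lemma res_res (M : X.Modules) {W V U : X.Opens} (h : W ≤ V) (h' : V ≤ U) (s : Γ(M, U)) :
    res M h (res M h' s) = res M (h.trans h') s :=
  (ConcreteCategory.congr_hom (M.presheaf.map_comp (homOfLE h').op (homOfLE h).op) s).symm

lemma resO_resO {W V U : X.Opens} (h : W ≤ V) (h' : V ≤ U) (s : Γ(X, U)) :
    resO h (resO h' s) = resO (h.trans h') s :=
  (ConcreteCategory.congr_hom (X.presheaf.map_comp (homOfLE h').op (homOfLE h).op) s).symm

lemma resO_self {U : X.Opens} (h : U ≤ U) (s : Γ(X, U)) : resO h s = s :=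
  ConcreteCategory.congr_hom (X.presheaf.map_id (.op U)) s

lemma res_smul (M : X.Modules) {V U : X.Opens} (h : V ≤ U) (r : Γ(X, U)) (s : Γ(M, U)) :
    res M h (r • s) = resO h r • res M h s :=
  Scheme.Modules.map_smul M (homOfLE h) r s

lemma app_res {M N : X.Modules} (f : M ⟶ N) {V U : X.Opens} (h : V ≤ U) (s : Γ(M, U)) :
    (f.app V).hom (res M h s) = res N h ((f.app U).hom s) :=
  ConcreteCategory.congr_hom (f.mapPresheaf.naturality (homOfLE h).op) s

lemma res_locally_eq (M : X.Modules) {ι : Type u} {U : ι → X.Opens} {V : X.Opens}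
    (hV : ∀ i, U i ≤ V) (hc : V ≤ iSup U) {s t : Γ(M, V)}
    (h : ∀ i, res M (hV i) s = res M (hV i) t) : s = t :=
  TopCat.Sheaf.eq_of_locally_eq' ⟨M.presheaf, M.isSheaf⟩ U V (fun i ↦ homOfLE (hV i)) hc s t h

lemma res_glue (M : X.Modules) {ι : Type u} {U : ι → X.Opens} {V : X.Opens}
    (hV : ∀ i, U i ≤ V) (hc : V ≤ iSup U) (s : ∀ i, Γ(M, U i))
    (h : ∀ i j, res M (inf_le_left : U i ⊓ U j ≤ U i) (s i) =
      res M (inf_le_right : U i ⊓ U j ≤ U j) (s j)) :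
    ∃ t : Γ(M, V), ∀ i, res M (hV i) t = s i :=
  (TopCat.Sheaf.existsUnique_gluing' ⟨M.presheaf, M.isSheaf⟩ U V
    (fun i ↦ homOfLE (hV i)) hc s h).exists

/-- The homomorphisms `M|_U ⟶ N|_U` of sheaves of modules: families of additive maps on sections
over the open subsets of `U`, linear over functions and compatible with restrictions. -/
def localHom (M N : X.Modules) (U : X.Opens) :
    AddSubgroup (∀ V : {V : X.Opens // V ≤ U}, Γ(M, V.1) →+ Γ(N, V.1)) where
  carrier := {φ | (∀ V (r : Γ(X, V.1)) s, φ V (r • s) = r • φ V s) ∧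
    ∀ V W (h : V.1 ≤ W.1) s, φ V (res M h s) = res N h (φ W s)}
  zero_mem' := ⟨fun _ _ _ ↦ (smul_zero _).symm, fun _ _ _ _ ↦ (map_zero _).symm⟩
  add_mem' {φ ψ} hφ hψ := ⟨fun V r s ↦ by
      rw [Pi.add_apply, AddMonoidHom.add_apply, AddMonoidHom.add_apply, hφ.1, hψ.1, smul_add],
    fun V W h s ↦ by
      rw [Pi.add_apply, Pi.add_apply, AddMonoidHom.add_apply, AddMonoidHom.add_apply, hφ.2 V W h,
        hψ.2 V W h, map_add]⟩
  neg_mem' {φ} hφ := ⟨fun V r s ↦ by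
      rw [Pi.neg_apply, AddMonoidHom.neg_apply, AddMonoidHom.neg_apply, hφ.1, smul_neg],
    fun V W h s ↦ by
      rw [Pi.neg_apply, Pi.neg_apply, AddMonoidHom.neg_apply, AddMonoidHom.neg_apply, hφ.2 V W h,
        map_neg]⟩

variable {M N : X.Modules}

/-- The action of a local homomorphism on sections. -/
def ev {U : X.Opens} (φ : localHom M N U) {V : X.Opens} (h : V ≤ U) : Γ(M, V) →+ Γ(N, V) :=
  φ.1 ⟨V, h⟩

lemma ev_smul {U : X.Opens} (φ : localHom M N U) {V : X.Opens} (h : V ≤ U) (r : Γ(X, V))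
    (s : Γ(M, V)) : ev φ h (r • s) = r • ev φ h s := φ.2.1 ⟨V, h⟩ r s

lemma ev_res {U : X.Opens} (φ : localHom M N U) {V W : X.Opens} (h : W ≤ U) (h' : V ≤ W)
    (s : Γ(M, W)) : ev φ (h'.trans h) (res M h' s) = res N h' (ev φ h s) :=
  φ.2.2 ⟨V, _⟩ ⟨W, h⟩ h' s

lemma localHom_ext {U : X.Opens} {φ ψ : localHom M N U}
    (H : ∀ (V : X.Opens) (h : V ≤ U) s, ev φ h s = ev ψ h s) : φ = ψ :=
  Subtype.ext (funext fun ⟨V, h⟩ ↦ AddMonoidHom.ext fun s ↦ H V h s)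

/-- Constructor for local homomorphisms. -/
def mkLocal {U : X.Opens} (f : ∀ V : X.Opens, V ≤ U → Γ(M, V) → Γ(N, V))
    (f_add : ∀ V h s t, f V h (s + t) = f V h s + f V h t)
    (f_smul : ∀ V h (r : Γ(X, V)) s, f V h (r • s) = r • f V h s)
    (f_res : ∀ V W (h : W ≤ U) (h' : V ≤ W) s, f V (h'.trans h) (res M h' s) = res N h' (f W h s)) :
    localHom M N U :=
  ⟨fun V ↦ AddMonoidHom.mk' (f V.1 V.2) (f_add V.1 V.2), fun V ↦ f_smul V.1 V.2,
    fun V W h s ↦ f_res V.1 W.1 W.2 h s⟩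

instance (U : X.Opens) : SMul Γ(X, U) (localHom M N U) where
  smul r φ := mkLocal (fun _ h s ↦ resO h r • ev φ h s)
    (fun V h s t ↦ by rw [map_add, smul_add])
    (fun V h r' s ↦ by rw [ev_smul, smul_smul, smul_smul, mul_comm])
    (fun V W h h' s ↦ by rw [ev_res, res_smul, resO_resO])

lemma ev_smul_left {U : X.Opens} (r : Γ(X, U)) (φ : localHom M N U) {V : X.Opens} (h : V ≤ U)
    (s : Γ(M, V)) : ev (r • φ) h s = resO h r • ev φ h s := rfl

lemma ev_add {U : X.Opens} (φ ψ : localHom M N U) {V : X.Opens} (h : V ≤ U)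
    (s : Γ(M, V)) : ev (φ + ψ) h s = ev φ h s + ev ψ h s := rfl

lemma ev_zero {U : X.Opens} {V : X.Opens} (h : V ≤ U)
    (s : Γ(M, V)) : ev (0 : localHom M N U) h s = 0 := rfl

instance (U : X.Opens) : Module Γ(X, U) (localHom M N U) where
  one_smul φ := localHom_ext fun V h s ↦ by rw [ev_smul_left, map_one, one_smul]
  mul_smul r r' φ := localHom_ext fun V h s ↦ by
    rw [ev_smul_left, ev_smul_left, ev_smul_left, map_mul, mul_smul]
  smul_zero r := localHom_ext fun V h s ↦ by rw [ev_smul_left, ev_zero, smul_zero]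
  smul_add r φ ψ := localHom_ext fun V h s ↦ by
    rw [ev_smul_left, ev_add, ev_add, smul_add, ev_smul_left, ev_smul_left]
  add_smul r r' φ := localHom_ext fun V h s ↦ by
    rw [ev_smul_left, ev_add, map_add, add_smul, ev_smul_left, ev_smul_left]
  zero_smul φ := localHom_ext fun V h s ↦ by rw [ev_smul_left, map_zero, zero_smul, ev_zero]

/-- Restriction of local homomorphisms. -/
def localRes (M N : X.Modules) {V U : X.Opens} (h : V ≤ U) : localHom M N U →+ localHom M N V where
  toFun φ := ⟨fun W ↦ φ.1 ⟨W.1, W.2.trans h⟩, fun W ↦ φ.2.1 ⟨W.1, W.2.trans h⟩,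
    fun W W' ↦ φ.2.2 ⟨W.1, W.2.trans h⟩ ⟨W'.1, W'.2.trans h⟩⟩
  map_zero' := rfl
  map_add' _ _ := rfl

lemma ev_localRes {V U : X.Opens} (h : V ≤ U) (φ : localHom M N U) {W : X.Opens} (h' : W ≤ V)
    (s : Γ(M, W)) : ev (localRes M N h φ) h' s = ev φ (h'.trans h) s := rfl

/-- The presheaf of local homomorphisms. -/
def localHomPresheaf (M N : X.Modules) : X.Opensᵒᵖ ⥤ Ab.{u} where
  obj U := .of (localHom M N U.unop)
  map i := AddCommGrpCat.ofHom (localRes M N i.unop.le)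
  map_id _ := rfl
  map_comp _ _ := rfl

instance (U : X.Opensᵒᵖ) : Module (X.ringCatSheaf.obj.obj U) ((localHomPresheaf M N).obj U) :=
  (inferInstance : Module Γ(X, U.unop) (localHom M N U.unop))

lemma localHom_glue {ι : Type u} (U : ι → X.Opens) (φ : ∀ i, localHom M N (U i))
    (H : ∀ i j, localRes M N (inf_le_left : U i ⊓ U j ≤ U i) (φ i) =
      localRes M N (inf_le_right : U i ⊓ U j ≤ U j) (φ j)) :
    ∃! ψ : localHom M N (iSup U), ∀ i, localRes M N (le_iSup U i) ψ = φ i := by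
  have hcov (V : X.Opens) (h : V ≤ iSup U) : V ≤ ⨆ i, V ⊓ U i := by
    rw [← inf_iSup_eq]; exact le_inf le_rfl h
  have key (V : X.Opens) (h : V ≤ iSup U) (s : Γ(M, V)) : ∃ t : Γ(N, V), ∀ i,
      res N (inf_le_left : V ⊓ U i ≤ V) t =
        ev (φ i) (inf_le_right : V ⊓ U i ≤ U i) (res M inf_le_left s) := by
    refine res_glue N _ (hcov V h) _ fun i j ↦ ?_
    rw [← ev_res, ← ev_res, res_res, res_res]
    have hle : (V ⊓ U i) ⊓ (V ⊓ U j) ≤ U i ⊓ U j :=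
      inf_le_inf inf_le_right inf_le_right
    exact congrArg (fun x ↦ ev x hle (res M (inf_le_left.trans inf_le_left) s)) (H i j)
  choose f hf using key
  have huniq (V : X.Opens) (h : V ≤ iSup U) (t t' : Γ(N, V))
      (e : ∀ i, res N (inf_le_left : V ⊓ U i ≤ V) t = res N (inf_le_left : V ⊓ U i ≤ V) t') :
      t = t' := res_locally_eq N _ (hcov V h) e
  have hff (V : X.Opens) (i : ι) (h : V ≤ iSup U) (h' : V ≤ U i) (s : Γ(M, V)) :
      f V h s = ev (φ i) h' s := by
    have e := hf V h s i
    rw [ev_res (φ i) h'] at e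
    have := congrArg (res N (le_inf le_rfl h' : V ≤ V ⊓ U i)) e
    rwa [res_res, res_res, res_self, res_self] at this
  refine ⟨mkLocal f (fun V h s t ↦ ?_) (fun V h r s ↦ ?_) (fun V W h h' s ↦ ?_),
    fun i ↦ ?_, fun ψ hψ ↦ ?_⟩
  · refine huniq V h _ _ fun i ↦ ?_
    rw [map_add, hf, hf, hf, map_add, map_add]
  · refine huniq V h _ _ fun i ↦ ?_
    rw [res_smul, hf, hf, res_smul, ev_smul]
  · refine huniq V (h'.trans h) _ _ fun i ↦ ?_
    rw [hf, res_res, res_res]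
    have e := congrArg (res N (inf_le_inf_right (U i) h' : V ⊓ U i ≤ W ⊓ U i)) (hf W h s i)
    rw [res_res, ← ev_res, res_res] at e
    exact e.symm
  · exact localHom_ext fun V h s ↦ hff V i _ h s
  · refine localHom_ext fun V h s ↦ huniq V h _ _ fun i ↦ ?_
    refine Eq.trans ?_ (hf V h s i).symm
    rw [← hψ i, ev_localRes]
    exact (ev_res ψ h _ s).symm

/-- The sheaf of homomorphisms between two sheaves of modules. -/
def sheafHom (M N : X.Modules) : X.Modules where
  val := PresheafOfModules.ofPresheaf (R := X.ringCatSheaf.obj) (localHomPresheaf M N)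
    fun U V i r φ ↦ localHom_ext fun W h s ↦ by
      refine (congrArg (· • ev (M := M) (N := N) φ (h.trans i.unop.le) s)
        (resO_resO h i.unop.le r).symm)
  isSheaf := by
    change TopCat.Presheaf.IsSheaf (localHomPresheaf M N)
    rw [TopCat.Presheaf.isSheaf_iff_isSheafUniqueGluing]
    intro ι U φ H
    exact localHom_glue U φ H

end InternalHom

section HomSheafFunctoriality

variable {X : Scheme.{u}}

/-- A morphism of sheaves of modules from its action on sections. -/
def mkHom {M N : X.Modules} (f : ∀ U : X.Opens, Γ(M, U) → Γ(N, U))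
    (f_add : ∀ U s t, f U (s + t) = f U s + f U t)
    (f_smul : ∀ U (r : Γ(X, U)) s, f U (r • s) = r • f U s)
    (f_res : ∀ V U (h : V ≤ U) s, f V (res M h s) = res N h (f U s)) : M ⟶ N :=
  SheafOfModules.Hom.mk (PresheafOfModules.homMk
    { app := fun U ↦ AddCommGrpCat.ofHom (AddMonoidHom.mk' (f U.unop) (f_add U.unop))
      naturality := fun U V i ↦ by
        ext s
        exact f_res V.unop U.unop i.unop.le s }
    fun U r s ↦ f_smul U.unop r s)

lemma mkHom_app {M N : X.Modules} (f : ∀ U : X.Opens, Γ(M, U) → Γ(N, U))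
    (f_add : ∀ U s t, f U (s + t) = f U s + f U t)
    (f_smul : ∀ U (r : Γ(X, U)) s, f U (r • s) = r • f U s)
    (f_res : ∀ V U (h : V ≤ U) s, f V (res M h s) = res N h (f U s)) (U : X.Opens) (s : Γ(M, U)) :
    ((mkHom f f_add f_smul f_res).app U).hom s = f U s := rfl

lemma modHom_ext {M N : X.Modules} {f g : M ⟶ N}
    (h : ∀ U (s : Γ(M, U)), (f.app U).hom s = (g.app U).hom s) : f = g :=
  Scheme.Modules.hom_ext f g fun U ↦ by ext s; exact h U s

/-- Sections of the sheaf of homomorphisms are the local homomorphisms. -/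
def toLocal {M N : X.Modules} {U : X.Opens} : Γ(sheafHom M N, U) →+ localHom M N U :=
  AddMonoidHom.id _

/-- Local homomorphisms as sections of the sheaf of homomorphisms. -/
def ofLocal {M N : X.Modules} {U : X.Opens} : localHom M N U →+ Γ(sheafHom M N, U) :=
  AddMonoidHom.id _

lemma toLocal_injective {M N : X.Modules} {U : X.Opens} :
    Function.Injective (toLocal (M := M) (N := N) (U := U)) := fun _ _ h ↦ h

lemma toLocal_ofLocal {M N : X.Modules} {U : X.Opens} (φ : localHom M N U) :
    toLocal (ofLocal φ) = φ := rfl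

lemma toLocal_smul {M N : X.Modules} {U : X.Opens} (r : Γ(X, U)) (φ : Γ(sheafHom M N, U)) :
    toLocal (r • φ) = r • toLocal φ := rfl

lemma toLocal_res {M N : X.Modules} {V U : X.Opens} (h : V ≤ U) (φ : Γ(sheafHom M N, U)) :
    toLocal (res _ h φ) = localRes M N h (toLocal φ) := rfl

/-- Post-composition of local homomorphisms. -/
def localPost (M : X.Modules) {N N' : X.Modules} (f : N ⟶ N') {U : X.Opens}
    (φ : localHom M N U) : localHom M N' U :=
  mkLocal (fun V h s ↦ (f.app V).hom (ev φ h s))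
    (fun _ _ _ _ ↦ by rw [map_add, map_add])
    (fun V h r s ↦ by rw [ev_smul]; exact f.app_smul r _)
    (fun V W h h' s ↦ by rw [ev_res, app_res])

lemma ev_localPost (M : X.Modules) {N N' : X.Modules} (f : N ⟶ N') {U : X.Opens}
    (φ : localHom M N U) {V : X.Opens} (h : V ≤ U) (s : Γ(M, V)) :
    ev (localPost M f φ) h s = (f.app V).hom (ev φ h s) := rfl

/-- Pre-composition of local homomorphisms. -/
def localPre {M M' : X.Modules} (f : M' ⟶ M) (N : X.Modules) {U : X.Opens}
    (φ : localHom M N U) : localHom M' N U :=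
  mkLocal (fun V h s ↦ ev φ h ((f.app V).hom s))
    (fun _ _ _ _ ↦ by rw [map_add, map_add])
    (fun V h r s ↦ by rw [← ev_smul]; exact congrArg _ (f.app_smul r _))
    (fun V W h h' s ↦ by rw [app_res, ev_res])

lemma ev_localPre {M M' : X.Modules} (f : M' ⟶ M) (N : X.Modules) {U : X.Opens}
    (φ : localHom M N U) {V : X.Opens} (h : V ≤ U) (s : Γ(M', V)) :
    ev (localPre f N φ) h s = ev φ h ((f.app V).hom s) := rfl

/-- `ℋom(M, -)` on morphisms. -/
def postcomp (M : X.Modules) {N N' : X.Modules} (f : N ⟶ N') : sheafHom M N ⟶ sheafHom M N' :=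
  mkHom (fun U φ ↦ ofLocal (localPost M f (toLocal φ)))
    (fun _ φ ψ ↦ toLocal_injective <| localHom_ext fun V h s ↦
      map_add (f.app V).hom (ev (toLocal φ) h s) (ev (toLocal ψ) h s))
    (fun _ r φ ↦ toLocal_injective <| localHom_ext fun _ h s ↦
      f.app_smul (resO h r) (ev (toLocal φ) h s))
    (fun _ _ _ _ ↦ rfl)

/-- `ℋom(-, N)` on morphisms. -/
def precomp {M M' : X.Modules} (f : M' ⟶ M) (N : X.Modules) : sheafHom M N ⟶ sheafHom M' N :=
  mkHom (fun U φ ↦ ofLocal (localPre f N (toLocal φ)))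
    (fun _ _ _ ↦ rfl) (fun _ _ _ ↦ rfl) (fun _ _ _ _ ↦ rfl)

end HomSheafFunctoriality

section EquivariantHom

variable {X : Scheme.{u}} {G : Type} [Group G] {a : G →* End X}

/-- The pullback of functions along the action of `g`. -/
def actO (a : G →* End X) (g : G) {U : X.Opens} : Γ(X, U) →+* Γ(X, (a g) ⁻¹ᵁ U) :=
  ((a g).app U).hom

lemma preimage_le (a : G →* End X) (g : G) {V U : X.Opens} (h : V ≤ U) :
    (a g) ⁻¹ᵁ V ≤ (a g) ⁻¹ᵁ U := fun _ hx ↦ h hx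

lemma actO_res (a : G →* End X) (g : G) {V U : X.Opens} (h : V ≤ U) (r : Γ(X, U)) :
    actO a g (resO h r) = resO (preimage_le a g h) (actO a g r) :=
  ConcreteCategory.congr_hom ((a g).naturality (homOfLE h).op) r

lemma app_congr_apply {f g : X ⟶ X} (e : f = g) (U : X.Opens) (r : Γ(X, U)) :
    (f.app U).hom r = resO (by rw [e]) ((g.app U).hom r) := by
  subst e
  exact (resO_self _ _).symm

lemma actO_one (a : G →* End X) {U : X.Opens} (r : Γ(X, U)) :
    actO a 1 r = resO (preimage_one a U).le r :=
  app_congr_apply (map_one a) U r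

lemma actO_mul (a : G →* End X) (g h : G) {U : X.Opens} (r : Γ(X, U)) :
    actO a (g * h) r = resO (preimage_mul a g h U).le (actO a h (actO a g r)) := by
  refine (app_congr_apply (map_mul a g h) U r).trans ?_
  rfl

lemma actO_inv (a : G →* End X) (g : G) {V : X.Opens}
    (h : V ≤ (a g) ⁻¹ᵁ ((a g⁻¹) ⁻¹ᵁ V)) (r : Γ(X, V)) :
    resO h (actO a g (actO a g⁻¹ r)) = r := by
  have e : ∀ k : G, k = 1 → ∀ h' : V ≤ (a k) ⁻¹ᵁ V, resO h' (actO a k r) = r := by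
    rintro _ rfl h'
    rw [actO_one, resO_resO, resO_self]
  have := e (g⁻¹ * g) (inv_mul_cancel g) (by rw [preimage_mul]; exact h)
  rwa [actO_mul, resO_resO] at this

lemma le_preimage_inv (a : G →* End X) (g : G) (V : X.Opens) :
    V ≤ (a g) ⁻¹ᵁ ((a g⁻¹) ⁻¹ᵁ V) := by
  rw [← preimage_mul, inv_mul_cancel, preimage_one]

lemma preimage_inv_le (a : G →* End X) (g : G) {V U : X.Opens} (h : V ≤ (a g) ⁻¹ᵁ U) :
    (a g⁻¹) ⁻¹ᵁ V ≤ U := by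
  refine (preimage_le a g⁻¹ h).trans ?_
  rw [← preimage_mul, mul_inv_cancel, preimage_one]

namespace GSheaf

/-- The action of `g` on sections of an equivariant sheaf, by pullback along the action on `X`. -/
def pull (M : GSheaf a) (g : G) {U : X.Opens} : Γ(M.sheaf, U) →+ Γ(M.sheaf, (a g) ⁻¹ᵁ U) :=
  ((M.act g).app U).hom

lemma pull_smul (M : GSheaf a) (g : G) {U : X.Opens} (r : Γ(X, U)) (s : Γ(M.sheaf, U)) :
    M.pull g (r • s) = actO a g r • M.pull g s :=
  (M.act g).app_smul r s

lemma pull_res (M : GSheaf a) (g : G) {V U : X.Opens} (h : V ≤ U) (s : Γ(M.sheaf, U)) :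
    M.pull g (res _ h s) = res _ (preimage_le a g h) (M.pull g s) :=
  app_res (M.act g) h s

lemma pull_one (M : GSheaf a) {U : X.Opens} (s : Γ(M.sheaf, U)) :
    M.pull 1 s = res _ (preimage_one a U).le s := by
  have e := M.act_one
  have e2 := congrArg (fun f ↦ (Scheme.Modules.Hom.app f U).hom s) e
  rw [pushOne_app] at e2
  exact e2

lemma pull_mul (M : GSheaf a) (g h : G) {U : X.Opens} (s : Γ(M.sheaf, U)) :
    M.pull (g * h) s = res _ (preimage_mul a g h U).le (M.pull h (M.pull g s)) := by
  have e2 := congrArg (fun f ↦ (Scheme.Modules.Hom.app f U).hom s) (M.act_mul g h)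
  rw [Scheme.Modules.Hom.comp_app, Scheme.Modules.Hom.comp_app, pushMul_app] at e2
  exact e2

lemma pull_inv (M : GSheaf a) (g : G) {V : X.Opens}
    (h : V ≤ (a g) ⁻¹ᵁ ((a g⁻¹) ⁻¹ᵁ V)) (s : Γ(M.sheaf, V)) :
    res _ h (M.pull g (M.pull g⁻¹ s)) = s := by
  have e : ∀ k : G, k = 1 → ∀ h' : V ≤ (a k) ⁻¹ᵁ V, res _ h' (M.pull k s) = s := by
    rintro _ rfl h'
    rw [pull_one, res_res, res_self]
  have := e (g⁻¹ * g) (inv_mul_cancel g) (by rw [preimage_mul]; exact h)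
  rwa [pull_mul, res_res] at this

lemma pull_inv' (M : GSheaf a) (g : G) {V : X.Opens} (s : Γ(M.sheaf, V)) :
    M.pull g⁻¹ (M.pull g s) =
      res _ (preimage_inv_le a g le_rfl) s := by
  have e : ∀ k : G, k = 1 → ∀ h' : (a k) ⁻¹ᵁ V ≤ V, M.pull k s = res _ h' s := by
    rintro _ rfl h'
    rw [pull_one]
  have h1 := e (g * g⁻¹) (mul_inv_cancel g)
    (by rw [preimage_mul]; exact preimage_inv_le a g le_rfl)
  rw [pull_mul] at h1
  have h2 := congrArg (res M.sheaf (preimage_mul a g g⁻¹ V).ge) h1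
  rwa [res_res, res_res, res_self] at h2

variable (F : GSheaf a) {N N' : GSheaf a}

/-- The conjugation action on local homomorphisms. -/
def localAct (g : G) {U : X.Opens} (φ : localHom F.sheaf N.sheaf U) :
    localHom F.sheaf N.sheaf ((a g) ⁻¹ᵁ U) :=
  mkLocal (fun V h s ↦ res _ (le_preimage_inv a g V)
      (N.pull g (ev φ (preimage_inv_le a g h) (F.pull g⁻¹ s))))
    (fun V h s t ↦ by rw [map_add, map_add, map_add, map_add])
    (fun V h r s ↦ by rw [pull_smul, ev_smul, pull_smul, res_smul, actO_inv])
    (fun V W h h' s ↦ by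
      rw [pull_res, ev_res, pull_res, res_res, res_res])

variable {F}

lemma localAct_pull (g : G) {U : X.Opens} (φ : localHom F.sheaf N.sheaf U) {V : X.Opens}
    (h : V ≤ U) (t : Γ(F.sheaf, V)) :
    ev (localAct F g φ) (preimage_le a g h) (F.pull g t) = N.pull g (ev φ h t) := by
  change res _ _ (N.pull g (ev φ _ (F.pull g⁻¹ (F.pull g t)))) = _
  rw [pull_inv', ev_res φ h, pull_res, res_res, res_self]

lemma localAct_ext {g : G} {U : X.Opens} {φ ψ : localHom F.sheaf N.sheaf ((a g) ⁻¹ᵁ U)}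
    (H : ∀ (V : X.Opens) (h : V ≤ U) (t : Γ(F.sheaf, V)),
      ev φ (preimage_le a g h) (F.pull g t) = ev ψ (preimage_le a g h) (F.pull g t)) : φ = ψ := by
  refine localHom_ext fun W h s ↦ ?_
  rw [← F.pull_inv g (le_preimage_inv a g W) s, ev_res φ (preimage_le a g (preimage_inv_le a g h)),
    ev_res ψ (preimage_le a g (preimage_inv_le a g h)), H _ (preimage_inv_le a g h)]

variable (F) in
/-- The conjugation action on the sheaf of homomorphisms. -/
def homAct (N : GSheaf a) (g : G) :
    sheafHom F.sheaf N.sheaf ⟶ (push a g).obj (sheafHom F.sheaf N.sheaf) :=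
  mkHom (fun U φ ↦ ofLocal (U := (a g) ⁻¹ᵁ U) (localAct F g (toLocal φ)))
    (fun U φ ψ ↦ localAct_ext (F := F) (N := N) (g := g) (U := U) fun V h t ↦ by
      refine (localAct_pull g (toLocal φ + toLocal ψ) h t).trans ?_
      refine Eq.trans ?_ (congrArg₂ (· + ·) (localAct_pull g (toLocal φ) h t)
        (localAct_pull g (toLocal ψ) h t)).symm
      rw [ev_add, map_add])
    (fun U r φ ↦ localAct_ext (F := F) (N := N) (g := g) (U := U) fun V h t ↦ by
      refine (localAct_pull g (r • toLocal φ) h t).trans ?_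
      rw [ev_smul_left, pull_smul, actO_res, ← localAct_pull g (toLocal φ) h t]
      rfl)
    (fun V U h φ ↦ localAct_ext (F := F) (N := N) (g := g) (U := V) fun W h' t ↦
      (localAct_pull g (localRes _ _ h (toLocal φ)) h' t).trans
        (localAct_pull g (toLocal φ) (h'.trans h) t).symm)

lemma homAct_app (g : G) {U : X.Opens} (φ : Γ(sheafHom F.sheaf N.sheaf, U)) :
    toLocal (U := (a g) ⁻¹ᵁ U) (((homAct F N g).app U).hom φ) = localAct F g (toLocal φ) := rfl

variable (F) in
/-- The equivariant sheaf `ℋom(F, N)`, with the action by conjugation. -/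
def homObj (N : GSheaf a) : GSheaf a where
  sheaf := sheafHom F.sheaf N.sheaf
  act := homAct F N
  act_one := modHom_ext fun U φ ↦ localAct_ext (F := F) (N := N) (g := 1) (U := U) fun V h t ↦ by
    refine (localAct_pull 1 (toLocal φ) h t).trans ?_
    rw [pushOne_app, pull_one, pull_one, ← ev_res]
    rfl
  act_mul g h := modHom_ext fun U φ ↦ localAct_ext (F := F) (N := N) (g := g * h) (U := U)
    fun V hV t ↦ by
    refine (localAct_pull (g * h) (toLocal φ) hV t).trans ?_
    have e1 := localAct_pull h (localAct F g (toLocal φ)) (preimage_le a g hV) (F.pull g t)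
    rw [localAct_pull g (toLocal φ) hV] at e1
    rw [pull_mul, pull_mul, ← e1, ← ev_res]
    rw [Scheme.Modules.Hom.comp_app, Scheme.Modules.Hom.comp_app, pushMul_app]
    rfl

/-- `ℋom(F, -)` on morphisms of equivariant sheaves. -/
def homMap (f : N ⟶ N') : homObj F N ⟶ homObj F N' :=
  Hom.mk (postcomp F.sheaf f.hom) fun g ↦ modHom_ext fun U φ ↦
    localAct_ext (F := F) (N := N') (g := g) (U := U) fun V h t ↦ by
      refine (congrArg (f.hom.app _).hom (localAct_pull g (toLocal φ) h t)).trans ?_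
      refine Eq.trans ?_ (localAct_pull g (localPost _ f.hom (toLocal φ)) h t).symm
      exact congrArg (fun k ↦ (Scheme.Modules.Hom.app k V).hom (ev (toLocal φ) h t)) (f.comm g)

variable (F) in
/-- The functor `ℋom(F, -)` on equivariant sheaves. -/
def homFunctor : GSheaf a ⥤ GSheaf a where
  obj N := homObj F N
  map f := homMap f
  map_id _ := rfl
  map_comp _ _ := rfl

instance : (homFunctor F).Additive where
  map_add {_ _ _ _} := rfl

end GSheaf

end EquivariantHom

section DerivedDual

variable {X : Scheme.{u}} {G : Type} [Group G]

/-- The structure sheaf as a sheaf of modules over itself. -/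
def structureSheaf (X : Scheme.{u}) : X.Modules := SheafOfModules.unit X.ringCatSheaf

/-- Functions as sections of the structure sheaf. -/
def ofFun {U : X.Opens} : Γ(X, U) →+ Γ(structureSheaf X, U) := AddMonoidHom.id _

/-- Sections of the structure sheaf as functions. -/
def toFun {U : X.Opens} : Γ(structureSheaf X, U) →+ Γ(X, U) := AddMonoidHom.id _

/-- The structure sheaf with its natural equivariant structure, given by pullback of functions. -/
def structureGSheaf (a : G →* End X) : GSheaf a where
  sheaf := structureSheaf X
  act g := mkHom (fun U s ↦ ofFun (U := (a g) ⁻¹ᵁ U) (actO a g (toFun s)))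
    (fun U s t ↦ map_add (actO a g) (toFun s) (toFun t))
    (fun U r s ↦ map_mul (actO a g) r (toFun s))
    (fun V U h s ↦ actO_res a g h (toFun s))
  act_one := modHom_ext fun U s ↦ by
    rw [pushOne_app]
    exact actO_one a (toFun s)
  act_mul g h := modHom_ext fun U s ↦ by
    rw [Scheme.Modules.Hom.comp_app, Scheme.Modules.Hom.comp_app, pushMul_app]
    exact actO_mul a g h (toFun s)

/-- The derived dual `F^∨ = Rℋom(F, 𝒪_X)` of an equivariant sheaf of modules, in the bounded
below derived category of equivariant sheaves of modules. -/
def derivedDual {a : G →* End X} [HasDerivedCategory.{w} (GSheaf a)] (F : GSheaf a) :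
    DerivedCategory.Plus (GSheaf a) :=
  (GSheaf.homFunctor F).rightDerivedFunctorPlus.obj
    ((DerivedCategory.Plus.singleFunctor (GSheaf a) 0).obj (structureGSheaf a))

end DerivedDual

section Families

variable {X : Scheme.{u}}

/-- Multiplication by a global function. -/
def scale (M : X.Modules) (r : Γ(X, ⊤)) : M ⟶ M :=
  mkHom (fun U s ↦ resO (le_top : U ≤ ⊤) r • s)
    (fun U s t ↦ smul_add _ s t)
    (fun U r' s ↦ smul_comm _ r' s)
    (fun V U h s ↦ by rw [res_smul, resO_resO])

/-- A sheaf of modules on a locally noetherian scheme is coherent if it is quasi-coherent and its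
modules of sections over affine open subsets are finitely generated. -/
def IsCoherent (M : X.Modules) : Prop :=
  SheafOfModules.IsQuasicoherent M ∧ ∀ U : X.Opens, IsAffineOpen U → Module.Finite Γ(X, U) Γ(M, U)

/-- Flatness of a quasi-coherent sheaf of modules on `X` over `Y`, tested on affine open subsets. -/
def IsFlatOver {Y : Scheme.{u}} (p : X ⟶ Y) (M : X.Modules) : Prop :=
  ∀ (W : Y.Opens) (U : X.Opens) (h : U ≤ p ⁻¹ᵁ W), IsAffineOpen W → IsAffineOpen U →
    letI : Module Γ(Y, W) Γ(M, U) := Module.compHom _ (p.appLE W U h).hom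
    Module.Flat Γ(Y, W) Γ(M, U)

/-- The complex scalars as functions on an open subset of a scheme over `ℂ`. -/
def scalars {X : Scheme.{0}} (p : X ⟶ Spec (.of ℂ)) (U : X.Opens) : ℂ →+* Γ(X, U) :=
  (resO le_top).comp (p.appTop.hom.comp (Scheme.ΓSpecIso (.of ℂ)).inv.hom)

/-- The fibre of a sheaf of modules on `Y` at the `ℂ`-point of an open subset `W` given by `ε`. -/
def Fibre {Y : Scheme.{0}} (M : Y.Modules) {W : Y.Opens} (ε : Γ(Y, W) →+* ℂ) : Type :=
  letI := ε.toAlgebra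
  TensorProduct Γ(Y, W) ℂ Γ(M, W)

instance {Y : Scheme.{0}} (M : Y.Modules) {W : Y.Opens} (ε : Γ(Y, W) →+* ℂ) :
    AddCommGroup (Fibre M ε) :=
  letI := ε.toAlgebra
  (inferInstance : AddCommGroup (TensorProduct Γ(Y, W) ℂ Γ(M, W)))

instance {Y : Scheme.{0}} (M : Y.Modules) {W : Y.Opens} (ε : Γ(Y, W) →+* ℂ) :
    Module ℂ (Fibre M ε) :=
  letI := ε.toAlgebra
  (inferInstance : Module ℂ (TensorProduct Γ(Y, W) ℂ Γ(M, W)))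

/-- The map induced on fibres by a morphism of sheaves of modules. -/
def fibreMap {Y : Scheme.{0}} {M N : Y.Modules} (φ : M ⟶ N) {W : Y.Opens} (ε : Γ(Y, W) →+* ℂ) :
    Fibre M ε →ₗ[ℂ] Fibre N ε :=
  letI := ε.toAlgebra
  LinearMap.baseChange ℂ
    ({ toFun := (φ.app W).hom
       map_add' := map_add _
       map_smul' := fun r s ↦ φ.app_smul r s } : Γ(M, W) →ₗ[Γ(Y, W)] Γ(N, W))

end Families

section Gnat

variable {n : ℕ} {Y : Scheme.{0}} (f : Y ⟶ Spec (.of ℂ))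

/-- The action of a matrix on `Y × ℂⁿ`, trivial on `Y` and standard on `ℂⁿ`: the pullback of the
`i`-th coordinate is the `i`-th coordinate of the product of the matrix with the coordinate
vector. -/
def matrixAct (A : Matrix (Fin n) (Fin n) ℂ) : 𝔸(Fin n; Y) ⟶ 𝔸(Fin n; Y) :=
  AffineSpace.homOfVector (𝔸(Fin n; Y) ↘ Y) fun i ↦
    ∑ j, scalars ((𝔸(Fin n; Y) ↘ Y) ≫ f) ⊤ (A i j) * AffineSpace.coord Y j

lemma matrixAct_over (A : Matrix (Fin n) (Fin n) ℂ) :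
    matrixAct f A ≫ (𝔸(Fin n; Y) ↘ Y) = 𝔸(Fin n; Y) ↘ Y :=
  AffineSpace.homOfVector_over _ _

lemma matrixAct_coord (A : Matrix (Fin n) (Fin n) ℂ) (i : Fin n) :
    (matrixAct f A).appTop (AffineSpace.coord Y i) =
      ∑ j, scalars ((𝔸(Fin n; Y) ↘ Y) ≫ f) ⊤ (A i j) * AffineSpace.coord Y j :=
  AffineSpace.homOfVector_appTop_coord _ _ _

lemma appTop_scalars {X X' : Scheme.{0}} (q : X' ⟶ X) (p : X ⟶ Spec (.of ℂ)) (p' : X' ⟶ Spec (.of ℂ))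
    (h : q ≫ p = p') (c : ℂ) : q.appTop (scalars p ⊤ c) = scalars p' ⊤ c := by
  subst h
  change q.appTop (resO _ _) = resO _ _
  rw [resO_self, resO_self]
  rfl

lemma matrixAct_scalars (A : Matrix (Fin n) (Fin n) ℂ) (c : ℂ) :
    (matrixAct f A).appTop (scalars ((𝔸(Fin n; Y) ↘ Y) ≫ f) ⊤ c) =
      scalars ((𝔸(Fin n; Y) ↘ Y) ≫ f) ⊤ c :=
  appTop_scalars _ _ _ (by rw [← Category.assoc, matrixAct_over]) c

lemma matrixAct_one : matrixAct f (1 : Matrix (Fin n) (Fin n) ℂ) = 𝟙 _ := by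
  refine AffineSpace.hom_ext ?_ fun i ↦ ?_
  · rw [matrixAct_over, Category.id_comp]
  · rw [matrixAct_coord, Finset.sum_eq_single i, Matrix.one_apply_eq, map_one, one_mul]
    · rfl
    · intro j _ hj
      rw [Matrix.one_apply_ne hj.symm, map_zero, zero_mul]
    · exact fun h ↦ absurd (Finset.mem_univ i) h

lemma matrixAct_mul (A B : Matrix (Fin n) (Fin n) ℂ) :
    matrixAct f (A * B) = matrixAct f B ≫ matrixAct f A := by
  refine AffineSpace.hom_ext ?_ fun i ↦ ?_
  · rw [Category.assoc, matrixAct_over, matrixAct_over, matrixAct_over]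
  · have e : (matrixAct f B ≫ matrixAct f A).appTop (AffineSpace.coord Y i) =
        (matrixAct f B).appTop ((matrixAct f A).appTop (AffineSpace.coord Y i)) := rfl
    rw [e, matrixAct_coord, matrixAct_coord, map_sum]
    simp_rw [map_mul, matrixAct_scalars, matrixAct_coord, Finset.mul_sum]
    rw [Finset.sum_comm]
    refine Finset.sum_congr rfl fun k _ ↦ ?_
    rw [Matrix.mul_apply, map_sum, Finset.sum_mul]
    refine Finset.sum_congr rfl fun j _ ↦ ?_
    rw [map_mul, mul_assoc]

variable (G : Subgroup (Matrix.SpecialLinearGroup (Fin n) ℂ))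

/-- The action of `G` on `Y × ℂⁿ`. -/
def linearAct : G →* End 𝔸(Fin n; Y) where
  toFun g := matrixAct f g.1.1
  map_one' := matrixAct_one f
  map_mul' g h := matrixAct_mul f g.1.1 h.1.1

/-- The action of `g` on the direct image to `Y` of an equivariant sheaf. As `GSheaf.act g` is
the pullback along `v ↦ g v`, the left action of `g` is given by `g⁻¹`. -/
def groupEnd {f : Y ⟶ Spec (.of ℂ)} {G : Subgroup (Matrix.SpecialLinearGroup (Fin n) ℂ)}
    (F : GSheaf (linearAct f G)) (g : G) :
    (Scheme.Modules.pushforward (𝔸(Fin n; Y) ↘ Y)).obj F.sheaf ⟶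
      (Scheme.Modules.pushforward (𝔸(Fin n; Y) ↘ Y)).obj F.sheaf :=
  (Scheme.Modules.pushforward (𝔸(Fin n; Y) ↘ Y)).map (F.act g⁻¹) ≫
    (Scheme.Modules.pushforwardComp (linearAct f G g⁻¹) (𝔸(Fin n; Y) ↘ Y)).hom.app F.sheaf ≫
      (Scheme.Modules.pushforwardCongr (matrixAct_over f g⁻¹.1.1)).hom.app F.sheaf

/-- A polynomial as a global function on `Y × ℂⁿ`. -/
def polyFun (f : Y ⟶ Spec (.of ℂ)) : MvPolynomial (Fin n) ℂ →+* Γ(𝔸(Fin n; Y), ⊤) :=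
  MvPolynomial.eval₂Hom (scalars ((𝔸(Fin n; Y) ↘ Y) ≫ f) ⊤) (AffineSpace.coord Y)

/-- The action of a polynomial on the direct image to `Y` of a sheaf of modules. -/
def polyEnd {f : Y ⟶ Spec (.of ℂ)} {G : Subgroup (Matrix.SpecialLinearGroup (Fin n) ℂ)}
    (F : GSheaf (linearAct f G)) (r : MvPolynomial (Fin n) ℂ) :
    (Scheme.Modules.pushforward (𝔸(Fin n; Y) ↘ Y)).obj F.sheaf ⟶
      (Scheme.Modules.pushforward (𝔸(Fin n; Y) ↘ Y)).obj F.sheaf :=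
  (Scheme.Modules.pushforward (𝔸(Fin n; Y) ↘ Y)).map (scale F.sheaf (polyFun f r))

/-- A gnat-family on `Y × ℂⁿ`: a coherent `G`-sheaf, flat over `Y`, whose fibre over every closed
point of `Y` has global sections isomorphic to the regular representation of `G`, and is supported
on a single `G`-orbit. The closed points of an affine open subset `W` of `Y` are given by the
homomorphisms of `ℂ`-algebras `Γ(Y, W) → ℂ`. -/
structure IsGnatFamily {f : Y ⟶ Spec (.of ℂ)} {G : Subgroup (Matrix.SpecialLinearGroup (Fin n) ℂ)}
    (F : GSheaf (linearAct f G)) : Prop where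
  coherent : IsCoherent F.sheaf
  flat : IsFlatOver (𝔸(Fin n; Y) ↘ Y) F.sheaf
  regular (W : Y.Opens) (hW : IsAffineOpen W) (ε : Γ(Y, W) →+* ℂ)
    (hε : ε.comp (scalars f W) = RingHom.id ℂ) :
    ∃ e : Fibre ((Scheme.Modules.pushforward (𝔸(Fin n; Y) ↘ Y)).obj F.sheaf) ε ≃ₗ[ℂ] (G →₀ ℂ),
      ∀ g x, e (fibreMap (groupEnd F g) ε x) = Finsupp.mapDomain (g * ·) (e x)
  orbit (W : Y.Opens) (hW : IsAffineOpen W) (ε : Γ(Y, W) →+* ℂ)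
    (hε : ε.comp (scalars f W) = RingHom.id ℂ) :
    ∃ v : Fin n → ℂ, {p : Fin n → ℂ | ∀ r : MvPolynomial (Fin n) ℂ,
        fibreMap (polyEnd F r) ε = 0 → MvPolynomial.eval p r = 0} =
      {p | ∃ g : G, p = g.1.1.mulVec v}

/-- `D` is dual to the gnat-family `F`: it is a gnat-family whose direct image to `Y` is
`ℋom_Y(π_* F, 𝒪_Y)`, with the action `(g α)(s) = α(g⁻¹ s)` of `G` and the action
`(r α)(s) = α(r s)` of polynomials. -/
structure IsDualFamily {f : Y ⟶ Spec (.of ℂ)} {G : Subgroup (Matrix.SpecialLinearGroup (Fin n) ℂ)}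
    (F D : GSheaf (linearAct f G)) : Prop where
  gnat : IsGnatFamily D
  dual : ∃ e : (Scheme.Modules.pushforward (𝔸(Fin n; Y) ↘ Y)).obj D.sheaf ≅
      sheafHom ((Scheme.Modules.pushforward (𝔸(Fin n; Y) ↘ Y)).obj F.sheaf) (structureSheaf Y),
    (∀ g, groupEnd D g ≫ e.hom = e.hom ≫ precomp (groupEnd F g⁻¹) (structureSheaf Y)) ∧
    ∀ r, polyEnd D r ≫ e.hom = e.hom ≫ precomp (polyEnd F r) (structureSheaf Y)

end Gnat

end
end EquivSheaf

/-! Write `p` for the projection from `Y × ℂⁿ` to `Y` and put `P = p^* p_* F`. On `P` each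
coordinate acts in two ways: by multiplication on `Y × ℂⁿ`, and through its action on `p_* F`. The
differences `D_k` of the two actions commute, and the counit `P ⟶ F` is the quotient by their
images. Suppose that `p_* F` is locally free of finite rank. Over an affine open `W` the sections of
`P` are then polynomials in `t_1, …, t_n` with coefficients in `M = (p_* F)(W)`, and `D_k = t_k -
x_k`. The substitution `t_k ↦ t_k + x_k` turns the `D_k` into the variables
(`IsEval.bijective_sub`), so they form a regular sequence. Hence the complex of alternating forms on
`ℂⁿ` with values in `P`, with the Koszul differential of the `D_k`, is a resolution of `F` of length
`n` once it is augmented by evaluating top forms at the standard basis (`kosz_exact`,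
`exists_kosz`). The differential is equivariant because the `D_k` transform by `g` and the arguments
of forms by the contragredient matrix (`cpull_opAt_diff`); the augmentation is equivariant because
`G` has determinant one (`altEval_altMap`).

The transposed operators on `ℋom(P, 𝒪)` form a regular sequence by the same argument, so the dual
Koszul complex is exact except at its last term. The derived dual is therefore concentrated in
degree `n`, where it is the cokernel `dualG F` of the last transposed differential. The derived
functor is computed with an injective resolution `I` of `𝒪`: the functor `ℋom(-, I)` is exact in the
first variable, because injective equivariant sheaves are injective as sheaves, and locally
dualizable sheaves are acyclic for it, so dimension shifting along the Koszul resolution applies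
(`derivedDual_of_resolution`).

Over `p⁻¹ W`, a functional on `P` is a polynomial in the transposed operators whose coefficients are
functionals on `p_* F`. The cokernel retains the constant term, which identifies `p_* (dualG F)`
with `ℋom(p_* F, 𝒪_Y)` (`isIso_dualComp`), compatibly with `G` and with polynomials.

Local freeness of `p_* F` needs proof, since `p` is not proper. It comes from the fibres, all of
dimension `|G|` (`finite_of_fibreDim`). A Nullstellensatz for countably generated algebras bounds
the generic rank by the fibre dimension, flatness then lets denominators be cancelled near each
closed point, and dévissage reduces a general base to domains. A finite flat module over a
noetherian ring is projective.

That `dualG F` is a gnat-family follows from the perfect pairing between its fibres and those of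
`F`: the dual of a regular representation is regular, and a polynomial acts by the transpose, so the
support is unchanged. Finally, any two duals have isomorphic direct images with the same actions,
and an equivariant sheaf of this kind is recovered from its direct image as the quotient of `P` by
the `D_k` (`nonempty_iso_of_dirIm`). So every dual family is isomorphic to `dualG F`. -/

namespace EquivSheaf
noncomputable section

/-! ### Objects of the derived category with a single cohomology object -/

section DerivedConcentrated

universe w₁ w₂ v₁ v₂ u₁ u₂

variable {C : Type u₁} [Category.{v₁} C] [Abelian C] {E : Type u₂} [Category.{v₂} E] [Abelian E]

/-- Vanishing of homology away from `n` bounds the object from both sides in the t-structure, so it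
is a shifted single object, and its homology in degree `n` identifies that object. Full faithfulness
of `DerivedCategory.Plus.ι` brings the isomorphism back to the bounded below category. -/
lemma derivedPlus_iso_single [HasDerivedCategory.{w₂} E] (Z : DerivedCategory.Plus E) (n : ℤ)
    (A : E) (h0 : ∀ i : ℤ, i ≠ n → IsZero ((DerivedCategory.Plus.homologyFunctor E i).obj Z))
    (hn : Nonempty ((DerivedCategory.Plus.homologyFunctor E n).obj Z ≅ A)) :
    Nonempty (Z⟦n⟧ ≅ (DerivedCategory.Plus.singleFunctor E 0).obj A) := by
  let Z' := DerivedCategory.Plus.ι.obj Z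
  have : Z'.IsGE n := (DerivedCategory.isGE_iff _ _).2 fun i hi ↦ h0 i hi.ne
  have : Z'.IsLE n := (DerivedCategory.isLE_iff _ _).2 fun i hi ↦ h0 i hi.ne'
  obtain ⟨B, ⟨e⟩⟩ := Z'.exists_iso_singleFunctor_obj_of_isGE_of_isLE n
  obtain ⟨e'⟩ := hn
  let e1 : A ≅ B := e'.symm ≪≫ (DerivedCategory.homologyFunctor E n).mapIso e ≪≫
    (DerivedCategory.singleFunctorCompHomologyFunctorIso E n).app B
  let e2 : Z ≅ (DerivedCategory.Plus.singleFunctor E n).obj A :=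
    DerivedCategory.Plus.ι.preimageIso (e ≪≫ (DerivedCategory.singleFunctor E n).mapIso e1.symm)
  exact ⟨(shiftFunctor _ n).mapIso e2 ≪≫
    ((DerivedCategory.Plus.singleFunctors E).shiftIso n 0 n (add_zero n)).app A⟩

/-- The augmentation of the resolution becomes invertible in the derived category, and the unit of
the derived functor is invertible on bounded below complexes of injective objects. -/
lemma rightDerivedPlus_single_homology [HasDerivedCategory.{w₁} C] [HasDerivedCategory.{w₂} E]
    [EnoughInjectives C] (H : C ⥤ E) [H.Additive] (A : C) (R : InjectiveResolution A) (i : ℤ) :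
    Nonempty ((DerivedCategory.Plus.homologyFunctor E i).obj
      (H.rightDerivedFunctorPlus.obj ((DerivedCategory.Plus.singleFunctor C 0).obj A)) ≅
      ((H.mapHomologicalComplex (.up ℤ)).obj R.cochainComplex).homology i) := by
  -- Lifting the resolution to the full subcategory of injective objects exhibits `K` as a complex
  -- on which the unit is known to be invertible.
  let L : CochainComplex.Plus (InjectiveObject C) :=
    ⟨HomologicalComplex.liftObjectProperty _ R.cochainComplex inferInstance, 0, by
      rw [← CochainComplex.isStrictlyGE_mapHomologicalComplex_obj_iff _ (InjectiveObject.ι _)]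
      exact inferInstanceAs (R.cochainComplex.IsStrictlyGE 0)⟩
  let K := (InjectiveObject.ι C).mapCochainComplexPlus.obj L
  let K' := (HomotopyCategory.Plus.quotient C).obj K
  have h1 : IsIso (H.rightDerivedFunctorPlusUnit.app K') := inferInstance
  have h2 : IsIso (DerivedCategory.Q.map R.ι') :=
    (DerivedCategory.isIso_Q_map_iff_quasiIso C _).2 inferInstance
  let e0 := asIso (DerivedCategory.Q.map R.ι')
  let e : (DerivedCategory.Plus.singleFunctor C 0).obj A ≅ DerivedCategory.Plus.Qh.obj K' :=
    DerivedCategory.Plus.ι.preimageIso e0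
  let e2 := (DerivedCategory.Plus.homologyFunctor E i).mapIso
    (H.rightDerivedFunctorPlus.mapIso e ≪≫ (asIso (H.rightDerivedFunctorPlusUnit.app K')).symm)
  exact ⟨e2 ≪≫ (DerivedCategory.homologyFunctorFactors E i).app
    ((H.mapHomologicalComplex (.up ℤ)).obj R.cochainComplex)⟩

end DerivedConcentrated

/-! ### Dimension shifting for exact contravariant functors to complexes -/

section DimensionShift

open Opposite

universe v₁ v₂ u₁ u₂

variable {C : Type u₁} [Category.{v₁} C] [Abelian C] {E : Type u₂} [Category.{v₂} E] [Abelian E]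
  (H : Cᵒᵖ ⥤ CochainComplex E ℤ)

/-- The cohomology of a functor with values in complexes. -/
abbrev cohom (i : ℤ) : Cᵒᵖ ⥤ E := H ⋙ HomologicalComplex.homologyFunctor E (.up ℤ) i

/-- A contravariant functor with values in complexes is exact. -/
def ComplexExact : Prop := ∀ {A B D : C} (f : A ⟶ B) (g : B ⟶ D) (w : f ≫ g = 0),
  (ShortComplex.mk f g w).ShortExact → ∃ w', (ShortComplex.mk (H.map g.op) (H.map f.op) w').ShortExact

variable {H}

open ZeroObject in
-- Additivity is not part of exactness here. A zero morphism factors through two zero maps of the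
-- zero object, and exactness on the trivial short exact sequence kills their composite.
lemma ComplexExact.map_zero (hH : ComplexExact H) {A B : C} : H.map (0 : A ⟶ B).op = 0 := by
  obtain ⟨w', -⟩ := hH (0 : (0 : C) ⟶ 0) (0 : (0 : C) ⟶ 0) (by simp)
    ⟨ShortComplex.exact_of_isZero_X₂ _ (isZero_zero C)⟩
  have e : (0 : A ⟶ B) = (0 : A ⟶ 0) ≫ (0 : (0 : C) ⟶ 0) ≫ (0 : (0 : C) ⟶ 0) ≫ 0 := by
    simp
  rw [e]
  simp only [op_comp, Functor.map_comp, Category.assoc]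
  rw [reassoc_of% w']
  simp

lemma ComplexExact.cohom_map_zero (hH : ComplexExact H) (i : ℤ) {A B : C} :
    (cohom H i).map (0 : A ⟶ B).op = 0 := by
  rw [Functor.comp_map, hH.map_zero]
  exact (HomologicalComplex.homologyFunctor E (.up ℤ) i).map_zero _ _

lemma ComplexExact.isZero (hH : ComplexExact H) {A B D : C} {f : A ⟶ B} {g : B ⟶ D}
    {w : f ≫ g = 0} (hS : (ShortComplex.mk f g w).ShortExact) {i j : ℤ} (hij : i + 1 = j)
    (h1 : IsZero ((cohom H i).obj (op A))) (h2 : IsZero ((cohom H j).obj (op B))) :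
    IsZero ((cohom H j).obj (op D)) := by
  obtain ⟨w', h⟩ := hH f g w hS
  exact (h.homology_exact₁ i j hij).isZero_of_both_zeros (h1.eq_of_src _ _) (h2.eq_of_tgt _ _)

lemma ComplexExact.iso (hH : ComplexExact H) {A B D : C} {f : A ⟶ B} {g : B ⟶ D}
    {w : f ≫ g = 0} (hS : (ShortComplex.mk f g w).ShortExact) {i j : ℤ} (hij : i + 1 = j)
    (h1 : IsZero ((cohom H i).obj (op B))) (h2 : IsZero ((cohom H j).obj (op B))) :
    Nonempty ((cohom H j).obj (op D) ≅ (cohom H i).obj (op A)) := by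
  obtain ⟨w', h⟩ := hH f g w hS
  exact ⟨(h.δIso i j hij h1 h2).symm⟩

/-- The term after the connecting morphism in the long exact sequence vanishes, so the connecting
morphism is an epimorphism, and exactness before it makes it a cokernel. -/
lemma ComplexExact.cokernelIso (hH : ComplexExact H) {A B D : C} {f : A ⟶ B} {g : B ⟶ D}
    {w : f ≫ g = 0} (hS : (ShortComplex.mk f g w).ShortExact) {i j : ℤ} (hij : i + 1 = j)
    (h : IsZero ((cohom H j).obj (op B))) :
    Nonempty ((cohom H j).obj (op D) ≅ cokernel ((cohom H i).map f.op)) := by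
  obtain ⟨w', h'⟩ := hH f g w hS
  have h3 := h'.homology_exact₃ i j hij
  have : Epi (h'.δ i j hij) := h'.epi_δ i j hij h
  exact ⟨IsColimit.coconePointUniqueUpToIso h3.gIsCokernel (colimit.isColimit _)⟩

lemma ComplexExact.mono (hH : ComplexExact H) {A B D : C} {f : A ⟶ B} {g : B ⟶ D}
    {w : f ≫ g = 0} (hS : (ShortComplex.mk f g w).ShortExact) {i j : ℤ} (hij : i + 1 = j)
    (h : IsZero ((cohom H i).obj (op A))) : Mono ((cohom H j).map g.op) := by
  obtain ⟨w', h'⟩ := hH f g w hS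
  exact (h'.homology_exact₁ i j hij).mono_g (h.eq_of_src _ _)

/-- The image of `b` lies in the kernel of `c`, which by exactness is the image of `a ≫ b`. Since
`b` is a monomorphism, `a` must already be onto. -/
lemma epi_of_exact_comp {A B D K : E} {a : A ⟶ B} {b : B ⟶ D} {c : D ⟶ K} [Mono b] (w : b ≫ c = 0)
    (h : (ShortComplex.mk (a ≫ b) c (by rw [Category.assoc, w, comp_zero])).Exact) : Epi a := by
  have h1 := (ShortComplex.exact_iff_epi_kernel_lift _).1 h
  dsimp at h1
  have e : kernel.lift c (a ≫ b) (by rw [Category.assoc, w, comp_zero]) = a ≫ kernel.lift c b w := by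
    rw [← cancel_mono (kernel.ι c)]; simp
  rw [e] at h1
  have : Mono (kernel.lift c b w) := by
    have : Mono (kernel.lift c b w ≫ kernel.ι c) := by rwa [kernel.lift_ι]
    exact mono_of_mono _ (kernel.ι c)
  have : Epi (kernel.lift c b w) := epi_of_epi a _
  have : IsIso (kernel.lift c b w) := isIso_of_mono_of_epi _
  have e2 : a = (a ≫ kernel.lift c b w) ≫ inv (kernel.lift c b w) := by simp
  rw [e2]
  infer_instance

lemma kernel_shortExact {A B : C} (f : A ⟶ B) [Epi f] :
    (ShortComplex.mk (kernel.ι f) f (kernel.condition f)).ShortExact where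
  exact := ShortComplex.exact_of_f_is_kernel _ (kernelIsKernel f)

variable {n : ℕ} (K : ℕ → C) (d : ∀ j, K j ⟶ K (j + 1)) (w : ∀ j, d j ≫ d (j + 1) = 0)

include w in
/-- Cohomology of a quotient of the `k + 1`-st term of a resolution. -/
lemma ComplexExact.shift (hH : ComplexExact H) (hm : Mono (d 0))
    (hK : ∀ j, j + 1 < n → (ShortComplex.mk (d j) (d (j + 1)) (w j)).Exact)
    (h0 : ∀ A, IsZero ((cohom H (-1)).obj (op A)))
    (hac : ∀ j ≤ n, ∀ i > 0, IsZero ((cohom H i).obj (op (K j))))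
    (hdual : ∀ j, j + 2 ≤ n → ∀ w', (ShortComplex.mk ((cohom H 0).map (d (j + 1)).op)
      ((cohom H 0).map (d j).op) w').Exact) (k : ℕ) :
    k + 1 ≤ n → ∀ (A : C) (p : K (k + 1) ⟶ A) (wp : d k ≫ p = 0), Epi p →
    (ShortComplex.mk (d k) p wp).Exact →
    (∀ i : ℤ, 0 < i → i ≠ k + 1 → IsZero ((cohom H i).obj (op A))) ∧
    Nonempty ((cohom H (k + 1)).obj (op A) ≅ cokernel ((cohom H 0).map (d 0).op)) := by
  induction k with
  | zero =>
    intro hn A p wp _ hex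
    have hS : (ShortComplex.mk (d 0) p wp).ShortExact := { exact := hex }
    refine ⟨fun i hi hi' ↦ ?_, ?_⟩
    · exact hH.isZero hS (sub_add_cancel i 1) (hac 0 (by lia) (i - 1) (by norm_num at hi'; lia))
        (hac 1 (by lia) _ hi)
    · obtain ⟨e⟩ := hH.cokernelIso hS (i := 0) (j := 1) (by norm_num) (hac 1 (by lia) _ (by norm_num))
      exact ⟨eqToIso (by norm_num) ≪≫ e⟩
  | succ k ih =>
    intro hn A p wp _ hex
    -- The kernel of `p` is the quotient of `K (k + 1)` by the image of `d k`, so the induction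
    -- hypothesis applies to it.
    let κ : K (k + 1) ⟶ kernel p := kernel.lift p (d (k + 1)) wp
    have hκ : κ ≫ kernel.ι p = d (k + 1) := kernel.lift_ι _ _ _
    have : Epi κ := (ShortComplex.exact_iff_epi_kernel_lift _).1 hex
    have wκ : d k ≫ κ = 0 := by
      rw [← cancel_mono (kernel.ι p), Category.assoc, hκ, w, zero_comp]
    have hκex : (ShortComplex.mk (d k) κ wκ).Exact := by
      let φ : ShortComplex.mk (d k) κ wκ ⟶ ShortComplex.mk (d k) (d (k + 1)) (w k) :=
        { τ₁ := 𝟙 _, τ₂ := 𝟙 _, τ₃ := kernel.ι p }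
      have : Epi φ.τ₁ := inferInstanceAs (Epi (𝟙 _))
      have : IsIso φ.τ₂ := inferInstanceAs (IsIso (𝟙 _))
      have : Mono φ.τ₃ := inferInstanceAs (Mono (kernel.ι p))
      exact (ShortComplex.exact_iff_of_epi_of_isIso_of_mono φ).2 (hK k (by lia))
    obtain ⟨ih1, ⟨ih2⟩⟩ := ih (by lia) _ κ wκ inferInstance hκex
    have hS := kernel_shortExact p
    have hiso (i : ℤ) (hi : 0 < i) := hH.iso hS (i := i) rfl (hac _ hn i hi) (hac _ hn _ (by lia))
    refine ⟨fun i hi hi' ↦ ?_, ?_⟩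
    · by_cases h1 : i = 1
      -- Degree one is the only place where exactness of the dual complex is used. The cohomology is
      -- the cokernel of restriction from `K (k + 2)` to `kernel p`. Degree-zero classes on `kernel
      -- p` embed into those on `K (k + 1)` and vanish on `K k`, so by dual exactness each of them
      -- comes from `K (k + 2)`.
      · subst h1
        have : Mono ((cohom H 0).map κ.op) :=
          hH.mono (kernel_shortExact κ) (i := -1) (by norm_num) (h0 _)
        have w1 : (cohom H 0).map κ.op ≫ (cohom H 0).map (d k).op = 0 := by
          rw [← Functor.map_comp, ← op_comp, wκ, hH.cohom_map_zero]
        have : Epi ((cohom H 0).map (kernel.ι p).op) := by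
          have e : (cohom H 0).map (d (k + 1)).op =
              (cohom H 0).map (kernel.ι p).op ≫ (cohom H 0).map κ.op := by
            rw [← Functor.map_comp, ← op_comp, hκ]
          have := hdual k hn
          simp_rw [e] at this
          exact epi_of_exact_comp w1 (this (by rw [Category.assoc, w1, comp_zero]))
        obtain ⟨e⟩ := hH.cokernelIso hS (i := 0) (j := 1) (by norm_num) (hac _ hn _ (by norm_num))
        exact (isZero_cokernel_of_epi _).of_iso e
      · obtain ⟨e⟩ := hiso (i - 1) (by lia)
        rw [sub_add_cancel] at e
        exact (ih1 (i - 1) (by lia) (by push_cast at hi'; lia)).of_iso e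
    · obtain ⟨e⟩ := hiso (k + 1) (by lia)
      exact ⟨eqToIso (by push_cast; rfl) ≪≫ e ≪≫ ih2⟩

/-- Cohomology of an object with a finite resolution by acyclic objects whose dual is exact. -/
lemma ComplexExact.resolution (hH : ComplexExact H) (n : ℕ) {A : C} (p : K n ⟶ A) (hp : Epi p)
    (hm : if n = 0 then Mono p ∧ IsZero (K 1) else Mono (d 0))
    (hK : ∀ j, j + 1 < n → (ShortComplex.mk (d j) (d (j + 1)) (w j)).Exact)
    (hKp : ∀ j (h : j + 1 = n), ∃ wp, (ShortComplex.mk (d j) (eqToHom (by rw [h]) ≫ p) wp).Exact)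
    (h0 : ∀ i < 0, ∀ A, IsZero ((cohom H i).obj (op A)))
    (hac : ∀ j ≤ n, ∀ i > 0, IsZero ((cohom H i).obj (op (K j))))
    (hdual : ∀ j, j + 2 ≤ n → ∀ w', (ShortComplex.mk ((cohom H 0).map (d (j + 1)).op)
      ((cohom H 0).map (d j).op) w').Exact)
    (hdualm : ∀ j, j + 1 = n → Mono ((cohom H 0).map (d j).op)) :
    (∀ i : ℤ, i ≠ n → IsZero ((cohom H i).obj (op A))) ∧
    Nonempty ((cohom H n).obj (op A) ≅ cokernel ((cohom H 0).map (d 0).op)) := by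
  obtain _ | n := n
  -- In length zero the resolution is the isomorphism `p`, and the convention that `K 1` is zero
  -- makes the cokernel the whole of degree zero.
  · rw [if_pos rfl] at hm
    have := hm.1
    have : IsIso p := isIso_of_mono_of_epi p
    have e (i : ℤ) : (cohom H i).obj (op A) ≅ (cohom H i).obj (op (K 0)) :=
      (cohom H i).mapIso (asIso p).op
    refine ⟨fun i hi ↦ ?_, ?_⟩
    · rcases lt_or_gt_of_ne hi with h | h
      · exact h0 i h A
      · exact (hac 0 le_rfl i h).of_iso (e i)
    · have e1 : (cohom H 0).map (d 0).op = 0 := by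
        rw [hm.2.eq_of_tgt (d 0) 0, hH.cohom_map_zero]
      exact ⟨e 0 ≪≫ (cokernelZeroIsoTarget.symm ≪≫ cokernelIsoOfEq e1.symm)⟩
  · rw [if_neg (by simp)] at hm
    obtain ⟨wp, hex⟩ := hKp n rfl
    simp only [eqToHom_refl, Category.id_comp] at wp hex
    obtain ⟨h1, ⟨h2⟩⟩ := ComplexExact.shift (n := n + 1) K d w hH hm hK (h0 _ (by norm_num)) hac
      hdual n le_rfl A p wp hp hex
    refine ⟨fun i hi ↦ ?_, ⟨eqToIso (by push_cast; rfl) ≪≫ h2⟩⟩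
    rcases lt_trichotomy i 0 with h | h | h
    · exact h0 i h A
    -- In degree zero the maps induced by `p` and by the last differential are both monomorphisms,
    -- while their composite is zero, so the source vanishes.
    · subst h
      have m1 : Mono ((cohom H 0).map p.op) := hH.mono (kernel_shortExact p) (i := -1) (by norm_num)
        (h0 _ (by norm_num) _)
      have m2 := hdualm n rfl
      have e : (cohom H 0).map p.op ≫ (cohom H 0).map (d n).op = 0 := by
        rw [← Functor.map_comp, ← op_comp, wp, hH.cohom_map_zero]
      rw [IsZero.iff_id_eq_zero, ← cancel_mono ((cohom H 0).map p.op ≫ (cohom H 0).map (d n).op)]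
      rw [e, comp_zero, comp_zero]
    · exact h1 i h (by push_cast at hi; exact hi)

end DimensionShift

/-! ### Sheaves of modules described by sections; exactness as local lifting -/

section SectionSheaves

variable {X : Scheme.{u}}

/-- The presheaf of abelian groups given by groups of sections and restriction maps. -/
def sectionsPresheaf (S : X.Opens → Type u) [∀ U, AddCommGroup (S U)]
    (r : ∀ {V U : X.Opens}, V ≤ U → S U →+ S V) (r_self : ∀ U (s : S U), r le_rfl s = s)
    (r_r : ∀ {W V U : X.Opens} (h : W ≤ V) (h' : V ≤ U) (s : S U), r h (r h' s) = r (h.trans h') s) :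
    X.Opensᵒᵖ ⥤ Ab.{u} where
  obj U := .of (S U.unop)
  map i := AddCommGrpCat.ofHom (r i.unop.le)
  map_id U := by ext s; exact r_self U.unop s
  map_comp i j := by ext s; exact (r_r j.unop.le i.unop.le s).symm

/-- The presheaf of modules given by modules of sections and restriction maps. -/
def presheafOfSections (S : X.Opens → Type u) [∀ U, AddCommGroup (S U)]
    [inst : ∀ U, Module Γ(X, U) (S U)]
    (r : ∀ {V U : X.Opens}, V ≤ U → S U →+ S V) (r_self : ∀ U (s : S U), r le_rfl s = s)
    (r_r : ∀ {W V U : X.Opens} (h : W ≤ V) (h' : V ≤ U) (s : S U), r h (r h' s) = r (h.trans h') s)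
    (r_smul : ∀ {V U : X.Opens} (h : V ≤ U) (c : Γ(X, U)) (s : S U), r h (c • s) = resO h c • r h s) :
    X.PresheafOfModules :=
  letI : ∀ U : X.Opensᵒᵖ, Module (X.ringCatSheaf.obj.obj U)
      ((sectionsPresheaf S r r_self r_r).obj U) := fun U ↦ inst U.unop
  PresheafOfModules.ofPresheaf (R := X.ringCatSheaf.obj) (sectionsPresheaf S r r_self r_r)
    fun _ _ i c s ↦ r_smul i.unop.le c s

/-- The sheaf of modules given by modules of sections and restriction maps. -/
def ofSections (S : X.Opens → Type u) [∀ U, AddCommGroup (S U)] [inst : ∀ U, Module Γ(X, U) (S U)]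
    (r : ∀ {V U : X.Opens}, V ≤ U → S U →+ S V) (r_self : ∀ U (s : S U), r le_rfl s = s)
    (r_r : ∀ {W V U : X.Opens} (h : W ≤ V) (h' : V ≤ U) (s : S U), r h (r h' s) = r (h.trans h') s)
    (r_smul : ∀ {V U : X.Opens} (h : V ≤ U) (c : Γ(X, U)) (s : S U), r h (c • s) = resO h c • r h s)
    (sep : ∀ {ι : Type u} (U : ι → X.Opens) (s t : S (iSup U)),
      (∀ i, r (le_iSup U i) s = r (le_iSup U i) t) → s = t)
    (glue : ∀ {ι : Type u} (U : ι → X.Opens) (s : ∀ i, S (U i)),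
      (∀ i j, r (inf_le_left : U i ⊓ U j ≤ U i) (s i) = r (inf_le_right : U i ⊓ U j ≤ U j) (s j)) →
      ∃ t : S (iSup U), ∀ i, r (le_iSup U i) t = s i) : X.Modules where
  val := presheafOfSections S r r_self r_r r_smul
  isSheaf := by
    change TopCat.Presheaf.IsSheaf (sectionsPresheaf S r r_self r_r)
    rw [TopCat.Presheaf.isSheaf_iff_isSheafUniqueGluing]
    intro ι U φ H
    obtain ⟨t, ht⟩ := glue U φ H
    exact ⟨t, ht, fun t' ht' ↦ sep U t' t fun i ↦ (ht' i).trans (ht i).symm⟩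

lemma res_eq_of_local (M : X.Modules) {U : X.Opens} {s t : Γ(M, U)}
    (h : ∀ x ∈ U, ∃ (V : X.Opens) (hV : V ≤ U), x ∈ V ∧ res M hV s = res M hV t) : s = t := by
  refine res_locally_eq M (ι := {V : X.Opens // ∃ hV : V ≤ U, res M hV s = res M hV t})
    (U := Subtype.val) (fun V ↦ V.2.1) (fun x hx ↦ ?_) fun V ↦ V.2.2
  obtain ⟨V, hV, hx, e⟩ := h x hx
  exact TopologicalSpace.Opens.mem_iSup.2 ⟨⟨V, hV, e⟩, hx⟩

/-- The subsheaf of modules consisting of the sections with a local property. -/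
def subSheaf (N : X.Modules) (S : ∀ U : X.Opens, Submodule Γ(X, U) Γ(N, U))
    (hres : ∀ {V U : X.Opens} (h : V ≤ U), ∀ s ∈ S U, res N h s ∈ S V)
    (hloc : ∀ (U : X.Opens) (s : Γ(N, U)),
      (∀ x ∈ U, ∃ (V : X.Opens) (h : V ≤ U), x ∈ V ∧ res N h s ∈ S V) → s ∈ S U) : X.Modules :=
  ofSections (fun U ↦ S U)
    (fun h ↦ ((res N h).comp (S _).toAddSubgroup.subtype).codRestrict (S _).toAddSubgroup
      fun s ↦ hres h s.1 s.2)
    (fun _ s ↦ Subtype.ext (res_self N _ s.1)) (fun h h' s ↦ Subtype.ext (res_res N h h' s.1))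
    (fun h c s ↦ Subtype.ext (res_smul N h c s.1))
    (fun U s t H ↦ Subtype.ext (res_locally_eq N (le_iSup U) le_rfl
      fun i ↦ congrArg Subtype.val (H i)))
    (fun U s H ↦ by
      obtain ⟨t, ht⟩ := res_glue N (le_iSup U) le_rfl (fun i ↦ (s i).1)
        fun i j ↦ congrArg Subtype.val (H i j)
      refine ⟨⟨t, hloc _ _ fun x hx ↦ ?_⟩, fun i ↦ Subtype.ext (ht i)⟩
      obtain ⟨i, hi⟩ := TopologicalSpace.Opens.mem_iSup.1 hx
      refine ⟨U i, le_iSup U i, hi, ?_⟩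
      rw [ht]
      exact (s i).2)

section
variable {N : X.Modules} {S : ∀ U : X.Opens, Submodule Γ(X, U) Γ(N, U)}
    (hres : ∀ {V U : X.Opens} (h : V ≤ U), ∀ s ∈ S U, res N h s ∈ S V)
    (hloc : ∀ (U : X.Opens) (s : Γ(N, U)),
      (∀ x ∈ U, ∃ (V : X.Opens) (h : V ≤ U), x ∈ V ∧ res N h s ∈ S V) → s ∈ S U)

/-- The inclusion of a subsheaf. -/
def subSheafι : subSheaf N S hres hloc ⟶ N :=
  mkHom (fun U (s : S U) ↦ s.1) (fun _ _ _ ↦ rfl) (fun _ _ _ ↦ rfl) (fun _ _ _ _ ↦ rfl)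

/-- The factorization of a morphism through a subsheaf. -/
def subSheafLift {M : X.Modules} (f : M ⟶ N) (hf : ∀ U (s : Γ(M, U)), (f.app U).hom s ∈ S U) :
    M ⟶ subSheaf N S hres hloc :=
  mkHom (fun U s ↦ (⟨(f.app U).hom s, hf U s⟩ : S U))
    (fun U s t ↦ Subtype.ext (map_add (f.app U).hom s t))
    (fun U r s ↦ Subtype.ext (f.app_smul r s)) (fun V U h s ↦ Subtype.ext (app_res f h s))

lemma subSheafι_mem (U : X.Opens) (s : Γ(subSheaf N S hres hloc, U)) :
    ((subSheafι hres hloc).app U).hom s ∈ S U := Subtype.property (p := (· ∈ S U)) s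

lemma subSheafι_surj {U : X.Opens} {s : Γ(N, U)} (h : s ∈ S U) :
    ∃ t, ((subSheafι hres hloc).app U).hom t = s := ⟨(⟨s, h⟩ : S U), rfl⟩

lemma mono_of_app_injective {M N : X.Modules} (f : M ⟶ N)
    (h : ∀ U, Function.Injective (f.app U).hom) : Mono f where
  right_cancellation _ _ e := modHom_ext fun U s ↦
    h U (congrArg (fun k ↦ (Scheme.Modules.Hom.app k U).hom s) e)

instance : Mono (subSheafι hres hloc) :=
  mono_of_app_injective _ fun _ _ _ h ↦ Subtype.ext h

end

variable {M N K : X.Modules}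

lemma app_injective (f : M ⟶ N) [Mono f] (U : X.Opens) : Function.Injective (f.app U).hom := by
  have : Mono ((Scheme.Modules.toPresheaf X).map f) := inferInstance
  have h := (NatTrans.mono_iff_mono_app _).1 this (.op U)
  exact (AddCommGrpCat.mono_iff_injective _).1 h

/-- The image of a morphism locally contains a section. -/
def LocallyLifts (f : M ⟶ N) {U : X.Opens} (s : Γ(N, U)) : Prop :=
  ∀ x ∈ U, ∃ (V : X.Opens) (h : V ≤ U), x ∈ V ∧ ∃ t, (f.app V).hom t = res N h s

lemma LocallyLifts.res {f : M ⟶ N} {U V : X.Opens} {s : Γ(N, U)} (hs : LocallyLifts f s)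
    (h : V ≤ U) : LocallyLifts f (res N h s) := by
  intro x hx
  obtain ⟨W, hW, hxW, t, ht⟩ := hs x (h hx)
  exact ⟨V ⊓ W, inf_le_left, ⟨hx, hxW⟩, EquivSheaf.res M inf_le_right t, by
    rw [app_res, ht, res_res, res_res]⟩

lemma LocallyLifts.of_local {f : M ⟶ N} {U : X.Opens} {s : Γ(N, U)}
    (H : ∀ x ∈ U, ∃ (V : X.Opens) (h : V ≤ U), x ∈ V ∧ LocallyLifts f (EquivSheaf.res N h s)) :
    LocallyLifts f s := by
  intro x hx
  obtain ⟨V, h, hxV, hV⟩ := H x hx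
  obtain ⟨W, hW, hxW, t, ht⟩ := hV x hxV
  exact ⟨W, hW.trans h, hxW, t, by rw [ht, res_res]⟩

/-- The sections which are locally in the image. -/
def imageSections (f : M ⟶ N) (U : X.Opens) : Submodule Γ(X, U) Γ(N, U) where
  carrier := {s | LocallyLifts f s}
  zero_mem' x hx := ⟨U, le_rfl, hx, 0, by rw [map_zero, map_zero]⟩
  add_mem' {s t} hs ht x hx := by
    obtain ⟨V, hV, hxV, a, ha⟩ := hs x hx
    obtain ⟨W, hW, hxW, b, hb⟩ := ht x hx
    refine ⟨V ⊓ W, inf_le_left.trans hV, ⟨hxV, hxW⟩, EquivSheaf.res M inf_le_left a +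
      EquivSheaf.res M inf_le_right b, ?_⟩
    rw [map_add, app_res, app_res, ha, hb, res_res, res_res, map_add]
  smul_mem' r s hs x hx := by
    obtain ⟨V, hV, hxV, a, ha⟩ := hs x hx
    exact ⟨V, hV, hxV, resO hV r • a, by rw [res_smul, ← ha]; exact f.app_smul _ _⟩

lemma epi_of_locallyLifts (f : M ⟶ N) (h : ∀ U (s : Γ(N, U)), LocallyLifts f s) : Epi f where
  left_cancellation u v e := modHom_ext fun U s ↦ res_eq_of_local _ fun x hx ↦ by
    obtain ⟨V, hV, hxV, t, ht⟩ := h U s x hx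
    refine ⟨V, hV, hxV, ?_⟩
    rw [← app_res, ← app_res, ← ht]
    exact congrArg (fun k ↦ (Scheme.Modules.Hom.app k V).hom t) e

/-- Two explicit subsheaves of `N` are compared: the sections locally in the image of `f`, and the
sections killed by `g`. Exactness passes from `f` to the inclusion of the first, which is a
monomorphism and hence a kernel of `g`; so the second factors through the first. -/
lemma locallyLifts_of_exact {f : M ⟶ N} {g : N ⟶ K} {w : f ≫ g = 0}
    (h : (ShortComplex.mk f g w).Exact) {U : X.Opens} (s : Γ(N, U)) (hs : (g.app U).hom s = 0) :
    LocallyLifts f s := by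
  have h1 {V U : X.Opens} (h : V ≤ U) (s) (hs : s ∈ imageSections f U) :
      res N h s ∈ imageSections f V := LocallyLifts.res hs h
  have h2 (U : X.Opens) (s : Γ(N, U)) (H : ∀ x ∈ U, ∃ (V : X.Opens) (h : V ≤ U), x ∈ V ∧
      res N h s ∈ imageSections f V) : s ∈ imageSections f U := LocallyLifts.of_local H
  let i := subSheafι (S := imageSections f) h1 h2
  let f' : M ⟶ _ := subSheafLift (S := imageSections f) h1 h2 f
    fun U s x hx ↦ ⟨U, le_rfl, hx, s, (res_self _ _ _).symm⟩
  have e : f' ≫ i = f := rfl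
  have wi : i ≫ g = 0 := modHom_ext fun U s ↦ res_eq_of_local _ fun x hx ↦ by
    obtain ⟨V, hV, hxV, t, ht⟩ := subSheafι_mem (S := imageSections f) h1 h2 U s x hx
    refine ⟨V, hV, hxV, ?_⟩
    rw [← app_res, ← app_res]
    change (g.app V).hom ((i.app V).hom (res _ hV s)) = _
    rw [app_res, ← ht]
    exact congrArg (fun k ↦ (Scheme.Modules.Hom.app k V).hom t) w
  have hi : (ShortComplex.mk i g wi).Exact := by
    rw [ShortComplex.exact_iff_epi_kernel_lift] at h ⊢
    dsimp at h ⊢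
    have e2 : kernel.lift g f w = f' ≫ kernel.lift g i wi := by
      rw [← cancel_mono (kernel.ι g)]; simp [e]
    rw [e2] at h
    exact epi_of_epi f' _
  have : Mono i := inferInstanceAs (Mono (subSheafι h1 h2))
  let S2 (U : X.Opens) : Submodule Γ(X, U) Γ(N, U) :=
    { carrier := {s | (g.app U).hom s = 0}
      zero_mem' := map_zero _
      add_mem' := fun {a b} ha hb ↦ by
        change (g.app U).hom (a + b) = 0
        rw [map_add]; exact (congrArg₂ _ ha hb).trans (add_zero _)
      smul_mem' := fun r a ha ↦ (g.app_smul r a).trans (by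
        rw [show (g.app U) a = 0 from ha, smul_zero]) }
  have h3 {V U : X.Opens} (h : V ≤ U) (s) (hs : s ∈ S2 U) : res N h s ∈ S2 V := by
    change (g.app V).hom _ = 0
    rw [app_res, show (g.app U).hom s = 0 from hs, map_zero]
  have h4 (U : X.Opens) (s : Γ(N, U)) (H : ∀ x ∈ U, ∃ (V : X.Opens) (h : V ≤ U), x ∈ V ∧
      res N h s ∈ S2 V) : s ∈ S2 U := by
    refine res_eq_of_local _ fun x hx ↦ ?_
    obtain ⟨V, h, hxV, hV⟩ := H x hx
    refine ⟨V, h, hxV, ?_⟩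
    rw [← app_res, map_zero]
    exact hV
  let k := subSheafι (S := S2) h3 h4
  have wk : k ≫ g = 0 := modHom_ext fun U s ↦ subSheafι_mem (S := S2) h3 h4 U s
  obtain ⟨t, ht⟩ := subSheafι_surj (S := S2) h3 h4 (U := U) (s := s) hs
  have e3 : hi.lift k wk ≫ i = k := hi.lift_f k wk
  have e4 : (i.app U).hom (((hi.lift k wk).app U).hom t) = s :=
    (congrArg (fun k ↦ (Scheme.Modules.Hom.app k U).hom t) e3).trans ht
  rw [← e4]
  exact subSheafι_mem (S := imageSections f) h1 h2 U _

lemma locallyLifts_of_epi (f : M ⟶ N) [Epi f] {U : X.Opens} (s : Γ(N, U)) : LocallyLifts f s :=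
  locallyLifts_of_exact (w := (comp_zero : f ≫ (0 : N ⟶ N) = 0))
    ((ShortComplex.exact_iff_epi _ rfl).2 ‹_›) s rfl

lemma exact_of_locallyLifts {f : M ⟶ N} {g : N ⟶ K} (w : f ≫ g = 0)
    (h : ∀ U (s : Γ(N, U)), (g.app U).hom s = 0 → LocallyLifts f s) :
    (ShortComplex.mk f g w).Exact := by
  rw [ShortComplex.exact_iff_epi_kernel_lift]
  refine epi_of_locallyLifts _ fun U s x hx ↦ ?_
  have e : (g.app U).hom (((kernel.ι g).app U).hom s) = 0 :=
    congrArg (fun k ↦ (Scheme.Modules.Hom.app k U).hom s) (kernel.condition g)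
  obtain ⟨V, hV, hxV, t, ht⟩ := h U _ e x hx
  refine ⟨V, hV, hxV, t, app_injective (kernel.ι g) V ?_⟩
  refine Eq.trans ?_ (ht.trans (app_res _ _ _).symm)
  exact congrArg (fun k ↦ (Scheme.Modules.Hom.app k V).hom t) (kernel.lift_ι g f w)

/-- The sheaf `V ↦ N(V ∩ U)`. -/
def cut (N : X.Modules) (U : X.Opens) : X.Modules :=
  ofSections (fun V ↦ Γ(N, V ⊓ U)) (inst := fun V ↦ Module.compHom _ (resO (inf_le_left : V ⊓ U ≤ V))) (fun h ↦ res N (inf_le_inf_right U h))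
    (fun V s ↦ res_self _ _ _) (fun _ _ _ ↦ res_res _ _ _ _)
    (fun {V W} h c s ↦ by
      refine (res_smul N (inf_le_inf_right U h) (resO inf_le_left c) s).trans ?_
      rw [resO_resO]
      exact (congrArg (· • res N (inf_le_inf_right U h) s) (resO_resO inf_le_left h c)).symm)
    (fun V s t H ↦ res_locally_eq N (fun i ↦ inf_le_inf_right U (le_iSup V i))
      (by rw [iSup_inf_eq]) H)
    (fun V s H ↦ res_glue N (fun i ↦ inf_le_inf_right U (le_iSup V i)) (by rw [iSup_inf_eq]) s
      fun i j ↦ by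
        have e := congrArg (res N (show (V i ⊓ U) ⊓ (V j ⊓ U) ≤ (V i ⊓ V j) ⊓ U from
          le_inf (inf_le_inf inf_le_left inf_le_left) (inf_le_left.trans inf_le_right))) (H i j)
        rwa [res_res, res_res] at e)

/-- Sections of `cut N U`. -/
def cutSec {U V : X.Opens} : Γ(cut N U, V) →+ Γ(N, V ⊓ U) := AddMonoidHom.id _

/-- Sections of `cut N U`. -/
def secCut {U V : X.Opens} : Γ(N, V ⊓ U) →+ Γ(cut N U, V) := AddMonoidHom.id _

lemma cutSec_smul {U V : X.Opens} (r : Γ(X, V)) (s : Γ(cut N U, V)) :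
    cutSec (r • s) = resO (inf_le_left : V ⊓ U ≤ V) r • cutSec s := rfl

lemma cutSec_res {U V W : X.Opens} (h : W ≤ V) (s : Γ(cut N U, V)) :
    cutSec (res _ h s) = res N (inf_le_inf_right U h) (cutSec s) := rfl

/-- Local homomorphisms as homomorphisms to `cut N U`. -/
def localToCut {U : X.Opens} (φ : localHom M N U) : M ⟶ cut N U :=
  mkHom (fun V s ↦ secCut (ev φ (inf_le_right : V ⊓ U ≤ U) (res M inf_le_left s)))
    (fun V s t ↦ by rw [map_add, map_add, map_add])
    (fun V r s ↦ by rw [res_smul, ev_smul]; rfl)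
    (fun W V h s ↦ by
      rw [res_res]
      have := ev_res φ (inf_le_right : V ⊓ U ≤ U) (inf_le_inf_right U h) (res M inf_le_left s)
      rw [res_res] at this
      exact this)

/-- Homomorphisms to `cut N U` as local homomorphisms. -/
def localOfCut {U : X.Opens} (f : M ⟶ cut N U) : localHom M N U :=
  mkLocal (fun V h s ↦ res N (le_inf le_rfl h) (cutSec ((f.app V).hom s)))
    (fun V h s t ↦ by rw [map_add, map_add, map_add])
    (fun V h r s ↦ by
      have e : (f.app V).hom (r • s) = r • (f.app V).hom s := f.app_smul r s
      rw [e, cutSec_smul, res_smul, resO_resO, resO_self])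
    (fun V W h h' s ↦ by rw [app_res, cutSec_res, res_res, res_res])

lemma ev_localOfCut {U : X.Opens} (f : M ⟶ cut N U) {V : X.Opens} (h : V ≤ U) (s : Γ(M, V)) :
    ev (localOfCut f) h s = res N (le_inf le_rfl h) (cutSec ((f.app V).hom s)) := rfl

lemma cutSec_localToCut {U : X.Opens} (φ : localHom M N U) {V : X.Opens} (s : Γ(M, V)) :
    cutSec (((localToCut φ).app V).hom s) = ev φ inf_le_right (res M inf_le_left s) := rfl

/-- `cut N U` is the direct image of the restriction of `N` to `U`, so this is half of the
adjunction between restriction and direct image. It allows local homomorphisms to be treated by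
universal properties of global morphisms. -/
lemma localOfCut_localToCut {U : X.Opens} (φ : localHom M N U) : localOfCut (localToCut φ) = φ :=
  localHom_ext fun V h s ↦ by
    rw [ev_localOfCut, cutSec_localToCut, ← ev_res, res_res, res_self]

end SectionSheaves

/-! ### Injective sheaves: extending homomorphisms defined over an open subset -/

section InjectiveExtension

variable {X : Scheme.{u}}

/-- The inclusion of sheaves into presheaves has an exact left adjoint, namely sheafification, so it
preserves injective objects. -/
lemma injective_val (N : X.Modules) [hN : Injective N] :
    Injective ((Scheme.Modules.toPresheafOfModules X).obj N) := by
  have h : PreservesFiniteLimits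
      (PresheafOfModules.sheafification.{u} (𝟙 X.ringCatSheaf.obj)) := inferInstance
  exact @Injective.injective_of_adjoint _ _ _ _ _ _ inferInstance
    (PresheafOfModules.sheafificationAdjunction.{u} (𝟙 X.ringCatSheaf.obj)) N hN

/-- The sections of `M` over the open subsets of `U`, extended by zero. -/
def zeroExtSections (M : X.Modules) (U V : X.Opens) : Submodule Γ(X, V) Γ(M, V) where
  carrier := {s | ¬ V ≤ U → s = 0}
  zero_mem' _ := rfl
  add_mem' ha hb h := by rw [ha h, hb h, add_zero]
  smul_mem' r s hs h := by rw [hs h, smul_zero]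

lemma res_mem_zeroExtSections (M : X.Modules) {U V W : X.Opens} (h : W ≤ V) {s : Γ(M, V)}
    (hs : s ∈ zeroExtSections M U V) : res M h s ∈ zeroExtSections M U W := fun h' ↦ by
  rw [hs fun h'' ↦ h' (h.trans h''), map_zero]

/-- The presheaf extension by zero of the restriction of a sheaf to an open subset. -/
def zeroExt (M : X.Modules) (U : X.Opens) : X.PresheafOfModules :=
  presheafOfSections (fun V ↦ zeroExtSections M U V)
    (fun h ↦ ((res M h).comp (zeroExtSections M U _).toAddSubgroup.subtype).codRestrict
      (zeroExtSections M U _).toAddSubgroup fun s ↦ res_mem_zeroExtSections M h s.2)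
    (fun _ s ↦ Subtype.ext (res_self M _ s.1)) (fun h h' s ↦ Subtype.ext (res_res M h h' s.1))
    fun h c s ↦ Subtype.ext (res_smul M h c s.1)

open Classical in
/-- The value of a local homomorphism on a section, extended by zero. -/
def evZero {M N : X.Modules} {U : X.Opens} (φ : localHom M N U) (V : X.Opens) (s : Γ(M, V)) :
    Γ(N, V) :=
  if h : V ≤ U then ev φ h s else 0

lemma evZero_of_le {M N : X.Modules} {U : X.Opens} (φ : localHom M N U) {V : X.Opens} (h : V ≤ U)
    (s : Γ(M, V)) : evZero φ V s = ev φ h s := dif_pos h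

lemma evZero_of_not_le {M N : X.Modules} {U : X.Opens} (φ : localHom M N U) {V : X.Opens}
    (h : ¬ V ≤ U) (s : Γ(M, V)) : evZero φ V s = 0 := dif_neg h

lemma evZero_add {M N : X.Modules} {U : X.Opens} (φ : localHom M N U) (V : X.Opens)
    (s t : Γ(M, V)) : evZero φ V (s + t) = evZero φ V s + evZero φ V t := by
  by_cases h : V ≤ U
  · simp_rw [evZero_of_le φ h, map_add]
  · simp_rw [evZero_of_not_le φ h, add_zero]

lemma evZero_smul {M N : X.Modules} {U : X.Opens} (φ : localHom M N U) (V : X.Opens)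
    (r : Γ(X, V)) (s : Γ(M, V)) : evZero φ V (r • s) = r • evZero φ V s := by
  by_cases h : V ≤ U
  · simp_rw [evZero_of_le φ h, ev_smul]
  · simp_rw [evZero_of_not_le φ h, smul_zero]

/-- If `W` lies in `U` but `V` does not, the two sides agree only because `s` is zero; this is why
membership in `zeroExtSections` is required. -/
lemma evZero_res {M N : X.Modules} {U : X.Opens} (φ : localHom M N U) {W V : X.Opens}
    (h : W ≤ V) {s : Γ(M, V)} (hs : s ∈ zeroExtSections M U V) :
    evZero φ W (res M h s) = res N h (evZero φ V s) := by
  by_cases hV : V ≤ U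
  · rw [evZero_of_le φ hV, evZero_of_le φ (h.trans hV), ev_res]
  · have e : evZero φ W 0 = 0 := by
      have := evZero_add φ W 0 0
      rwa [add_zero, left_eq_add] at this
    rw [hs hV, map_zero, e, evZero_of_not_le φ hV, map_zero]

/-- Local homomorphisms extended by zero. -/
def zeroExtOfLocal {M N : X.Modules} {U : X.Opens} (φ : localHom M N U) :
    zeroExt M U ⟶ (Scheme.Modules.toPresheafOfModules X).obj N :=
  PresheafOfModules.homMk
    { app := fun V ↦ AddCommGrpCat.ofHom (AddMonoidHom.mk'
        (fun s : zeroExtSections M U V.unop ↦ (evZero φ V.unop s.1 : Γ(N, V.unop)))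
        (fun s t ↦ evZero_add φ _ s.1 t.1))
      naturality := fun V W i ↦ by
        ext s
        exact evZero_res φ i.unop.le (Subtype.property (p := (· ∈ zeroExtSections M U V.unop)) s) }
    fun V r s ↦ evZero_smul φ V.unop r (Subtype.val (p := (· ∈ zeroExtSections M U V.unop)) s)

/-- The functoriality of the extension by zero. -/
def zeroExtMap {M M' : X.Modules} (f : M' ⟶ M) (U : X.Opens) : zeroExt M' U ⟶ zeroExt M U :=
  PresheafOfModules.homMk
    { app := fun V ↦ AddCommGrpCat.ofHom
        (((f.app V.unop).hom.comp (zeroExtSections M' U V.unop).toAddSubgroup.subtype).codRestrict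
          (zeroExtSections M U V.unop).toAddSubgroup fun s h ↦ by
            change (f.app V.unop).hom s.1 = 0
            rw [s.2 h, map_zero])
      naturality := fun V W i ↦ by
        ext s
        exact Subtype.ext (app_res f i.unop.le
          (Subtype.val (p := (· ∈ zeroExtSections M' U V.unop)) s)) }
    fun V r s ↦ Subtype.ext (f.app_smul (U := V.unop) r
      (Subtype.val (p := (· ∈ zeroExtSections M' U V.unop)) s))

/-- A homomorphism from the extension by zero as a local homomorphism. -/
def localOfZeroExt {M N : X.Modules} {U : X.Opens}
    (ψ : zeroExt M U ⟶ (Scheme.Modules.toPresheafOfModules X).obj N) :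
    localHom M N U :=
  mkLocal (fun V h s ↦ (ψ.app (.op V)).hom (⟨s, fun h' ↦ absurd h h'⟩ : zeroExtSections M U V))
    (fun V h s t ↦ map_add (ψ.app (.op V)).hom (⟨s, fun h' ↦ absurd h h'⟩ : zeroExtSections M U V)
      (⟨t, fun h' ↦ absurd h h'⟩ : zeroExtSections M U V))
    (fun V h r s ↦ (ψ.app (.op V)).hom.map_smul r
      (⟨s, fun h' ↦ absurd h h'⟩ : zeroExtSections M U V))
    (fun V W h h' s ↦ PresheafOfModules.naturality_apply ψ (homOfLE h').op
      (⟨s, fun h' ↦ absurd h h'⟩ : zeroExtSections M U W))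

/-- Local homomorphisms to an injective sheaf of modules extend along monomorphisms. -/
lemma localPre_surjective {M M' : X.Modules} (f : M' ⟶ M) [Mono f] (N : X.Modules) [Injective N]
    {U : X.Opens} (φ : localHom M' N U) : ∃ ψ : localHom M N U, localPre f N ψ = φ := by
  -- Local homomorphisms over `U` are presheaf morphisms out of the extension by zero from `U`.
  -- Working with presheaves avoids sheafifying that extension and makes its functoriality in a
  -- monomorphism visibly injective.
  have := injective_val N
  have hm : Mono (zeroExtMap f U) := PresheafOfModules.mono_of_injective
    fun V s t h ↦ Subtype.ext (app_injective f V.unop (congrArg Subtype.val h))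
  obtain ⟨ψ, hψ⟩ := Injective.factors (zeroExtOfLocal φ) (zeroExtMap f U)
  refine ⟨localOfZeroExt ψ, localHom_ext fun V h s ↦ ?_⟩
  have e := congrArg (fun k ↦ (PresheafOfModules.Hom.app k (.op V)).hom
    (⟨s, fun h' ↦ absurd h h'⟩ : zeroExtSections M' U V)) hψ
  exact Eq.trans e (evZero_of_le φ h s)

end InjectiveExtension

/-! ### Injective equivariant sheaves and exactness of `ℋom(-, I)` -/

section EquivariantInjective

variable {X : Scheme.{u}} {G : Type} [Group G] {a : G →* End X}

lemma injective_push (g : G) (J : X.Modules) [Injective J] : Injective ((push a g).obj J) := by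
  let e : X.Modules ≌ X.Modules := CategoryTheory.Equivalence.mk (push a g⁻¹) (push a g)
    (pushOne a ≪≫ pushCongr a (mul_inv_cancel g).symm ≪≫ (pushMul a g g⁻¹).symm)
    (pushMul a g⁻¹ g ≪≫ pushCongr a (inv_mul_cancel g) ≪≫ (pushOne a).symm)
  have : (push a g⁻¹).IsEquivalence := e.isEquivalence_functor
  exact Injective.injective_of_adjoint e.toAdjunction J

/-- Frobenius reciprocity embeds `I` equivariantly into the sheaf coinduced from an injective
hull-like object `J`. As a sheaf this is a product of translates of `J`, hence injective, and
injectivity of `I` as an equivariant sheaf splits the embedding. -/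
lemma injective_sheaf (I : GSheaf a) [Injective I] : Injective I.sheaf := by
  let J := Injective.under I.sheaf
  have hm : Mono (GSheaf.toCoind I (Injective.ι I.sheaf)) := by
    apply (GSheaf.forget a).mono_of_mono_map
    have : Mono (GSheaf.toCoindHom I (Injective.ι I.sheaf) ≫ GSheaf.coindEval J) := by
      rw [GSheaf.toCoind_eval]; infer_instance
    exact mono_of_mono (GSheaf.toCoindHom I (Injective.ι I.sheaf)) (GSheaf.coindEval J)
  have (g : G) := injective_push (a := a) g J
  have hJ : Injective (GSheaf.coindSheaf a J) := inferInstance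
  obtain ⟨r, hr⟩ := Injective.factors (𝟙 I) (GSheaf.toCoind I (Injective.ι I.sheaf))
  let R : Retract I.sheaf (GSheaf.coindSheaf a J) :=
    { i := (GSheaf.toCoind I (Injective.ι I.sheaf)).hom
      r := r.hom
      retract := congrArg GSheaf.Hom.hom hr }
  exact ⟨fun {A B} u f _ ↦ by
    obtain ⟨v, hv⟩ := Injective.factors (u ≫ R.i) f
    exact ⟨v ≫ R.r, by rw [← Category.assoc, hv, Category.assoc, R.retract, Category.comp_id]⟩⟩

namespace GSheaf

/-- `ℋom(-, N)` on morphisms of equivariant sheaves. -/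
def homPre {F F' : GSheaf a} (f : F' ⟶ F) (N : GSheaf a) : homObj F N ⟶ homObj F' N :=
  Hom.mk (precomp f.hom N.sheaf) fun g ↦ modHom_ext fun U φ ↦
    localAct_ext (F := F') (N := N) (g := g) (U := U) fun V h t ↦ by
      have e : (f.hom.app ((a g) ⁻¹ᵁ V)).hom (F'.pull g t) = F.pull g ((f.hom.app V).hom t) :=
        congrArg (fun k ↦ (Scheme.Modules.Hom.app k V).hom t) (f.comm g)
      have e2 := localAct_pull g (toLocal φ) h ((f.hom.app V).hom t)
      rw [← e] at e2
      exact e2.trans (localAct_pull g (localPre f.hom N.sheaf (toLocal φ)) h t).symm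

lemma homPre_comp {F F' F'' : GSheaf a} (f : F'' ⟶ F') (g : F' ⟶ F) (N : GSheaf a) :
    homPre (f ≫ g) N = homPre g N ≫ homPre f N := rfl

lemma homPre_homMap {F F' N N' : GSheaf a} (f : F' ⟶ F) (g : N ⟶ N') :
    homMap g ≫ homPre f N' = homPre f N ≫ homMap g := rfl

/-- The complex `ℋom(-, I)` for a complex `I`. -/
def homComplex (I : CochainComplex (GSheaf a) ℤ) :
    (GSheaf a)ᵒᵖ ⥤ CochainComplex (GSheaf a) ℤ where
  obj F := ((homFunctor F.unop).mapHomologicalComplex (.up ℤ)).obj I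
  map f :=
    { f := fun i ↦ homPre f.unop (I.X i)
      comm' := fun _ _ _ ↦ (homPre_homMap _ _).symm }
  map_id _ := rfl
  map_comp _ _ := rfl

lemma shortExact_of_forget {S : ShortComplex (GSheaf a)} (h : (S.map (forget a)).ShortExact) :
    S.ShortExact where
  exact := (ShortComplex.exact_map_iff_of_faithful S (forget a)).1 h.exact
  mono_f := (forget a).mono_of_mono_map h.mono_f
  epi_g := (forget a).epi_of_epi_map h.epi_g

/-- Left exactness is the universal property of the quotient `g`, and surjectivity at the end holds
already over every open subset because the underlying sheaf of `N` is injective. -/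
lemma homPre_shortExact {F F' F'' : GSheaf a} {f : F ⟶ F'} {g : F' ⟶ F''} {w : f ≫ g = 0}
    (h : (ShortComplex.mk f g w).ShortExact) (N : GSheaf a) [Injective N] :
    ∃ w', (ShortComplex.mk (homPre g N) (homPre f N) w').ShortExact := by
  have hN := injective_sheaf N
  have h' := h.map_of_exact (forget a)
  have hf : Mono f.hom := h'.mono_f
  have hg : Epi g.hom := h'.epi_g
  have wh : f.hom ≫ g.hom = 0 := congrArg Hom.hom w
  have hex : (ShortComplex.mk f.hom g.hom wh).Exact := h'.exact
  have w' : homPre g N ≫ homPre f N = 0 := by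
    rw [← homPre_comp, w]
    ext1
    exact modHom_ext fun U φ ↦ localHom_ext fun V h s ↦
      map_zero (ev (M := F''.sheaf) (N := N.sheaf) (toLocal φ) h)
  refine ⟨w', shortExact_of_forget ?_⟩
  refine ShortComplex.ShortExact.mk' (exact_of_locallyLifts _ fun U φ hφ x hx ↦ ?_) ?_ ?_
  -- A local homomorphism killed by restriction along `f` is a global morphism to `cut N U`
  -- vanishing on `F`, so it factors through the cokernel `g`.
  · have e1 : f.hom ≫ localToCut (toLocal φ) = 0 := modHom_ext fun V s ↦ by
      refine Eq.trans (b := secCut (ev (toLocal φ) inf_le_right (res _ inf_le_left ((f.hom.app V).hom s)))) rfl ?_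
      rw [← app_res]
      exact congrArg (fun k : localHom F.sheaf N.sheaf U ↦ ev k inf_le_right (res _ inf_le_left s)) hφ
    have e2 : g.hom ≫ hex.desc (localToCut (toLocal φ)) e1 = localToCut (toLocal φ) :=
      hex.g_desc _ e1
    refine ⟨U, le_rfl, hx, ofLocal (localOfCut (hex.desc (localToCut (toLocal φ)) e1)), ?_⟩
    rw [res_self]
    refine (localHom_ext fun V h s ↦ ?_ : localPre g.hom N.sheaf (localOfCut (hex.desc (localToCut (toLocal φ)) e1)) = toLocal φ)
    rw [ev_localPre, ev_localOfCut]
    have e3 := congrArg (fun k ↦ (Scheme.Modules.Hom.app k V).hom s) e2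
    refine (congrArg (fun k ↦ res N.sheaf (le_inf le_rfl h) (cutSec k)) e3).trans ?_
    exact congrArg (fun k ↦ ev k h s) (localOfCut_localToCut (toLocal φ))
  · refine mono_of_app_injective _ fun U φ ψ e ↦ localHom_ext fun V h s ↦ ?_
    refine res_eq_of_local _ fun x hx ↦ ?_
    obtain ⟨W, hW, hxW, t, ht⟩ := locallyLifts_of_epi g.hom s x hx
    refine ⟨W, hW, hxW, ?_⟩
    change res _ hW (ev (toLocal φ) h s) = res _ hW (ev (toLocal ψ) h s)
    rw [← ev_res, ← ev_res, ← ht]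
    exact congrArg (fun k : localHom F'.sheaf N.sheaf U ↦ ev k (hW.trans h) t) e
  · refine epi_of_locallyLifts _ fun U φ x hx ↦ ?_
    obtain ⟨ψ, hψ⟩ := localPre_surjective f.hom N.sheaf (toLocal φ)
    refine ⟨U, le_rfl, hx, ofLocal ψ, ?_⟩
    rw [res_self]
    exact hψ

lemma homComplex_exact (I : CochainComplex (GSheaf a) ℤ) [∀ i, Injective (I.X i)] :
    ComplexExact (homComplex I) := by
  intro A B D f g w h
  have w' : (homComplex I).map g.op ≫ (homComplex I).map f.op = 0 := by
    ext i : 1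
    exact (homPre_shortExact h (I.X i)).1
  refine ⟨w', HomologicalComplex.shortExact_of_degreewise_shortExact _ fun i ↦ ?_⟩
  exact (homPre_shortExact h (I.X i)).2

end GSheaf

end EquivariantInjective

/-! ### Dual bases and exactness of `ℋom(E, -)` -/

section DualBases

variable {X : Scheme.{u}} {M N K : X.Modules}

/-- Preimages under a monomorphism are unique, so the local ones agree on overlaps and glue. -/
lemma LocallyLifts.exists_of_mono {f : M ⟶ N} [Mono f] {U : X.Opens} {s : Γ(N, U)}
    (h : LocallyLifts f s) : ∃ t, (f.app U).hom t = s := by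
  have hc : ∀ V : {V : X.Opens // ∃ h : V ≤ U, ∃ t, (f.app V).hom t = EquivSheaf.res N h s},
    ∃ t, (f.app V.1).hom t = EquivSheaf.res N V.2.1 s := fun V ↦ V.2.2
  choose t ht using hc
  have hU : U ≤ iSup (fun V : {V : X.Opens // ∃ h : V ≤ U, ∃ t, (f.app V).hom t =
      EquivSheaf.res N h s} ↦ V.1) := fun x hx ↦ by
    obtain ⟨V, hV, hxV, t, ht⟩ := h x hx
    exact TopologicalSpace.Opens.mem_iSup.2 ⟨⟨V, hV, t, ht⟩, hxV⟩
  obtain ⟨t', ht'⟩ := res_glue M (fun V ↦ V.2.1) hU t fun V W ↦ app_injective f _ (by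
    rw [app_res, app_res, ht, ht, res_res, res_res])
  refine ⟨t', res_locally_eq N (fun V ↦ V.2.1) hU fun V ↦ ?_⟩
  rw [← app_res, ht', ht]

/-- A dual basis of a sheaf of modules over an open subset. -/
def HasDualBasis (E : X.Modules) (U : X.Opens) : Prop :=
  ∃ (κ : Type) (_ : Fintype κ) (e : κ → Γ(E, U)) (c : κ → localHom E (structureSheaf X) U),
    ∀ (V : X.Opens) (h : V ≤ U) (s : Γ(E, V)), s = ∑ k, toFun (ev (c k) h s) • res E h (e k)

/-- Every point has a neighbourhood with a dual basis. -/
def LocallyDualizable (E : X.Modules) : Prop :=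
  ∀ x : X, ∃ U : X.Opens, x ∈ U ∧ HasDualBasis E U

lemma HasDualBasis.res {E : X.Modules} {U V : X.Opens} (hE : HasDualBasis E U) (h : V ≤ U) :
    HasDualBasis E V := by
  obtain ⟨κ, _, e, c, H⟩ := hE
  refine ⟨κ, ‹_›, fun k ↦ EquivSheaf.res E h (e k), fun k ↦ localRes _ _ h (c k), fun W hW s ↦ ?_⟩
  simp_rw [ev_localRes, res_res]
  exact H W _ s

/-- The local homomorphism given by coordinates and values. -/
def localOfBasis {E : X.Modules} {U : X.Opens} {κ : Type} [Fintype κ]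
    (c : κ → localHom E (structureSheaf X) U) (t : κ → Γ(N, U)) : localHom E N U :=
  mkLocal (fun V h s ↦ ∑ k, toFun (ev (c k) h s) • res N h (t k))
    (fun V h s s' ↦ by simp_rw [map_add, add_smul, Finset.sum_add_distrib])
    (fun V h r s ↦ by
      rw [Finset.smul_sum]
      refine Finset.sum_congr rfl fun k _ ↦ ?_
      rw [ev_smul]
      exact mul_smul r (toFun (ev (c k) h s)) (res N h (t k)))
    (fun V W h h' s ↦ by
      rw [map_sum]
      refine Finset.sum_congr rfl fun k _ ↦ ?_
      rw [ev_res (c k) h, res_smul, res_res]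
      rfl)

lemma ev_localOfBasis {E : X.Modules} {U : X.Opens} {κ : Type} [Fintype κ]
    (c : κ → localHom E (structureSheaf X) U) (t : κ → Γ(N, U)) {V : X.Opens} (h : V ≤ U)
    (s : Γ(E, V)) : ev (localOfBasis c t) h s = ∑ k, toFun (ev (c k) h s) • res N h (t k) := rfl

lemma eq_localOfBasis {E : X.Modules} {U : X.Opens} {κ : Type} [Fintype κ]
    {c : κ → localHom E (structureSheaf X) U} {e : κ → Γ(E, U)}
    (H : ∀ (V : X.Opens) (h : V ≤ U) (s : Γ(E, V)), s = ∑ k, toFun (ev (c k) h s) • res E h (e k))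
    (φ : localHom E N U) : φ = localOfBasis c fun k ↦ ev φ le_rfl (e k) :=
  localHom_ext fun V h s ↦ by
    rw [ev_localOfBasis]
    conv_lhs => rw [H V h s]
    rw [map_sum]
    exact Finset.sum_congr rfl fun k _ ↦ by rw [ev_smul, ev_res φ le_rfl h]

/-- A homomorphism from `E` is determined by its values on a dual basis. These are finitely many
sections of `N` killed by `g`, so they lift to `M` on a common smaller neighbourhood, and the
coordinates reassemble the lifts into a homomorphism. -/
lemma postcomp_locallyLifts {E : X.Modules} (hE : LocallyDualizable E) (f : M ⟶ N) {g : N ⟶ K}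
    (w : f ≫ g = 0) (hex : (ShortComplex.mk f g w).Exact) {U : X.Opens}
    (φ : Γ(sheafHom E N, U)) (hφ : ((postcomp E g).app U).hom φ = 0) :
    LocallyLifts (postcomp E f) φ := by
  intro x hx
  obtain ⟨V₀, hxV₀, hV₀⟩ := hE x
  obtain ⟨κ, _, e, c, H⟩ := hV₀.res (inf_le_left : V₀ ⊓ U ≤ V₀)
  have h0 : V₀ ⊓ U ≤ U := inf_le_right
  have hx0 : x ∈ V₀ ⊓ U := ⟨hxV₀, hx⟩
  have h1 (k : κ) : LocallyLifts f (ev (toLocal φ) h0 (e k)) := by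
    refine locallyLifts_of_exact hex _ ?_
    exact congrArg (fun k' : localHom E K U ↦ ev k' h0 (e k)) hφ
  choose V hV hxV t ht using fun k ↦ h1 k x hx0
  let W : X.Opens := (V₀ ⊓ U) ⊓ Finset.univ.inf V
  have hW : W ≤ V₀ ⊓ U := inf_le_left
  have hWV (k : κ) : W ≤ V k := inf_le_right.trans (Finset.inf_le (Finset.mem_univ k))
  have hxW : x ∈ W := by
    refine ⟨hx0, ?_⟩
    have : ∀ S : Finset κ, x ∈ S.inf V := by
      intro S
      classical
      induction S using Finset.induction_on with
      | empty => trivial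
      | insert k S _ ih => rw [Finset.inf_insert]; exact ⟨hxV k, ih⟩
    exact this _
  refine ⟨W, hW.trans h0, hxW, ofLocal (localOfBasis (fun k ↦ localRes _ _ hW (c k))
    fun k ↦ res M (hWV k) (t k)), localHom_ext fun Z hZ s ↦ ?_⟩
  have e1 := congrArg (fun k' ↦ ev k' (hZ.trans hW) s)
    (eq_localOfBasis H (localRes _ _ h0 (toLocal φ)))
  refine Eq.trans ?_ e1.symm
  change (f.app Z).hom (ev (localOfBasis _ _) hZ s) = _
  rw [ev_localOfBasis]
  change _ = ev (localOfBasis _ _) _ s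
  rw [ev_localOfBasis, map_sum]
  refine Finset.sum_congr rfl fun k _ ↦ ?_
  refine (f.app_smul _ _).trans ?_
  refine congrArg₂ (· • ·) rfl ?_
  refine (app_res f _ _).trans ?_
  refine (congrArg (res N hZ) (app_res f _ _)).trans ?_
  rw [ht, res_res, res_res, ev_localRes]

/-- Left exactness needs no dual basis: every value lifts uniquely through the monomorphism, and
uniqueness gives additivity, linearity and compatibility with restriction. -/
lemma postcomp_lifts_of_mono {E : X.Modules} (f : M ⟶ N) [Mono f] {g : N ⟶ K}
    (w : f ≫ g = 0) (hex : (ShortComplex.mk f g w).Exact) {U : X.Opens}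
    (φ : Γ(sheafHom E N, U)) (hφ : ((postcomp E g).app U).hom φ = 0) :
    ∃ χ, ((postcomp E f).app U).hom χ = φ := by
  have key (V : X.Opens) (h : V ≤ U) (s : Γ(E, V)) : ∃ t, (f.app V).hom t = ev (toLocal φ) h s := by
    refine (locallyLifts_of_exact hex _ ?_).exists_of_mono
    exact congrArg (fun k' : localHom E K U ↦ ev k' h s) hφ
  choose t ht using key
  refine ⟨ofLocal (mkLocal t (fun V h s s' ↦ app_injective f V ?_)
    (fun V h r s ↦ app_injective f V ?_) fun V W h h' s ↦ app_injective f V ?_), ?_⟩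
  · rw [map_add, ht, ht, ht, map_add]
  · have e : (f.app V).hom (r • t V h s) = r • (f.app V).hom (t V h s) := f.app_smul r _
    rw [e, ht, ht, ev_smul]
  · rw [app_res, ht, ht, ev_res]
  · exact localHom_ext fun V h s ↦ ht V h s

end DualBases

/-! ### Cohomology of `ℋom(E, I)` for an injective resolution `I` -/

section Acyclic

variable {X : Scheme.{u}} {G : Type} [Group G] {a : G →* End X}

namespace GSheaf

lemma exact_of_locallyLifts' {M N K : GSheaf a} {f : M ⟶ N} {g : N ⟶ K} (w : f ≫ g = 0)
    (h : ∀ U (s : Γ(N.sheaf, U)), (g.hom.app U).hom s = 0 → LocallyLifts f.hom s) :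
    (ShortComplex.mk f g w).Exact :=
  (ShortComplex.exact_map_iff_of_faithful _ (forget a)).1
    (exact_of_locallyLifts (congrArg Hom.hom w) h)

lemma forget_exact {M N K : GSheaf a} {f : M ⟶ N} {g : N ⟶ K} {w : f ≫ g = 0}
    (h : (ShortComplex.mk f g w).Exact) :
    (ShortComplex.mk f.hom g.hom (congrArg Hom.hom w)).Exact :=
  (ShortComplex.exact_map_iff_of_faithful _ (forget a)).2 h

/-- For locally dualizable `E` the functor `ℋom(E, -)` preserves exactness in the middle, so it
creates no cohomology where `I` has none. -/
lemma homComplex_acyclic (I : CochainComplex (GSheaf a) ℤ) (hI : ∀ i > 0, I.ExactAt i)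
    (E : GSheaf a) (hE : LocallyDualizable E.sheaf) (i : ℤ) (hi : 0 < i) :
    IsZero ((cohom (homComplex I) i).obj (.op E)) := by
  have h := hI i hi
  rw [HomologicalComplex.exactAt_iff' I (i - 1) i (i + 1) (by simp) (by simp)] at h
  refine HomologicalComplex.ExactAt.isZero_homology ?_
  rw [HomologicalComplex.exactAt_iff' _ (i - 1) i (i + 1) (by simp) (by simp)]
  exact exact_of_locallyLifts' _ fun U s hs ↦ postcomp_locallyLifts hE _ _ (forget_exact h) s hs

lemma homComplex_neg (I : CochainComplex (GSheaf a) ℤ) [I.IsStrictlyGE 0]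
    (E : GSheaf a) (i : ℤ) (hi : i < 0) :
    IsZero ((cohom (homComplex I) i).obj (.op E)) := by
  refine HomologicalComplex.ExactAt.isZero_homology ?_
  refine ShortComplex.exact_of_isZero_X₂ _ ?_
  exact (homFunctor E).map_isZero (CochainComplex.isZero_of_isStrictlyGE I 0 i hi)

/-- The functor `ℋom(-, N)`. -/
def homDual (N : GSheaf a) : (GSheaf a)ᵒᵖ ⥤ GSheaf a where
  obj E := homObj E.unop N
  map f := homPre f.unop N
  map_id _ := rfl
  map_comp _ _ := rfl

instance (E : GSheaf a) {N N' : GSheaf a} (f : N ⟶ N') [Mono f] : Mono (homMap (F := E) f) := by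
  have : Mono f.hom := inferInstanceAs (Mono ((forget a).map f))
  refine (forget a).mono_of_mono_map (mono_of_app_injective _ fun U φ ψ h ↦
    localHom_ext fun V hV s ↦ app_injective f.hom V ?_)
  exact congrArg (fun k : localHom E.sheaf N'.sheaf U ↦ ev k hV s) h

lemma homMap_exact (E : GSheaf a) {N N' N'' : GSheaf a} {f : N ⟶ N'} [Mono f] {g : N' ⟶ N''}
    {w : f ≫ g = 0} (h : (ShortComplex.mk f g w).Exact) :
    ∃ w', (ShortComplex.mk (homMap (F := E) f) (homMap (F := E) g) w').Exact := by
  have : Mono f.hom := inferInstanceAs (Mono ((forget a).map f))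
  have w' : homMap (F := E) f ≫ homMap (F := E) g = 0 := by
    change (homFunctor E).map f ≫ (homFunctor E).map g = 0
    rw [← Functor.map_comp, w, Functor.map_zero]
  refine ⟨w', exact_of_locallyLifts' _ fun U s hs x hx ↦ ?_⟩
  obtain ⟨χ, hχ⟩ := postcomp_lifts_of_mono f.hom _ (forget_exact h) s hs
  exact ⟨U, le_rfl, hx, χ, by rw [res_self]; exact hχ⟩

/-- The comparison of `ℋom(-, N)` with the cycles of `ℋom(-, I)` in degree zero. -/
def homDualCycles (I : CochainComplex (GSheaf a) ℤ) {N : GSheaf a} (i : N ⟶ I.X 0)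
    (w : i ≫ I.d 0 1 = 0) (E : (GSheaf a)ᵒᵖ) :
    (homDual N).obj E ⟶ ((homComplex I).obj E).cycles 0 :=
  ((homComplex I).obj E).liftCycles (A := (homDual N).obj E) (homMap (F := E.unop) i) 1 (by simp)
    (by
      change (homFunctor E.unop).map i ≫ (homFunctor E.unop).map (I.d 0 1) = 0
      rw [← Functor.map_comp, w, Functor.map_zero])

lemma homDualCycles_i (I : CochainComplex (GSheaf a) ℤ) {N : GSheaf a} (i : N ⟶ I.X 0)
    (w : i ≫ I.d 0 1 = 0) (E : (GSheaf a)ᵒᵖ) :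
    homDualCycles I i w E ≫ ((homComplex I).obj E).iCycles 0 = homMap (F := E.unop) i :=
  HomologicalComplex.liftCycles_i _ _ _ _ _

/-- The comparison of `ℋom(-, N)` with the zeroth cohomology of `ℋom(-, I)`. -/
def homDualTo (I : CochainComplex (GSheaf a) ℤ) {N : GSheaf a} (i : N ⟶ I.X 0)
    (w : i ≫ I.d 0 1 = 0) : homDual N ⟶ cohom (homComplex I) 0 where
  app E := homDualCycles I i w E ≫ ((homComplex I).obj E).homologyπ 0
  naturality E E' f := by
    have e1 := HomologicalComplex.homologyπ_naturality ((homComplex I).map f) 0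
    have e2 : (homDual N).map f ≫ homDualCycles I i w E' =
        homDualCycles I i w E ≫ HomologicalComplex.cyclesMap ((homComplex I).map f) 0 := by
      rw [← cancel_mono (((homComplex I).obj E').iCycles 0), Category.assoc, Category.assoc,
        HomologicalComplex.cyclesMap_i, homDualCycles_i, ← Category.assoc, homDualCycles_i]
      rfl
    exact (Category.assoc _ _ _).symm.trans
      ((congrArg (· ≫ ((homComplex I).obj E').homologyπ 0) e2).trans
        ((Category.assoc _ _ _).trans ((congrArg (homDualCycles I i w E ≫ ·) e1.symm).trans
          (Category.assoc _ _ _).symm)))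

/-- By left exactness `ℋom(E, N)` is the object of cycles in degree zero, and there are no
boundaries because the complex vanishes in degree `-1`. -/
lemma isIso_homDualTo (I : CochainComplex (GSheaf a) ℤ) [I.IsStrictlyGE 0] {N : GSheaf a}
    (i : N ⟶ I.X 0) [Mono i] (w : i ≫ I.d 0 1 = 0) (h : (ShortComplex.mk i (I.d 0 1) w).Exact) :
    IsIso (homDualTo I i w) := by
  rw [NatTrans.isIso_iff_isIso_app]
  intro E
  let K := (homComplex I).obj E
  have h1 : IsIso (K.homologyπ 0) := by
    refine K.isIso_homologyπ (-1) 0 (by simp) ?_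
    exact ((homFunctor E.unop).map_isZero
      (CochainComplex.isZero_of_isStrictlyGE I 0 (-1) (by norm_num))).eq_of_src _ _
  obtain ⟨w', hex⟩ := homMap_exact E.unop h
  let l := K.liftCycles (homMap (F := E.unop) i) 1 (by simp) w'
  have hl : l ≫ K.iCycles 0 = homMap (F := E.unop) i := K.liftCycles_i _ _ _ _
  have h2 : IsIso l := by
    refine ⟨hex.lift (K.iCycles 0) (K.iCycles_d 0 1), ?_, ?_⟩
    · rw [← cancel_mono (homMap (F := E.unop) i), Category.assoc]
      exact (congrArg _ (hex.lift_f _ _)).trans (hl.trans (Category.id_comp _).symm)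
    · rw [← cancel_mono (K.iCycles 0), Category.assoc, hl]
      exact (hex.lift_f _ _).trans (Category.id_comp _).symm
  exact inferInstanceAs (IsIso (l ≫ K.homologyπ 0))

lemma resolution_exactAt {N : GSheaf a} (R : InjectiveResolution N) (i : ℤ) (hi : 0 < i) :
    R.cochainComplex.ExactAt i :=
  R.cochainComplex.exactAt_of_isLE 0 i hi

/-- The augmentation of a resolution indexed by natural numbers is carried over to the cochain
complex indexed by integers in which derived functors are computed. -/
lemma resolution_zero {N : GSheaf a} (R : InjectiveResolution N) :
    ∃ (i : N ⟶ R.cochainComplex.X 0) (_ : Mono i) (w : i ≫ R.cochainComplex.d 0 1 = 0),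
      (ShortComplex.mk i (R.cochainComplex.d 0 1) w).Exact := by
  let e := R.cochainComplexXIso 0 0 (by simp)
  let e1 := R.cochainComplexXIso 1 1 (by simp)
  let j : N ⟶ R.cocomplex.X 0 := R.ι.f 0
  have wj : j ≫ R.cocomplex.d 0 1 = 0 := R.ι_f_zero_comp_complex_d
  have hj : IsLimit (KernelFork.ofι j wj) := R.isLimitKernelFork
  have hm : Mono j := inferInstanceAs (Mono (R.ι.f 0))
  have hd : R.cochainComplex.d 0 1 = e.hom ≫ R.cocomplex.d 0 1 ≫ e1.inv :=
    R.cochainComplex_d 0 1 0 1 _ _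
  have w : (j ≫ e.inv) ≫ R.cochainComplex.d 0 1 = 0 := by
    rw [hd, Category.assoc, e.inv_hom_id_assoc, reassoc_of% wj, zero_comp]
  refine ⟨j ≫ e.inv, mono_comp _ _, w, ?_⟩
  refine ShortComplex.exact_of_iso ?_ (ShortComplex.exact_of_f_is_kernel (ShortComplex.mk j _ wj) hj)
  exact ShortComplex.isoMk (Iso.refl _) e.symm e1.symm (by simp) (by simp [hd])

end GSheaf

end Acyclic

/-! ### The derived dual of a sheaf with a finite locally dualizable resolution -/

section DerivedDualOfResolution

variable {X : Scheme.{u}} {G : Type} [Group G] {a : G →* End X}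

namespace GSheaf

/-- The derived dual of an equivariant sheaf with a finite resolution by locally dualizable sheaves
whose dual is exact except in degree zero. -/
theorem derivedDual_of_resolution [HasDerivedCategory.{w} (GSheaf a)] (n : ℕ) (K : ℕ → GSheaf a)
    (d : ∀ j, K j ⟶ K (j + 1)) (w : ∀ j, d j ≫ d (j + 1) = 0) {F : GSheaf a} (p : K n ⟶ F)
    (hp : Epi p) (hm : if n = 0 then Mono p ∧ IsZero (K 1) else Mono (d 0))
    (hK : ∀ j, j + 1 < n → (ShortComplex.mk (d j) (d (j + 1)) (w j)).Exact)
    (hKp : ∀ j (h : j + 1 = n), ∃ wp, (ShortComplex.mk (d j) (eqToHom (by rw [h]) ≫ p) wp).Exact)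
    (hac : ∀ j ≤ n, LocallyDualizable (K j).sheaf)
    (hdual : ∀ j, j + 2 ≤ n → ∃ w', (ShortComplex.mk (homPre (d (j + 1)) (structureGSheaf a))
      (homPre (d j) (structureGSheaf a)) w').Exact)
    (hdualm : ∀ j, j + 1 = n → Mono (homPre (d j) (structureGSheaf a)))
    {D : GSheaf a} (hD : Nonempty (D ≅ cokernel (homPre (d 0) (structureGSheaf a)))) :
    Nonempty ((derivedDual F)⟦(n : ℤ)⟧ ≅ (DerivedCategory.Plus.singleFunctor (GSheaf a) 0).obj D) := by
  let O := structureGSheaf a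
  let R := injectiveResolution O
  let I := R.cochainComplex
  obtain ⟨i, _, wi, hi⟩ := resolution_zero R
  have := isIso_homDualTo I i wi hi
  -- This identifies the zeroth cohomology of `ℋom(-, I)` with the underived dual, so the hypotheses
  -- on the duals of the differentials become the hypotheses of dimension shifting.
  let e : homDual O ≅ cohom (homComplex I) 0 := asIso (homDualTo I i wi)
  obtain ⟨h1, ⟨h2⟩⟩ := ComplexExact.resolution K d w (homComplex_exact I) n p hp hm hK hKp
    (fun i hi A ↦ homComplex_neg I A i hi)
    (fun j hj i hi ↦ homComplex_acyclic I (fun i hi ↦ resolution_exactAt R i hi) _ (hac j hj) i hi)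
    (fun j hj w' ↦ by
      obtain ⟨w'', h⟩ := hdual j hj
      refine ShortComplex.exact_of_iso ?_ h
      exact ShortComplex.isoMk (e.app _) (e.app _) (e.app _)
        (e.hom.naturality (d (j + 1)).op).symm (e.hom.naturality (d j).op).symm)
    (fun j hj ↦ by
      have : Mono ((homDual O).map (d j).op) := hdualm j hj
      have e5 : (cohom (homComplex I) 0).map (d j).op =
          (e.app _).inv ≫ (homDual O).map (d j).op ≫ (e.app _).hom := by
        rw [Iso.eq_inv_comp]
        exact (e.hom.naturality (d j).op).symm
      rw [e5]
      infer_instance)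
  obtain ⟨e'⟩ := hD
  refine derivedPlus_iso_single _ n D (fun j hj ↦ ?_) ?_
  · obtain ⟨e3⟩ := rightDerivedPlus_single_homology (homFunctor F) O R j
    exact (h1 j hj).of_iso e3
  · obtain ⟨e3⟩ := rightDerivedPlus_single_homology (homFunctor F) O R n
    refine ⟨e3 ≪≫ h2 ≪≫ ?_ ≪≫ e'.symm⟩
    exact (cokernel.mapIso ((homDual O).map (d 0).op) ((cohom (homComplex I) 0).map (d 0).op)
      (e.app _) (e.app _) (e.hom.naturality (d 0).op)).symm

end GSheaf

end DerivedDualOfResolution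

/-! ### Sheaves whose sections over an affine open localize -/

section Localizing

variable {X : Scheme.{u}} {E E' : X.Modules} {U : X.Opens}

lemma isUnit_resO (h : Γ(X, U)) {V : X.Opens} (hV : V ≤ X.basicOpen h) :
    IsUnit (resO (hV.trans (X.basicOpen_le h)) h) := by
  have h1 : IsUnit (resO (X.basicOpen_le h) h) := RingedSpace.isUnit_res_basicOpen _ h
  have h2 := h1.map (resO hV)
  rwa [resO_resO] at h2

lemma smul_cancel {M : X.Modules} {h : Γ(X, U)} (hh : IsUnit h) (m : ℕ) {s t : Γ(M, U)}
    (e : h ^ m • s = h ^ m • t) : s = t := by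
  obtain ⟨u, hu⟩ := hh.pow m
  rw [← hu] at e
  have := congrArg (fun x ↦ (↑u⁻¹ : Γ(X, U)) • x) e
  simpa [smul_smul] using this

/-- Restriction to basic open subsets is localization. -/
structure Localizing (E : X.Modules) (U : X.Opens) : Prop where
  zero (h : Γ(X, U)) (s : Γ(E, U)) : res E (X.basicOpen_le h) s = 0 → ∃ m : ℕ, h ^ m • s = 0
  lift (h : Γ(X, U)) (t : Γ(E, X.basicOpen h)) :
    ∃ (m : ℕ) (s : Γ(E, U)), res E (X.basicOpen_le h) s = resO (X.basicOpen_le h) h ^ m • t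

lemma localizing_structureSheaf (hU : IsAffineOpen U) : Localizing (structureSheaf X) U where
  zero h s hs := by
    have := hU.isLocalization_basicOpen h
    have hs' : algebraMap Γ(X, U) Γ(X, X.basicOpen h) (toFun s) = 0 := hs
    obtain ⟨⟨_, m, rfl⟩, hm⟩ := (IsLocalization.map_eq_zero_iff (.powers h) _ _).1 hs'
    exact ⟨m, hm⟩
  lift h t := by
    have := hU.isLocalization_basicOpen h
    obtain ⟨⟨s, _, m, rfl⟩, hm⟩ := IsLocalization.surj (.powers h) (toFun t)
    refine ⟨m, ofFun s, hm.symm.trans ?_⟩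
    rw [map_pow, mul_comm]
    rfl

lemma Localizing.basicOpen (hE : Localizing E U) (hU : IsAffineOpen U) (h : Γ(X, U)) :
    Localizing E (X.basicOpen h) := by
  -- Clearing denominators extends `h'`, up to a power of `h`, to a function `s` on `U`. The extra
  -- factor `h` in `r` confines its basic open subset to that of `h`, where `r` and `h'` differ by a
  -- unit.
  have key (h' : Γ(X, X.basicOpen h)) : ∃ (r v : _), IsUnit v ∧
      resO (X.basicOpen_le h) r = v * h' ∧ X.basicOpen r = X.basicOpen h' := by
    obtain ⟨m, s, hs⟩ := (localizing_structureSheaf hU).lift h (ofFun h')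
    have hs' : resO (X.basicOpen_le h) (toFun s) = resO (X.basicOpen_le h) h ^ m * h' := hs
    have hu := isUnit_resO h le_rfl
    refine ⟨h * toFun s, resO (X.basicOpen_le h) h * resO (X.basicOpen_le h) h ^ m,
      hu.mul (hu.pow m), by rw [map_mul, hs', mul_assoc], ?_⟩
    have e := X.basicOpen_res (toFun s) (homOfLE (X.basicOpen_le h)).op
    rw [Scheme.basicOpen_mul, ← e]
    change X.basicOpen (resO (X.basicOpen_le h) (toFun s)) = _
    rw [hs', Scheme.basicOpen_mul, X.basicOpen_of_isUnit (hu.pow m)]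
    exact inf_eq_right.2 (X.basicOpen_le h')
  constructor
  · intro h' s hs
    obtain ⟨r, v, hv, hr, hD⟩ := key h'
    obtain ⟨k, σ, hσ⟩ := hE.lift h s
    have h0 : res E (X.basicOpen_le r) σ = 0 := by
      have e1 : X.basicOpen r ≤ X.basicOpen h' := hD.le
      have e2 := res_res E (e1.trans (X.basicOpen_le h')) (X.basicOpen_le h) σ
      rw [← e2, hσ, res_smul, ← res_res E e1 (X.basicOpen_le h'), hs, map_zero, smul_zero]
    obtain ⟨l, hl⟩ := hE.zero r σ h0
    refine ⟨l, smul_cancel (hv.pow l) 1 (smul_cancel (isUnit_resO h le_rfl) k ?_)⟩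
    have e := congrArg (res E (X.basicOpen_le h)) hl
    rw [res_smul, hσ, map_zero, map_pow, hr, mul_pow] at e
    rw [smul_zero, smul_zero, ← e, pow_one, smul_smul, smul_smul, smul_smul]
    congr 1
    ring
  · intro h' t
    obtain ⟨r, v, hv, hr, hD⟩ := key h'
    obtain ⟨l, σ, hσ⟩ := hE.lift r (res E hD.le t)
    obtain ⟨u, hu⟩ := hv.pow l
    refine ⟨l, (↑u⁻¹ : Γ(X, X.basicOpen h)) • res E (X.basicOpen_le h) σ, ?_⟩
    have e := congrArg (res E hD.ge) hσ
    rw [res_smul, res_res, res_res, res_self, map_pow, resO_resO,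
      ← resO_resO (X.basicOpen_le h') (X.basicOpen_le h), hr, map_mul] at e
    rw [res_smul, res_res, e, smul_smul, mul_pow, ← map_pow (resO _) v, ← hu, ← mul_assoc, ← map_mul,
      Units.inv_mul, map_one, one_mul]

/-- Coordinates embed sections into finitely many functions, for which the property is localization
of the coordinate ring. The sum of the exponents serves as a common one, so that no maximum need be
taken. -/
lemma HasDualBasis.localizing (hE : HasDualBasis E U) (hU : IsAffineOpen U) : Localizing E U := by
  classical
  obtain ⟨κ, _, e, c, H⟩ := hE
  have hO := localizing_structureSheaf hU
  constructor
  · intro h s hs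
    have h1 (k : κ) : ∃ m : ℕ, h ^ m • ev (c k) le_rfl s = 0 := by
      refine hO.zero h _ ?_
      rw [← ev_res, hs, map_zero]
    choose m hm using h1
    refine ⟨∑ k, m k, ?_⟩
    rw [H U le_rfl s, Finset.smul_sum]
    refine Finset.sum_eq_zero fun k _ ↦ ?_
    have e1 : h ^ (∑ k, m k) • ev (c k) le_rfl s = 0 := by
      rw [← Finset.sum_erase_add _ _ (Finset.mem_univ k), pow_add, mul_smul, hm, smul_zero]
    rw [smul_smul]
    exact (congrArg (fun f ↦ toFun f • EquivSheaf.res E le_rfl (e k)) e1).trans (by rw [map_zero, zero_smul])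
  · intro h t
    choose m s hs using fun k ↦ hO.lift h (ev (c k) (X.basicOpen_le h) t)
    refine ⟨∑ k, m k, ∑ k, (h ^ (∑ k, m k - m k) * toFun (s k)) • e k, ?_⟩
    conv_rhs => rw [H _ (X.basicOpen_le h) t]
    rw [map_sum, Finset.smul_sum]
    refine Finset.sum_congr rfl fun k _ ↦ ?_
    have hk : m k ≤ ∑ k, m k := Finset.single_le_sum (fun _ _ ↦ Nat.zero_le _) (Finset.mem_univ k)
    have e1 : resO (X.basicOpen_le h) (toFun (s k)) =
      resO (X.basicOpen_le h) h ^ m k * toFun (ev (c k) (X.basicOpen_le h) t) := hs k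
    rw [res_smul, map_mul, e1, ← mul_assoc, map_pow, ← pow_add, Nat.sub_add_cancel hk, mul_smul]

/-- Powers of generators of the unit ideal again generate it, so local membership up to denominators
is membership. Vanishing is the case of the zero submodule. -/
lemma eq_zero_of_span {R M : Type*} [CommRing R] [AddCommGroup M] [Module R M] {S : Set R}
    (hS : Ideal.span S = ⊤) (N : Submodule R M) (s : M) (h : ∀ r ∈ S, ∃ m : ℕ, r ^ m • s ∈ N) :
    s ∈ N :=
  Submodule.mem_of_span_eq_top_of_smul_pow_mem N S hS s fun r ↦ h r.1 r.2

lemma span_eq_top_of_forall (hU : IsAffineOpen U) (P : Γ(X, U) → Prop)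
    (h : ∀ x ∈ U, ∃ f, P f ∧ x ∈ X.basicOpen f) : Ideal.span {f | P f} = ⊤ := by
  rw [← hU.self_le_iSup_basicOpen_iff]
  intro x hx
  obtain ⟨f, hf, hxf⟩ := h x hx
  exact TopologicalSpace.Opens.mem_iSup.2 ⟨⟨f, hf⟩, hxf⟩

lemma exists_basicOpen (hU : IsAffineOpen U) {V : X.Opens} {x : X} (hxV : x ∈ V) (hxU : x ∈ U) :
    ∃ h : Γ(X, U), X.basicOpen h ≤ V ∧ x ∈ X.basicOpen h :=
  hU.exists_basicOpen_le ⟨x, hxV⟩ hxU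

section Extension

variable (hE : Localizing E U) (hU : IsAffineOpen U)

lemma localHom_ext_of_localizing (hE : Localizing E U) (hU : IsAffineOpen U)
    {φ ψ : localHom E E' U} (H : ∀ s, ev φ le_rfl s = ev ψ le_rfl s) : φ = ψ := by
  refine localHom_ext fun V hV s ↦ res_eq_of_local _ fun x hx ↦ ?_
  obtain ⟨h, hh, hxh⟩ := exists_basicOpen hU hx (hV hx)
  obtain ⟨m, σ, hσ⟩ := hE.lift h (res E hh s)
  refine ⟨_, hh, hxh, smul_cancel (isUnit_resO h le_rfl) m ?_⟩
  rw [← ev_res, ← ev_res, ← ev_smul, ← ev_smul, ← hσ, ev_res φ le_rfl, ev_res ψ le_rfl, H]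

variable (f : Γ(E, U) →+ Γ(E', U))

/-- The sections whose restrictions to basic open subsets are the values of the extension of `f`. -/
def IsExt (V : X.Opens) (s : Γ(E, V)) (t : Γ(E', V)) : Prop :=
  ∀ (h : Γ(X, U)) (hh : X.basicOpen h ≤ V) (m : ℕ) (σ : Γ(E, U)),
    res E (X.basicOpen_le h) σ = resO (X.basicOpen_le h) h ^ m • res E hh s →
    res E' (X.basicOpen_le h) (f σ) = resO (X.basicOpen_le h) h ^ m • res E' hh t

variable {f}

include hE hU in
lemma IsExt.unique {V : X.Opens} (hV : V ≤ U) {s : Γ(E, V)} {t t' : Γ(E', V)}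
    (h : IsExt f V s t) (h' : IsExt f V s t') : t = t' := by
  refine res_eq_of_local _ fun x hx ↦ ?_
  obtain ⟨r, hh, hxh⟩ := exists_basicOpen hU hx (hV hx)
  obtain ⟨m, σ, hσ⟩ := hE.lift r (res E hh s)
  exact ⟨_, hh, hxh, smul_cancel (isUnit_resO r le_rfl) m
    ((h r hh m σ hσ).symm.trans (h' r hh m σ hσ))⟩

variable (hf : ∀ (r : Γ(X, U)) s, f (r • s) = r • f s)

-- The two sides compare the fractions `f σ / h ^ m` and `f σ' / h' ^ m'` with denominators cleared.
-- The difference `h' ^ m' • σ - h ^ m • σ'` vanishes where `h * h'` is invertible, so a power of `h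
-- * h'` kills it over `U`, and `f` is linear over `U`.
include hE hf in
lemma ext_compat {V : X.Opens} {s : Γ(E, V)} {h h' : Γ(X, U)} (hh : X.basicOpen h ≤ V)
    (hh' : X.basicOpen h' ≤ V) {m m' : ℕ} {σ σ' : Γ(E, U)}
    (hσ : res E (X.basicOpen_le h) σ = resO (X.basicOpen_le h) h ^ m • res E hh s)
    (hσ' : res E (X.basicOpen_le h') σ' = resO (X.basicOpen_le h') h' ^ m' • res E hh' s)
    {W : X.Opens} (hW : W ≤ X.basicOpen h) (hW' : W ≤ X.basicOpen h') :
    resO (hW'.trans (X.basicOpen_le h')) h' ^ m' • res E' (hW.trans (X.basicOpen_le h)) (f σ) =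
    resO (hW.trans (X.basicOpen_le h)) h ^ m • res E' (hW'.trans (X.basicOpen_le h')) (f σ') := by
  have hD : X.basicOpen (h * h') = X.basicOpen h ⊓ X.basicOpen h' := X.basicOpen_mul h h'
  have hDh : X.basicOpen (h * h') ≤ X.basicOpen h := hD.le.trans inf_le_left
  have hDh' : X.basicOpen (h * h') ≤ X.basicOpen h' := hD.le.trans inf_le_right
  have h0 : res E (X.basicOpen_le (h * h')) (h' ^ m' • σ - h ^ m • σ') = 0 := by
    rw [map_sub, res_smul, res_smul, ← res_res E hDh (X.basicOpen_le h), hσ,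
      ← res_res E hDh' (X.basicOpen_le h'), hσ', res_smul, res_smul, res_res, res_res, smul_smul,
      smul_smul]
    simp only [map_pow, resO_resO]
    exact sub_eq_zero.2 (congrArg (· • _) (mul_comm _ _))
  obtain ⟨l, hl⟩ := hE.zero _ _ h0
  have e := congrArg (fun x ↦ res E' (hW.trans (X.basicOpen_le h)) (f x)) hl
  simp only [hf, map_zero, map_sub, res_smul, map_pow] at e
  have hu := isUnit_resO (h * h') (V := W) (by rw [hD]; exact le_inf hW hW')
  rw [← sub_eq_zero]
  refine smul_cancel hu l ?_
  rw [smul_zero]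
  exact e

-- The fractions `f σ / h ^ m` over all basic open subsets inside `V` agree on overlaps by
-- `ext_compat` and glue. The same comparison shows that the result does not depend on the chosen
-- numerators and exponents.
include hE hU hf in
lemma IsExt.exists {V : X.Opens} (hV : V ≤ U) (s : Γ(E, V)) : ∃ t, IsExt f V s t := by
  let ι := {h : Γ(X, U) // X.basicOpen h ≤ V}
  choose m σ hσ using fun h : ι ↦ hE.lift h.1 (res E h.2 s)
  have hu (h : ι) : ∃ t : Γ(E', X.basicOpen h.1),
      res E' (X.basicOpen_le h.1) (f (σ h)) = resO (X.basicOpen_le h.1) h.1 ^ m h • t := by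
    obtain ⟨u, hu⟩ := (isUnit_resO h.1 le_rfl).pow (m h)
    exact ⟨(↑u⁻¹ : Γ(X, X.basicOpen h.1)) • _, by rw [← hu, smul_smul, Units.mul_inv, one_smul]⟩
  choose t ht using hu
  have hcov : V ≤ ⨆ h : ι, X.basicOpen h.1 := fun x hx ↦ by
    obtain ⟨h, hh, hxh⟩ := exists_basicOpen hU hx (hV hx)
    exact TopologicalSpace.Opens.mem_iSup.2 ⟨⟨h, hh⟩, hxh⟩
  have hloc (h h' : Γ(X, U)) (hh : X.basicOpen h ≤ V) (hh' : X.basicOpen h' ≤ V) (m m' : ℕ)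
      (σ σ' : Γ(E, U)) (t : Γ(E', X.basicOpen h)) (t' : Γ(E', X.basicOpen h'))
      (h1 : res E (X.basicOpen_le h) σ = resO (X.basicOpen_le h) h ^ m • res E hh s)
      (h2 : res E (X.basicOpen_le h') σ' = resO (X.basicOpen_le h') h' ^ m' • res E hh' s)
      (h3 : res E' (X.basicOpen_le h) (f σ) = resO (X.basicOpen_le h) h ^ m • t)
      (h4 : res E' (X.basicOpen_le h') (f σ') = resO (X.basicOpen_le h') h' ^ m' • t')
      (W : X.Opens) (hW : W ≤ X.basicOpen h) (hW' : W ≤ X.basicOpen h') :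
      res E' hW t = res E' hW' t' := by
    have e := ext_compat hE hf hh hh' h1 h2 hW hW'
    rw [← res_res E' hW (X.basicOpen_le h), h3, ← res_res E' hW' (X.basicOpen_le h'), h4,
      res_smul, res_smul, map_pow, map_pow, resO_resO, resO_resO, smul_comm] at e
    exact smul_cancel (isUnit_resO h' hW') m' (smul_cancel (isUnit_resO h hW) m e)
  obtain ⟨T, hT⟩ := res_glue E' (fun h : ι ↦ h.2) hcov t fun h h' ↦
    hloc h.1 h'.1 h.2 h'.2 _ _ _ _ _ _ (hσ h) (hσ h') (ht h) (ht h') _ _ _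
  refine ⟨T, fun h hh k τ hτ ↦ ?_⟩
  obtain ⟨u, hu⟩ := (isUnit_resO h le_rfl).pow k
  have e : res E' (X.basicOpen_le h) (f τ) = resO (X.basicOpen_le h) h ^ k •
      ((↑u⁻¹ : Γ(X, X.basicOpen h)) • res E' (X.basicOpen_le h) (f τ)) := by
    rw [← hu, smul_smul, Units.mul_inv, one_smul]
  rw [e, hT ⟨h, hh⟩]
  congr 1
  have := hloc h h hh hh _ _ _ _ _ _ hτ (hσ ⟨h, hh⟩) e (ht ⟨h, hh⟩) _ le_rfl le_rfl
  rwa [res_self, res_self] at this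

include hE hU hf in
/-- A homomorphism between the modules of sections over an affine open subset extends to a
homomorphism of sheaves if the source is quasi-coherent. -/
lemma exists_localHom : ∃ φ : localHom E E' U, ∀ s, ev φ le_rfl s = f s := by
  choose t ht using fun (V : X.Opens) (hV : V ≤ U) (s : Γ(E, V)) ↦ IsExt.exists hE hU hf hV s
  refine ⟨mkLocal t (fun V hV s s' ↦ ?_) (fun V hV r s ↦ ?_) fun V W h h' s ↦ ?_, fun s ↦ ?_⟩
  -- Each property of the extension is obtained from uniqueness: the candidate value is shown to
  -- satisfy `IsExt`. After multiplication by a power of `h` every section involved comes from `U`,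
  -- where `f` is additive and linear.
  · refine IsExt.unique hE hU hV (ht V hV _) fun h hh m σ hσ ↦ ?_
    obtain ⟨k, τ, hτ⟩ := hE.lift h (res E hh s)
    obtain ⟨k', τ', hτ'⟩ := hE.lift h (res E hh s')
    refine smul_cancel (isUnit_resO h le_rfl) (k + k') ?_
    have e1 := ht V hV s h hh k τ hτ
    have e2 := ht V hV s' h hh k' τ' hτ'
    have e3 : res E (X.basicOpen_le h) (h ^ (k + k') • σ) =
        res E (X.basicOpen_le h) (h ^ (m + k') • τ + h ^ (m + k) • τ') := by
      rw [map_add, res_smul, res_smul, res_smul, hσ, hτ, hτ', map_add]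
      simp only [map_pow, smul_add, smul_smul, ← pow_add]
      ring_nf
    rw [← sub_eq_zero, ← map_sub] at e3
    obtain ⟨l, hl⟩ := hE.zero h _ e3
    have e4 := congrArg (fun x ↦ res E' (X.basicOpen_le h) (f x)) hl
    simp only [hf, map_zero, map_sub, map_add, res_smul, map_pow, e1, e2] at e4
    rw [← sub_eq_zero]
    refine smul_cancel (isUnit_resO h le_rfl) l ?_
    rw [smul_zero, ← e4, map_add]
    simp only [smul_add, smul_smul, ← pow_add]
    congr 2
    ring_nf
  · refine IsExt.unique hE hU hV (ht V hV _) fun h hh m σ hσ ↦ ?_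
    obtain ⟨k, τ, hτ⟩ := hE.lift h (res E hh s)
    obtain ⟨j, ρ, hρ⟩ := (localizing_structureSheaf hU).lift h (ofFun (resO hh r))
    have hρ' : resO (X.basicOpen_le h) (toFun ρ) = resO (X.basicOpen_le h) h ^ j * resO hh r := hρ
    have e1 := ht V hV s h hh k τ hτ
    refine smul_cancel (isUnit_resO h le_rfl) (k + j) ?_
    have e3 : res E (X.basicOpen_le h) (h ^ (k + j) • σ) =
        res E (X.basicOpen_le h) (h ^ m • toFun ρ • τ) := by
      rw [res_smul, res_smul, res_smul, hσ, hτ, hρ', res_smul]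
      simp only [map_pow, smul_smul]
      ring_nf
    rw [← sub_eq_zero, ← map_sub] at e3
    obtain ⟨l, hl⟩ := hE.zero h _ e3
    have e4 := congrArg (fun x ↦ res E' (X.basicOpen_le h) (f x)) hl
    simp only [hf, map_zero, map_sub, res_smul, map_pow, e1, hρ'] at e4
    rw [← sub_eq_zero]
    refine smul_cancel (isUnit_resO h le_rfl) l ?_
    rw [smul_zero, ← e4, res_smul]
    simp only [smul_smul]
    congr 2
    ring_nf
  · refine IsExt.unique hE hU (h'.trans h) (ht V _ _) fun r hh m σ hσ ↦ ?_
    rw [res_res] at hσ ⊢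
    exact ht W h s r _ m σ hσ
  · refine IsExt.unique hE hU le_rfl (ht U le_rfl s) fun h hh m σ hσ ↦ ?_
    have e3 : res E (X.basicOpen_le h) (σ - h ^ m • s) = 0 := by
      rw [map_sub, res_smul, hσ, map_pow, sub_self]
    obtain ⟨l, hl⟩ := hE.zero h _ e3
    have e4 := congrArg (fun x ↦ res E' (X.basicOpen_le h) (f x)) hl
    simp only [hf, map_zero, map_sub, res_smul, map_pow] at e4
    rw [← sub_eq_zero]
    refine smul_cancel (isUnit_resO h le_rfl) l ?_
    rw [smul_zero, ← e4]

end Extension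

end Localizing

/-! ### Exact sequences of localizing sheaves on affine open subsets -/

section LocalizingExact

variable {X : Scheme.{u}} {M N K : X.Modules} {U : X.Opens}

/-- A morphism of sheaves of modules on sections, as a linear map. -/
def appLin (f : M ⟶ N) (U : X.Opens) : Γ(M, U) →ₗ[Γ(X, U)] Γ(N, U) where
  toFun := (f.app U).hom
  map_add' := map_add _
  map_smul' := f.app_smul

lemma appLin_res (f : M ⟶ N) {V U : X.Opens} (h : V ≤ U) (s : Γ(M, U)) :
    appLin f V (res M h s) = res N h (appLin f U s) := app_res f h s

section

variable {d : M ⟶ N} {q : N ⟶ K} {w : d ≫ q = 0} (hex : (ShortComplex.mk d q w).Exact)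
  (hU : IsAffineOpen U) (hM : Localizing M U) (hN : Localizing N U)

-- A section killed by `q` lifts on a basic open neighbourhood of each point. Clearing denominators
-- makes a multiple of it lift over `U`, and these multipliers generate the unit ideal.
include hex hU hM hN in
lemma exists_lift_of_exact (s : Γ(N, U)) (hs : appLin q U s = 0) : ∃ t, appLin d U t = s := by
  have hl : LocallyLifts d s := locallyLifts_of_exact hex s hs
  refine eq_zero_of_span (span_eq_top_of_forall hU
    (fun h ↦ ∃ t, appLin d _ t = res N (X.basicOpen_le h) s) fun x hx ↦ ?_)
    (LinearMap.range (appLin d U)) s ?_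
  · obtain ⟨V, hV, hxV, t, ht⟩ := hl x hx
    obtain ⟨h, hh, hxh⟩ := exists_basicOpen hU hxV hx
    refine ⟨h, ⟨res M hh t, ?_⟩, hxh⟩
    rw [appLin_res, show appLin d V t = _ from ht, res_res]
  · rintro h ⟨t, ht⟩
    obtain ⟨m, t', ht'⟩ := hM.lift h t
    have e : res N (X.basicOpen_le h) (h ^ m • s - appLin d U t') = 0 := by
      rw [map_sub, ← appLin_res, ht', LinearMap.map_smul, ht, res_smul, map_pow, sub_self]
    obtain ⟨k, hk⟩ := hN.zero h _ e
    refine ⟨k + m, h ^ k • t', ?_⟩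
    rw [smul_sub, sub_eq_zero] at hk
    rw [pow_add, mul_smul, hk, LinearMap.map_smul]

include hex hU hM hN in
lemma smul_eq_zero_of_exact (s : Γ(N, U)) (h : Γ(X, U))
    (hs : res K (X.basicOpen_le h) (appLin q U s) = 0) : ∃ k : ℕ, h ^ k • appLin q U s = 0 := by
  obtain ⟨t, ht⟩ := exists_lift_of_exact hex (hU.basicOpen h) (hM.basicOpen hU h)
    (hN.basicOpen hU h) (res N (X.basicOpen_le h) s) (by rw [appLin_res, hs])
  obtain ⟨m, t', ht'⟩ := hM.lift h t
  have e : res N (X.basicOpen_le h) (h ^ m • s - appLin d U t') = 0 := by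
    rw [map_sub, ← appLin_res, ht', LinearMap.map_smul, ht, res_smul, map_pow, sub_self]
  obtain ⟨k, hk⟩ := hN.zero h _ e
  refine ⟨k + m, ?_⟩
  rw [smul_sub, sub_eq_zero] at hk
  have e1 : appLin q U (appLin d U t') = 0 :=
    congrArg (fun f ↦ appLin f U t') w
  rw [pow_add, mul_smul, ← LinearMap.map_smul, ← LinearMap.map_smul, hk, LinearMap.map_smul, e1,
    smul_zero]

-- Nothing is assumed about the cokernel `K` itself. The obstruction `v` to lifting a multiple of
-- `s` vanishes where `h` is invertible. It lies in the image of `q` over each member of a finite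
-- cover, where `smul_eq_zero_of_exact` bounds the power of `h` needed to kill it.
include hex hU hM hN in
lemma app_surjective_of_exact [Epi q] (s : Γ(K, U)) : ∃ t, appLin q U t = s := by
  classical
  let P (h : Γ(X, U)) : Prop := ∃ t, appLin q _ t = res K (X.basicOpen_le h) s
  have hS : Ideal.span {h | P h} = ⊤ := span_eq_top_of_forall hU P fun x hx ↦ by
    obtain ⟨V, hV, hxV, t, ht⟩ := locallyLifts_of_epi q s x hx
    obtain ⟨h, hh, hxh⟩ := exists_basicOpen hU hxV hx
    refine ⟨h, ⟨res N hh t, ?_⟩, hxh⟩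
    rw [appLin_res, show appLin q V t = _ from ht, res_res]
  obtain ⟨S, hSP, hS1⟩ := Ideal.span_eq_top_iff_finite _ |>.1 hS
  refine eq_zero_of_span hS1 (LinearMap.range (appLin q U)) s ?_
  intro h hh
  obtain ⟨t, ht⟩ := hSP hh
  obtain ⟨m, t', ht'⟩ := hN.lift h t
  let v := h ^ m • s - appLin q U t'
  have hv : res K (X.basicOpen_le h) v = 0 := by
    rw [map_sub, ← appLin_res, ht', LinearMap.map_smul, ht, res_smul, map_pow, sub_self]
  have h1 (r : S) : ∃ k : ℕ, resO (X.basicOpen_le r.1) h ^ k • res K (X.basicOpen_le r.1) v = 0 := by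
    obtain ⟨t₁, ht₁⟩ := hSP r.2
    have e : appLin q _ (resO (X.basicOpen_le r.1) h ^ m • t₁ - res N (X.basicOpen_le r.1) t') =
        res K (X.basicOpen_le r.1) v := by
      rw [map_sub, LinearMap.map_smul, ht₁, appLin_res, map_sub, res_smul, map_pow]
    have := smul_eq_zero_of_exact hex (hU.basicOpen r.1) (hM.basicOpen hU r.1)
      (hN.basicOpen hU r.1) (resO (X.basicOpen_le r.1) h ^ m • t₁ - res N (X.basicOpen_le r.1) t')
      (resO (X.basicOpen_le r.1) h) ?_
    · rwa [e] at this
    · have hD : X.basicOpen (resO (X.basicOpen_le r.1) h) ≤ X.basicOpen h :=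
        (X.basicOpen_res h (homOfLE (X.basicOpen_le r.1)).op).le.trans inf_le_right
      rw [e, res_res, ← res_res K hD (X.basicOpen_le h), hv, map_zero]
  choose k hk using h1
  have hz : h ^ (∑ r, k r) • v = 0 := by
    have hcov : U ≤ ⨆ r : S, X.basicOpen r.1 := (hU.self_le_iSup_basicOpen_iff (s := S)).2 hS1
    refine res_eq_of_local _ fun x hx ↦ ?_
    obtain ⟨r, hr⟩ := TopologicalSpace.Opens.mem_iSup.1 (hcov hx)
    refine ⟨_, X.basicOpen_le r.1, hr, ?_⟩
    rw [res_smul, map_zero, map_pow, ← Finset.sum_erase_add _ _ (Finset.mem_univ r), pow_add,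
      mul_smul, hk, smul_zero]
  refine ⟨∑ r, k r + m, h ^ (∑ r, k r) • t', ?_⟩
  rw [smul_sub, sub_eq_zero] at hz
  rw [pow_add, mul_smul, hz, LinearMap.map_smul]

-- Cokernels inherit the property; this is how the dual, constructed as a cokernel, turns out to be
-- quasi-coherent.
include hex hU hM hN in
lemma localizing_of_exact [Epi q] : Localizing K U where
  zero h s hs := by
    obtain ⟨t, rfl⟩ := app_surjective_of_exact hex hU hM hN s
    exact smul_eq_zero_of_exact hex hU hM hN t h hs
  lift h t := by
    obtain ⟨t', rfl⟩ := app_surjective_of_exact hex (hU.basicOpen h) (hM.basicOpen hU h)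
      (hN.basicOpen hU h) t
    obtain ⟨m, s, hs⟩ := hN.lift h t'
    exact ⟨m, appLin q U s, by rw [← appLin_res, hs, LinearMap.map_smul]⟩

end

/-- A local section becomes, after clearing denominators, the restriction of a section over the
affine open `U`; a further power moves it into the kernel of `g` over `U`, where it lifts. -/
lemma exact_of_affine {f : M ⟶ N} {g : N ⟶ K} (w : f ≫ g = 0)
    (h : ∀ x : X, ∃ U : X.Opens, x ∈ U ∧ IsAffineOpen U ∧ Localizing N U ∧ Localizing K U ∧
      ∀ s, appLin g U s = 0 → ∃ t, appLin f U t = s) : (ShortComplex.mk f g w).Exact := by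
  refine exact_of_locallyLifts w fun V s hs x hx ↦ ?_
  obtain ⟨U, hxU, hU, hN, hK, H⟩ := h x
  obtain ⟨r, hr, hxr⟩ := exists_basicOpen hU hx hxU
  obtain ⟨m, σ, hσ⟩ := hN.lift r (res N hr s)
  have e1 : res K (X.basicOpen_le r) (appLin g U σ) = 0 := by
    rw [← appLin_res, hσ, LinearMap.map_smul, appLin_res, show appLin g V s = 0 from hs, map_zero,
      smul_zero]
  obtain ⟨k, hk⟩ := hK.zero r _ e1
  rw [← LinearMap.map_smul] at hk
  obtain ⟨τ, hτ⟩ := H _ hk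
  obtain ⟨u, hu⟩ := (isUnit_resO r le_rfl).pow (k + m)
  refine ⟨_, hr, hxr, (↑u⁻¹ : Γ(X, X.basicOpen r)) • res M (X.basicOpen_le r) τ, ?_⟩
  refine (LinearMap.map_smul (appLin f _) _ _).trans ?_
  rw [appLin_res, hτ, res_smul, hσ, smul_smul, smul_smul, map_pow, mul_assoc, ← pow_add, ← hu,
    Units.inv_mul, one_smul]

lemma epi_of_affine (f : M ⟶ N)
    (h : ∀ x : X, ∃ U : X.Opens, x ∈ U ∧ IsAffineOpen U ∧ Localizing N U ∧
      ∀ s, ∃ t, appLin f U t = s) : Epi f := by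
  refine (ShortComplex.exact_iff_epi _ rfl).1 (exact_of_affine (comp_zero : f ≫ (0 : N ⟶ N) = 0)
    fun x ↦ ?_)
  obtain ⟨U, hx, hU, hN, H⟩ := h x
  exact ⟨U, hx, hU, hN, hN, fun s _ ↦ H s⟩

lemma mono_of_affine (f : M ⟶ N)
    (h : ∀ x : X, ∃ U : X.Opens, x ∈ U ∧ IsAffineOpen U ∧ Localizing M U ∧ Localizing N U ∧
      ∀ s, appLin f U s = 0 → s = 0) : Mono f := by
  refine (ShortComplex.exact_iff_mono _ rfl).1 (exact_of_affine (zero_comp : (0 : M ⟶ M) ≫ f = 0)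
    fun x ↦ ?_)
  obtain ⟨U, hx, hU, hM, hN, H⟩ := h x
  exact ⟨U, hx, hU, hM, hN, fun s hs ↦ ⟨0, by rw [H s hs]; rfl⟩⟩

end LocalizingExact

/-! ### Comparison of the localizing property with quasi-coherence -/

section QuasiCoherent

/-- The basic open subset of a spectrum. -/
def specBasicOpen {R : CommRingCat.{u}} (f : R) : (Spec R).Opens := PrimeSpectrum.basicOpen f

lemma isLocalizing_iff_spec {R : CommRingCat.{u}} (M : (Spec R).Modules) :
    IsLocalizing (modulesSpecToSheaf.obj M) ↔
      (∀ (f : R) (s : Γ(M, ⊤)), res M (le_top : PrimeSpectrum.basicOpen f ≤ ⊤) s = 0 →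
        ∃ m : ℕ, f ^ m • s = 0) ∧
      ∀ (f : R) (t : Γ(M, specBasicOpen f)), ∃ (m : ℕ) (s : Γ(M, ⊤)),
        res M le_top s = f ^ m • t := by
  let φ (f : R) := ((modulesSpecToSheaf.obj M).obj.map (PrimeSpectrum.basicOpen f).leTop.op).hom
  refine ⟨fun h ↦ ?_, fun h f ↦ IsLocalizedModule.Away.mk_of_addCommGroup ?_ ?_ ?_⟩
  · have hf (f : R) : IsLocalizedModule.Away f (φ f) := h f
    refine ⟨fun f s hs ↦ ?_, fun f s ↦ ?_⟩
    · obtain ⟨⟨_, n, rfl⟩, hn⟩ := (IsLocalizedModule.eq_zero_iff (.powers f) (φ f)).mp hs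
      exact ⟨n, hn⟩
    · obtain ⟨n, y, hy⟩ := (hf f).surj _ _ s
      exact ⟨n, y, hy.symm⟩
  · exact Scheme.Modules.isUnit_algebraMap_end_of_le_basicOpen f le_rfl
  · intro x
    obtain ⟨n, t, ht⟩ := h.2 _ x
    exact ⟨n, t, ht.symm⟩
  · intro x hx
    obtain ⟨n, hn⟩ := h.1 _ _ hx
    exact ⟨n, hn⟩

variable {X : Scheme.{u}} {M : X.Modules} {U : X.Opens} (hU : IsAffineOpen U)

lemma image_fromSpec_le (V : (Spec Γ(X, U)).Opens) : hU.fromSpec ''ᵁ V ≤ U := by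
  exact (Scheme.Hom.image_le_opensRange _ V).trans hU.opensRange_fromSpec.le

lemma fromSpec_smul (V : (Spec Γ(X, U)).Opens) (r : Γ(X, U)) (s : Γ(M, hU.fromSpec ''ᵁ V)) :
    (M.restrictAppIso hU.fromSpec V).hom (r • (M.restrictAppIso hU.fromSpec V).inv s) =
      resO (image_fromSpec_le hU V) r • s := by
  rw [Scheme.Modules.smul_Spec_def]
  change (hU.fromSpec.appIso V).inv _ • s = _
  congr 1
  have e := hU.fromSpec.appLE_appIso_inv (U := U) (V := V) (by
    rw [hU.fromSpec_preimage_self]; exact le_top)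
  rw [Scheme.Hom.appLE, hU.fromSpec_app_self, Category.assoc] at e
  exact congrArg (fun f ↦ f.hom r) e

lemma res_restrict {Z : Scheme.{u}} (j : Z ⟶ X) [IsOpenImmersion j] {V W : Z.Opens} (h : V ≤ W)
    (s : Γ(M, j ''ᵁ W)) : res (M.restrict j) h ((M.restrictAppIso j W).inv s) =
      (M.restrictAppIso j V).inv (res M (Scheme.Hom.image_mono j h) s) := rfl

lemma image_fromSpec_top : hU.fromSpec ''ᵁ ⊤ = U := by
  rw [Scheme.Hom.image_top_eq_opensRange, hU.opensRange_fromSpec]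

/-- Along the identification of `U` with the spectrum of its functions, both conditions say that
sections over basic open subsets are localizations of global sections. The work lies in matching
restrictions and scalars. -/
lemma localizing_iff_isIso_fromTildeΓ :
    Localizing M U ↔ IsIso (M.restrict hU.fromSpec).fromTildeΓ := by
  rw [isIso_fromTildeΓ_iff_isLocalizing, isLocalizing_iff_spec]
  have eT := image_fromSpec_top hU
  have eD (f : Γ(X, U)) := hU.fromSpec_image_basicOpen f
  constructor
  · intro H
    refine ⟨fun f s hs ↦ ?_, fun f t ↦ ?_⟩
    · have h0 : res M (X.basicOpen_le f) (res M eT.ge (M.restrictAppIso _ _ |>.hom s)) = 0 := by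
        rw [res_res]
        have e2 := congrArg (res M (eD f).ge) hs
        refine Eq.trans ?_ (e2.trans (map_zero _))
        exact (res_res M (eD f).ge _ (M.restrictAppIso _ _ |>.hom s)).symm
      obtain ⟨m, hm⟩ := H.zero f _ h0
      refine ⟨m, ?_⟩
      have e1 := fromSpec_smul (M := M) hU ⊤ (f ^ m) (M.restrictAppIso _ _ |>.hom s)
      have e2 := congrArg (res M eT.le) hm
      rw [res_smul, res_res, res_self, map_zero] at e2
      exact e1.trans e2
    · obtain ⟨m, s, hs⟩ := H.lift f (res M (eD f).ge (M.restrictAppIso _ _ |>.hom t))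
      refine ⟨m, (M.restrictAppIso _ _).inv (res M eT.le s), ?_⟩
      have e1 := fromSpec_smul (M := M) hU _ (f ^ m) (M.restrictAppIso _ _ |>.hom t)
      have e2 := congrArg (res M (eD f).le) hs
      rw [res_smul, res_res, res_res, res_self, map_pow, resO_resO, ← map_pow] at e2
      exact (res_res M _ eT.le s).trans (e2.trans e1.symm)
  · intro H
    refine ⟨fun f s hs ↦ ?_, fun f t ↦ ?_⟩
    · have e2 := congrArg (res M (eD f).le) hs
      rw [res_res, map_zero] at e2
      have h0 : res (M.restrict hU.fromSpec) (le_top : specBasicOpen f ≤ ⊤)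
          ((M.restrictAppIso hU.fromSpec ⊤).inv (res M eT.le s)) = 0 := by
        refine (res_restrict _ _ _).trans ?_
        rw [res_res]
        exact (congrArg (M.restrictAppIso hU.fromSpec _).inv e2).trans (map_zero _)
      obtain ⟨m, hm⟩ := H.1 f _ h0
      refine ⟨m, ?_⟩
      have e1 := fromSpec_smul (M := M) hU ⊤ (f ^ m) (res M eT.le s)
      have e2 := congrArg (res M eT.ge) (e1.symm.trans hm)
      rw [res_smul, res_res, res_self, resO_resO, resO_self] at e2
      exact e2.trans (map_zero _)
    · obtain ⟨m, s, hs⟩ := H.2 f ((M.restrictAppIso _ _).inv (res M (eD f).le t))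
      obtain ⟨s', hs'⟩ : ∃ s' : Γ(M, hU.fromSpec ''ᵁ ⊤), s = (M.restrictAppIso hU.fromSpec ⊤).inv s' :=
        ⟨(M.restrictAppIso hU.fromSpec ⊤).hom s, rfl⟩
      rw [hs'] at hs
      refine ⟨m, res M eT.ge s', ?_⟩
      have e1 := fromSpec_smul (M := M) hU _ (f ^ m) (res M (eD f).le t)
      have e3 := congrArg (M.restrictAppIso hU.fromSpec _).hom hs
      have e4 := congrArg (res M (eD f).ge) (e3.trans e1)
      rw [res_smul, res_res, res_self, resO_resO, map_pow] at e4
      rw [res_res]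
      refine Eq.trans ?_ e4
      rw [res_restrict]
      exact (res_res M (eD f).ge _ s').symm

lemma localizing_of_isQuasicoherent [M.IsQuasicoherent] (hU : IsAffineOpen U) : Localizing M U :=
  (localizing_iff_isIso_fromTildeΓ hU).2 inferInstance

/-- On the spectrum the sheaf comes from a module, which has the presentation with all elements as
generators. This is transported first to the open subscheme `U` and then to the slice site on which
quasi-coherence is defined. -/
lemma nonempty_presentation_over (H : Localizing M U) (hU : IsAffineOpen U) :
    Nonempty (SheafOfModules.Presentation.{u} (R := X.ringCatSheaf.over U) (SheafOfModules.over M U)) := by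
  have h1 : IsIso (M.restrict hU.fromSpec).fromTildeΓ := (localizing_iff_isIso_fromTildeΓ hU).1 H
  let P0 : (M.restrict hU.fromSpec).Presentation :=
    @SheafOfModules.Presentation.ofIsIso.{u, u, u} _ _ _ _ _ _ _ _ (M.restrict hU.fromSpec).fromTildeΓ h1
      (presentationTilde.{u} _ .univ (by simp) _ (Submodule.span_eq _))
  let P1 := Scheme.Modules.presentationRestrict hU.isoSpec.hom P0
  let i1 : (M.restrict hU.fromSpec).restrict hU.isoSpec.hom ≅ M.restrict U.ι :=
    (Scheme.Modules.restrictFunctorComp _ _).symm.app M ≪≫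
      (Scheme.Modules.restrictFunctorCongr (hU.isoSpec_hom_fromSpec)).app M
  have h2 : IsIso i1.hom := inferInstance
  let P2 := @SheafOfModules.Presentation.ofIsIso.{u, u, u} _ _ _ _ _ _ _ _ i1.hom h2 P1
  let e := Scheme.Modules.overEquiv U
  let η : e.inverse.obj (SheafOfModules.unit _) ≅ SheafOfModules.unit _ :=
    (e.unitIso.app (SheafOfModules.unit _)).symm
  have h3 : PreservesColimitsOfSize.{u, u} e.inverse := inferInstance
  let P3 := @SheafOfModules.Presentation.map _ _ _ _ _ _ _ _ _ _ _ _ _ P2 e.inverse h3 η.symm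
  exact ⟨SheafOfModules.Presentation.ofIsIso.{u, u, u} ((e.inverse.mapIso
    ((Scheme.Modules.overFunctorEquiv U).app M).symm ≪≫ (e.unitIso.app _).symm).hom) P3⟩

lemma isQuasicoherent_of_localizing
    (h : ∀ x : X, ∃ U : X.Opens, x ∈ U ∧ IsAffineOpen U ∧ Localizing M U) : M.IsQuasicoherent := by
  choose U hxU hU hM using h
  have cov : (Opens.grothendieckTopology X).CoversTop U := by
    rw [Opens.coversTop_iff, TopologicalSpace.IsOpenCover, eq_top_iff]
    exact fun x _ ↦ TopologicalSpace.Opens.mem_iSup.2 ⟨x, hxU x⟩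
  exact SheafOfModules.QuasicoherentData.isQuasicoherent.{u}
    { I := X
      X := U
      coversTop := cov
      presentation := fun x ↦ (nonempty_presentation_over (hM x) (hU x)).some }

end QuasiCoherent

/-! ### Finiteness of flat families with fibres of constant dimension -/

section FiniteFamilies

open TensorProduct

/-- A residue field of `T` has countable dimension over `ℂ`. A transcendental element `x` would make
the uncountably many fractions `1 / (x - c)` linearly independent, so the residue field is algebraic
and equal to `ℂ`. -/
lemma exists_algHom_of_countable {T σ : Type} [CommRing T] [Nontrivial T] [Algebra ℂ T] [Countable σ]
    (f : MvPolynomial σ ℂ →ₐ[ℂ] T) (hf : Function.Surjective f) : Nonempty (T →ₐ[ℂ] ℂ) := by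
  obtain ⟨m, hm⟩ := Ideal.exists_maximal T
  letI := Ideal.Quotient.field m
  have hg : Function.Surjective ((Ideal.Quotient.mkₐ ℂ m).comp f) :=
    Ideal.Quotient.mk_surjective.comp hf
  have hr : Module.rank ℂ (T ⧸ m) ≤ Cardinal.aleph0 := by
    refine (((Ideal.Quotient.mkₐ ℂ m).comp f).toLinearMap.rank_le_of_surjective hg).trans ?_
    rw [← (MvPolynomial.basisMonomials σ ℂ).mk_eq_rank'']
    exact Cardinal.mk_le_aleph0
  have hi : Algebra.IsIntegral ℂ (T ⧸ m) := by
    rw [← Algebra.isAlgebraic_iff_isIntegral]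
    refine ⟨fun x ↦ by_contra fun hx ↦ ?_⟩
    have h2 := (Transcendental.linearIndependent_sub_inv (F := ℂ) hx).cardinal_le_rank
    rw [Cardinal.mk_complex] at h2
    exact absurd (h2.trans hr) (not_le.2 Cardinal.aleph0_lt_continuum)
  let e := AlgEquiv.ofBijective (Algebra.ofId ℂ (T ⧸ m))
    (IsAlgClosed.algebraMap_bijective_of_isIntegral (k := ℂ))
  exact ⟨e.symm.toAlgHom.comp (Ideal.Quotient.mkₐ ℂ m)⟩

lemma exists_algHom_ker {A : Type} [CommRing A] [Algebra ℂ A] [Algebra.FiniteType ℂ A] (m : Ideal A)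
    [hm : m.IsMaximal] : ∃ ε : A →ₐ[ℂ] ℂ, ∀ x, ε x = 0 ↔ x ∈ m := by
  obtain ⟨n, f, hf⟩ := Algebra.FiniteType.iff_quotient_mvPolynomial''.1
    (inferInstance : Algebra.FiniteType ℂ A)
  have : Nontrivial (A ⧸ m) := Ideal.Quotient.nontrivial_iff.2 hm.ne_top
  obtain ⟨ε⟩ := exists_algHom_of_countable ((Ideal.Quotient.mkₐ ℂ m).comp f)
    (Ideal.Quotient.mk_surjective.comp hf)
  let δ := ε.comp (Ideal.Quotient.mkₐ ℂ m)
  have hle : m ≤ RingHom.ker δ := fun x hx ↦ by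
    change ε (Ideal.Quotient.mk m x) = 0
    rw [Ideal.Quotient.eq_zero_iff_mem.2 hx, map_zero]
  exact ⟨δ, fun x ↦ by rw [hm.eq_of_le (RingHom.ker_ne_top _) hle]; rfl⟩

/-- `M` has no proper submodule containing certain finitely many elements and stable under
certain finitely many endomorphisms. -/
def FGUnder (A M : Type) [CommRing A] [AddCommGroup M] [Module A M] : Prop :=
  ∃ (S : Finset M) (T : Finset (Module.End A M)), ∀ N : Submodule A M, (∀ s ∈ S, s ∈ N) →
    (∀ t ∈ T, ∀ x ∈ N, t x ∈ N) → N = ⊤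

/-- The fibre of `M` at `ε` has dimension `N`. -/
def FibreDim {A : Type} (M : Type) [CommRing A] [AddCommGroup M] [Module A M] (N : ℕ)
    (ε : A →+* ℂ) : Prop :=
  ∃ q : M →ₛₗ[ε] (Fin N → ℂ), Function.Surjective q ∧
    ∀ ψ : M →ₛₗ[ε] ℂ, ∃ χ : (Fin N → ℂ) →ₗ[ℂ] ℂ, ∀ m, ψ m = χ (q m)

variable {A M : Type} [CommRing A] [AddCommGroup M] [Module A M]

/-- The finitely many operators have countably many words, and the span of the words applied to the
generators is stable under them. -/
lemma FGUnder.exists_countable (h : FGUnder A M) :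
    ∃ C : Set M, C.Countable ∧ Submodule.span A C = ⊤ := by
  obtain ⟨S, T, H⟩ := h
  let w (l : List T) (s : S) : M := l.foldr (fun t x ↦ t.1 x) s.1
  refine ⟨Set.range fun p : List T × S ↦ w p.1 p.2, Set.countable_range _, H _ (fun s hs ↦ ?_)
    fun t ht x hx ↦ ?_⟩
  · exact Submodule.subset_span ⟨⟨[], ⟨s, hs⟩⟩, rfl⟩
  · induction hx using Submodule.span_induction with
    | mem x hx =>
      obtain ⟨⟨l, s⟩, rfl⟩ := hx
      exact Submodule.subset_span ⟨⟨⟨t, ht⟩ :: l, s⟩, rfl⟩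
    | zero => rw [map_zero]; exact zero_mem _
    | add x y _ _ hx hy => rw [map_add]; exact add_mem hx hy
    | smul a x _ hx => rw [map_smul]; exact Submodule.smul_mem _ _ hx

/-- Coordinates with respect to `b` are linear functionals on `M` with values in the fraction field.
Their values on a countable spanning set, together with `A`, generate a countably generated algebra,
which has a complex point. Specializing there gives functionals on a single fibre that are dual to
the images of `b`, so these images are independent. -/
lemma not_linearIndependent_of_fibreDim [IsDomain A] [Algebra ℂ A] [Algebra.FiniteType ℂ A]
    (hc : ∃ C : Set M, C.Countable ∧ Submodule.span A C = ⊤) {N : ℕ}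
    (hN : ∀ ε : A →ₐ[ℂ] ℂ, FibreDim M N ε.toRingHom) {ι : Type} [Fintype ι] (b : ι → M)
    (hb : LinearIndependent A b) : Fintype.card ι ≤ N := by
  classical
  let K := FractionRing A
  obtain ⟨C, hC, hspan⟩ := hc
  let j : M →ₗ[A] LocalizedModule (nonZeroDivisors A) M := LocalizedModule.mkLinearMap _ _
  have hb' : LinearIndependent K (j ∘ b) := hb.of_isLocalizedModule K (nonZeroDivisors A) j
  obtain ⟨r, hr⟩ := LinearMap.exists_leftInverse_of_injective
    (Finsupp.linearCombination K (j ∘ b)) (LinearMap.ker_eq_bot.2 hb')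
  let φ (i : ι) : M →ₗ[A] K := ((Finsupp.lapply i ∘ₗ r).restrictScalars A) ∘ₗ j
  have hφ (i k : ι) : φ i (b k) = if i = k then 1 else 0 := by
    have e := LinearMap.congr_fun hr (Finsupp.single k 1)
    rw [LinearMap.comp_apply, Finsupp.linearCombination_single, one_smul] at e
    change (r (j (b k))) i = _
    rw [show r (j (b k)) = Finsupp.single k 1 from e, Finsupp.single_apply]
    simp only [eq_comm]
  obtain ⟨n, f, hf⟩ := Algebra.FiniteType.iff_quotient_mvPolynomial''.1
    (inferInstance : Algebra.FiniteType ℂ A)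
  have : Countable C := hC
  let val : Fin n ⊕ C × ι → K :=
    Sum.elim (fun k ↦ algebraMap A K (f (.X k))) (fun p ↦ φ p.2 p.1)
  let T := (MvPolynomial.aeval (R := ℂ) val).range
  have hA (x : A) : algebraMap A K x ∈ T := by
    obtain ⟨p, rfl⟩ := hf x
    refine ⟨MvPolynomial.rename Sum.inl p, ?_⟩
    have : (MvPolynomial.aeval (R := ℂ) val).comp (MvPolynomial.rename Sum.inl) =
        (IsScalarTower.toAlgHom ℂ A K).comp f := by
      ext k
      simp [val]
    exact DFunLike.congr_fun this p
  have hM (i : ι) (m : M) : φ i m ∈ T := by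
    have hm : m ∈ Submodule.span A C := hspan ▸ Submodule.mem_top
    induction hm using Submodule.span_induction with
    | mem x hx => exact ⟨.X (.inr (⟨x, hx⟩, i)), by simp [val]⟩
    | zero => rw [map_zero]; exact zero_mem _
    | add x y _ _ hx hy => rw [map_add]; exact add_mem hx hy
    | smul a x _ hx => rw [map_smul, Algebra.smul_def]; exact mul_mem (hA a) hx
  obtain ⟨ε⟩ := exists_algHom_of_countable (MvPolynomial.aeval (R := ℂ) val).rangeRestrict
    (AlgHom.rangeRestrict_surjective _)
  let δ : A →ₐ[ℂ] ℂ := ε.comp ((IsScalarTower.toAlgHom ℂ A K).codRestrict T hA)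
  let ψ (i : ι) : M →ₛₗ[δ.toRingHom] ℂ :=
    { toFun := fun m ↦ ε ⟨φ i m, hM i m⟩
      map_add' := fun x y ↦ by
        rw [← map_add]
        congr 1
        exact Subtype.ext (map_add _ _ _)
      map_smul' := fun a x ↦ by
        refine Eq.trans ?_ (map_mul ε _ _)
        congr 1
        refine Subtype.ext ((map_smul _ _ _).trans (Algebra.smul_def _ _)) }
  obtain ⟨q, -, hq⟩ := hN δ
  choose χ hχ using fun i ↦ hq (ψ i)
  have hψ (i k : ι) : χ i (q (b k)) = if i = k then 1 else 0 := by
    rw [← hχ]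
    change ε ⟨_, _⟩ = _
    simp only [hφ]
    split_ifs
    · exact map_one ε
    · exact map_zero ε
  have hli : LinearIndependent ℂ fun k ↦ q (b k) := by
    rw [Fintype.linearIndependent_iff]
    intro g hg i
    have h1 : ∑ k, g k * χ i (q (b k)) = 0 := by
      simpa using congrArg (χ i) hg
    simp_rw [hψ] at h1
    simpa using h1
  simpa using hli.fintype_card_le_finrank

/-- The elements `e i` become the standard basis in the fibre, so the rows of `a` are independent at
`ε`. The matrix there has a right inverse over `ℂ`, whose entries are constants of `A`. -/
lemma exists_lift_of_fibreDim [Algebra ℂ A] [Module.Flat A M] {N k : ℕ} {ε : A →ₐ[ℂ] ℂ}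
    {q : M →ₛₗ[ε.toRingHom] (Fin N → ℂ)} {e : Fin N → M} (he : ∀ i, q (e i) = Pi.single i 1)
    (a : Fin N → Fin k → A) (y : Fin k → M) (hy : ∀ i, e i = ∑ j, a i j • y j) :
    ∃ C : Matrix (Fin k) (Fin N) A, ε (Matrix.det (Matrix.of a * C)) = 1 := by
  let B : Matrix (Fin N) (Fin k) ℂ := (Matrix.of a).map ε
  have hB : LinearMap.ker (Matrix.vecMulLinear B) = ⊥ := by
    refine LinearMap.ker_eq_bot'.2 fun α hα ↦ ?_
    have h1 : ∑ i, α i • q (e i) = 0 := by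
      simp_rw [hy, map_sum, map_smulₛₗ, Finset.smul_sum]
      rw [Finset.sum_comm]
      refine Finset.sum_eq_zero fun j _ ↦ ?_
      have := congrFun hα j
      simp only [Matrix.vecMulLinear_apply, Matrix.vecMul, dotProduct] at this
      simp_rw [smul_smul, ← Finset.sum_smul]
      exact (congrArg (· • q (y j)) this).trans (zero_smul _ _)
    simp_rw [he] at h1
    funext i
    have := congrFun h1 i
    simpa [Pi.single_apply] using this
  obtain ⟨r, hr⟩ := LinearMap.exists_leftInverse_of_injective _ hB
  let C : Matrix (Fin k) (Fin N) ℂ := LinearMap.toMatrixRight' r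
  have hC : B * C = 1 := by
    have e1 : LinearMap.toMatrixRight' (Matrix.vecMulLinear B) = B :=
      LinearMap.toMatrixRight'.apply_symm_apply B
    have := congrArg LinearMap.toMatrixRight' hr
    rwa [LinearMap.toMatrixRight'_comp, LinearMap.toMatrixRight'_id, e1] at this
  refine ⟨C.map (algebraMap ℂ A), ?_⟩
  have e2 : (C.map (algebraMap ℂ A)).map (ε : A →+* ℂ) = C := by
    ext i j
    simp
  rw [← AlgHom.coe_toRingHom, RingHom.map_det, RingHom.mapMatrix_apply, Matrix.map_mul, e2]
  exact (congrArg Matrix.det hC).trans Matrix.det_one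

/-- By the equational criterion of flatness the given relation is trivial, so `x` and the `e i` are
combinations of elements `y j` whose coefficients satisfy the relation. The coefficient matrix of
the `e i` is right invertible near `ε`, and Cramer's rule expresses `u` through `v` with the
determinant as denominator. -/
lemma exists_smul_eq_of_fibreDim [IsDomain A] [Algebra ℂ A] [Module.Flat A M] {N : ℕ}
    {ε : A →ₐ[ℂ] ℂ}
    {q : M →ₛₗ[ε.toRingHom] (Fin N → ℂ)} {e : Fin N → M} (he : ∀ i, q (e i) = Pi.single i 1)
    (v : A) (u : Fin N → A) (x : M) (h : v • x = ∑ i, u i • e i) :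
    ∃ (s : A) (w : Fin N → A), ε s = 1 ∧ ∀ i, s * u i = v * w i := by
  have h0 : ∑ o : Option (Fin N), Option.elim o (-v) u • Option.elim o x e = 0 := by
    rw [Fintype.sum_option]
    simp [← h]
  obtain ⟨k, a, y, h1, h2⟩ := Module.Flat.isTrivialRelation_of_sum_smul_eq_zero h0
  obtain ⟨C, hC⟩ := exists_lift_of_fibreDim he (fun i ↦ a (some i)) y fun i ↦ h1 (some i)
  let B : Matrix (Fin N) (Fin k) A := Matrix.of fun i ↦ a (some i)
  have h3 : Matrix.vecMul u B = v • a none := by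
    funext j
    have := h2 j
    rw [Fintype.sum_option] at this
    simp only [Option.elim] at this
    rw [neg_mul, neg_add_eq_zero] at this
    exact this.symm
  refine ⟨(B * C).det, Matrix.vecMul (a none) (C * (B * C).adjugate), hC, fun i ↦ ?_⟩
  have h4 : Matrix.vecMul u (B * C * (B * C).adjugate) = v • Matrix.vecMul (a none) (C * (B * C).adjugate) := by
    rw [Matrix.mul_assoc, ← Matrix.vecMul_vecMul, h3, Matrix.smul_vecMul]
  rw [Matrix.mul_adjugate, Matrix.vecMul_smul, Matrix.vecMul_one] at h4
  exact congrFun h4 i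

/-- A flat family over a domain whose fibres have the same finite dimension is finite. -/
lemma finite_of_fibreDim_of_isDomain [IsDomain A] [Algebra ℂ A] [Algebra.FiniteType ℂ A]
    [Module.Flat A M] (hM : FGUnder A M) {N : ℕ}
    (hN : ∀ ε : A →ₐ[ℂ] ℂ, FibreDim M N ε.toRingHom) : Module.Finite A M := by
  classical
  -- Near each closed point, after inverting one function, the module is spanned by lifts of a basis
  -- of the fibre.
  have hmax (m : Ideal A) [m.IsMaximal] : ∃ (f : A) (L : Submodule A M), f ∉ m ∧ L.FG ∧
      ∀ x, ∃ k : ℕ, f ^ k • x ∈ L := by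
    obtain ⟨ε, hε⟩ := exists_algHom_ker m
    obtain ⟨q, hq, -⟩ := hN ε
    choose e he using fun i : Fin N ↦ hq (Pi.single i 1)
    let L := Submodule.span A (Set.range e)
    have hs1 (s : A) (hs : ε s = 1) : s ≠ 0 := by
      rintro rfl
      simp at hs
    -- A linear relation is the case `v = 0` of `exists_smul_eq_of_fibreDim`.
    have hli : LinearIndependent A e := by
      rw [Fintype.linearIndependent_iff]
      intro g hg i
      obtain ⟨s, w, hs, hw⟩ := exists_smul_eq_of_fibreDim he 0 g 0 (by rw [hg, smul_zero])
      have := hw i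
      rw [zero_mul] at this
      exact (mul_eq_zero.1 this).resolve_left (hs1 s hs)
    -- The bound on the generic rank makes `x` dependent on `e`, with a nonzero coefficient on `x`.
    -- Flatness replaces this uncontrolled coefficient by one that is `1` at the chosen point.
    have hx (x : M) : ∃ s : A, ε s = 1 ∧ s • x ∈ L := by
      have hdep : ¬ LinearIndependent A fun o : Option (Fin N) ↦ Option.elim o x e := fun h ↦ by
        have := not_linearIndependent_of_fibreDim hM.exists_countable hN _ h
        simp at this
      rw [Fintype.linearIndependent_iff] at hdep
      push Not at hdep
      obtain ⟨g, hg, o, ho⟩ := hdep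
      rw [Fintype.sum_option] at hg
      simp only [Option.elim] at hg
      have hv : g none ≠ 0 := fun h ↦ by
        rw [h, zero_smul, zero_add] at hg
        cases o with
        | none => exact ho h
        | some i => exact ho (Fintype.linearIndependent_iff.1 hli _ hg i)
      obtain ⟨s, w, hs, hw⟩ := exists_smul_eq_of_fibreDim he (g none) (fun i ↦ - g (some i)) x (by
        simp_rw [neg_smul, Finset.sum_neg_distrib]
        exact eq_neg_of_add_eq_zero_left hg)
      refine ⟨s, hs, ?_⟩
      have : s • x = ∑ i, w i • e i := by
        have htf : Module.IsTorsionFree A M := inferInstance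
        refine smul_right_injective M hv ?_
        change g none • s • x = g none • _
        rw [smul_comm, eq_neg_of_add_eq_zero_left hg, smul_neg, Finset.smul_sum, Finset.smul_sum,
          ← Finset.sum_neg_distrib]
        refine Finset.sum_congr rfl fun i _ ↦ ?_
        rw [smul_smul, smul_smul, ← hw, mul_neg, neg_smul]
      rw [this]
      exact sum_mem fun i _ ↦ Submodule.smul_mem _ _ (Submodule.subset_span ⟨i, rfl⟩)
    obtain ⟨S, T, H⟩ := hM
    choose s hs hsx using hx
    -- One denominator serves the generators and the images of the basis under the operators. The
    -- elements that a power of `f` brings into `L` then form a stable submodule containing the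
    -- generators, hence everything.
    let f : A := (∏ x ∈ S, s x) * ∏ p : T × Fin N, s (p.1.1 (e p.2))
    have hf : ε f = 1 := by simp [f, hs]
    have hdvd {x : M} {r : A} (h1 : s x ∣ r) : r • x ∈ L := by
      obtain ⟨c, rfl⟩ := h1
      rw [mul_comm, mul_smul]
      exact Submodule.smul_mem _ _ (hsx x)
    have hfL (t : Module.End A M) (ht : t ∈ T) (x : M) (hx : x ∈ L) : f • t x ∈ L := by
      induction hx using Submodule.span_induction with
      | mem x hx =>
        obtain ⟨i, rfl⟩ := hx
        exact hdvd ((Finset.dvd_prod_of_mem (fun p : T × Fin N ↦ s (p.1.1 (e p.2)))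
          (Finset.mem_univ (⟨⟨t, ht⟩, i⟩ : T × Fin N))).mul_left _)
      | zero => rw [map_zero, smul_zero]; exact zero_mem _
      | add x y _ _ hx hy => rw [map_add, smul_add]; exact add_mem hx hy
      | smul a x _ hx => rw [map_smul, smul_comm]; exact Submodule.smul_mem _ _ hx
    let P : Submodule A M :=
      { carrier := {x | ∃ k : ℕ, f ^ k • x ∈ L}
        zero_mem' := ⟨0, by simp⟩
        add_mem' := by
          rintro x y ⟨k, hk⟩ ⟨l, hl⟩
          refine ⟨k + l, ?_⟩
          rw [smul_add]
          refine add_mem ?_ ?_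
          · rw [add_comm, pow_add, mul_smul]; exact Submodule.smul_mem _ _ hk
          · rw [pow_add, mul_smul]; exact Submodule.smul_mem _ _ hl
        smul_mem' := by
          rintro a x ⟨k, hk⟩
          exact ⟨k, by rw [smul_comm]; exact Submodule.smul_mem _ _ hk⟩ }
    have hP : P = ⊤ := by
      refine H P (fun x hx ↦ ⟨1, ?_⟩) fun t ht x ⟨k, hk⟩ ↦ ⟨k + 1, ?_⟩
      · rw [pow_one]
        exact hdvd ((Finset.dvd_prod_of_mem s hx).mul_right _)
      · rw [pow_succ', mul_smul, ← map_smul]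
        exact hfL t ht _ hk
    refine ⟨f, L, fun h ↦ ?_, Submodule.fg_span (Set.finite_range e), fun x ↦ ?_⟩
    · rw [(hε f).2 h] at hf
      exact zero_ne_one hf
    · exact (hP ▸ Submodule.mem_top : x ∈ P)
  let Q (f : A) : Prop := ∃ L : Submodule A M, L.FG ∧ ∀ x, ∃ k : ℕ, f ^ k • x ∈ L
  have hQ : Ideal.span {f | Q f} = ⊤ := by
    by_contra h
    obtain ⟨m, hm, hle⟩ := Ideal.exists_le_maximal _ h
    obtain ⟨f, L, hf, hL⟩ := hmax m
    exact hf (hle (Ideal.subset_span ⟨L, hL⟩))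
  obtain ⟨S, hSQ, hS⟩ := (Ideal.span_eq_top_iff_finite _).1 hQ
  choose L hL hLx using fun f : S ↦ hSQ f.2
  refine ⟨?_⟩
  have : (⊤ : Submodule A M) = ⨆ f, L f := by
    refine le_antisymm (fun x _ ↦ ?_) le_top
    refine eq_zero_of_span hS _ x fun r hr ↦ ?_
    obtain ⟨k, hk⟩ := hLx ⟨r, hr⟩ x
    exact ⟨k, Submodule.mem_iSup_of_mem _ hk⟩
  rw [this]
  exact Submodule.fg_iSup _ hL

lemma FGUnder.baseChange (h : FGUnder A M) (B : Type) [CommRing B] [Algebra A B] :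
    FGUnder B (B ⊗[A] M) := by
  classical
  obtain ⟨S, T, H⟩ := h
  refine ⟨S.image fun s ↦ 1 ⊗ₜ s, T.image fun t ↦ t.baseChange B, fun N hS hT ↦ ?_⟩
  have h1 : (N.restrictScalars A).comap (TensorProduct.mk A B M 1) = ⊤ := by
    refine H _ (fun s hs ↦ hS _ (Finset.mem_image_of_mem _ hs)) fun t ht x hx ↦ ?_
    have := hT _ (Finset.mem_image_of_mem _ ht) _ hx
    rwa [TensorProduct.mk_apply, LinearMap.baseChange_tmul] at this
  refine eq_top_iff.2 fun z _ ↦ ?_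
  induction z with
  | zero => exact zero_mem _
  | add x y hx hy => exact add_mem (hx trivial) (hy trivial)
  | tmul b m =>
    have h2 : (1 : B) ⊗ₜ[A] m ∈ N := by
      have : m ∈ (N.restrictScalars A).comap (TensorProduct.mk A B M 1) := h1 ▸ Submodule.mem_top
      exact this
    have := N.smul_mem b h2
    rwa [TensorProduct.smul_tmul', smul_eq_mul, mul_one] at this

lemma FibreDim.baseChange {B : Type} [CommRing B] [Algebra A B] {N : ℕ} (ε : B →+* ℂ)
    (h : FibreDim M N (ε.comp (algebraMap A B))) : FibreDim (B ⊗[A] M) N ε := by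
  obtain ⟨q, hq, H⟩ := h
  let q₀ : B ⊗[A] M →+ (Fin N → ℂ) := TensorProduct.liftAddHom
    { toFun := fun b ↦ (DistribSMul.toAddMonoidHom _ (ε b)).comp q.toAddMonoidHom
      map_zero' := by ext; simp
      map_add' := fun x y ↦ by ext; simp [add_mul] } fun r b m ↦ by
        change ε (r • b) • q m = ε b • q (r • m)
        rw [q.map_smulₛₗ, Algebra.smul_def r b, map_mul, smul_smul, mul_comm]
        rfl
  have hq₀ (b : B) (m : M) : q₀ (b ⊗ₜ m) = ε b • q m := rfl
  refine ⟨{ q₀ with map_smul' := fun b z ↦ ?_ }, fun v ↦ ?_, fun ψ ↦ ?_⟩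
  · change q₀ (b • z) = ε b • q₀ z
    induction z with
    | zero => simp
    | add x y hx hy => rw [smul_add, map_add, hx, hy, map_add, smul_add]
    | tmul c m => rw [TensorProduct.smul_tmul', hq₀, hq₀, smul_smul, smul_eq_mul, map_mul]
  · obtain ⟨m, rfl⟩ := hq v
    exact ⟨1 ⊗ₜ m, (hq₀ 1 m).trans (by rw [map_one, one_smul])⟩
  · obtain ⟨χ, hχ⟩ := H
      { toFun := fun m ↦ ψ (1 ⊗ₜ m)
        map_add' := fun x y ↦ by rw [TensorProduct.tmul_add, map_add]
        map_smul' := fun r m ↦ by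
          rw [TensorProduct.tmul_smul, ← algebraMap_smul B r, map_smulₛₗ]
          rfl }
    refine ⟨χ, fun z ↦ ?_⟩
    change ψ z = χ (q₀ z)
    induction z with
    | zero => rw [map_zero, map_zero, map_zero]
    | add x y hx hy => rw [map_add, map_add, map_add, hx, hy]
    | tmul b m =>
      rw [hq₀, map_smul, ← hχ]
      have : b ⊗ₜ[A] m = b • 1 ⊗ₜ m := by rw [TensorProduct.smul_tmul', smul_eq_mul, mul_one]
      rw [this, map_smulₛₗ]
      rfl

/-- A flat family whose fibres have the same finite dimension is finite. -/
lemma finite_of_fibreDim [Algebra ℂ A] [Algebra.FiniteType ℂ A] [Module.Flat A M]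
    (hM : FGUnder A M) {N : ℕ} (hN : ∀ ε : A →ₐ[ℂ] ℂ, FibreDim M N ε.toRingHom) :
    Module.Finite A M := by
  have : IsNoetherianRing A := Algebra.FiniteType.isNoetherianRing ℂ A
  have key : Module.Finite A (A ⊗[A] M) := by
    -- Dévissage over finite `A`-modules `L` shows that `L ⊗ M` is finite. For a prime quotient the
    -- base change satisfies all hypotheses over a domain, and right exactness of the tensor product
    -- handles extensions.
    refine IsNoetherianRing.induction_on_isQuotientEquivQuotientPrime A
      (inferInstance : Module.Finite A A)
      (motive := fun L _ _ _ ↦ Module.Finite A (L ⊗[A] M)) ?_ ?_ ?_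
    · intro L _ _ _ _
      have : Subsingleton (L ⊗[A] M) := inferInstance
      infer_instance
    · intro L _ _ _ p e
      have : Module.Finite (A ⧸ p.1) ((A ⧸ p.1) ⊗[A] M) := by
        have := Algebra.FiniteType.of_surjective (Ideal.Quotient.mkₐ ℂ p.1)
          Ideal.Quotient.mk_surjective
        refine finite_of_fibreDim_of_isDomain (hM.baseChange _) (N := N) fun ε ↦ ?_
        exact FibreDim.baseChange _ (hN (ε.comp (Ideal.Quotient.mkₐ ℂ p.1)))
      have : Module.Finite A ((A ⧸ p.1) ⊗[A] M) := Module.Finite.trans (A ⧸ p.1) _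
      exact Module.Finite.equiv (TensorProduct.congr e (LinearEquiv.refl A M)).symm
    · intro L₁ _ _ _ L₂ _ _ _ L₃ _ _ _ f g _ hg hfg h1 h3
      have hex := rTensor_exact M hfg hg
      have hs := LinearMap.rTensor_surjective M hg
      exact Module.Finite.of_exact hex hs
  exact Module.Finite.equiv (TensorProduct.lid A M)

end FiniteFamilies

/-! ### Regular sequences of commuting operators -/

section RegularOperators

variable {n : ℕ} {Γ Γ' : Type*} [AddCommGroup Γ] [AddCommGroup Γ']

/-- The sum of the ranges of the first `k` operators. -/
def opRange (D : Fin n → Γ →+ Γ) (k : ℕ) : AddSubgroup Γ := ⨆ i : {i : Fin n // i.1 < k}, (D i).range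

lemma mem_opRange (D : Fin n → Γ →+ Γ) {k : ℕ} (i : Fin n) (h : i.1 < k) (ω : Γ) :
    D i ω ∈ opRange D k :=
  AddSubgroup.mem_iSup_of_mem (⟨i, h⟩ : {i : Fin n // i.1 < k}) ⟨ω, rfl⟩

lemma opRange_le {D : Fin n → Γ →+ Γ} {k : ℕ} {S : AddSubgroup Γ}
    (h : ∀ i : Fin n, i.1 < k → ∀ ω, D i ω ∈ S) : opRange D k ≤ S :=
  iSup_le fun i ↦ by
    rintro _ ⟨ω, rfl⟩
    exact h i.1 i.2 ω

lemma map_mem_opRange {D : Fin n → Γ →+ Γ} {D' : Fin n → Γ' →+ Γ'} (f : Γ →+ Γ')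
    (hf : ∀ i ω, f (D i ω) = D' i (f ω)) {k : ℕ} {ω : Γ} (h : ω ∈ opRange D k) :
    f ω ∈ opRange D' k :=
  (opRange_le (S := (opRange D' k).comap f) fun i hi ω ↦ by
    rw [AddSubgroup.mem_comap, hf]
    exact mem_opRange D' i hi _) h

lemma opRange_mono (D : Fin n → Γ →+ Γ) {k l : ℕ} (h : k ≤ l) : opRange D k ≤ opRange D l :=
  opRange_le fun i hi ω ↦ mem_opRange D i (hi.trans_le h) ω

lemma exists_of_mem_opRange_succ {D : Fin n → Γ →+ Γ} (k : Fin n) {ω : Γ}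
    (h : ω ∈ opRange D (k.1 + 1)) : ∃ β, ω - D k β ∈ opRange D k.1 := by
  have : opRange D (k.1 + 1) ≤ opRange D k.1 ⊔ (D k).range := opRange_le fun i hi ω ↦ by
    rcases Nat.lt_succ_iff_lt_or_eq.1 hi with h | h
    · exact AddSubgroup.mem_sup_left (mem_opRange D i h ω)
    · obtain rfl : i = k := Fin.ext h
      exact AddSubgroup.mem_sup_right ⟨ω, rfl⟩
  obtain ⟨a, ha, _, ⟨β, rfl⟩, rfl⟩ := AddSubgroup.mem_sup.1 (this h)
  exact ⟨β, by rwa [add_sub_cancel_right]⟩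

/-- The operators form a regular sequence. -/
def RegSeq (D : Fin n → Γ →+ Γ) : Prop :=
  ∀ (k : Fin n) (ω : Γ), D k ω ∈ opRange D k.1 → ω ∈ opRange D k.1

/-- Membership in the ranges is carried to the larger group by the maps `s` and back by the maps
`r`, both of which commute with the operators. -/
lemma RegSeq.of_retract {D : Fin n → Γ →+ Γ} {D' : Fin n → Γ' →+ Γ'} (h : RegSeq D) {σ : Type*}
    [Fintype σ] (s : σ → Γ' →+ Γ) (r : σ → Γ →+ Γ') (hs : ∀ c i ω, s c (D' i ω) = D i (s c ω))
    (hr : ∀ c i ω, r c (D i ω) = D' i (r c ω)) (hsr : ∀ ω, ∑ c, r c (s c ω) = ω) : RegSeq D' := by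
  intro k ω hω
  rw [← hsr ω]
  refine sum_mem fun c _ ↦ map_mem_opRange _ (hr c) (h k _ ?_)
  rw [← hs]
  exact map_mem_opRange _ (hs c) hω

/-! ### Exactness of Koszul complexes from contracting homotopies -/

section Koszul

variable {C : ℕ → Type*} [∀ j, AddCommGroup (C j)] {D : ∀ j, Fin n → C j →+ C j}

/-- A cochain complex with contracting homotopies for a regular sequence is exact below degree
`n`. -/
lemma exact_of_regSeq (hD : ∀ j, RegSeq (D j)) (d : ∀ j, C j →+ C (j + 1))
    (hd : ∀ j ω, d (j + 1) (d j ω) = 0) (h : Fin n → ∀ j, C (j + 1) →+ C j)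
    (dD : ∀ j i ω, d j (D j i ω) = D (j + 1) i (d j ω))
    (hhD : ∀ k j i ω, h k j (D (j + 1) i ω) = D j i (h k j ω))
    (h0 : ∀ k ω, h k 0 (d 0 ω) = D 0 k ω)
    (h1 : ∀ k j ω, h k (j + 1) (d (j + 1) ω) + d j (h k j ω) = D (j + 1) k ω) :
    (0 < n → ∀ ω, d 0 ω = 0 → ω = 0) ∧
      ∀ j, j + 1 < n → ∀ ω, d (j + 1) ω = 0 → ∃ α, d j α = ω := by
  -- The statement is strengthened to exactness modulo the ranges of the first `k` operators and
  -- proved by descending induction on `k`. With `m = n - k` operators left, it is claimed only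
  -- below degree `m`.
  have key (m : ℕ) : ∀ k, k + m = n →
      (0 < m → ∀ ω, d 0 ω ∈ opRange (D 1) k → ω ∈ opRange (D 0) k) ∧
      ∀ j, j + 1 < m → ∀ ω, d (j + 1) ω ∈ opRange (D (j + 2)) k →
        ∃ α, ω - d j α ∈ opRange (D (j + 1)) k := by
    induction m with
    | zero => exact fun k _ ↦ ⟨fun h ↦ absurd h (lt_irrefl 0), fun j hj ↦ by omega⟩
    | succ m ih =>
      intro k hk
      let κ : Fin n := ⟨k, by omega⟩
      obtain ⟨ih0, ih1⟩ := ih (k + 1) (by omega)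
      refine ⟨fun _ ω hω ↦ hD 0 κ ω ?_, fun j hj ω hω ↦ ?_⟩
      · rw [← h0]
        exact map_mem_opRange _ (hhD κ 0) hω
      -- Modulo the first `k` ranges the homotopy formula reads `d (h ω) = D_k ω`. Hence `h ω` is a
      -- cycle modulo one more range, and by induction it is `b + D_k β` with `d b = 0`. Then `D_k
      -- (ω - d β)` is zero modulo the first `k` ranges, and regularity cancels `D_k`.
      · have e1 : h κ (j + 1) (d (j + 1) ω) ∈ opRange (D (j + 1)) k :=
          map_mem_opRange _ (hhD κ (j + 1)) hω
        have e2 : d j (h κ j ω) ∈ opRange (D (j + 1)) (k + 1) := by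
          rw [← add_sub_cancel_left (h κ (j + 1) (d (j + 1) ω)) (d j _), h1]
          exact sub_mem (mem_opRange _ κ (Nat.lt_succ_self k) _)
            (opRange_mono _ (Nat.le_succ k) e1)
        have e3 : ∃ b, d j b = 0 ∧ h κ j ω - b ∈ opRange (D j) (k + 1) := by
          cases j with
          | zero => exact ⟨0, map_zero _, by rw [sub_zero]; exact ih0 (by omega) _ e2⟩
          | succ j =>
            obtain ⟨α, hα⟩ := ih1 j (by omega) _ e2
            exact ⟨d j α, hd _ _, hα⟩
        obtain ⟨b, hb, hb'⟩ := e3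
        obtain ⟨β, hβ⟩ := exists_of_mem_opRange_succ κ hb'
        refine ⟨β, hD _ κ _ ?_⟩
        have e4 := map_mem_opRange (D' := D (j + 1)) (d j) (dD j) hβ
        rw [map_sub, map_sub, hb, sub_zero, dD] at e4
        have : D (j + 1) κ (ω - d j β) =
            h κ (j + 1) (d (j + 1) ω) + (d j (h κ j ω) - D (j + 1) κ (d j β)) := by
          rw [map_sub, ← h1 κ j ω, add_sub_assoc]
        rw [this]
        exact add_mem e1 e4
  have hbot (j : ℕ) : opRange (D j) 0 = ⊥ :=
    le_bot_iff.1 (opRange_le fun i hi ↦ absurd hi (Nat.not_lt_zero _))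
  obtain ⟨k0, k1⟩ := key n 0 (zero_add n)
  refine ⟨fun hn ω hω ↦ ?_, fun j hj ω hω ↦ ?_⟩
  · simpa [hbot] using k0 hn ω (by rw [hω]; exact zero_mem _)
  · obtain ⟨α, hα⟩ := k1 j hj ω (by rw [hω]; exact zero_mem _)
    rw [hbot, AddSubgroup.mem_bot, sub_eq_zero] at hα
    exact ⟨α, hα.symm⟩

/-- A chain complex with contracting homotopies for a regular sequence is exact in positive
degrees. -/
lemma exact_of_regSeq' (hD : ∀ j, RegSeq (D j)) (hn : ∀ j, n < j → Subsingleton (C j))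
    (d : ∀ j, C (j + 1) →+ C j)
    (hd : ∀ j ω, d j (d (j + 1) ω) = 0) (h : Fin n → ∀ j, C j →+ C (j + 1))
    (dD : ∀ j i ω, d j (D (j + 1) i ω) = D j i (d j ω))
    (hhD : ∀ k j i ω, h k j (D j i ω) = D (j + 1) i (h k j ω))
    (h1 : ∀ k j ω, h k j (d j ω) + d (j + 1) (h k (j + 1) ω) = D (j + 1) k ω) (j : ℕ)
    (ω : C (j + 1)) (hω : d j ω = 0) : ∃ α, d (j + 1) α = ω := by
  -- The induction is again descending in `k`, now with the bound `k ≤ j`. It starts at `k = n`,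
  -- where the term of degree `j + 1` vanishes.
  have key (m : ℕ) : ∀ k, k + m = n → ∀ j, k ≤ j → ∀ ω, d j ω ∈ opRange (D j) k →
        ∃ α, ω - d (j + 1) α ∈ opRange (D (j + 1)) k := by
    induction m with
    | zero =>
      intro k hk j hj ω _
      have := hn (j + 1) (by omega)
      exact ⟨0, by rw [Subsingleton.elim (ω - d (j + 1) 0) 0]; exact zero_mem _⟩
    | succ m ih =>
      intro k hk j hj ω hω
      let κ : Fin n := ⟨k, by omega⟩
      have e1 : h κ j (d j ω) ∈ opRange (D (j + 1)) k := map_mem_opRange _ (hhD κ j) hω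
      have e2 : d (j + 1) (h κ (j + 1) ω) ∈ opRange (D (j + 1)) (k + 1) := by
        rw [← add_sub_cancel_left (h κ j (d j ω)) (d (j + 1) _), h1]
        exact sub_mem (mem_opRange _ κ (Nat.lt_succ_self k) _) (opRange_mono _ (Nat.le_succ k) e1)
      obtain ⟨b, hb'⟩ := ih (k + 1) (by omega) (j + 1) (by omega) _ e2
      obtain ⟨β, hβ⟩ := exists_of_mem_opRange_succ κ hb'
      refine ⟨β, hD _ κ _ ?_⟩
      have e4 := map_mem_opRange (D' := D (j + 1)) (d (j + 1)) (dD (j + 1)) hβ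
      rw [map_sub, map_sub, hd, sub_zero, dD] at e4
      have : D (j + 1) κ (ω - d (j + 1) β) =
          h κ j (d j ω) + (d (j + 1) (h κ (j + 1) ω) - D (j + 1) κ (d (j + 1) β)) := by
        rw [map_sub, ← h1 κ j ω, add_sub_assoc]
      rw [this]
      exact add_mem e1 e4
  obtain ⟨α, hα⟩ := key n 0 (zero_add n) j (Nat.zero_le j) ω (by rw [hω]; exact zero_mem _)
  have hbot : opRange (D (j + 1)) 0 = ⊥ :=
    le_bot_iff.1 (opRange_le fun i hi ↦ absurd hi (Nat.not_lt_zero _))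
  rw [hbot, AddSubgroup.mem_bot, sub_eq_zero] at hα
  exact ⟨α, hα.symm⟩

end Koszul

/-! ### Modules extended from the base: polynomials with coefficients in a module -/

section Polynomials

variable {M : Type*} [AddCommGroup M]

variable (M n) in
/-- Polynomials in `n` variables with coefficients in `M`. -/
abbrev PolyMod : Type _ := (Fin n →₀ ℕ) →₀ M

variable (M) in
/-- Multiplication by a variable. -/
def shift (k : Fin n) : PolyMod n M →+ PolyMod n M :=
  Finsupp.mapDomain.addMonoidHom (· + Finsupp.single k 1)

lemma shift_single (k : Fin n) (a : Fin n →₀ ℕ) (m : M) :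
    shift M k (Finsupp.single a m) = Finsupp.single (a + Finsupp.single k 1) m :=
  Finsupp.mapDomain_single

lemma shift_apply_add (k : Fin n) (f : PolyMod n M) (a : Fin n →₀ ℕ) :
    shift M k f (a + Finsupp.single k 1) = f a :=
  Finsupp.mapDomain_apply (add_left_injective _) f a

/-- An operator on coefficients. -/
def coeffMap {M' : Type*} [AddCommGroup M'] (x : M →+ M') : PolyMod n M →+ PolyMod n M' :=
  Finsupp.mapRange.addMonoidHom x

lemma coeffMap_single {M' : Type*} [AddCommGroup M'] (x : M →+ M') (a : Fin n →₀ ℕ) (m : M) :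
    coeffMap x (Finsupp.single a m) = Finsupp.single a (x m) :=
  Finsupp.mapRange_single (hf := map_zero x)

lemma coeffMap_shift {M' : Type*} [AddCommGroup M'] (x : M →+ M') (k : Fin n) (f : PolyMod n M) :
    coeffMap x (shift M k f) = shift M' k (coeffMap x f) := by
  induction f using Finsupp.induction_linear with
  | zero => simp
  | add f g hf hg => rw [map_add, map_add, hf, hg, map_add, map_add]
  | single a m => rw [shift_single, coeffMap_single, coeffMap_single, shift_single]

lemma shift_comm (k l : Fin n) (f : PolyMod n M) :
    shift M k (shift M l f) = shift M l (shift M k f) := by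
  induction f using Finsupp.induction_linear with
  | zero => simp
  | add f g hf hg => simp only [map_add, hf, hg]
  | single a m => rw [shift_single, shift_single, shift_single, shift_single, add_right_comm]

/-- Evaluation of polynomials at operators. -/
structure IsEval (T : Fin n → Γ →+ Γ) (η : M →+ Γ) (Ψ : PolyMod n M →+ Γ) : Prop where
  zero (m : M) : Ψ (Finsupp.single 0 m) = η m
  shift (k : Fin n) (f : PolyMod n M) : Ψ (shift M k f) = T k (Ψ f)

variable {T : Fin n → Γ →+ Γ} {η : M →+ Γ} {Ψ Ψ' : PolyMod n M →+ Γ}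

lemma finsupp_induction {P : (Fin n →₀ ℕ) → Prop} (h0 : P 0)
    (h1 : ∀ a k, P a → P (a + Finsupp.single k 1)) (a : Fin n →₀ ℕ) : P a := by
  have key (b : Fin n →₀ ℕ) : ∀ a, P a → P (a + b) := by
    induction b using Finsupp.induction_linear with
    | zero => exact fun a ha ↦ by rwa [add_zero]
    | add f g hf hg => exact fun a ha ↦ by rw [← add_assoc]; exact hg _ (hf _ ha)
    | single k m =>
      induction m with
      | zero => exact fun a ha ↦ by rwa [Finsupp.single_zero, add_zero]
      | succ m ih =>
        exact fun a ha ↦ by rw [Finsupp.single_add, ← add_assoc]; exact h1 _ _ (ih _ ha)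
  simpa using key a 0 h0

lemma IsEval.unique (h : IsEval T η Ψ) (h' : IsEval T η Ψ') : Ψ = Ψ' := by
  refine Finsupp.addHom_ext fun a m ↦ ?_
  induction a using finsupp_induction with
  | h0 => rw [h.zero, h'.zero]
  | h1 a k ih => rw [← shift_single, h.shift, h'.shift, ih]

lemma IsEval.exists (hT : ∀ k l γ, T k (T l γ) = T l (T k γ)) (η : M →+ Γ) :
    ∃ Ψ, IsEval T η Ψ := by
  let S : Set (AddMonoid.End Γ) := Set.range T
  have hS : ∀ a ∈ S, ∀ b ∈ S, a * b = b * a := by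
    rintro _ ⟨k, rfl⟩ _ ⟨l, rfl⟩
    exact AddMonoidHom.ext fun γ ↦ hT k l γ
  -- The submonoid generated by commuting operators is commutative, so monomials in them are
  -- unordered products.
  let _ : CommMonoid (Submonoid.closure S) :=
    { mul_comm := (Submonoid.isMulCommutative_closure _ hS).is_comm.comm }
  let t (k : Fin n) : Submonoid.closure S := ⟨T k, Submonoid.subset_closure ⟨k, rfl⟩⟩
  let mon (a : Fin n →₀ ℕ) : Submonoid.closure S := ∏ k, t k ^ a k
  have h0 : mon 0 = 1 := by simp [mon]
  have h1 (a) (k : Fin n) : mon (a + Finsupp.single k 1) = t k * mon a := by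
    simp only [mon, Finsupp.add_apply, pow_add, Finset.prod_mul_distrib]
    rw [mul_comm]
    congr 1
    rw [Finset.prod_eq_single k]
    · simp
    · intro l _ hl
      rw [Finsupp.single_eq_of_ne hl, pow_zero]
    · exact fun h ↦ absurd (Finset.mem_univ k) h
  let Ψ : PolyMod n M →+ Γ := Finsupp.liftAddHom fun a ↦ AddMonoidHom.comp (mon a).1 η
  have hΨ (a m) : Ψ (Finsupp.single a m) = (mon a).1 (η m) := Finsupp.liftAddHom_apply_single _ _ _
  refine ⟨Ψ, fun m ↦ by rw [hΨ, h0]; rfl, fun k f ↦ ?_⟩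
  induction f using Finsupp.induction_linear with
  | zero => simp
  | add f g hf hg => rw [map_add, map_add, hf, hg, map_add, map_add]
  | single a m => rw [shift_single, hΨ, hΨ, h1]; rfl

lemma IsEval.coeffMap (h : IsEval T η Ψ) {x : M →+ M} {X : Γ →+ Γ}
    (hX : ∀ k γ, X (T k γ) = T k (X γ)) (hx : ∀ m, η (x m) = X (η m)) (f : PolyMod n M) :
    Ψ (coeffMap x f) = X (Ψ f) := by
  have h1 : IsEval T (X.comp η) (Ψ.comp (EquivSheaf.coeffMap x)) :=
    ⟨fun m ↦ by
      rw [AddMonoidHom.comp_apply, coeffMap_single, h.zero, hx]; rfl, fun k f ↦ by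
      rw [AddMonoidHom.comp_apply, coeffMap_shift, h.shift]; rfl⟩
  have h2 : IsEval T (X.comp η) (X.comp Ψ) :=
    ⟨fun m ↦ by rw [AddMonoidHom.comp_apply, h.zero]; rfl, fun k f ↦ by
      rw [AddMonoidHom.comp_apply, h.shift, hX]; rfl⟩
  exact DFunLike.congr_fun (h1.unique h2) f

/-- Substituting `t_k - x_k` for `t_k` is an automorphism of the polynomials, with inverse the
substitution of `t_k + x_k`. Evaluation at `T - X` is evaluation at `T` composed with it. -/
lemma IsEval.bijective_sub (hΨ : IsEval T η Ψ) (hb : Function.Bijective Ψ) {x : Fin n → M →+ M}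
    {X : Fin n → Γ →+ Γ} (hx : ∀ k l m, x k (x l m) = x l (x k m))
    (hXT : ∀ k l γ, X k (T l γ) = T l (X k γ)) (hxX : ∀ k m, η (x k m) = X k (η m))
    (hΨ' : IsEval (fun k ↦ T k - X k) η Ψ') : Function.Bijective Ψ' := by
  let i : M →+ PolyMod n M := Finsupp.singleAddHom 0
  have hcomm (k l : Fin n) (f : PolyMod n M) : EquivSheaf.coeffMap (x k) (EquivSheaf.coeffMap (x l) f) =
      EquivSheaf.coeffMap (x l) (EquivSheaf.coeffMap (x k) f) := Finsupp.ext fun a ↦ hx k l (f a)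
  obtain ⟨Φ, hΦ⟩ := IsEval.exists (T := fun k ↦ EquivSheaf.shift M k - EquivSheaf.coeffMap (x k))
    (fun k l γ ↦ by
      simp only [AddMonoidHom.sub_apply, map_sub, coeffMap_shift, shift_comm k l, hcomm k l]
      abel) i
  obtain ⟨Φ', hΦ'⟩ := IsEval.exists (T := fun k ↦ EquivSheaf.shift M k + EquivSheaf.coeffMap (x k))
    (fun k l γ ↦ by
      simp only [AddMonoidHom.add_apply, map_add, coeffMap_shift, shift_comm k l, hcomm k l]
      abel) i
  have hid : IsEval (EquivSheaf.shift M) i (AddMonoidHom.id _) := ⟨fun _ ↦ rfl, fun _ _ ↦ rfl⟩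
  have hΦx (k f) : Φ (EquivSheaf.coeffMap (x k) f) = EquivSheaf.coeffMap (x k) (Φ f) :=
    hΦ.coeffMap (fun l γ ↦ by simp only [AddMonoidHom.sub_apply, map_sub, coeffMap_shift, hcomm k l])
      (fun m ↦ (coeffMap_single _ _ _).symm) f
  have hΦx' (k f) : Φ' (EquivSheaf.coeffMap (x k) f) = EquivSheaf.coeffMap (x k) (Φ' f) :=
    hΦ'.coeffMap (fun l γ ↦ by simp only [AddMonoidHom.add_apply, map_add, coeffMap_shift, hcomm k l])
      (fun m ↦ (coeffMap_single _ _ _).symm) f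
  have e1 : Φ'.comp Φ = AddMonoidHom.id _ := IsEval.unique (T := EquivSheaf.shift M) (η := i)
    ⟨fun m ↦ by rw [AddMonoidHom.comp_apply, hΦ.zero]; exact hΦ'.zero m, fun k f ↦ by
      rw [AddMonoidHom.comp_apply, hΦ.shift, AddMonoidHom.sub_apply, map_sub, hΦ'.shift, hΦx',
        AddMonoidHom.add_apply, add_sub_cancel_right]
      rfl⟩ hid
  have e2 : Φ.comp Φ' = AddMonoidHom.id _ := IsEval.unique (T := EquivSheaf.shift M) (η := i)
    ⟨fun m ↦ by rw [AddMonoidHom.comp_apply, hΦ'.zero]; exact hΦ.zero m, fun k f ↦ by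
      rw [AddMonoidHom.comp_apply, hΦ'.shift, AddMonoidHom.add_apply, map_add, hΦ.shift, hΦx,
        AddMonoidHom.sub_apply, sub_add_cancel]
      rfl⟩ hid
  have e3 : Ψ' = Ψ.comp Φ := hΨ'.unique
    ⟨fun m ↦ by rw [AddMonoidHom.comp_apply, hΦ.zero]; exact hΨ.zero m, fun k f ↦ by
      rw [AddMonoidHom.comp_apply, hΦ.shift, AddMonoidHom.sub_apply, map_sub, hΨ.shift,
        hΨ.coeffMap (hXT k) (hxX k)]
      rfl⟩
  rw [e3]
  exact hb.comp ⟨Function.LeftInverse.injective (DFunLike.congr_fun e1),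
    Function.RightInverse.surjective (DFunLike.congr_fun e2)⟩

/-- The subgroup generated by the first `k` shifts is spanned by monomials, so membership is read
off from coefficients. Regularity of the variables follows at once. -/
lemma mem_opRange_shift {k : ℕ} {f : PolyMod n M} : f ∈ opRange (shift M) k ↔
    ∀ a : Fin n →₀ ℕ, (∀ i : Fin n, i.1 < k → a i = 0) → f a = 0 := by
  constructor
  · intro h
    let S : AddSubgroup (PolyMod n M) :=
      { carrier := {f | ∀ a : Fin n →₀ ℕ, (∀ i : Fin n, i.1 < k → a i = 0) → f a = 0}
        zero_mem' := fun _ _ ↦ rfl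
        add_mem' := fun hf hg a ha ↦ by rw [Finsupp.add_apply, hf a ha, hg a ha, add_zero]
        neg_mem' := fun hf a ha ↦ by rw [Finsupp.neg_apply, hf a ha, neg_zero] }
    refine (opRange_le (S := S) fun i hi f a ha ↦ ?_) h
    refine Finsupp.mapDomain_notin_range f a ?_
    rintro ⟨b, rfl⟩
    have := ha i hi
    simp at this
  · intro h
    rw [← Finsupp.sum_single f]
    refine sum_mem fun a ha ↦ ?_
    have : ∃ i : Fin n, i.1 < k ∧ a i ≠ 0 := by
      by_contra! h'
      exact Finsupp.mem_support_iff.1 ha (h a h')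
    obtain ⟨i, hi, hai⟩ := this
    have e : a - Finsupp.single i 1 + Finsupp.single i 1 = a := by
      refine tsub_add_cancel_of_le ?_
      rw [Finsupp.single_le_iff]
      exact Nat.one_le_iff_ne_zero.2 hai
    rw [← e, ← shift_single]
    exact mem_opRange _ i hi _

lemma regSeq_shift : RegSeq (shift (n := n) M) := by
  intro k f hf
  rw [mem_opRange_shift] at hf ⊢
  intro a ha
  rw [← shift_apply_add k]
  refine hf _ fun i hi ↦ ?_
  have : i ≠ k := fun h ↦ by rw [h] at hi; exact lt_irrefl _ hi
  rw [Finsupp.add_apply, ha i hi, zero_add, Finsupp.single_eq_of_ne this]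

variable {D : Fin n → Γ →+ Γ}

lemma IsEval.regSeq (h : IsEval D η Ψ) (hb : Function.Bijective Ψ) : RegSeq D := by
  let e := AddEquiv.ofBijective Ψ hb
  refine (regSeq_shift (M := M) (n := n)).of_retract (σ := Unit) (fun _ ↦ e.symm.toAddMonoidHom)
    (fun _ ↦ Ψ) (fun _ i ω ↦ ?_) (fun _ ↦ h.shift) fun ω ↦ ?_
  · obtain ⟨f, rfl⟩ := hb.2 ω
    rw [← h.shift]
    exact (e.symm_apply_apply _).trans (congrArg _ (e.symm_apply_apply f).symm)
  · rw [Finset.sum_const, Finset.card_univ, Fintype.card_unit, one_smul]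
    exact e.apply_symm_apply ω

/-- The representative `m` is the constant term. Together with `IsEval.eq_zero_of_mem` this
identifies `M` with the quotient of `Γ` by the ranges of all the operators. -/
lemma IsEval.exists_sub_mem (h : IsEval D η Ψ) (hb : Function.Bijective Ψ) (γ : Γ) :
    ∃ m, γ - η m ∈ opRange D n := by
  obtain ⟨f, rfl⟩ := hb.2 γ
  refine ⟨f 0, ?_⟩
  rw [← h.zero, ← map_sub]
  refine map_mem_opRange Ψ h.shift (mem_opRange_shift.2 fun a ha ↦ ?_)
  obtain rfl : a = 0 := Finsupp.ext fun i ↦ ha i i.2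
  rw [Finsupp.sub_apply, Finsupp.single_eq_same, sub_self]

lemma IsEval.eq_zero_of_mem (h : IsEval D η Ψ) (hb : Function.Bijective Ψ) {m : M}
    (hm : η m ∈ opRange D n) : m = 0 := by
  let e := AddEquiv.ofBijective Ψ hb
  have h1 : e.symm.toAddMonoidHom (η m) ∈ opRange (EquivSheaf.shift M) n :=
    map_mem_opRange _ (fun i ω ↦ by
      obtain ⟨f, rfl⟩ := hb.2 ω
      rw [← h.shift]
      exact (e.symm_apply_apply _).trans (congrArg _ (e.symm_apply_apply f).symm)) hm
  have h2 : e.symm.toAddMonoidHom (η m) = Finsupp.single 0 m := by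
    rw [← h.zero]
    exact e.symm_apply_apply _
  rw [h2, mem_opRange_shift] at h1
  simpa using h1 0 fun _ _ ↦ rfl

/-- A module over a polynomial ring with a dual basis consisting of extended elements is extended. -/
lemma IsEval.bijective_of_dualBasis {A B : Type*} [CommRing A] [CommRing B] [Module A M]
    [Module B Γ] {φ : A →+* B} {t : Fin n → B} {Θ : PolyMod n A →+ B}
    (hΘ : IsEval (fun k ↦ AddMonoidHom.mulLeft (t k)) φ.toAddMonoidHom Θ)
    (hΘb : Function.Bijective Θ) (hη : ∀ (c : A) m, η (c • m) = φ c • η m)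
    (hΨ : IsEval (fun k ↦ DistribSMul.toAddMonoidHom Γ (t k)) η Ψ) {κ : Type*} [Fintype κ]
    (e : κ → M) (f : κ → M →+ A) (F : κ → Γ →ₗ[B] B) (hF : ∀ k m, F k (η m) = φ (f k m))
    (he : ∀ γ, γ = ∑ k, F k γ • η (e k)) (hf : ∀ m, (∀ k, f k m = 0) → m = 0) :
    Function.Bijective Ψ := by
  have h1 (k : κ) (g : PolyMod n A) :
      Ψ (EquivSheaf.coeffMap ((smulAddHom A M).flip (e k)) g) = Θ g • η (e k) := by
    have e1 : IsEval (fun k ↦ DistribSMul.toAddMonoidHom Γ (t k))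
        (η.comp ((smulAddHom A M).flip (e k)))
        (Ψ.comp (EquivSheaf.coeffMap ((smulAddHom A M).flip (e k)))) :=
      ⟨fun m ↦ by rw [AddMonoidHom.comp_apply, coeffMap_single, hΨ.zero]; rfl, fun k f ↦ by
        rw [AddMonoidHom.comp_apply, coeffMap_shift, hΨ.shift]; rfl⟩
    have e2 : IsEval (fun k ↦ DistribSMul.toAddMonoidHom Γ (t k))
        (η.comp ((smulAddHom A M).flip (e k)))
        (((smulAddHom B Γ).flip (η (e k))).comp Θ) :=
      ⟨fun c ↦ by
        rw [AddMonoidHom.comp_apply, hΘ.zero]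
        exact (hη c (e k)).symm, fun l f ↦ by
        rw [AddMonoidHom.comp_apply, hΘ.shift]
        exact mul_smul (t l) (Θ f) (η (e k))⟩
    exact DFunLike.congr_fun (e1.unique e2) g
  -- The functionals act coefficientwise, so a polynomial evaluating to zero has coefficients killed
  -- by every `f k`.
  have h2 (k : κ) (g : PolyMod n M) : F k (Ψ g) = Θ (EquivSheaf.coeffMap (f k) g) := by
    have e1 : IsEval (fun k ↦ AddMonoidHom.mulLeft (t k)) (φ.toAddMonoidHom.comp (f k))
        ((F k).toAddMonoidHom.comp Ψ) :=
      ⟨fun m ↦ by rw [AddMonoidHom.comp_apply, hΨ.zero]; exact hF k m, fun l f ↦ by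
        rw [AddMonoidHom.comp_apply, hΨ.shift]
        exact (F k).map_smul (t l) (Ψ f)⟩
    have e2 : IsEval (fun k ↦ AddMonoidHom.mulLeft (t k)) (φ.toAddMonoidHom.comp (f k))
        (Θ.comp (EquivSheaf.coeffMap (f k))) :=
      ⟨fun m ↦ by rw [AddMonoidHom.comp_apply, coeffMap_single, hΘ.zero]; rfl, fun l f ↦ by
        rw [AddMonoidHom.comp_apply, coeffMap_shift, hΘ.shift]; rfl⟩
    exact DFunLike.congr_fun (e1.unique e2) g
  constructor
  · rw [injective_iff_map_eq_zero]
    intro g hg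
    refine Finsupp.ext fun a ↦ hf _ fun k ↦ ?_
    have := h2 k g
    rw [hg, map_zero] at this
    have e := hΘb.1 (this.symm.trans (map_zero Θ).symm)
    exact DFunLike.congr_fun e a
  · intro γ
    choose g hg using fun k ↦ hΘb.2 (F k γ)
    refine ⟨∑ k, EquivSheaf.coeffMap ((smulAddHom A M).flip (e k)) (g k), ?_⟩
    rw [map_sum]
    conv_rhs => rw [he γ]
    refine Finset.sum_congr rfl fun k _ ↦ ?_
    rw [h1, hg]

end Polynomials

end RegularOperators

/-! ### Inverse images of sheaves of modules and of functionals -/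

section InverseImage

variable {X Y : Scheme.{u}} (p : X ⟶ Y) (N : Y.Modules) {M : X.Modules}

/-- The pullback of functions. -/
def pullO {W : Y.Opens} : Γ(Y, W) →+* Γ(X, p ⁻¹ᵁ W) := (p.app W).hom

lemma pullO_res {V W : Y.Opens} (h : V ≤ W) (r : Γ(Y, W)) :
    pullO p (resO h r) = resO (fun _ hx ↦ h hx : p ⁻¹ᵁ V ≤ p ⁻¹ᵁ W) (pullO p r) :=
  ConcreteCategory.congr_hom (p.naturality (homOfLE h).op) r

lemma preimage_mono {V W : Y.Opens} (h : V ≤ W) : p ⁻¹ᵁ V ≤ p ⁻¹ᵁ W := fun _ hx ↦ h hx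

/-- The inverse image of a sheaf of modules. -/
abbrev invIm : X.Modules := (Scheme.Modules.pullback p).obj N

/-- The pullback of sections. -/
def eta {W : Y.Opens} : Γ(N, W) →+ Γ(invIm p N, p ⁻¹ᵁ W) :=
  (((Scheme.Modules.pullbackPushforwardAdjunction p).unit.app N).app W).hom

lemma eta_smul {W : Y.Opens} (r : Γ(Y, W)) (s : Γ(N, W)) :
    eta p N (r • s) = pullO p r • eta p N s :=
  Scheme.Modules.Hom.app_smul ((Scheme.Modules.pullbackPushforwardAdjunction p).unit.app N) r s

lemma eta_res {V W : Y.Opens} (h : V ≤ W) (s : Γ(N, W)) :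
    eta p N (res N h s) = res (invIm p N) (preimage_mono p h) (eta p N s) :=
  app_res ((Scheme.Modules.pullbackPushforwardAdjunction p).unit.app N) h s

variable {p N}

/-- The homomorphism from the inverse image given by a homomorphism to a direct image. -/
def invImDesc (φ : N ⟶ (Scheme.Modules.pushforward p).obj M) : invIm p N ⟶ M :=
  ((Scheme.Modules.pullbackPushforwardAdjunction p).homEquiv _ _).symm φ

lemma invImDesc_eta (φ : N ⟶ (Scheme.Modules.pushforward p).obj M) {W : Y.Opens} (s : Γ(N, W)) :
    ((invImDesc φ).app (p ⁻¹ᵁ W)).hom (eta p N s) = (φ.app W).hom s := by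
  have e := ((Scheme.Modules.pullbackPushforwardAdjunction p).homEquiv N M).apply_symm_apply φ
  rw [Adjunction.homEquiv_unit] at e
  exact congrArg (fun k ↦ (Scheme.Modules.Hom.app k W).hom s) e

lemma invIm_hom_ext {f g : invIm p N ⟶ M}
    (h : ∀ (W : Y.Opens) (s : Γ(N, W)),
      (f.app (p ⁻¹ᵁ W)).hom (eta p N s) = (g.app (p ⁻¹ᵁ W)).hom (eta p N s)) : f = g := by
  apply ((Scheme.Modules.pullbackPushforwardAdjunction p).homEquiv N M).injective
  rw [Adjunction.homEquiv_unit, Adjunction.homEquiv_unit]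
  exact modHom_ext h

/-- Passing to `cut` turns a local homomorphism into a global one, and a global homomorphism out of
an inverse image is determined by its values on pulled back sections. -/
lemma invIm_localHom_ext {U : X.Opens} {φ ψ : localHom (invIm p N) M U}
    (h : ∀ (V : X.Opens) (hV : V ≤ U) (W : Y.Opens) (hW : V ≤ p ⁻¹ᵁ W) (s : Γ(N, W)),
      ev φ hV (res _ hW (eta p N s)) = ev ψ hV (res _ hW (eta p N s))) : φ = ψ := by
  rw [← localOfCut_localToCut φ, ← localOfCut_localToCut ψ]
  congr 1
  refine invIm_hom_ext fun W s ↦ ?_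
  exact h _ _ W _ s

lemma invIm_localHom_ext' {W₀ : Y.Opens} {φ ψ : localHom (invIm p N) M (p ⁻¹ᵁ W₀)}
    (h : ∀ (W : Y.Opens) (hW : W ≤ W₀) (s : Γ(N, W)),
      ev φ (preimage_mono p hW) (eta p N s) = ev ψ (preimage_mono p hW) (eta p N s)) : φ = ψ := by
  refine invIm_localHom_ext fun V hV W hW s ↦ ?_
  have hle : V ≤ p ⁻¹ᵁ (W ⊓ W₀) := fun x hx ↦ ⟨hW hx, hV hx⟩
  have e : res (invIm p N) hW (eta p N s) = res (invIm p N) hle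
      (eta p N (res N inf_le_left s)) := by
    rw [eta_res, res_res]
  rw [e, ev_res φ (preimage_mono p inf_le_right) hle, ev_res ψ (preimage_mono p inf_le_right) hle,
    h _ inf_le_right]

/-- The local homomorphism from the inverse image given by a local semilinear map. -/
def invImLocal {W₀ : Y.Opens} (φ : localHom N ((Scheme.Modules.pushforward p).obj M) W₀) :
    localHom (invIm p N) M (p ⁻¹ᵁ W₀) :=
  localOfCut (invImDesc (mkHom
    (fun W s ↦ secCut (N := M) (U := p ⁻¹ᵁ W₀) (V := p ⁻¹ᵁ W)
      (ev φ (inf_le_right : W ⊓ W₀ ≤ W₀) (res N inf_le_left s)))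
    (fun W s t ↦ by rw [map_add, map_add]; exact map_add _ _ _)
    (fun W r s ↦ by
      rw [res_smul, ev_smul]
      exact congrArg (fun c ↦ c • (show Γ(M, p ⁻¹ᵁ (W ⊓ W₀)) from
        ev φ inf_le_right (res N inf_le_left s))) (pullO_res p (inf_le_left : W ⊓ W₀ ≤ W) r))
    (fun V W h s ↦ by
      rw [res_res]
      have := ev_res φ (inf_le_right : W ⊓ W₀ ≤ W₀) (inf_le_inf_right W₀ h) (res N inf_le_left s)
      rw [res_res] at this
      exact this)))

lemma ev_invImLocal {W₀ : Y.Opens} (φ : localHom N ((Scheme.Modules.pushforward p).obj M) W₀)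
    {W : Y.Opens} (hW : W ≤ W₀) (s : Γ(N, W)) :
    ev (invImLocal φ) (preimage_mono p hW) (eta p N s) = ev φ hW s := by
  refine (ev_localOfCut _ _ _).trans ?_
  rw [invImDesc_eta]
  refine ((ev_res φ (inf_le_right : W ⊓ W₀ ≤ W₀) (le_inf le_rfl hW)
    (res N inf_le_left s)).symm.trans ?_)
  rw [res_res, res_self]

lemma toFun_injective {U : X.Opens} : Function.Injective (toFun (X := X) (U := U)) := fun _ _ h ↦ h

/-- The pullback of functions as a homomorphism of sheaves of modules. -/
def structureUnit (p : X ⟶ Y) :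
    structureSheaf Y ⟶ (Scheme.Modules.pushforward p).obj (structureSheaf X) :=
  mkHom (fun W s ↦ ofFun (X := X) (U := p ⁻¹ᵁ W) (pullO p (toFun s)))
    (fun _ s t ↦ map_add (pullO p) (toFun s) (toFun t))
    (fun _ r s ↦ map_mul (pullO p) r (toFun s)) (fun _ _ h s ↦ pullO_res p h (toFun s))

variable (p) in
/-- The extension of a local functional to the inverse image. -/
def extend {W₀ : Y.Opens} : localHom N (structureSheaf Y) W₀ →+
    localHom (invIm p N) (structureSheaf X) (p ⁻¹ᵁ W₀) :=
  AddMonoidHom.mk' (fun c ↦ invImLocal (localPost N (structureUnit p) c)) fun c c' ↦ by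
    refine invIm_localHom_ext' fun W hW s ↦ ?_
    rw [ev_add, ev_invImLocal _ hW, ev_invImLocal _ hW, ev_invImLocal _ hW, ev_localPost, ev_localPost,
      ev_localPost, ev_add, map_add]
    rfl

lemma ev_extend {W₀ : Y.Opens} (c : localHom N (structureSheaf Y) W₀) {W : Y.Opens} (hW : W ≤ W₀)
    (s : Γ(N, W)) : toFun (ev (extend p c) (preimage_mono p hW) (eta p N s)) =
      pullO p (toFun (ev c hW s)) := ev_invImLocal (localPost N (structureUnit p) c) hW s

lemma extend_smul {W₀ : Y.Opens} (r : Γ(Y, W₀)) (c : localHom N (structureSheaf Y) W₀) :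
    extend p (r • c) = pullO p r • extend p c := by
  refine invIm_localHom_ext' fun W hW s ↦ toFun_injective ?_
  rw [ev_extend _ hW, ev_smul_left]
  refine (map_mul (pullO p) (resO hW r) (toFun (ev c hW s))).trans ?_
  rw [← ev_extend _ hW, pullO_res]
  rfl

lemma extend_res {V W : Y.Opens} (h : V ≤ W) (c : localHom N (structureSheaf Y) W) :
    extend p (localRes _ _ h c) = localRes _ _ (preimage_mono p h) (extend p c) := by
  refine invIm_localHom_ext' fun W' hW s ↦ toFun_injective ?_
  rw [ev_extend _ hW, ev_localRes, ev_localRes]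
  exact (ev_extend c (hW.trans h) s).symm

/-- The identity and the endomorphism built from the extended coordinates agree on pulled back
sections, where the formula is that of the original dual basis. -/
lemma invIm_dualBasis {W₀ : Y.Opens} {κ : Type} [Fintype κ] {e : κ → Γ(N, W₀)}
    {c : κ → localHom N (structureSheaf Y) W₀}
    (H : ∀ (V : Y.Opens) (h : V ≤ W₀) (s : Γ(N, V)),
      s = ∑ k, toFun (ev (c k) h s) • res N h (e k)) (V : X.Opens) (h : V ≤ p ⁻¹ᵁ W₀)
    (s : Γ(invIm p N, V)) :
    s = ∑ k, toFun (ev (extend p (c k)) h s) • res (invIm p N) h (eta p N (e k)) := by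
  let φ : localHom (invIm p N) (invIm p N) (p ⁻¹ᵁ W₀) :=
    mkLocal (fun _ _ s ↦ s) (fun _ _ _ _ ↦ rfl) (fun _ _ _ _ ↦ rfl) (fun _ _ _ _ _ ↦ rfl)
  have e : φ = localOfBasis (fun k ↦ extend p (c k)) fun k ↦ eta p N (e k) := by
    refine invIm_localHom_ext' fun W hW s ↦ ?_
    rw [ev_localOfBasis]
    change eta p N s = _
    conv_lhs => rw [H W hW s]
    rw [map_sum]
    refine Finset.sum_congr rfl fun k _ ↦ ?_
    rw [eta_smul, ev_extend _ hW, eta_res]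
  exact congrArg (fun φ ↦ ev φ h s) e

lemma HasDualBasis.invIm {W₀ : Y.Opens} (H : HasDualBasis N W₀) :
    HasDualBasis (invIm p N) (p ⁻¹ᵁ W₀) := by
  obtain ⟨κ, _, e, c, H⟩ := H
  exact ⟨κ, ‹_›, fun k ↦ eta p N (e k), fun k ↦ extend p (c k), invIm_dualBasis H⟩

end InverseImage

/-! ### The Koszul complex of alternating forms with values in a vector space -/

section AlternatingForms

variable {n : ℕ} {Γ Γ' : Type*} [AddCommGroup Γ] [Module ℂ Γ] [AddCommGroup Γ'] [Module ℂ Γ']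

/-- Alternating forms on `ℂⁿ` with values in a vector space. -/
abbrev Alt (n j : ℕ) (Γ : Type*) [AddCommGroup Γ] [Module ℂ Γ] : Type _ :=
  (Fin n → ℂ) [⋀^Fin j]→ₗ[ℂ] Γ

/-- The linear combinations of operators. -/
abbrev opAt (D : Fin n → Γ →ₗ[ℂ] Γ) : (Fin n → ℂ) →ₗ[ℂ] (Γ →ₗ[ℂ] Γ) := Fintype.linearCombination ℂ D

lemma opAt_apply (D : Fin n → Γ →ₗ[ℂ] Γ) (v : Fin n → ℂ) (x : Γ) :
    opAt D v x = ∑ i, v i • D i x := by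
  rw [Fintype.linearCombination_apply, LinearMap.sum_apply]
  rfl

lemma opAt_single (D : Fin n → Γ →ₗ[ℂ] Γ) (k : Fin n) : opAt D (Pi.single k 1) = D k := by
  rw [Fintype.linearCombination_apply_single, one_smul]

/-- The differential of the Koszul complex of a family of operators. -/
def koszul (D : Fin n → Γ →ₗ[ℂ] Γ) {j : ℕ} (ω : Alt n j Γ) : Alt n (j + 1) Γ :=
  AlternatingMap.alternatizeUncurryFin
    { toFun := fun v ↦ (opAt D v).compAlternatingMap ω
      map_add' := fun v v' ↦ by ext; simp
      map_smul' := fun c v ↦ by ext; simp }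

lemma koszul_apply (D : Fin n → Γ →ₗ[ℂ] Γ) {j : ℕ} (ω : Alt n j Γ) (v : Fin (j + 1) → Fin n → ℂ) :
    koszul D ω v = ∑ i : Fin (j + 1), (-1) ^ (i : ℕ) • opAt D (v i) (ω (i.removeNth v)) :=
  AlternatingMap.alternatizeUncurryFin_apply _ _

/-- The square alternates the bilinear map `(v, w) ↦ D_v D_w`, which is symmetric because the
operators commute. -/
lemma koszul_koszul (D : Fin n → Γ →ₗ[ℂ] Γ) (hD : ∀ k l x, D k (D l x) = D l (D k x)) {j : ℕ}
    (ω : Alt n j Γ) : koszul D (koszul D ω) = 0 := by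
  have hD' (v w x) : opAt D v (opAt D w x) = opAt D w (opAt D v x) := by
    simp_rw [opAt_apply, map_sum, map_smul, Finset.smul_sum]
    rw [Finset.sum_comm]
    simp_rw [hD, smul_comm (v _)]
  let f : (Fin n → ℂ) →ₗ[ℂ] (Fin n → ℂ) →ₗ[ℂ] Alt n j Γ := LinearMap.mk₂ ℂ
    (fun v w ↦ (opAt D v).compAlternatingMap ((opAt D w).compAlternatingMap ω))
    (fun v v' w ↦ by ext; simp) (fun c v w ↦ by ext; simp) (fun v w w' ↦ by ext; simp)
    (fun c v w ↦ by ext; simp)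
  rw [← AlternatingMap.alternatizeUncurryFin_alternatizeUncurryFinLM_comp_of_symmetric (f := f)
    fun v w ↦ AlternatingMap.ext fun _ ↦ hD' v w _]
  rw [koszul]
  congr 1
  refine LinearMap.ext fun v ↦ AlternatingMap.ext fun z ↦ ?_
  rw [LinearMap.comp_apply, AlternatingMap.alternatizeUncurryFinLM_apply,
    AlternatingMap.alternatizeUncurryFin_apply]
  change opAt D v (koszul D ω z) = _
  rw [koszul_apply, map_sum]
  refine Finset.sum_congr rfl fun i _ ↦ ?_
  rw [map_zsmul]
  rfl

/-- This is Cartan's homotopy formula. Inserting `b` in the first place, the term that removes it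
gives the operator `D_b`, and the remaining terms cancel by the shift in sign. -/
lemma koszul_cons (D : Fin n → Γ →ₗ[ℂ] Γ) {j : ℕ} (ω : Alt n (j + 1) Γ) (b : Fin n → ℂ) :
    (koszul D ω).curryLeft b + koszul D (ω.curryLeft b) = (opAt D b).compAlternatingMap ω := by
  ext v
  rw [AlternatingMap.add_apply, AlternatingMap.curryLeft_apply_apply, koszul_apply, koszul_apply,
    Fin.sum_univ_succ, add_assoc, ← Finset.sum_add_distrib]
  simp only [Fin.val_zero, pow_zero, one_smul, LinearMap.compAlternatingMap_apply,
    Matrix.cons_val_zero]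
  rw [add_eq_left.2]
  · rfl
  · refine Finset.sum_eq_zero fun i _ ↦ ?_
    rw [AlternatingMap.curryLeft_apply_apply, Fin.val_succ, pow_succ, mul_neg_one, neg_smul,
      Matrix.cons_val_succ, neg_add_eq_zero]
    congr 3
    refine funext fun l ↦ ?_
    refine Fin.cases ?_ (fun l ↦ ?_) l
    · simp [Fin.removeNth]
    · simp [Fin.removeNth]

lemma koszul_cons_zero (D : Fin n → Γ →ₗ[ℂ] Γ) (ω : Alt n 0 Γ) (b : Fin n → ℂ) :
    (koszul D ω).curryLeft b = (opAt D b).compAlternatingMap ω := by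
  ext v
  rw [AlternatingMap.curryLeft_apply_apply, koszul_apply, Fin.sum_univ_succ]
  simp only [Fin.val_zero, pow_zero, one_smul, LinearMap.compAlternatingMap_apply,
    Matrix.cons_val_zero, Finset.univ_eq_empty, Finset.sum_empty, add_zero]
  congr 2

/-- The wedge product with a coordinate. -/
def wedgeCoord (k : Fin n) {j : ℕ} (ω : Alt n j Γ) : Alt n (j + 1) Γ :=
  AlternatingMap.alternatizeUncurryFin (LinearMap.smulRight (LinearMap.proj k) ω)

lemma wedgeCoord_apply (k : Fin n) {j : ℕ} (ω : Alt n j Γ) (v : Fin (j + 1) → Fin n → ℂ) :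
    wedgeCoord k ω v = ∑ i : Fin (j + 1), (-1) ^ (i : ℕ) • v i k • ω (i.removeNth v) :=
  AlternatingMap.alternatizeUncurryFin_apply _ _

lemma koszul_eq_sum (D : Fin n → Γ →ₗ[ℂ] Γ) {j : ℕ} (ω : Alt n j Γ) :
    koszul D ω = ∑ k, (D k).compAlternatingMap (wedgeCoord k ω) := by
  ext v
  let ev : Alt n (j + 1) Γ →+ Γ := ⟨⟨(· v), rfl⟩, fun _ _ ↦ rfl⟩
  rw [koszul_apply]
  refine Eq.trans ?_ (map_sum ev _ _).symm
  change _ = ∑ k, (D k).compAlternatingMap (wedgeCoord k ω) v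
  simp_rw [LinearMap.compAlternatingMap_apply, wedgeCoord_apply, map_sum, map_zsmul, map_smul,
    opAt_apply, Finset.smul_sum]
  exact Finset.sum_comm

/-- The operation on alternating forms given by linear maps on the values and the arguments. -/
def altMap (f : Γ →ₗ[ℂ] Γ') (B : (Fin n → ℂ) →ₗ[ℂ] (Fin n → ℂ)) {j : ℕ} (ω : Alt n j Γ) :
    Alt n j Γ' := (f.compAlternatingMap ω).compLinearMap B

lemma altMap_apply (f : Γ →ₗ[ℂ] Γ') (B : (Fin n → ℂ) →ₗ[ℂ] (Fin n → ℂ)) {j : ℕ} (ω : Alt n j Γ)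
    (v : Fin j → Fin n → ℂ) : altMap f B ω v = f (ω fun l ↦ B (v l)) := rfl

lemma altMap_koszul {D : Fin n → Γ →ₗ[ℂ] Γ} {D' : Fin n → Γ' →ₗ[ℂ] Γ'} (f : Γ →ₗ[ℂ] Γ')
    (B : (Fin n → ℂ) →ₗ[ℂ] (Fin n → ℂ)) (h : ∀ v x, f (opAt D (B v) x) = opAt D' v (f x)) {j : ℕ}
    (ω : Alt n j Γ) : altMap f B (koszul D ω) = koszul D' (altMap f B ω) := by
  ext v
  rw [altMap_apply, koszul_apply, koszul_apply, map_sum]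
  refine Finset.sum_congr rfl fun i _ ↦ ?_
  rw [map_zsmul, h]
  rfl

variable (n) in
/-- The evaluation of alternating forms of top degree at the standard basis. -/
def altEval (Γ : Type*) [AddCommGroup Γ] [Module ℂ Γ] : Alt n n Γ →+ Γ :=
  AddMonoidHom.mk' (fun ω ↦ ω fun i ↦ Pi.single i 1) fun _ _ ↦ rfl

lemma altEval_injective : Function.Injective (altEval n Γ) := by
  rw [injective_iff_map_eq_zero]
  intro ω hω
  refine Module.Basis.ext_alternating (Pi.basisFun ℂ (Fin n)) fun I hI ↦ ?_
  let σ := Equiv.ofBijective I (Finite.injective_iff_bijective.1 hI)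
  have e : (fun i ↦ Pi.basisFun ℂ (Fin n) (I i)) =
      fun i ↦ (fun i ↦ Pi.single i (1 : ℂ) : Fin n → Fin n → ℂ) (σ i) := by
    ext i : 1
    exact Pi.basisFun_apply _ _ _
  rw [e]
  refine (ω.map_perm (fun i ↦ Pi.single i (1 : ℂ)) σ).trans ?_
  exact (congrArg _ hω).trans (smul_zero _)

/-- The form of top degree with a given value at the standard basis. -/
def altTop (x : Γ) : Alt n n Γ :=
  (LinearMap.toSpanSingleton ℂ Γ x).compAlternatingMap Matrix.detRowAlternating

lemma altTop_apply (x : Γ) (v : Fin n → Fin n → ℂ) : altTop x v = Matrix.det v • x := rfl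

lemma det_single : Matrix.det (fun i ↦ Pi.single i (1 : ℂ) : Matrix (Fin n) (Fin n) ℂ) = 1 := by
  refine Eq.trans ?_ (Matrix.det_one (n := Fin n) (R := ℂ))
  congr 1
  ext i j
  rw [Matrix.one_apply, Pi.single_apply]
  simp only [eq_comm]

lemma altEval_altTop (x : Γ) : altEval n Γ (altTop x) = x :=
  (altTop_apply x fun i ↦ Pi.single i 1).trans (by rw [det_single, one_smul])

lemma altTop_altEval (ω : Alt n n Γ) : altTop (altEval n Γ ω) = ω :=
  altEval_injective (altEval_altTop _)

/-- Top forms transform by the determinant. This is where the hypothesis that `G` lies in the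
special linear group enters: it makes the augmentation of the Koszul complex equivariant without a
twist. -/
lemma altEval_altMap (f : Γ →ₗ[ℂ] Γ') (B : Matrix (Fin n) (Fin n) ℂ) (hB : B.det = 1)
    (ω : Alt n n Γ) : altEval n Γ' (altMap f B.mulVecLin ω) = f (altEval n Γ ω) := by
  change f (ω fun i ↦ B.mulVecLin (Pi.single i 1)) = f (ω fun i ↦ Pi.single i 1)
  have h : ω (fun i ↦ B.mulVecLin (Pi.single i 1)) =
      Matrix.det (fun i ↦ B.mulVecLin (Pi.single i 1)) • altEval n Γ ω :=
    (congrArg (fun ω : Alt n n Γ ↦ ω fun i ↦ B.mulVecLin (Pi.single i 1)) (altTop_altEval ω)).symm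
  have e : Matrix.det (fun i ↦ B.mulVecLin (Pi.single i 1)) = 1 := by
    refine Eq.trans ?_ ((Matrix.det_transpose B).trans hB)
    congr 1
    ext i j
    simp
  rw [h, e, one_smul]
  rfl

/-- The alternating form `ρ_I` dual to a family of basis vectors. -/
def altDual {j : ℕ} (I : Fin j → Fin n) : Alt n j ℂ :=
  (j.factorial : ℂ)⁻¹ • MultilinearMap.alternatization
    ((MultilinearMap.mkPiAlgebra ℂ (Fin j) ℂ).compLinearMap fun l ↦ LinearMap.proj (I l))

lemma altDual_apply {j : ℕ} (I : Fin j → Fin n) (v : Fin j → Fin n → ℂ) :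
    altDual I v = (j.factorial : ℂ)⁻¹ * ∑ σ : Equiv.Perm (Fin j),
      Equiv.Perm.sign σ • ∏ l, v (σ l) (I l) := by
  rw [altDual, AlternatingMap.smul_apply, MultilinearMap.alternatization_apply, smul_eq_mul]
  rfl

/-- The sum runs over all index tuples, not only the increasing ones. Each permutation contributes
`ω v`, and the normalizing factor in `altDual` removes the factorial. The formula presents forms as
a retract of a finite sum of copies of the values. -/
lemma sum_altDual {j : ℕ} (ω : Alt n j Γ) (v : Fin j → Fin n → ℂ) :
    ∑ I : Fin j → Fin n, altDual I v • ω (fun l ↦ Pi.single (I l) 1) = ω v := by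
  have h1 (w : Fin j → Fin n → ℂ) :
      ω w = ∑ I : Fin j → Fin n, (∏ l, w l (I l)) • ω (fun l ↦ Pi.single (I l) 1) := by
    have e : w = fun l ↦ ∑ i, w l i • Pi.single i (1 : ℂ) := by
      ext l i
      simp [Finset.sum_apply, Pi.single_apply]
    conv_lhs => rw [e]
    have := ω.toMultilinearMap.map_sum fun l i ↦ w l i • Pi.single i (1 : ℂ)
    refine this.trans (Finset.sum_congr rfl fun I _ ↦ ?_)
    exact ω.toMultilinearMap.map_smul_univ (fun l ↦ w l (I l)) _
  have h2 (σ : Equiv.Perm (Fin j)) : ∑ I : Fin j → Fin n, (Equiv.Perm.sign σ • ∏ l, v (σ l) (I l)) •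
      ω (fun l ↦ Pi.single (I l) 1) = ω v := by
    simp_rw [smul_assoc]
    rw [← Finset.smul_sum, ← h1 fun l ↦ v (σ l)]
    have := ω.map_perm v σ
    refine (congrArg (Equiv.Perm.sign σ • ·) this).trans ?_
    rw [smul_smul, Int.units_mul_self, one_smul]
  simp_rw [altDual_apply, mul_smul, Finset.sum_smul]
  rw [← Finset.smul_sum, Finset.sum_comm]
  simp_rw [h2]
  rw [Finset.sum_const, Finset.card_univ, Fintype.card_perm, Fintype.card_fin, ← Nat.cast_smul_eq_nsmul ℂ,
    smul_smul, inv_mul_cancel₀ (Nat.cast_ne_zero.2 (Nat.factorial_ne_zero j)), one_smul]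

/-- The inclusion of the values into the alternating forms. -/
def altIncl {j : ℕ} (I : Fin j → Fin n) (x : Γ) : Alt n j Γ :=
  (LinearMap.toSpanSingleton ℂ Γ x).compAlternatingMap (altDual I)

lemma subsingleton_alt {j : ℕ} (h : n < j) : Subsingleton (Alt n j Γ) where
  allEq ω ω' := by
    have (ω : Alt n j Γ) : ω = 0 := Module.Basis.ext_alternating (Pi.basisFun ℂ (Fin n)) fun I hI ↦ by
      have := Fintype.card_le_of_injective I hI
      simp only [Fintype.card_fin] at this
      omega
    rw [this ω, this ω']

end AlternatingForms

/-! ### Sheaves of alternating forms and their Koszul differential -/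

section AlternatingSheaves

variable {X : Scheme.{0}} (q : X ⟶ Spec (.of ℂ)) {n : ℕ} {P P' : X.Modules}

/-- Sections of a sheaf of modules as a complex vector space. -/
def CSec (_ : X ⟶ Spec (.of ℂ)) (P : X.Modules) (U : X.Opens) : Type := Γ(P, U)

instance (U : X.Opens) : AddCommGroup (CSec q P U) := inferInstanceAs (AddCommGroup Γ(P, U))
instance (U : X.Opens) : Module Γ(X, U) (CSec q P U) := inferInstanceAs (Module Γ(X, U) Γ(P, U))
instance (U : X.Opens) : Module ℂ (CSec q P U) := Module.compHom _ (scalars q U)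
instance (U : X.Opens) : SMulCommClass ℂ Γ(X, U) (CSec q P U) :=
  ⟨fun c r s ↦ smul_comm (scalars q U c) r s⟩

instance (U : X.Opens) : SMulCommClass Γ(X, U) ℂ (CSec q P U) := SMulCommClass.symm _ _ _

lemma resO_scalars {V U : X.Opens} (h : V ≤ U) (c : ℂ) :
    resO h (scalars q U c) = scalars q V c := resO_resO _ _ _

/-- Restriction of sections. -/
def cres {V U : X.Opens} (h : V ≤ U) : CSec q P U →ₗ[ℂ] CSec q P V where
  toFun := res P h
  map_add' := map_add _
  map_smul' c s := (res_smul P h (scalars q U c) s).trans (by rw [resO_scalars]; rfl)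

/-- The action of a homomorphism on sections. -/
def cmap (f : P ⟶ P') (U : X.Opens) : CSec q P U →ₗ[ℂ] CSec q P' U where
  toFun := (f.app U).hom
  map_add' := map_add _
  map_smul' c s := f.app_smul (scalars q U c) s

lemma cmap_res (f : P ⟶ P') {V U : X.Opens} (h : V ≤ U) (s : CSec q P U) :
    cmap q f V (cres q h s) = cres q h (cmap q f U s) := app_res f h s

variable (P n) in
/-- The sheaf of alternating forms on `ℂⁿ` with values in a sheaf of modules. -/
def altSheaf (j : ℕ) : X.Modules :=
  ofSections (fun U ↦ Alt n j (CSec q P U))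
    (fun h ↦ AddMonoidHom.mk' (fun ω ↦ (cres q h).compAlternatingMap ω) fun ω ω' ↦ by ext; simp)
    (fun U ω ↦ AlternatingMap.ext fun v ↦ res_self P le_rfl (ω v))
    (fun h h' ω ↦ AlternatingMap.ext fun v ↦ res_res P h h' (ω v))
    (fun h c ω ↦ AlternatingMap.ext fun v ↦ res_smul P h c (ω v))
    (fun U ω ω' H ↦ AlternatingMap.ext fun v ↦ res_locally_eq P (le_iSup U) le_rfl
      fun i ↦ congrArg (fun ω ↦ ω v) (H i))
    (fun U ω H ↦ by
      have key (v) : ∃ t : CSec q P (iSup U), ∀ i, cres q (le_iSup U i) t = ω i v :=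
        res_glue P (le_iSup U) le_rfl (fun i ↦ ω i v) fun i j ↦ congrArg (fun ω ↦ ω v) (H i j)
      choose t ht using key
      have hu {s s' : CSec q P (iSup U)}
          (h : ∀ i, cres q (le_iSup U i) s = cres q (le_iSup U i) s') : s = s' :=
        res_locally_eq P (le_iSup U) le_rfl h
      refine ⟨{ toFun := t
                map_update_add' := fun v l x y ↦ hu fun i ↦ ?_
                map_update_smul' := fun v l c x ↦ hu fun i ↦ ?_
                map_eq_zero_of_eq' := fun v k l h h' ↦ hu fun i ↦ ?_ },
        fun i ↦ AlternatingMap.ext fun v ↦ ht v i⟩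
      · rw [map_add, ht, ht, ht, AlternatingMap.map_update_add]
      · rw [map_smul, ht, ht, AlternatingMap.map_update_smul]
      · rw [ht, map_zero, AlternatingMap.map_eq_zero_of_eq _ _ h h'])

variable {q} {j : ℕ}

/-- Sections of the sheaf of alternating forms. -/
def altSec {U : X.Opens} : Γ(altSheaf q n P j, U) →+ Alt n j (CSec q P U) := AddMonoidHom.id _

/-- Sections of the sheaf of alternating forms. -/
def secAlt {U : X.Opens} : Alt n j (CSec q P U) →+ Γ(altSheaf q n P j, U) := AddMonoidHom.id _

lemma altSec_injective {U : X.Opens} :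
    Function.Injective (altSec (q := q) (n := n) (P := P) (j := j) (U := U)) := fun _ _ h ↦ h

/-- A homomorphism from the sheaf of alternating forms. -/
def altHom {j' : ℕ} (T : ∀ U : X.Opens, Alt n j (CSec q P U) → Alt n j' (CSec q P' U))
    (T_add : ∀ U ω ω' v, T U (ω + ω') v = T U ω v + T U ω' v)
    (T_smul : ∀ U (r : Γ(X, U)) ω v, T U (r • ω) v = r • T U ω v)
    (T_res : ∀ V U (h : V ≤ U) ω v,
      T V ((cres q h).compAlternatingMap ω) v = cres q h (T U ω v)) :
    altSheaf q n P j ⟶ altSheaf q n P' j' :=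
  mkHom (fun U ω ↦ secAlt (T U (altSec ω)))
    (fun U ω ω' ↦ AlternatingMap.ext fun v ↦ T_add U ω ω' v)
    (fun U r ω ↦ AlternatingMap.ext fun v ↦ T_smul U r ω v)
    (fun V U h ω ↦ AlternatingMap.ext fun v ↦ T_res V U h ω v)

lemma altHom_ext {M : X.Modules} {f g : M ⟶ altSheaf q n P j}
    (h : ∀ U s v, altSec ((f.app U).hom s) v = altSec ((g.app U).hom s) v) : f = g :=
  modHom_ext fun U s ↦ AlternatingMap.ext (h U s)

/-- Operators on the coefficients. -/
def altPost (f : P ⟶ P') (j : ℕ) : altSheaf q n P j ⟶ altSheaf q n P' j :=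
  altHom (fun U ω ↦ (cmap q f U).compAlternatingMap ω)
    (fun U ω ω' v ↦ map_add (cmap q f U) (ω v) (ω' v))
    (fun U r ω v ↦ f.app_smul r (ω v)) (fun V U h ω v ↦ cmap_res q f h (ω v))

variable (q) in
/-- The operators on sections given by a family of endomorphisms. -/
abbrev cops (D : Fin n → (P ⟶ P)) (U : X.Opens) : Fin n → CSec q P U →ₗ[ℂ] CSec q P U :=
  fun k ↦ cmap q (D k) U

lemma opAt_smul (D : Fin n → (P ⟶ P)) {U : X.Opens} (v : Fin n → ℂ) (r : Γ(X, U))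
    (s : CSec q P U) : opAt (cops q D U) v (r • s) = r • opAt (cops q D U) v s := by
  simp_rw [opAt_apply, Finset.smul_sum]
  refine Finset.sum_congr rfl fun k _ ↦ ?_
  rw [smul_comm r]
  exact congrArg (v k • ·) ((D k).app_smul r s)

lemma opAt_res (D : Fin n → (P ⟶ P)) {V U : X.Opens} (h : V ≤ U) (v : Fin n → ℂ)
    (s : CSec q P U) :
    opAt (cops q D V) v (cres q h s) = cres q h (opAt (cops q D U) v s) := by
  simp_rw [opAt_apply, map_sum, map_smul, cmap_res]

/-- The Koszul differential on sheaves of alternating forms. -/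
def kosz (D : Fin n → (P ⟶ P)) (j : ℕ) : altSheaf q n P j ⟶ altSheaf q n P (j + 1) :=
  altHom (fun U ω ↦ koszul (cops q D U) ω)
    (fun U ω ω' v ↦ by
      simp_rw [koszul_apply, AlternatingMap.add_apply, map_add, smul_add, Finset.sum_add_distrib])
    (fun U r ω v ↦ by
      simp_rw [koszul_apply, AlternatingMap.smul_apply, opAt_smul, Finset.smul_sum]
      exact Finset.sum_congr rfl fun i _ ↦ smul_comm _ _ _)
    (fun V U h ω v ↦ by
      simp_rw [koszul_apply, LinearMap.compAlternatingMap_apply, opAt_res, map_sum, map_zsmul])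

lemma kosz_kosz (D : Fin n → (P ⟶ P)) (hD : ∀ k l, D k ≫ D l = D l ≫ D k) (j : ℕ) :
    kosz (q := q) D j ≫ kosz D (j + 1) = 0 :=
  altHom_ext fun U ω v ↦ congrArg (fun ω ↦ ω v) (koszul_koszul (cops q D U)
    (fun k l x ↦ congrArg (fun f ↦ (Scheme.Modules.Hom.app f U).hom x) (hD l k)) (altSec ω))

/-- The interior product with a basis vector. -/
def interior (P : X.Modules) (k : Fin n) (j : ℕ) : altSheaf q n P (j + 1) ⟶ altSheaf q n P j :=
  altHom (fun U ω ↦ ω.curryLeft (Pi.single k 1)) (fun _ _ _ _ ↦ rfl) (fun _ _ _ _ ↦ rfl)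
    (fun _ _ _ _ _ ↦ rfl)

/-- The wedge product with a coordinate. -/
def wedge (P : X.Modules) (k : Fin n) (j : ℕ) : altSheaf q n P j ⟶ altSheaf q n P (j + 1) :=
  altHom (fun U ω ↦ wedgeCoord k ω)
    (fun U ω ω' v ↦ by
      simp_rw [wedgeCoord_apply, AlternatingMap.add_apply, smul_add, Finset.sum_add_distrib])
    (fun U r ω v ↦ by
      simp_rw [wedgeCoord_apply, AlternatingMap.smul_apply, Finset.smul_sum]
      exact Finset.sum_congr rfl fun i _ ↦ by rw [smul_comm r, smul_comm r])
    (fun V U h ω v ↦ by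
      simp_rw [wedgeCoord_apply, LinearMap.compAlternatingMap_apply, map_sum, map_zsmul, map_smul])

lemma kosz_interior (D : Fin n → (P ⟶ P)) (k : Fin n) (j : ℕ) :
    kosz (q := q) D (j + 1) ≫ interior P k (j + 1) + interior P k j ≫ kosz D j =
      altPost (D k) (j + 1) :=
  altHom_ext fun U ω v ↦ by
    have := congrArg (fun ω ↦ ω v) (koszul_cons (cops q D U) (altSec ω) (Pi.single k 1))
    simp only [opAt_single] at this
    exact this

lemma kosz_interior_zero (D : Fin n → (P ⟶ P)) (k : Fin n) :
    kosz (q := q) D 0 ≫ interior P k 0 = altPost (D k) 0 :=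
  altHom_ext fun U ω v ↦ by
    have := congrArg (fun ω ↦ ω v) (koszul_cons_zero (cops q D U) (altSec ω) (Pi.single k 1))
    simp only [opAt_single] at this
    exact this

lemma kosz_eq_sum (D : Fin n → (P ⟶ P)) (j : ℕ) :
    kosz (q := q) D j = ∑ k, wedge P k j ≫ altPost (D k) (j + 1) := by
  refine modHom_ext fun U ω ↦ ?_
  let e : (altSheaf q n P j ⟶ altSheaf q n P (j + 1)) →+ Alt n (j + 1) (CSec q P U) :=
    ⟨⟨fun f ↦ altSec ((f.app U).hom ω), rfl⟩, fun _ _ ↦ rfl⟩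
  exact (koszul_eq_sum (cops q D U) (altSec ω)).trans
    (map_sum e (fun k ↦ wedge P k j ≫ altPost (D k) (j + 1)) Finset.univ).symm

lemma altPost_kosz (D : Fin n → (P ⟶ P)) (hD : ∀ k l, D k ≫ D l = D l ≫ D k) (k : Fin n) (j : ℕ) :
    altPost (q := q) (D k) j ≫ kosz D j = kosz D j ≫ altPost (D k) (j + 1) :=
  altHom_ext fun U ω v ↦ congrArg (fun ω ↦ ω v)
    (altMap_koszul (D := cops q D U) (D' := cops q D U) (cmap q (D k) U) LinearMap.id (fun v x ↦ by
      simp_rw [opAt_apply, map_sum, map_smul]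
      refine Finset.sum_congr rfl fun l _ ↦ congrArg (v l • ·) ?_
      exact congrArg (fun f ↦ (Scheme.Modules.Hom.app f U).hom x) (hD l k)) (altSec ω)).symm

lemma altPost_interior (f : P ⟶ P') (k : Fin n) (j : ℕ) :
    altPost (q := q) f (j + 1) ≫ interior P' k j = interior P k j ≫ altPost f j := rfl

/-- Evaluation at standard basis vectors. -/
def altProj (P : X.Modules) {j : ℕ} (I : Fin j → Fin n) : altSheaf q n P j ⟶ P :=
  mkHom (fun U ω ↦ altSec ω fun l ↦ Pi.single (I l) 1) (fun _ _ _ ↦ rfl) (fun _ _ _ ↦ rfl)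
    (fun _ _ _ _ ↦ rfl)

/-- A section as an element of a complex vector space. -/
def csec (q : X ⟶ Spec (.of ℂ)) {P : X.Modules} {U : X.Opens} : Γ(P, U) →+ CSec q P U :=
  AddMonoidHom.id _

/-- The inclusion of the values into the forms. -/
def altInj (P : X.Modules) {j : ℕ} (I : Fin j → Fin n) : P ⟶ altSheaf q n P j :=
  mkHom (fun U s ↦ secAlt (altIncl I (csec q s)))
    (fun _ s t ↦ AlternatingMap.ext fun v ↦ smul_add (altDual I v) (csec q s) (csec q t))
    (fun U r s ↦ AlternatingMap.ext fun v ↦ smul_comm (altDual I v) r (csec q s))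
    (fun _ _ h s ↦ AlternatingMap.ext fun v ↦ ((cres q h).map_smul (altDual I v) (csec q s)).symm)

lemma altPost_altProj (f : P ⟶ P') {j : ℕ} (I : Fin j → Fin n) :
    altPost (q := q) f j ≫ altProj P' I = altProj P I ≫ f := rfl

lemma altInj_altPost (f : P ⟶ P') {j : ℕ} (I : Fin j → Fin n) :
    altInj (q := q) P I ≫ altPost f j = f ≫ altInj P' I :=
  altHom_ext fun U s v ↦ (cmap q f U).map_smul (altDual I v) (csec q s)

/-- Together with the compatibility of both maps with operators on the values, this transfers dual
bases and regularity from `P` to sheaves of forms. -/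
lemma sum_altProj_altInj (P : X.Modules) (j : ℕ) :
    ∑ I : Fin j → Fin n, altProj P I ≫ altInj P I = 𝟙 (altSheaf q n P j) := by
  refine modHom_ext fun U ω ↦ ?_
  let e : (altSheaf q n P j ⟶ altSheaf q n P j) →+ Alt n j (CSec q P U) :=
    ⟨⟨fun f ↦ altSec ((f.app U).hom ω), rfl⟩, fun _ _ ↦ rfl⟩
  refine (map_sum e _ _).trans (AlternatingMap.ext fun v ↦ ?_)
  let e' : Alt n j (CSec q P U) →+ CSec q P U := ⟨⟨(· v), rfl⟩, fun _ _ ↦ rfl⟩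
  exact (map_sum e' _ _).trans (sum_altDual (altSec ω) v)

lemma subsingleton_altSheaf (h : n < j) (U : X.Opens) : Subsingleton Γ(altSheaf q n P j, U) :=
  subsingleton_alt (Γ := CSec q P U) h

end AlternatingSheaves

/-! ### Dual bases and regularity for retracts and duals -/

section Retracts

variable {X : Scheme.{u}} {M E E' : X.Modules}

/-- The action of a homomorphism on sections. -/
def secMap (f : M ⟶ E) (U : X.Opens) : Γ(M, U) →+ Γ(E, U) := (f.app U).hom

lemma secMap_comp (f : M ⟶ E) (g : E ⟶ E') (U : X.Opens) (s : Γ(M, U)) :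
    secMap (f ≫ g) U s = secMap g U (secMap f U s) := rfl

lemma secMap_add (f g : M ⟶ E) (U : X.Opens) : secMap (f + g) U = secMap f U + secMap g U := rfl

lemma secMap_sum {ι : Type*} [Fintype ι] (f : ι → (M ⟶ E)) (U : X.Opens) (s : Γ(M, U)) :
    secMap (∑ i, f i) U s = ∑ i, secMap (f i) U s :=
  map_sum (⟨⟨fun f ↦ secMap f U s, rfl⟩, fun _ _ ↦ rfl⟩ : (M ⟶ E) →+ Γ(E, U)) f Finset.univ

lemma secMap_smul (f : M ⟶ E) {U : X.Opens} (r : Γ(X, U)) (s : Γ(M, U)) :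
    secMap f U (r • s) = r • secMap f U s := f.app_smul r s

lemma secMap_res (f : M ⟶ E) {V U : X.Opens} (h : V ≤ U) (s : Γ(M, U)) :
    secMap f V (res M h s) = res E h (secMap f U s) := app_res f h s

lemma HasDualBasis.of_retract {ι : Type} [Fintype ι] (s : ι → (M ⟶ E)) (r : ι → (E ⟶ M))
    (h : ∑ i, s i ≫ r i = 𝟙 M) {U : X.Opens} (hE : HasDualBasis E U) : HasDualBasis M U := by
  obtain ⟨κ, _, e, c, H⟩ := hE
  refine ⟨ι × κ, inferInstance, fun k ↦ secMap (r k.1) U (e k.2), fun k ↦ localPre (s k.1) _ (c k.2),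
    fun V hV t ↦ ?_⟩
  have e1 := secMap_sum (fun i ↦ s i ≫ r i) V t
  rw [h] at e1
  refine e1.trans ?_
  rw [Fintype.sum_prod_type]
  refine Finset.sum_congr rfl fun i _ ↦ ?_
  rw [secMap_comp, H V hV (secMap (s i) V t), map_sum]
  refine Finset.sum_congr rfl fun k _ ↦ ?_
  rw [secMap_smul, secMap_res]
  rfl

/-- The roles are exchanged: the coordinates form the basis of the dual, and evaluation at the old
basis gives the new coordinates. -/
lemma HasDualBasis.hom {U : X.Opens} (hE : HasDualBasis E U) :
    HasDualBasis (sheafHom E (structureSheaf X)) U := by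
  obtain ⟨κ, _, e, c, H⟩ := hE
  let evAt (k : κ) : localHom (sheafHom E (structureSheaf X)) (structureSheaf X) U :=
    mkLocal (fun V h φ ↦ ev (toLocal φ) le_rfl (EquivSheaf.res E h (e k))) (fun _ _ _ _ ↦ rfl)
      (fun V h r φ ↦ by rw [toLocal_smul, ev_smul_left, resO_self])
      (fun V W h h' φ ↦ by
        rw [toLocal_res, ev_localRes, ← res_res E h' h, ev_res (toLocal φ) le_rfl h'])
  refine ⟨κ, ‹_›, fun k ↦ ofLocal (c k), evAt, fun V h φ ↦ toLocal_injective ?_⟩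
  refine localHom_ext fun V' h' s ↦ ?_
  let e' : Γ(sheafHom E (structureSheaf X), V) →+ Γ(structureSheaf X, V') :=
    ⟨⟨fun φ ↦ ev (toLocal φ) h' s, rfl⟩, fun _ _ ↦ rfl⟩
  refine Eq.trans ?_ (map_sum e' (fun k ↦ toFun (ev (evAt k) h φ) • EquivSheaf.res _ h (ofLocal (c k)))
    Finset.univ).symm
  conv_lhs => rw [H V' (h'.trans h) s]
  rw [map_sum]
  refine Finset.sum_congr rfl fun k _ ↦ ?_
  rw [ev_smul]
  change toFun (ev (c k) _ s) • ev (toLocal φ) h' _ =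
    resO h' (toFun (ev (toLocal φ) le_rfl (EquivSheaf.res E h (e k)))) • ev (c k) _ s
  rw [← res_res E h' h, ev_res (toLocal φ) le_rfl h']
  exact mul_comm (toFun (ev (c k) (h'.trans h) s)) _

lemma precomp_comp (f : M ⟶ E) (g : E ⟶ E') (N : X.Modules) :
    precomp (f ≫ g) N = precomp g N ≫ precomp f N := rfl

lemma precomp_id (N : X.Modules) : precomp (𝟙 M) N = 𝟙 _ := rfl

lemma precomp_add (f g : M ⟶ E) (N : X.Modules) :
    precomp (f + g) N = precomp f N + precomp g N :=
  modHom_ext fun U φ ↦ toLocal_injective <| localHom_ext fun V h s ↦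
    map_add (ev (toLocal φ) h) (secMap f V s) (secMap g V s)

lemma precomp_zero (N : X.Modules) : precomp (0 : M ⟶ E) N = 0 :=
  modHom_ext fun U φ ↦ toLocal_injective <| localHom_ext fun V h s ↦ map_zero (ev (toLocal φ) h)

lemma precomp_sum {ι : Type*} [Fintype ι] (f : ι → (M ⟶ E)) (N : X.Modules) :
    precomp (∑ i, f i) N = ∑ i, precomp (f i) N :=
  map_sum (⟨⟨fun f ↦ precomp f N, precomp_zero N⟩, fun f g ↦ precomp_add f g N⟩ :
    (M ⟶ E) →+ (sheafHom E N ⟶ sheafHom M N)) f Finset.univ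

variable {n : ℕ}

/-- A family of endomorphisms acts on the sections over an open subset by a regular sequence. -/
def RegOn (D : Fin n → (E ⟶ E)) (U : X.Opens) : Prop := RegSeq fun k ↦ secMap (D k) U

lemma RegOn.of_retract {D : Fin n → (E ⟶ E)} {D' : Fin n → (M ⟶ M)} {U : X.Opens} (H : RegOn D U)
    {ι : Type} [Fintype ι] (s : ι → (M ⟶ E)) (r : ι → (E ⟶ M)) (h : ∑ i, s i ≫ r i = 𝟙 M)
    (hs : ∀ i k, D' k ≫ s i = s i ≫ D k) (hr : ∀ i k, D k ≫ r i = r i ≫ D' k) : RegOn D' U :=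
  RegSeq.of_retract H (fun i ↦ secMap (s i) U) (fun i ↦ secMap (r i) U)
    (fun i k t ↦ congrArg (fun f ↦ secMap f U t) (hs i k))
    (fun i k t ↦ congrArg (fun f ↦ secMap f U t) (hr i k))
    (fun t ↦ (secMap_sum (fun i ↦ s i ≫ r i) U t).symm.trans
      (congrArg (fun f ↦ secMap f U t) h))

end Retracts

/-! ### Exactness of the Koszul complex of sheaves and of its dual -/

section KoszulSheaves

variable {X : Scheme.{0}} {q : X ⟶ Spec (.of ℂ)} {n : ℕ} {P : X.Modules} (D : Fin n → (P ⟶ P))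
  (hD : ∀ k l, D k ≫ D l = D l ≫ D k) {U : X.Opens}

variable (q) in
lemma HasDualBasis.altSheaf (h : HasDualBasis P U) (j : ℕ) : HasDualBasis (altSheaf q n P j) U :=
  h.of_retract (altProj P) (altInj P) (sum_altProj_altInj P j)

variable {D}

lemma RegOn.alt (h : RegOn D U) (j : ℕ) : RegOn (fun k ↦ altPost (q := q) (n := n) (D k) j) U :=
  h.of_retract (altProj P) (altInj P) (sum_altProj_altInj P j) (fun I k ↦ altPost_altProj _ _)
    fun I k ↦ (altInj_altPost _ _).symm

lemma RegOn.altDual (h : RegOn (fun k ↦ precomp (D k) (structureSheaf X)) U) (j : ℕ) :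
    RegOn (fun k ↦ precomp (altPost (q := q) (n := n) (D k) j) (structureSheaf X)) U :=
  h.of_retract (fun I : Fin j → Fin n ↦ precomp (altInj P I) _) (fun I ↦ precomp (altProj P I) _)
    (by
      simp_rw [← precomp_comp]
      rw [← precomp_sum, sum_altProj_altInj, precomp_id])
    (fun I k ↦ by rw [← precomp_comp, ← precomp_comp, altInj_altPost])
    (fun I k ↦ by rw [← precomp_comp, ← precomp_comp, altPost_altProj])

include hD in
lemma kosz_sections (h : RegOn D U) :
    (0 < n → ∀ ω, secMap (kosz (q := q) D 0) U ω = 0 → ω = 0) ∧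
      ∀ j, j + 1 < n → ∀ ω, secMap (kosz (q := q) D (j + 1)) U ω = 0 →
        ∃ α, secMap (kosz D j) U α = ω :=
  exact_of_regSeq (C := fun j ↦ Γ(altSheaf q n P j, U)) (fun j ↦ h.alt j)
    (fun j ↦ secMap (kosz D j) U) (fun j ω ↦ congrArg (fun f ↦ secMap f U ω) (kosz_kosz D hD j))
    (fun k j ↦ secMap (interior P k j) U)
    (fun j k ω ↦ congrArg (fun f ↦ secMap f U ω) (altPost_kosz D hD k j))
    (fun k j i ω ↦ congrArg (fun f ↦ secMap f U ω) (altPost_interior (D i) k j))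
    (fun k ω ↦ congrArg (fun f ↦ secMap f U ω) (kosz_interior_zero D k))
    (fun k j ω ↦ congrArg (fun f ↦ secMap f U ω) (kosz_interior D k j))

include hD in
lemma precomp_kosz_kosz (j : ℕ) : precomp (kosz (q := q) D (j + 1)) (structureSheaf X) ≫
    precomp (kosz D j) (structureSheaf X) = 0 := by
  rw [← precomp_comp, kosz_kosz D hD, precomp_zero]

lemma eq_zero_of_lt {j : ℕ} (hj : n < j)
    (φ : Γ(sheafHom (altSheaf q n P j) (structureSheaf X), U)) : φ = 0 :=
  toLocal_injective <| localHom_ext fun V hV s ↦ by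
    have := subsingleton_altSheaf (q := q) (P := P) hj V
    rw [Subsingleton.elim s 0, map_zero, map_zero]

-- Transposing Cartan's formula gives contracting homotopies on the dual complex. Its terms vanish
-- above degree `n`, so exactness holds in all positive degrees.
include hD in
lemma precomp_kosz_sections (h : RegOn (fun k ↦ precomp (D k) (structureSheaf X)) U) (j : ℕ)
    (ω : Γ(sheafHom (altSheaf q n P (j + 1)) (structureSheaf X), U))
    (hω : secMap (precomp (kosz D j) (structureSheaf X)) U ω = 0) :
    ∃ α, secMap (precomp (kosz D (j + 1)) (structureSheaf X)) U α = ω := by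
  let T {j j' : ℕ} (f : altSheaf q n P j ⟶ altSheaf q n P j') :
      Γ(sheafHom (altSheaf q n P j') (structureSheaf X), U) →+
        Γ(sheafHom (altSheaf q n P j) (structureSheaf X), U) :=
    secMap (precomp f (structureSheaf X)) U
  have T_comp {j j' j'' : ℕ} (f : altSheaf q n P j ⟶ altSheaf q n P j')
      (g : altSheaf q n P j' ⟶ altSheaf q n P j'') (φ) : T f (T g φ) = T (f ≫ g) φ := rfl
  have T_add {j j' : ℕ} (f g : altSheaf q n P j ⟶ altSheaf q n P j') (φ) :
      T (f + g) φ = T f φ + T g φ := congrArg (fun f ↦ secMap f U φ) (precomp_add f g _)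
  have T_zero {j j' : ℕ} (φ) : T (0 : altSheaf q n P j ⟶ altSheaf q n P j') φ = 0 :=
    congrArg (fun f ↦ secMap f U φ) (precomp_zero _)
  refine exact_of_regSeq' (C := fun j ↦ Γ(sheafHom (altSheaf q n P j) (structureSheaf X), U))
    (D := fun j k ↦ T (altPost (D k) j)) (fun j ↦ h.altDual j)
    (fun j hj ↦ ⟨fun φ ψ ↦ (eq_zero_of_lt hj φ).trans (eq_zero_of_lt hj ψ).symm⟩)
    (fun j ↦ T (kosz D j)) (fun j ω ↦ ?_) (fun k j ↦ T (interior P k j)) (fun j k ω ↦ ?_)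
    (fun k j i ω ↦ ?_) (fun k j ω ↦ ?_) j ω hω
  · rw [T_comp, kosz_kosz D hD, T_zero]
  · rw [T_comp, T_comp, altPost_kosz D hD]
  · rw [T_comp, T_comp, altPost_interior]
  · rw [T_comp, T_comp, ← T_add, add_comm (interior P k j ≫ kosz D j), kosz_interior]

variable (q) in
include hD in
lemma kosz_exact (h : ∀ x : X, ∃ U : X.Opens, x ∈ U ∧ IsAffineOpen U ∧ HasDualBasis P U ∧ RegOn D U)
    {j : ℕ} (hj : j + 1 < n) :
    (ShortComplex.mk (kosz (q := q) D j) (kosz D (j + 1)) (kosz_kosz D hD j)).Exact := by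
  refine exact_of_affine _ fun x ↦ ?_
  obtain ⟨U, hx, hU, hP, hr⟩ := h x
  exact ⟨U, hx, hU, (hP.altSheaf q _).localizing hU, (hP.altSheaf q _).localizing hU,
    (kosz_sections hD hr).2 j hj⟩

variable (q) in
include hD in
lemma kosz_mono (h : ∀ x : X, ∃ U : X.Opens, x ∈ U ∧ IsAffineOpen U ∧ HasDualBasis P U ∧ RegOn D U)
    (hn : 0 < n) : Mono (kosz (q := q) D 0) := by
  refine mono_of_affine _ fun x ↦ ?_
  obtain ⟨U, hx, hU, hP, hr⟩ := h x
  exact ⟨U, hx, hU, (hP.altSheaf q _).localizing hU, (hP.altSheaf q _).localizing hU,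
    (kosz_sections hD hr).1 hn⟩

variable (q) in
include hD in
lemma precomp_kosz_exact (h : ∀ x : X, ∃ U : X.Opens, x ∈ U ∧ IsAffineOpen U ∧ HasDualBasis P U ∧
      RegOn (fun k ↦ precomp (D k) (structureSheaf X)) U) (j : ℕ) :
    (ShortComplex.mk (precomp (kosz (q := q) D (j + 1)) (structureSheaf X))
      (precomp (kosz D j) (structureSheaf X)) (precomp_kosz_kosz hD j)).Exact := by
  refine exact_of_affine _ fun x ↦ ?_
  obtain ⟨U, hx, hU, hP, hr⟩ := h x
  exact ⟨U, hx, hU, (hP.altSheaf q _).hom.localizing hU, (hP.altSheaf q _).hom.localizing hU,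
    precomp_kosz_sections hD hr j⟩

-- In degree `n`, exactness makes an element of the kernel the image of a functional on forms of
-- degree `n + 1`, and there are no such forms.
variable (q) in
include hD in
lemma precomp_kosz_mono (h : ∀ x : X, ∃ U : X.Opens, x ∈ U ∧ IsAffineOpen U ∧ HasDualBasis P U ∧
      RegOn (fun k ↦ precomp (D k) (structureSheaf X)) U) {j : ℕ} (hj : j + 1 = n) :
    Mono (precomp (kosz (q := q) D j) (structureSheaf X)) := by
  refine mono_of_affine _ fun x ↦ ?_
  obtain ⟨U, hx, hU, hP, hr⟩ := h x
  refine ⟨U, hx, hU, (hP.altSheaf q _).hom.localizing hU, (hP.altSheaf q _).hom.localizing hU,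
    fun s hs ↦ ?_⟩
  obtain ⟨α, rfl⟩ := precomp_kosz_sections hD hr j s hs
  rw [eq_zero_of_lt (show n < j + 1 + 1 by omega) α, map_zero]

end KoszulSheaves

/-! ### Forms of top degree and the augmentation -/

section TopDegree

variable {X : Scheme.{0}} {q : X ⟶ Spec (.of ℂ)} {U : X.Opens}

lemma opRange_zero {n : ℕ} {Γ : Type*} [AddCommGroup Γ] (D : Fin n → Γ →+ Γ) : opRange D 0 = ⊥ :=
  le_bot_iff.1 (opRange_le fun _ hi ↦ absurd hi (Nat.not_lt_zero _))

/-- The alternating forms of top degree with given values at the standard basis. -/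
def topHom (q : X ⟶ Spec (.of ℂ)) (n : ℕ) (P : X.Modules) : P ⟶ altSheaf q n P n :=
  mkHom (fun U s ↦ secAlt (altTop (csec q s)))
    (fun _ s t ↦ AlternatingMap.ext fun v ↦ smul_add (Matrix.det v) (csec q s) (csec q t))
    (fun U r s ↦ AlternatingMap.ext fun v ↦ smul_comm (Matrix.det v) r (csec q s))
    (fun _ _ h s ↦ AlternatingMap.ext fun v ↦ ((cres q h).map_smul (Matrix.det v) (csec q s)).symm)

lemma topHom_altPost {n : ℕ} {P : X.Modules} (f : P ⟶ P) :
    f ≫ topHom q n P = topHom q n P ≫ altPost f n :=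
  altHom_ext fun U s v ↦ ((cmap q f U).map_smul (Matrix.det v) (csec q s)).symm

/-- Applying `D_k` to the values of a top form gives the differential of its contraction with the
`k`-th basis vector: the other term of Cartan's formula has degree above the top. -/
lemma exists_kosz {j : ℕ} {P : X.Modules} (D : Fin (j + 1) → (P ⟶ P))
    (ω : Γ(altSheaf q (j + 1) P (j + 1), U))
    (h : secMap (altProj P id) U ω ∈ opRange (fun k ↦ secMap (D k) U) (j + 1)) :
    ∃ α, secMap (kosz D j) U α = ω := by
  have e0 (k s) : secMap (topHom q (j + 1) P) U (secMap (D k) U s) =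
      secMap (altPost (D k) (j + 1)) U (secMap (topHom q (j + 1) P) U s) := by
    rw [← secMap_comp, ← secMap_comp, topHom_altPost]
  have e := map_mem_opRange (D' := fun k ↦ secMap (altPost (q := q) (D k) (j + 1)) U)
    (secMap (topHom q (j + 1) P) U) e0 h
  have e1 : secMap (topHom q (j + 1) P) U (secMap (altProj P id) U ω) = ω :=
    altTop_altEval (altSec ω)
  rw [e1] at e
  refine (opRange_le (S := (secMap (kosz D j) U).range) fun k _ ω' ↦ ?_) e
  refine ⟨secMap (interior P k j) U ω', ?_⟩
  have e2 := congrArg (fun f ↦ secMap f U ω') (kosz_interior (q := q) D k j)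
  refine Eq.trans ?_ e2
  have := subsingleton_altSheaf (q := q) (P := P) (Nat.lt_succ_self (j + 1)) U
  have e3 : secMap (kosz D (j + 1)) U ω' = 0 := Subsingleton.elim _ _
  rw [secMap_add, AddMonoidHom.add_apply, secMap_comp, e3, map_zero, zero_add]
  rfl

lemma kosz_altProj {j : ℕ} {P F : X.Modules} (D : Fin (j + 1) → (P ⟶ P)) (ε : P ⟶ F)
    (hε : ∀ k, D k ≫ ε = 0) : kosz (q := q) D j ≫ altProj P id ≫ ε = 0 := by
  rw [kosz_eq_sum, Preadditive.sum_comp]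
  refine Finset.sum_eq_zero fun k _ ↦ ?_
  rw [Category.assoc, ← Category.assoc (altPost (D k) (j + 1)), altPost_altProj, Category.assoc, hε,
    comp_zero, comp_zero]

end TopDegree

/-! ### The equivariant Koszul resolution -/

section EquivariantKoszul

variable {X : Scheme.{0}} {q : X ⟶ Spec (.of ℂ)} {n : ℕ} {G : Type} [Group G] {a : G →* End X}

lemma actO_scalars (hq : ∀ g, (a g : X ⟶ X) ≫ q = q) (g : G) (U : X.Opens) (c : ℂ) :
    actO a g (scalars q U c) = scalars q ((a g) ⁻¹ᵁ U) c := by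
  have e1 : actO a g (resO (le_top : U ≤ ⊤) (scalars q ⊤ c)) =
      resO (preimage_le a g (le_top : U ≤ ⊤)) (actO a g (scalars q ⊤ c)) := actO_res a g le_top _
  rw [resO_scalars] at e1
  rw [e1, ← resO_scalars q (le_top : (a g) ⁻¹ᵁ U ≤ ⊤)]
  exact congrArg _ (appTop_scalars (a g) q q (hq g) c)

/-- The pullback of sections as a linear map. -/
def cpull (hq : ∀ g, (a g : X ⟶ X) ≫ q = q) (P : GSheaf a) (g : G) (U : X.Opens) :
    CSec q P.sheaf U →ₗ[ℂ] CSec q P.sheaf ((a g) ⁻¹ᵁ U) where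
  toFun := P.pull g
  map_add' := map_add _
  map_smul' c s := (P.pull_smul g (scalars q U c) s).trans
    (congrArg (· • P.pull g s) (actO_scalars hq g U c))

variable (hq : ∀ g, (a g : X ⟶ X) ≫ q = q) (B : G →* Matrix (Fin n) (Fin n) ℂ)
  (P : GSheaf a)

/-- The action on the sheaf of alternating forms. -/
def altAct (j : ℕ) (g : G) :
    altSheaf q n P.sheaf j ⟶ (push a g).obj (altSheaf q n P.sheaf j) :=
  mkHom (fun U ω ↦ secAlt (U := (a g) ⁻¹ᵁ U)
      (altMap (cpull hq P g U) (B g).mulVecLin (altSec ω)))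
    (fun U ω ω' ↦ AlternatingMap.ext fun v ↦ map_add (P.pull g) _ _)
    (fun U r ω ↦ AlternatingMap.ext fun v ↦ P.pull_smul g r _)
    (fun V U h ω ↦ AlternatingMap.ext fun v ↦ P.pull_res g h _)

lemma altSec_altAct (j : ℕ) (g : G) {U : X.Opens} (ω : Γ(altSheaf q n P.sheaf j, U))
    (v : Fin j → Fin n → ℂ) : altSec (U := (a g) ⁻¹ᵁ U) (((altAct hq B P j g).app U).hom ω) v =
      cpull hq P g U (altSec ω fun l ↦ (B g).mulVec (v l)) := rfl

/-- The equivariant sheaf of alternating forms. -/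
def altG (j : ℕ) : GSheaf a where
  sheaf := altSheaf q n P.sheaf j
  act := altAct hq B P j
  act_one := modHom_ext fun U ω ↦ by
    rw [pushOne_app]
    refine altSec_injective (AlternatingMap.ext fun v ↦ (altSec_altAct hq B P j 1 ω v).trans ?_)
    simp_rw [map_one, Matrix.one_mulVec]
    exact P.pull_one (altSec ω v)
  act_mul g h := modHom_ext fun U ω ↦ by
    rw [Scheme.Modules.Hom.comp_app, Scheme.Modules.Hom.comp_app, pushMul_app]
    refine altSec_injective (AlternatingMap.ext fun v ↦
      (altSec_altAct hq B P j (g * h) ω v).trans ?_)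
    simp_rw [map_mul, ← Matrix.mulVec_mulVec]
    exact P.pull_mul g h (altSec ω fun l ↦ (B g).mulVec ((B h).mulVec (v l)))

variable {B P} {D : Fin n → (P.sheaf ⟶ P.sheaf)}

/-- The Koszul differential on equivariant sheaves of alternating forms. -/
def koszG (hDG : ∀ (g : G) (U : X.Opens) v x, cpull hq P g U (opAt (cops q D U) ((B g).mulVec v) x) =
      opAt (cops q D ((a g) ⁻¹ᵁ U)) v (cpull hq P g U x)) (j : ℕ) :
    altG hq B P j ⟶ altG hq B P (j + 1) :=
  GSheaf.Hom.mk (kosz D j) fun g ↦ modHom_ext fun U ω ↦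
    (altMap_koszul (cpull hq P g U) (B g).mulVecLin (hDG g U) (altSec ω)).symm

/-- The augmentation of the Koszul complex. -/
def augG (hB : ∀ g, (B g).det = 1) {F : GSheaf a} (ε : P ⟶ F) : altG hq B P n ⟶ F :=
  GSheaf.Hom.mk (altProj P.sheaf id ≫ ε.hom) fun g ↦ modHom_ext fun U ω ↦ by
    have e : F.pull g (secMap ε.hom U (altEval n (CSec q P.sheaf U) (altSec ω))) =
        secMap ε.hom ((a g) ⁻¹ᵁ U) (P.pull g (altEval n (CSec q P.sheaf U) (altSec ω))) :=
      (congrArg (fun f ↦ (Scheme.Modules.Hom.app f U).hom (altEval n (CSec q P.sheaf U) (altSec ω))) (ε.comm g)).symm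
    refine Eq.trans ?_ e.symm
    exact congrArg (secMap ε.hom ((a g) ⁻¹ᵁ U))
      (altEval_altMap (cpull hq P g U) (B g) (hB g) (altSec ω))

variable (hD : ∀ k l, D k ≫ D l = D l ≫ D k)
  (hDG : ∀ (g : G) (U : X.Opens) v x, cpull hq P g U (opAt (cops q D U) ((B g).mulVec v) x) =
      opAt (cops q D ((a g) ⁻¹ᵁ U)) v (cpull hq P g U x))
  {hB : ∀ g, (B g).det = 1} {F : GSheaf a} (ε : P ⟶ F) (hε : ∀ k, D k ≫ ε.hom = 0)

include hD hB hε in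
/-- The Koszul resolution computes the derived dual. -/
theorem derivedDual_of_koszul [HasDerivedCategory.{w} (GSheaf a)]
    (h : ∀ x : X, ∃ U : X.Opens, x ∈ U ∧ IsAffineOpen U ∧ Localizing F.sheaf U ∧
      HasDualBasis P.sheaf U ∧ RegOn D U ∧
      RegOn (fun k ↦ precomp (D k) (structureSheaf X)) U ∧
      (∀ t, ∃ s, secMap ε.hom U s = t) ∧
      ∀ s, secMap ε.hom U s = 0 → s ∈ opRange (fun k ↦ secMap (D k) U) n) :
    Nonempty ((derivedDual F)⟦(n : ℤ)⟧ ≅ (DerivedCategory.Plus.singleFunctor (GSheaf a) 0).obj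
      (cokernel (GSheaf.homPre (koszG hq hDG 0) (structureGSheaf a)))) := by
  have hw (j) : koszG hq hDG j ≫ koszG hq hDG (j + 1) = 0 := GSheaf.hom_ext (kosz_kosz D hD j)
  have h1 : ∀ x : X, ∃ U : X.Opens, x ∈ U ∧ IsAffineOpen U ∧ HasDualBasis P.sheaf U ∧ RegOn D U :=
    fun x ↦ by obtain ⟨U, hx, hU, -, hP, hr, -⟩ := h x; exact ⟨U, hx, hU, hP, hr⟩
  have h2 : ∀ x : X, ∃ U : X.Opens, x ∈ U ∧ IsAffineOpen U ∧ HasDualBasis P.sheaf U ∧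
      RegOn (fun k ↦ precomp (D k) (structureSheaf X)) U :=
    fun x ↦ by obtain ⟨U, hx, hU, -, hP, -, hr, -⟩ := h x; exact ⟨U, hx, hU, hP, hr⟩
  refine GSheaf.derivedDual_of_resolution n (altG hq B P) (koszG hq hDG) hw (augG hq hB ε)
    ?_ ?_ (fun j hj ↦ ?_) (fun j hj ↦ ?_) (fun j hj x ↦ ?_) (fun j hj ↦ ?_) (fun j hj ↦ ?_)
    ⟨Iso.refl _⟩
  · refine (GSheaf.forget a).epi_of_epi_map (epi_of_affine _ fun x ↦ ?_)
    obtain ⟨U, hx, hU, hF, hP, -, -, hs, -⟩ := h x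
    refine ⟨U, hx, hU, hF, fun t ↦ ?_⟩
    obtain ⟨s, hs⟩ := hs t
    refine ⟨secAlt (altTop (csec q s)), (congrArg (secMap ε.hom U) ?_).trans hs⟩
    exact altEval_altTop (csec q s)
  -- With no variables the augmentation itself must be an isomorphism. Its kernel lies in the empty
  -- sum of ranges, and there are no forms of degree one.
  · split_ifs with hn
    · subst hn
      refine ⟨(GSheaf.forget a).mono_of_mono_map (mono_of_affine _ fun x ↦ ?_), ?_⟩
      · obtain ⟨U, hx, hU, hF, hP, -, -, -, hk⟩ := h x
        refine ⟨U, hx, hU, (hP.altSheaf q _).localizing hU, hF, fun ω hω ↦ ?_⟩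
        have e : secMap (altProj P.sheaf id) U ω = 0 := by
          have := hk (secMap (altProj P.sheaf id) U ω) hω
          rwa [opRange_zero, AddSubgroup.mem_bot] at this
        exact altEval_injective (e.trans (map_zero _).symm)
      · rw [IsZero.iff_id_eq_zero]
        exact GSheaf.hom_ext (modHom_ext fun U ω ↦
          (subsingleton_altSheaf (q := q) (P := P.sheaf) Nat.zero_lt_one U).elim _ _)
    · have := kosz_mono q hD h1 (Nat.pos_of_ne_zero hn)
      exact (GSheaf.forget a).mono_of_mono_map this
  · exact (ShortComplex.exact_map_iff_of_faithful _ (GSheaf.forget a)).1 (kosz_exact q hD h1 hj)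
  · subst hj
    simp only [eqToHom_refl, Category.id_comp]
    exact ⟨GSheaf.hom_ext (kosz_altProj D ε.hom hε), (ShortComplex.exact_map_iff_of_faithful _ (GSheaf.forget a)).1
      (exact_of_affine _ fun x ↦ by
        obtain ⟨U, hx, hU, hF, hP, -, -, -, hk⟩ := h x
        exact ⟨U, hx, hU, (hP.altSheaf q _).localizing hU, hF, fun ω hω ↦
          exists_kosz D _ (hk _ hω)⟩)⟩
  · obtain ⟨U, hx, hU, -, hP, -⟩ := h x
    exact ⟨U, hx, hP.altSheaf q j⟩
  · exact ⟨GSheaf.hom_ext (precomp_kosz_kosz hD j),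
      (ShortComplex.exact_map_iff_of_faithful _ (GSheaf.forget a)).1 (precomp_kosz_exact q hD h2 j)⟩
  · have := precomp_kosz_mono q hD h2 hj
    exact (GSheaf.forget a).mono_of_mono_map this

end EquivariantKoszul

/-! ### Functions on affine space over an affine open subset -/

section AffineSpaceSections

lemma appLE_bijective {X Y : Scheme.{u}} (f : X ⟶ Y) [IsOpenImmersion f] {U : Y.Opens} {V : X.Opens}
    (hU : U ≤ f.opensRange) (e : V ≤ f ⁻¹ᵁ U) (hV : V = f ⁻¹ᵁ U) :
    Function.Bijective (f.appLE U V e).hom := by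
  subst hV
  have := f.isIso_app U hU
  rw [← f.app_eq_appLE]
  exact ConcreteCategory.bijective_of_isIso (f.app U)

lemma appLE_top_apply {X Y : Scheme.{u}} (f : X ⟶ Y) (e) (r : Γ(Y, ⊤)) :
    (f.appLE ⊤ ⊤ e).hom r = f.appTop.hom r :=
  (ConcreteCategory.congr_hom (f.app_eq_appLE (U := ⊤)) r).symm

variable {n : ℕ} {Y : Scheme.{0}}

lemma le_opensRange_map (W : Y.Opens) :
    IsOpenImmersion (AffineSpace.map (Fin n) W.ι) ∧
      ∀ [IsOpenImmersion (AffineSpace.map (Fin n) W.ι)],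
        (𝔸(Fin n; Y) ↘ Y) ⁻¹ᵁ W ≤ (AffineSpace.map (Fin n) W.ι).opensRange := by
  have h := AffineSpace.isPullback_map (n := Fin n) W.ι
  refine ⟨MorphismProperty.of_isPullback h.flip inferInstance, fun {_} x hx ↦ ?_⟩
  have e := IsOpenImmersion.range_pullbackFst W.ι (𝔸(Fin n; Y) ↘ Y)
  obtain ⟨z, rfl⟩ : x ∈ Set.range (pullback.fst (𝔸(Fin n; Y) ↘ Y) W.ι) := by
    rw [e, Scheme.Opens.opensRange_ι]
    exact hx
  refine ⟨h.isoPullback.inv z, ?_⟩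
  rw [← Scheme.Hom.comp_apply, h.isoPullback_inv_fst]

/-- Affine space over the affine scheme `W` is the spectrum of a polynomial ring. It is identified
with the preimage of `W` by the open immersion into affine space over `Y`, and the two evaluations
are compared on constants and variables. -/
lemma eval₂_bijective {W : Y.Opens} (hW : IsAffineOpen W) :
    Function.Bijective (MvPolynomial.eval₂Hom (pullO (𝔸(Fin n; Y) ↘ Y) (W := W))
      fun k ↦ resO (le_top : (𝔸(Fin n; Y) ↘ Y) ⁻¹ᵁ W ≤ ⊤) (AffineSpace.coord Y k)) := by
  let j := AffineSpace.map (Fin n) W.ι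
  have hj : IsOpenImmersion j := (le_opensRange_map W).1
  have : IsAffine W := hW
  have hle : (⊤ : 𝔸(Fin n; W).Opens) ≤ j ⁻¹ᵁ ((𝔸(Fin n; Y) ↘ Y) ⁻¹ᵁ W) := by
    rw [← Scheme.Hom.comp_preimage, AffineSpace.map_over, Scheme.Hom.comp_preimage]
    rw [Scheme.Opens.ι_preimage_self]
    exact le_rfl
  let τ := (j.appLE ((𝔸(Fin n; Y) ↘ Y) ⁻¹ᵁ W) ⊤ hle).hom
  have hτ : Function.Bijective τ :=
    appLE_bijective j (le_opensRange_map W).2 hle (top_le_iff.1 hle).symm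
  let σ := (W.ι.appLE W ⊤ (by rw [Scheme.Opens.ι_preimage_self])).hom
  have hσ : Function.Bijective σ :=
    appLE_bijective W.ι (by rw [Scheme.Opens.opensRange_ι]) _ (by rw [Scheme.Opens.ι_preimage_self])
  have h1 : Function.Bijective (MvPolynomial.eval₂Hom ((𝔸(Fin n; W) ↘ (W : Scheme)).appTop).hom
      (AffineSpace.coord (n := Fin n) (W : Scheme))) := by
    have e := AffineSpace.isoOfIsAffine_hom_appTop (n := Fin n) (S := W)
    rw [← Iso.inv_comp_eq] at e
    have : IsIso (AffineSpace.isoOfIsAffine (Fin n) W).hom.appTop :=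
      inferInstanceAs (IsIso ((AffineSpace.isoOfIsAffine (Fin n) W).hom.app ⊤))
    have := ConcreteCategory.bijective_of_isIso
      ((Scheme.ΓSpecIso (.of (MvPolynomial (Fin n) Γ(W, ⊤)))).inv ≫
        (AffineSpace.isoOfIsAffine (Fin n) W).hom.appTop)
    rw [e] at this
    exact this
  have h2 : τ.comp (MvPolynomial.eval₂Hom (pullO (𝔸(Fin n; Y) ↘ Y) (W := W))
      fun k ↦ resO (le_top : (𝔸(Fin n; Y) ↘ Y) ⁻¹ᵁ W ≤ ⊤) (AffineSpace.coord Y k)) =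
      (MvPolynomial.eval₂Hom ((𝔸(Fin n; W) ↘ (W : Scheme)).appTop).hom
      (AffineSpace.coord (n := Fin n) (W : Scheme))).comp (MvPolynomial.map σ) := by
    refine MvPolynomial.ringHom_ext (fun c ↦ ?_) fun k ↦ ?_
    · simp only [RingHom.comp_apply, MvPolynomial.coe_eval₂Hom, MvPolynomial.eval₂_C,
        MvPolynomial.map_C]
      have e1 := Scheme.Hom.appLE_comp_appLE j (𝔸(Fin n; Y) ↘ Y) W ((𝔸(Fin n; Y) ↘ Y) ⁻¹ᵁ W) ⊤
        le_rfl hle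
      have e2 := Scheme.Hom.appLE_comp_appLE (𝔸(Fin n; W) ↘ (W : Scheme)) W.ι W ⊤ ⊤
        (by rw [Scheme.Opens.ι_preimage_self]) le_rfl
      simp only [j, AffineSpace.map_over] at e1
      have e3 := e1.trans e2.symm
      rw [← Scheme.Hom.app_eq_appLE] at e3
      refine (ConcreteCategory.congr_hom e3 c).trans ?_
      exact appLE_top_apply _ _ _
    · simp only [RingHom.comp_apply, MvPolynomial.coe_eval₂Hom, MvPolynomial.eval₂_X,
        MvPolynomial.map_X]
      have e1 := Scheme.Hom.map_appLE j hle (homOfLE le_top).op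
      refine (ConcreteCategory.congr_hom e1 (AffineSpace.coord Y k)).trans ?_
      exact (appLE_top_apply _ _ _).trans (AffineSpace.map_appTop_coord W.ι k)
  have h3 := h1.comp (show Function.Bijective (MvPolynomial.map (σ := Fin n) σ) from
    ⟨MvPolynomial.map_injective σ hσ.1, MvPolynomial.map_surjective σ hσ.2⟩)
  have h4 : Function.Bijective (τ ∘ (MvPolynomial.eval₂Hom (pullO (𝔸(Fin n; Y) ↘ Y) (W := W))
      fun k ↦ resO (le_top : (𝔸(Fin n; Y) ↘ Y) ⁻¹ᵁ W ≤ ⊤) (AffineSpace.coord Y k))) := by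
    rw [← RingHom.coe_comp, h2, RingHom.coe_comp]
    exact h3
  exact (Function.Bijective.of_comp_iff' hτ _).1 h4

/-- Evaluation of polynomials is bijective onto the functions on affine space. -/
lemma exists_isEval_functions {W : Y.Opens} (hW : IsAffineOpen W) :
    ∃ Θ : PolyMod n Γ(Y, W) →+ Γ(𝔸(Fin n; Y), (𝔸(Fin n; Y) ↘ Y) ⁻¹ᵁ W),
      IsEval (fun k ↦ AddMonoidHom.mulLeft (resO (le_top : (𝔸(Fin n; Y) ↘ Y) ⁻¹ᵁ W ≤ ⊤)
        (AffineSpace.coord Y k))) (pullO (𝔸(Fin n; Y) ↘ Y) (W := W)).toAddMonoidHom Θ ∧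
      Function.Bijective Θ := by
  let r := (MvPolynomial.basisMonomials (Fin n) Γ(Y, W)).repr.symm
  have hr (a c) : r (Finsupp.single a c) = MvPolynomial.monomial a c := by
    rw [Module.Basis.repr_symm_single, MvPolynomial.coe_basisMonomials, MvPolynomial.smul_monomial,
      smul_eq_mul, mul_one]
  let E := MvPolynomial.eval₂Hom (pullO (𝔸(Fin n; Y) ↘ Y) (W := W))
      fun k ↦ resO (le_top : (𝔸(Fin n; Y) ↘ Y) ⁻¹ᵁ W ≤ ⊤) (AffineSpace.coord Y k)
  refine ⟨E.toAddMonoidHom.comp r.toAddEquiv.toAddMonoidHom, ⟨fun c ↦ ?_, fun k f ↦ ?_⟩,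
    (eval₂_bijective hW).comp r.bijective⟩
  · change E (r (Finsupp.single 0 c)) = _
    rw [hr]
    exact MvPolynomial.eval₂_C _ _ _
  · change E (r (shift _ k f)) = _ * E (r f)
    have : r (shift _ k f) = MvPolynomial.X k * r f := by
      induction f using Finsupp.induction_linear with
      | zero => rw [map_zero, map_zero, mul_zero]
      | add f g hf hg => rw [map_add, map_add, hf, hg, map_add, mul_add]
      | single a c =>
        rw [shift_single, hr, hr, MvPolynomial.X, MvPolynomial.monomial_mul, one_mul, add_comm]
    rw [this, map_mul]
    congr 1
    exact MvPolynomial.eval₂_X _ _ _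

lemma isAffineOpen_preimage {W : Y.Opens} (hW : IsAffineOpen W) :
    IsAffineOpen ((𝔸(Fin n; Y) ↘ Y) ⁻¹ᵁ W) := hW.preimage _

end AffineSpaceSections

open TensorProduct

/-! ### Direct images and dual bases of finite projective modules -/

section DirectImages

variable {X Y : Scheme.{u}}

lemma Localizing.pushforward {p : X ⟶ Y} {E : X.Modules} {W : Y.Opens}
    (hE : Localizing E (p ⁻¹ᵁ W)) : Localizing ((Scheme.Modules.pushforward p).obj E) W where
  zero h s hs := by
    have e : X.basicOpen (pullO p h) = p ⁻¹ᵁ (Y.basicOpen h) := (Scheme.preimage_basicOpen p h).symm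
    have e1 : EquivSheaf.res E (preimage_mono p (Y.basicOpen_le h)) s = 0 := hs
    have e2 := congrArg (EquivSheaf.res E e.le) e1
    rw [map_zero] at e2
    obtain ⟨m, hm⟩ := hE.zero (pullO p h) s ((res_res E e.le _ _).symm.trans e2)
    refine ⟨m, ?_⟩
    rw [← map_pow] at hm
    exact hm
  lift h t := by
    have e : X.basicOpen (pullO p h) = p ⁻¹ᵁ (Y.basicOpen h) := (Scheme.preimage_basicOpen p h).symm
    let t' : Γ(E, p ⁻¹ᵁ (Y.basicOpen h)) := t
    obtain ⟨m, s, hs⟩ := hE.lift (pullO p h) (EquivSheaf.res E e.le t')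
    refine ⟨m, s, ?_⟩
    have e1 := congrArg (EquivSheaf.res E e.ge) hs
    rw [res_res, res_smul, res_res, res_self, map_pow, resO_resO,
      ← pullO_res p (Y.basicOpen_le h), ← map_pow] at e1
    exact e1

/-- A splitting of a finite free cover gives functionals on the module of sections, which extend to
the sheaf by `exists_localHom`. The dual basis identity holds over `U`, and local homomorphisms are
determined there. -/
lemma hasDualBasis_of_projective {N : X.Modules} {U : X.Opens} (hN : Localizing N U)
    (hU : IsAffineOpen U) [Module.Finite Γ(X, U) Γ(N, U)] [Module.Projective Γ(X, U) Γ(N, U)] :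
    HasDualBasis N U := by
  obtain ⟨k, s, hs⟩ := Module.Finite.exists_fin' Γ(X, U) Γ(N, U)
  obtain ⟨i, hi⟩ := Module.projective_lifting_property s LinearMap.id hs
  let f (l : Fin k) : Γ(N, U) →+ Γ(structureSheaf X, U) :=
    ofFun.comp ((LinearMap.proj l).comp i).toAddMonoidHom
  have hf (l : Fin k) (r : Γ(X, U)) (m : Γ(N, U)) : f l (r • m) = r • f l m :=
    ((LinearMap.proj l).comp i).map_smul r m
  choose c hc using fun l ↦ exists_localHom hN hU (hf l)
  refine ⟨Fin k, inferInstance, fun l ↦ s (Pi.single l 1), c, ?_⟩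
  let φ : localHom N N U :=
    mkLocal (fun _ _ s ↦ s) (fun _ _ _ _ ↦ rfl) (fun _ _ _ _ ↦ rfl) (fun _ _ _ _ _ ↦ rfl)
  have e : φ = localOfBasis c fun l ↦ s (Pi.single l 1) := by
    refine localHom_ext_of_localizing hN hU fun m ↦ ?_
    rw [ev_localOfBasis]
    change m = _
    have e1 : s (i m) = m := LinearMap.congr_fun hi m
    conv_lhs => rw [← e1, pi_eq_sum_univ' (i m), map_sum]
    refine Finset.sum_congr rfl fun l _ ↦ ?_
    rw [map_smul, res_self, hc]
    rfl
  exact fun V h s ↦ congrArg (fun φ ↦ ev φ h s) e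

end DirectImages

/-! ### The direct image of a gnat-family is finite projective -/

section GnatFamilies

variable {n : ℕ} {Y : Scheme.{0}} {f : Y ⟶ Spec (.of ℂ)}
  {G : Subgroup (Matrix.SpecialLinearGroup (Fin n) ℂ)} {F : GSheaf (linearAct f G)}
  {W : Y.Opens}

/-- The direct image of a sheaf of modules on `Y × ℂⁿ`. -/
abbrev dirIm (M : 𝔸(Fin n; Y).Modules) : Y.Modules :=
  (Scheme.Modules.pushforward (𝔸(Fin n; Y) ↘ Y)).obj M

/-- A coordinate function. -/
def coordOn (W : Y.Opens) (k : Fin n) : Γ(𝔸(Fin n; Y), (𝔸(Fin n; Y) ↘ Y) ⁻¹ᵁ W) :=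
  resO le_top (AffineSpace.coord Y k)

/-- Functions over the preimage of `W` are polynomials in the coordinates with coefficients from
`W`, so stability under these suffices. -/
lemma smul_mem_of_coord (hW : IsAffineOpen W) {M : Type*} [AddCommGroup M]
    [Module Γ(𝔸(Fin n; Y), (𝔸(Fin n; Y) ↘ Y) ⁻¹ᵁ W) M] (K : AddSubgroup M)
    (h0 : ∀ (c : Γ(Y, W)), ∀ m ∈ K, pullO (𝔸(Fin n; Y) ↘ Y) c • m ∈ K)
    (h1 : ∀ k, ∀ m ∈ K, coordOn (n := n) W k • m ∈ K)
    (b : Γ(𝔸(Fin n; Y), (𝔸(Fin n; Y) ↘ Y) ⁻¹ᵁ W)) (m : M) (hm : m ∈ K) : b • m ∈ K := by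
  obtain ⟨g, rfl⟩ := (eval₂_bijective (n := n) hW).2 b
  induction g using MvPolynomial.induction_on generalizing m with
  | C c =>
    rw [MvPolynomial.coe_eval₂Hom, MvPolynomial.eval₂_C]
    exact h0 c m hm
  | add f g hf hg => rw [map_add, add_smul]; exact K.add_mem (hf m hm) (hg m hm)
  | mul_X g k ih =>
    rw [map_mul, mul_smul]
    refine ih _ ?_
    rw [MvPolynomial.coe_eval₂Hom, MvPolynomial.eval₂_X]
    exact h1 k m hm

/-- Flatness of a module over a ring that maps to its ring of scalars. -/
def FlatVia {A B : Type*} [CommRing A] [CommRing B] (φ : A →+* B) (M : Type*) [AddCommGroup M]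
    [Module B M] : Prop :=
  letI : Module A M := Module.compHom M φ
  Module.Flat A M

/-- The fibre of a module at a homomorphism to `ℂ`. -/
abbrev ModFibre {A : Type} (M : Type) [CommRing A] [AddCommGroup M] [Module A M] (ε : A →+* ℂ) :
    Type :=
  letI := ε.toAlgebra
  TensorProduct A ℂ M

section ModFibre

variable {A M : Type} [CommRing A] [AddCommGroup M] [Module A M] {ε : A →+* ℂ}

/-- The value of an element in a fibre. -/
def fibreMk (ε : A →+* ℂ) : M →ₛₗ[ε] ModFibre M ε :=
  letI := ε.toAlgebra
  { toFun := fun m ↦ (1 : ℂ) ⊗ₜ[A] m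
    map_add' := fun m m' ↦ TensorProduct.tmul_add _ _ _
    map_smul' := fun r m ↦ by
      rw [← TensorProduct.smul_tmul, TensorProduct.smul_tmul']
      rfl }

lemma fibreMk_surjective (hs : Function.Surjective ε) :
    Function.Surjective (fibreMk (M := M) ε) := fun x ↦ by
  letI := ε.toAlgebra
  induction x using TensorProduct.induction_on with
  | zero => exact ⟨0, map_zero _⟩
  | tmul c m =>
    obtain ⟨r, rfl⟩ := hs c
    refine ⟨r • m, ?_⟩
    change (1 : ℂ) ⊗ₜ[A] (r • m) = _
    rw [← TensorProduct.smul_tmul]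
    congr 1
    exact (Algebra.smul_def _ _).trans (mul_one _)
  | add x y hx hy =>
    obtain ⟨m, rfl⟩ := hx
    obtain ⟨m', rfl⟩ := hy
    exact ⟨m + m', map_add _ _ _⟩

lemma exists_fibre_lift (hs : Function.Surjective ε) (ψ : M →ₛₗ[ε] ℂ) :
    ∃ χ : ModFibre M ε →ₗ[ℂ] ℂ, ∀ m, χ (fibreMk ε m) = ψ m := by
  letI := ε.toAlgebra
  let ψ' : M →ₗ[A] ℂ :=
    { toFun := ψ
      map_add' := map_add ψ
      map_smul' := fun r m ↦ (ψ.map_smulₛₗ r m).trans (Algebra.smul_def r (ψ m)).symm }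
  refine ⟨TensorProduct.AlgebraTensorModule.lift
    ((LinearMap.toSpanSingleton ℂ (M →ₗ[A] ℂ) ψ')), fun m ↦ ?_⟩
  change (1 : ℂ) • ψ m = ψ m
  exact one_smul _ _

lemma fibreDim_of_equiv (hs : Function.Surjective ε) {N : ℕ}
    (e : ModFibre M ε ≃ₗ[ℂ] (Fin N → ℂ)) : FibreDim M N ε := by
  refine ⟨e.toLinearMap.comp (fibreMk ε), e.surjective.comp (fibreMk_surjective hs), fun ψ ↦ ?_⟩
  obtain ⟨χ, hχ⟩ := exists_fibre_lift hs ψ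
  refine ⟨χ.comp e.symm.toLinearMap, fun m ↦ ?_⟩
  change _ = χ (e.symm (e _))
  rw [e.symm_apply_apply, hχ]

end ModFibre

lemma finiteType_sections [LocallyOfFiniteType f] (hW : IsAffineOpen W) :
    (scalars f W).FiniteType := by
  have h := f.finiteType_appLE (isAffineOpen_top (Spec (.of ℂ))) hW le_top
  have e : scalars f W =
      (f.appLE ⊤ W le_top).hom.comp (Scheme.ΓSpecIso (.of ℂ)).commRingCatIsoToRingEquiv.symm := rfl
  rw [e]
  exact h.comp (RingHom.FiniteType.of_surjective _ (RingEquiv.surjective _))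

namespace IsGnatFamily

variable (hF : IsGnatFamily F) (hW : IsAffineOpen W)

include hF hW in
lemma localizing : Localizing F.sheaf ((𝔸(Fin n; Y) ↘ Y) ⁻¹ᵁ W) :=
  have := hF.coherent.1
  localizing_of_isQuasicoherent (isAffineOpen_preimage hW)

include hF hW in
lemma flat_sections : Module.Flat Γ(Y, W) Γ(dirIm F.sheaf, W) := by
  have h : ((𝔸(Fin n; Y) ↘ Y).appLE W ((𝔸(Fin n; Y) ↘ Y) ⁻¹ᵁ W) le_rfl).hom =
      pullO (𝔸(Fin n; Y) ↘ Y) :=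
    congrArg CommRingCat.Hom.hom ((𝔸(Fin n; Y) ↘ Y).app_eq_appLE (U := W)).symm
  have H : FlatVia ((𝔸(Fin n; Y) ↘ Y).appLE W ((𝔸(Fin n; Y) ↘ Y) ⁻¹ᵁ W) le_rfl).hom
    Γ(F.sheaf, (𝔸(Fin n; Y) ↘ Y) ⁻¹ᵁ W) := hF.flat W _ le_rfl hW (isAffineOpen_preimage hW)
  rw [h] at H
  exact H

-- Coherence gives finitely many generators over functions on `W × ℂⁿ`; over functions on `W` alone
-- they generate only with the help of the coordinate operators.
include hF hW in
lemma fgUnder : FGUnder Γ(Y, W) Γ(dirIm F.sheaf, W) := by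
  have := hF.coherent.2 _ (isAffineOpen_preimage hW)
  obtain ⟨S, hS⟩ := this.fg_top
  let M := Γ(F.sheaf, (𝔸(Fin n; Y) ↘ Y) ⁻¹ᵁ W)
  have hc (k : Fin n) (r : Γ(Y, W)) (m : M) : coordOn W k • pullO (𝔸(Fin n; Y) ↘ Y) r • m =
    pullO (𝔸(Fin n; Y) ↘ Y) r • coordOn W k • m := smul_comm _ _ _
  have ha (k : Fin n) (m m' : M) : coordOn W k • (m + m') = coordOn W k • m + coordOn W k • m' :=
    smul_add _ _ _
  let t (k : Fin n) : Module.End Γ(Y, W) Γ(dirIm F.sheaf, W) :=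
    { toFun := fun (m : M) ↦ coordOn W k • m
      map_add' := ha k
      map_smul' := hc k }
  classical
  refine ⟨S, Finset.univ.image t, fun K hK hT ↦ ?_⟩
  let K₀ : AddSubgroup Γ(F.sheaf, (𝔸(Fin n; Y) ↘ Y) ⁻¹ᵁ W) := K.toAddSubgroup
  have h0 (c : Γ(Y, W)) (m : Γ(F.sheaf, (𝔸(Fin n; Y) ↘ Y) ⁻¹ᵁ W)) (hm : m ∈ K₀) :
    pullO (𝔸(Fin n; Y) ↘ Y) c • m ∈ K₀ := K.smul_mem c hm
  have h1 (k : Fin n) (m : Γ(F.sheaf, (𝔸(Fin n; Y) ↘ Y) ⁻¹ᵁ W)) (hm : m ∈ K₀) :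
    coordOn W k • m ∈ K₀ := hT (t k) (Finset.mem_image_of_mem _ (Finset.mem_univ k)) m hm
  let K' : Submodule Γ(𝔸(Fin n; Y), (𝔸(Fin n; Y) ↘ Y) ⁻¹ᵁ W)
      Γ(F.sheaf, (𝔸(Fin n; Y) ↘ Y) ⁻¹ᵁ W) :=
    { K₀ with smul_mem' := smul_mem_of_coord hW K₀ h0 h1 }
  have h : (⊤ : Submodule _ _) ≤ K' := by
    rw [← hS, Submodule.span_le]
    exact hK
  have h' (m : Γ(F.sheaf, (𝔸(Fin n; Y) ↘ Y) ⁻¹ᵁ W)) : m ∈ K' := h trivial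
  exact top_le_iff.1 fun m _ ↦ h' m

include hF hW in
lemma fibreDim [Finite G] (ε : Γ(Y, W) →+* ℂ) (hε : ε.comp (scalars f W) = RingHom.id ℂ) :
    FibreDim Γ(dirIm F.sheaf, W) (Nat.card G) ε := by
  obtain ⟨e, -⟩ := hF.regular W hW ε hε
  exact fibreDim_of_equiv (hs := fun c ↦ ⟨scalars f W c, RingHom.congr_fun hε c⟩)
    (e.trans ((Finsupp.domLCongr (Finite.equivFin G)).trans (Finsupp.linearEquivFunOnFinite ℂ ℂ _)))

-- All fibres have dimension `|G|`, which gives finiteness by `finite_of_fibreDim`; over a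
-- noetherian ring a finite flat module is finitely presented, hence projective.
include hF hW in
lemma finite_projective [Finite G] [LocallyOfFiniteType f] :
    Module.Finite Γ(Y, W) Γ(dirIm F.sheaf, W) ∧ Module.Projective Γ(Y, W) Γ(dirIm F.sheaf, W) := by
  let := (scalars f W).toAlgebra
  have h1 : Algebra.FiniteType ℂ Γ(Y, W) := finiteType_sections hW
  have h2 := hF.flat_sections hW
  have h3 := finite_of_fibreDim (hF.fgUnder hW) fun ε : Γ(Y, W) →ₐ[ℂ] ℂ ↦
    hF.fibreDim hW ε.toRingHom (RingHom.ext fun c ↦ ε.commutes c)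
  have : IsNoetherianRing Γ(Y, W) := Algebra.FiniteType.isNoetherianRing ℂ _
  have := Module.finitePresentation_of_finite Γ(Y, W) Γ(dirIm F.sheaf, W)
  exact ⟨h3, Module.Flat.projective_of_finitePresentation⟩

include hF hW in
lemma hasDualBasis [Finite G] [LocallyOfFiniteType f] : HasDualBasis (dirIm F.sheaf) W := by
  obtain ⟨h1, h2⟩ := hF.finite_projective hW
  exact hasDualBasis_of_projective (hF.localizing hW).pushforward hW

end IsGnatFamily

end GnatFamilies

/-! ### The sheaf `p^* p_* F`, its counit and the difference operators -/

section EquivariantInverseImage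

variable {X Y : Scheme.{u}} {p : X ⟶ Y} {G : Type} [Group G] {a : G →* End X}

lemma preimage_eq_of_comp {s : X ⟶ X} (h : s ≫ p = p) (W : Y.Opens) : s ⁻¹ᵁ (p ⁻¹ᵁ W) = p ⁻¹ᵁ W := by
  conv_rhs => rw [← h]
  rfl

variable (hp : ∀ g, (a g : X ⟶ X) ≫ p = p) (F : GSheaf a)

include hp in
lemma preimage_act (g : G) (W : Y.Opens) : (a g) ⁻¹ᵁ (p ⁻¹ᵁ W) = p ⁻¹ᵁ W :=
  preimage_eq_of_comp (hp g) W

lemma app_congr_apply' {f g : X ⟶ Y} (e : f = g) (U : Y.Opens) (r : Γ(Y, U)) :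
    (f.app U).hom r = resO (by rw [e]) ((g.app U).hom r) := by
  subst e
  exact (resO_self _ _).symm

lemma actO_pullO (g : G) {W : Y.Opens} (r : Γ(Y, W)) :
    actO a g (pullO p r) = resO (preimage_act hp g W).le (pullO p r) :=
  app_congr_apply' (hp g) W r

/-- The action of `g` on a direct image, by pullback. -/
def gEnd (g : G) :
    (Scheme.Modules.pushforward p).obj F.sheaf ⟶ (Scheme.Modules.pushforward p).obj F.sheaf :=
  (Scheme.Modules.pushforward p).map (F.act g) ≫
    (Scheme.Modules.pushforwardComp (a g) p).hom.app F.sheaf ≫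
      (Scheme.Modules.pushforwardCongr (hp g)).hom.app F.sheaf

/-- Sections of a direct image as sections over the preimage. -/
def dirSec {M : X.Modules} {W : Y.Opens} :
    Γ((Scheme.Modules.pushforward p).obj M, W) →+ Γ(M, p ⁻¹ᵁ W) := AddMonoidHom.id _

/-- Sections over a preimage as sections of the direct image. -/
def secDir {M : X.Modules} {W : Y.Opens} :
    Γ(M, p ⁻¹ᵁ W) →+ Γ((Scheme.Modules.pushforward p).obj M, W) := AddMonoidHom.id _

lemma dirSec_injective {M : X.Modules} {W : Y.Opens} :
    Function.Injective (dirSec (p := p) (M := M) (W := W)) := fun _ _ h ↦ h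

lemma dirSec_smul {M : X.Modules} {W : Y.Opens} (r : Γ(Y, W))
    (s : Γ((Scheme.Modules.pushforward p).obj M, W)) : dirSec (r • s) = pullO p r • dirSec s := rfl

lemma dirSec_gEnd (g : G) {W : Y.Opens} (s : Γ((Scheme.Modules.pushforward p).obj F.sheaf, W)) :
    dirSec (secMap (gEnd hp F g) W s) =
      res F.sheaf (preimage_act hp g W).ge (F.pull g (dirSec s)) := rfl

lemma gEnd_one : gEnd hp F 1 = 𝟙 _ := modHom_ext fun W s ↦ dirSec_injective <| by
  refine (dirSec_gEnd hp F 1 s).trans ?_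
  rw [GSheaf.pull_one, res_res, res_self]
  rfl

/-- Pullback of sections is a right action: read as composition of functions, the order of `g` and
`h` is reversed. -/
lemma gEnd_mul (g h : G) : gEnd hp F (g * h) = gEnd hp F g ≫ gEnd hp F h :=
  modHom_ext fun W s ↦ dirSec_injective <| by
    refine (dirSec_gEnd hp F (g * h) s).trans ?_
    refine Eq.trans ?_ (dirSec_gEnd hp F h (secMap (gEnd hp F g) W s)).symm
    rw [dirSec_gEnd, GSheaf.pull_mul, GSheaf.pull_res, res_res, res_res]

/-- Multiplication by a function as an endomorphism of a direct image. -/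
def fnEnd (p : X ⟶ Y) (M : X.Modules) (r : Γ(X, ⊤)) :
    (Scheme.Modules.pushforward p).obj M ⟶ (Scheme.Modules.pushforward p).obj M :=
  (Scheme.Modules.pushforward p).map (scale M r)

lemma dirSec_fnEnd (M : X.Modules) (r : Γ(X, ⊤)) {W : Y.Opens}
    (s : Γ((Scheme.Modules.pushforward p).obj M, W)) :
    dirSec (secMap (fnEnd p M r) W s) = resO (le_top : p ⁻¹ᵁ W ≤ ⊤) r • dirSec s := rfl

lemma secMap_scale (M : X.Modules) (r : Γ(X, ⊤)) {U : X.Opens} (s : Γ(M, U)) :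
    secMap (scale M r) U s = resO (le_top : U ≤ ⊤) r • s := rfl

/-- The pullback of global functions. -/
def actTop (a : G →* End X) (g : G) : Γ(X, ⊤) →+* Γ(X, ⊤) := actO a g

lemma actO_resO_top (g : G) {U : X.Opens} (r : Γ(X, ⊤)) :
    actO a g (resO (le_top : U ≤ ⊤) r) = resO le_top (actTop a g r) := actO_res a g le_top r

lemma fnEnd_gEnd (g : G) (r : Γ(X, ⊤)) :
    fnEnd p F.sheaf r ≫ gEnd hp F g = gEnd hp F g ≫ fnEnd p F.sheaf (actTop a g r) :=
  modHom_ext fun W s ↦ dirSec_injective <| by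
    refine (dirSec_gEnd hp F g (secMap (fnEnd p F.sheaf r) W s)).trans ?_
    refine Eq.trans ?_ (dirSec_fnEnd F.sheaf _ (secMap (gEnd hp F g) W s)).symm
    rw [dirSec_gEnd, dirSec_fnEnd, GSheaf.pull_smul, res_smul, actO_resO_top, resO_resO]

lemma secMap_invImDesc {M : X.Modules} {N : Y.Modules} (φ : N ⟶ (Scheme.Modules.pushforward p).obj M) {W : Y.Opens}
    (s : Γ(N, W)) : secMap (invImDesc φ) (p ⁻¹ᵁ W) (eta p N s) = secMap φ W s := invImDesc_eta φ s

/-- The inverse image of an equivariant sheaf's direct image, with its equivariant structure. -/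
def invImAct (g : G) : invIm p ((Scheme.Modules.pushforward p).obj F.sheaf) ⟶
    (push a g).obj (invIm p ((Scheme.Modules.pushforward p).obj F.sheaf)) :=
  invImDesc (M := (push a g).obj (invIm p ((Scheme.Modules.pushforward p).obj F.sheaf))) (mkHom
    (fun W s ↦ secDir (M := (push a g).obj (invIm p ((Scheme.Modules.pushforward p).obj F.sheaf)))
      (secDir (p := a g) (res (invIm p ((Scheme.Modules.pushforward p).obj F.sheaf)) (preimage_act hp g W).le
      (eta p _ (secMap (gEnd hp F g) W s)))))
    (fun W s t ↦ by rw [map_add, map_add, map_add, map_add, map_add])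
    (fun W r s ↦ by
      rw [secMap_smul, eta_smul, res_smul, ← actO_pullO hp]
      rfl)
    (fun V W h s ↦ by
      have e := res_res (invIm p ((Scheme.Modules.pushforward p).obj F.sheaf))
        (preimage_le a g (preimage_mono p h)) (preimage_act hp g W).le
        (eta p _ (secMap (gEnd hp F g) W s))
      rw [secMap_res, eta_res, res_res]
      exact e.symm))

lemma invImAct_eta (g : G) {W : Y.Opens} (s : Γ((Scheme.Modules.pushforward p).obj F.sheaf, W)) :
    ((invImAct hp F g).app (p ⁻¹ᵁ W)).hom (eta p _ s) =
      res (invIm p ((Scheme.Modules.pushforward p).obj F.sheaf)) (preimage_act hp g W).le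
        (eta p _ (secMap (gEnd hp F g) W s)) :=
  invImDesc_eta _ s

lemma invImAct_res_eta (g : G) {W : Y.Opens} {V : X.Opens} (h : V ≤ p ⁻¹ᵁ W)
    (s : Γ((Scheme.Modules.pushforward p).obj F.sheaf, W)) :
    ((invImAct hp F g).app V).hom (res _ h (eta p _ s)) =
      res (invIm p ((Scheme.Modules.pushforward p).obj F.sheaf))
        ((preimage_le a g h).trans (preimage_act hp g W).le)
        (eta p _ (secMap (gEnd hp F g) W s)) := by
  refine (app_res (invImAct hp F g) h _).trans ?_
  rw [invImAct_eta]
  exact res_res (invIm p ((Scheme.Modules.pushforward p).obj F.sheaf)) (preimage_le a g h) _ _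

/-- The inverse image of the direct image of an equivariant sheaf. -/
def invImG : GSheaf a where
  sheaf := invIm p ((Scheme.Modules.pushforward p).obj F.sheaf)
  act := invImAct hp F
  act_one := invIm_hom_ext fun W s ↦ by
    rw [pushOne_app, invImAct_eta, gEnd_one]
    rfl
  act_mul g h := invIm_hom_ext fun W s ↦ by
    rw [Scheme.Modules.Hom.comp_app, Scheme.Modules.Hom.comp_app, pushMul_app, invImAct_eta,
      gEnd_mul]
    have e1 := invImAct_eta hp F g s
    have e2 := invImAct_res_eta hp F h (preimage_act hp g W).le (secMap (gEnd hp F g) W s)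
    refine Eq.trans ?_ (congrArg (res (invIm p ((Scheme.Modules.pushforward p).obj F.sheaf))
      (preimage_mul a g h (p ⁻¹ᵁ W)).le)
      ((congrArg (fun x ↦ ((invImAct hp F h).app ((a g) ⁻¹ᵁ p ⁻¹ᵁ W)).hom x) e1).trans e2)).symm
    rw [res_res]
    rfl

/-- The pullback of sections of the inverse image. -/
def invPull (g : G) {U : X.Opens} : Γ(invIm p ((Scheme.Modules.pushforward p).obj F.sheaf), U) →+
    Γ(invIm p ((Scheme.Modules.pushforward p).obj F.sheaf), (a g) ⁻¹ᵁ U) := (invImG hp F).pull g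

lemma invPull_smul (g : G) {U : X.Opens} (r : Γ(X, U))
    (s : Γ(invIm p ((Scheme.Modules.pushforward p).obj F.sheaf), U)) :
    invPull hp F g (r • s) = actO a g r • invPull hp F g s := (invImG hp F).pull_smul g r s

lemma invPull_eta (g : G) {W : Y.Opens} (s : Γ((Scheme.Modules.pushforward p).obj F.sheaf, W)) :
    invPull hp F g (eta p _ s) =
      res (invIm p ((Scheme.Modules.pushforward p).obj F.sheaf)) (preimage_act hp g W).le
        (eta p _ (secMap (gEnd hp F g) W s)) := invImAct_eta hp F g s

/-- The counit as a morphism of sheaves. -/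
def counit (p : X ⟶ Y) (M : X.Modules) : invIm p ((Scheme.Modules.pushforward p).obj M) ⟶ M :=
  invImDesc (𝟙 ((Scheme.Modules.pushforward p).obj M))

lemma secMap_counit (M : X.Modules) {W : Y.Opens} (s : Γ((Scheme.Modules.pushforward p).obj M, W)) :
    secMap (counit p M) (p ⁻¹ᵁ W) (eta p _ s) = dirSec s :=
  secMap_invImDesc (M := M) (𝟙 ((Scheme.Modules.pushforward p).obj M)) s

/-- The counit as a morphism of equivariant sheaves. -/
def counitG : invImG hp F ⟶ F :=
  GSheaf.Hom.mk (counit p F.sheaf) fun g ↦ invIm_hom_ext fun W s ↦ by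
    have e1 : secMap (counit p F.sheaf) ((a g) ⁻¹ᵁ p ⁻¹ᵁ W) (invPull hp F g (eta p _ s)) =
        F.pull g (secMap (counit p F.sheaf) (p ⁻¹ᵁ W) (eta p _ s)) := by
      rw [invPull_eta, secMap_res, secMap_counit, secMap_counit, dirSec_gEnd, res_res, res_self]
    exact e1

/-- The inverse image of a homomorphism. -/
def invImMap {N N' : Y.Modules} (φ : N ⟶ N') : invIm p N ⟶ invIm p N' :=
  invImDesc (φ ≫ (Scheme.Modules.pullbackPushforwardAdjunction p).unit.app N')

lemma secMap_invImMap {N N' : Y.Modules} (φ : N ⟶ N') {W : Y.Opens} (s : Γ(N, W)) :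
    secMap (invImMap (p := p) φ) (p ⁻¹ᵁ W) (eta p N s) = eta p N' (secMap φ W s) :=
  secMap_invImDesc _ s

/-- The difference of the actions of a function on the inverse image of a direct image. -/
def delta (p : X ⟶ Y) (M : X.Modules) (r : Γ(X, ⊤)) :
    invIm p ((Scheme.Modules.pushforward p).obj M) ⟶ invIm p ((Scheme.Modules.pushforward p).obj M) :=
  scale _ r - invImMap (fnEnd p M r)

lemma secMap_sub {M E : X.Modules} (f g : M ⟶ E) (U : X.Opens) :
    secMap (f - g) U = secMap f U - secMap g U := rfl

lemma secMap_delta (M : X.Modules) (r : Γ(X, ⊤)) {W : Y.Opens}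
    (s : Γ((Scheme.Modules.pushforward p).obj M, W)) :
    secMap (delta p M r) (p ⁻¹ᵁ W) (eta p _ s) =
      resO (le_top : p ⁻¹ᵁ W ≤ ⊤) r • eta p _ s - eta p _ (secMap (fnEnd p M r) W s) := by
  rw [delta, secMap_sub, AddMonoidHom.sub_apply, secMap_invImMap]
  rfl

lemma delta_counit (M : X.Modules) (r : Γ(X, ⊤)) : delta p M r ≫ counit p M = 0 :=
  invIm_hom_ext fun W s ↦ by
    change secMap (counit p M) (p ⁻¹ᵁ W) (secMap (delta p M r) (p ⁻¹ᵁ W) (eta p _ s)) = 0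
    rw [secMap_delta, map_sub, secMap_counit, secMap_smul, secMap_counit, dirSec_fnEnd, sub_self]

lemma scale_comp {M E : X.Modules} (φ : M ⟶ E) (r : Γ(X, ⊤)) : scale M r ≫ φ = φ ≫ scale E r :=
  modHom_ext fun _ s ↦ secMap_smul φ _ s

lemma fnEnd_comm (M : X.Modules) (r r' : Γ(X, ⊤)) :
    fnEnd p M r ≫ fnEnd p M r' = fnEnd p M r' ≫ fnEnd p M r := by
  rw [fnEnd, fnEnd, ← Functor.map_comp, ← Functor.map_comp, scale_comp]

lemma invImMap_comp {N N' N'' : Y.Modules} (φ : N ⟶ N') (ψ : N' ⟶ N'') :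
    invImMap (p := p) φ ≫ invImMap ψ = invImMap (φ ≫ ψ) := invIm_hom_ext fun W s ↦ by
  change secMap (invImMap ψ) (p ⁻¹ᵁ W) (secMap (invImMap φ) (p ⁻¹ᵁ W) (eta p _ s)) =
    secMap (invImMap (φ ≫ ψ)) (p ⁻¹ᵁ W) (eta p _ s)
  rw [secMap_invImMap, secMap_invImMap, secMap_invImMap, secMap_comp]

lemma delta_comm (M : X.Modules) (r r' : Γ(X, ⊤)) :
    delta p M r ≫ delta p M r' = delta p M r' ≫ delta p M r := by
  rw [delta, delta]
  simp only [Preadditive.sub_comp, Preadditive.comp_sub, invImMap_comp, fnEnd_comm M r r',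
    scale_comp (scale _ r) r', scale_comp (invImMap _)]
  abel

lemma delta_act (g : G) (r : Γ(X, ⊤)) : delta p F.sheaf r ≫ invImAct hp F g =
    invImAct hp F g ≫ (push a g).map (delta p F.sheaf (actTop a g r)) :=
  invIm_hom_ext fun W s ↦ by
    have e1 : invPull hp F g (secMap (delta p F.sheaf r) (p ⁻¹ᵁ W) (eta p _ s)) =
        secMap (delta p F.sheaf (actTop a g r)) ((a g) ⁻¹ᵁ p ⁻¹ᵁ W)
          (invPull hp F g (eta p _ s)) := by
      rw [secMap_delta, map_sub, invPull_smul, invPull_eta, invPull_eta, actO_resO_top,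
        secMap_res, secMap_delta, map_sub, res_smul, resO_resO, ← secMap_comp, ← secMap_comp,
        fnEnd_gEnd]
    exact e1

lemma delta_add (M : X.Modules) (r r' : Γ(X, ⊤)) : delta p M (r + r') = delta p M r + delta p M r' :=
  invIm_hom_ext fun W s ↦ by
    change secMap (delta p M (r + r')) (p ⁻¹ᵁ W) (eta p _ s) =
      secMap (delta p M r + delta p M r') (p ⁻¹ᵁ W) (eta p _ s)
    rw [secMap_add, AddMonoidHom.add_apply, secMap_delta, secMap_delta, secMap_delta, map_add,
      add_smul]
    have e : secMap (fnEnd p M (r + r')) W s = secMap (fnEnd p M r) W s + secMap (fnEnd p M r') W s :=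
      dirSec_injective <| by
        rw [map_add, dirSec_fnEnd, dirSec_fnEnd, dirSec_fnEnd, map_add, add_smul]
    rw [e, map_add]
    abel

/-- The pullback of global functions from the base. -/
def pullTop (p : X ⟶ Y) : Γ(Y, ⊤) →+* Γ(X, ⊤) := pullO (W := ⊤) p

lemma resO_pullTop (c : Γ(Y, ⊤)) {W : Y.Opens} :
    resO (le_top : p ⁻¹ᵁ W ≤ ⊤) (pullTop p c) = pullO p (resO (le_top : W ≤ ⊤) c) :=
  (pullO_res p (le_top : W ≤ ⊤) c).symm

/-- Functions from `Y` act identically through both factors, so the difference operator is linear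
over them. With `delta_add` this makes the operators of the coordinates transform by the matrix of
`g`. -/
lemma delta_pullTop_mul (M : X.Modules) (c : Γ(Y, ⊤)) (r : Γ(X, ⊤)) :
    delta p M (pullTop p c * r) = delta p M r ≫ scale _ (pullTop p c) :=
  invIm_hom_ext fun W s ↦ by
    change secMap (delta p M (pullTop p c * r)) (p ⁻¹ᵁ W) (eta p _ s) =
      resO (le_top : p ⁻¹ᵁ W ≤ ⊤) (pullTop p c) • secMap (delta p M r) (p ⁻¹ᵁ W) (eta p _ s)
    rw [secMap_delta, secMap_delta, smul_sub, smul_smul, ← map_mul, resO_pullTop, ← eta_smul]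
    congr 2
    refine dirSec_injective ?_
    rw [dirSec_smul, dirSec_fnEnd, dirSec_fnEnd, map_mul, resO_pullTop, mul_smul]

end EquivariantInverseImage

/-! ### Difference operators as variables of a polynomial module -/

section ExtendedModules

variable {n : ℕ} {Y : Scheme.{0}} {W : Y.Opens}

/-- The dual basis of extended elements shows that `Γ` consists of polynomials with coefficients in
`M`. The operators `T k` are extended from `M` and commute with the variables, so `bijective_sub`
allows the variables to be replaced by the differences. -/
lemma exists_isEval_of_dualBasis (hW : IsAffineOpen W) {M Γ : Type*} [AddCommGroup M]
    [AddCommGroup Γ] [Module Γ(Y, W) M] [Module Γ(𝔸(Fin n; Y), (𝔸(Fin n; Y) ↘ Y) ⁻¹ᵁ W) Γ]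
    (η : M →+ Γ) (hη : ∀ (c : Γ(Y, W)) m, η (c • m) = pullO (𝔸(Fin n; Y) ↘ Y) c • η m)
    {κ : Type*} [Fintype κ] (e : κ → M) (φ : κ → M →+ Γ(Y, W))
    (Φ : κ → Γ →ₗ[Γ(𝔸(Fin n; Y), (𝔸(Fin n; Y) ↘ Y) ⁻¹ᵁ W)]
      Γ(𝔸(Fin n; Y), (𝔸(Fin n; Y) ↘ Y) ⁻¹ᵁ W))
    (hΦ : ∀ k m, Φ k (η m) = pullO (𝔸(Fin n; Y) ↘ Y) (φ k m)) (he : ∀ γ, γ = ∑ k, Φ k γ • η (e k))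
    (hφ : ∀ m, (∀ k, φ k m = 0) → m = 0) {x : Fin n → M →+ M} {T : Fin n → Γ →+ Γ}
    (hx : ∀ k l m, x k (x l m) = x l (x k m)) (hT : ∀ k l γ, T k (T l γ) = T l (T k γ))
    (hTt : ∀ k l γ, T k (coordOn (n := n) W l • γ) = coordOn (n := n) W l • T k γ)
    (hxT : ∀ k m, η (x k m) = T k (η m)) :
    ∃ Ψ, IsEval (fun k ↦ DistribSMul.toAddMonoidHom Γ (coordOn (n := n) W k) - T k) η Ψ ∧
      Function.Bijective Ψ := by
  obtain ⟨Θ, hΘ, hΘb⟩ := exists_isEval_functions (n := n) hW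
  obtain ⟨Ψ, hΨ⟩ := IsEval.exists
    (T := fun k ↦ DistribSMul.toAddMonoidHom Γ (coordOn (n := n) W k))
    (fun k l γ ↦ smul_comm (coordOn (n := n) W k) (coordOn (n := n) W l) γ) η
  have hb := IsEval.bijective_of_dualBasis hΘ hΘb hη hΨ e φ Φ hΦ he hφ
  obtain ⟨Ψ', hΨ'⟩ := IsEval.exists
    (T := fun k ↦ DistribSMul.toAddMonoidHom Γ (coordOn (n := n) W k) - T k)
    (fun k l γ ↦ by
      change coordOn (n := n) W k • (coordOn (n := n) W l • γ - T l γ) - T k (coordOn (n := n) W l • γ - T l γ) =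
        coordOn (n := n) W l • (coordOn (n := n) W k • γ - T k γ) - T l (coordOn (n := n) W k • γ - T k γ)
      rw [map_sub, map_sub, hTt, hTt, hT k l, smul_sub, smul_sub, smul_comm (coordOn (n := n) W k) (coordOn (n := n) W l)]
      abel) η
  exact ⟨Ψ', hΨ', hΨ.bijective_sub hb hx hTt hxT hΨ'⟩

variable (M : 𝔸(Fin n; Y).Modules)

/-- The operators whose Koszul complex resolves a sheaf. -/
def diff (k : Fin n) : invIm (𝔸(Fin n; Y) ↘ Y) (dirIm M) ⟶ invIm (𝔸(Fin n; Y) ↘ Y) (dirIm M) :=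
  delta (𝔸(Fin n; Y) ↘ Y) M (AffineSpace.coord Y k)

/-- The endomorphism of the direct image given by a coordinate. -/
def coordEnd (k : Fin n) : dirIm M ⟶ dirIm M := fnEnd (𝔸(Fin n; Y) ↘ Y) M (AffineSpace.coord Y k)

lemma secMap_diff (k : Fin n) {U : 𝔸(Fin n; Y).Opens}
    (s : Γ(invIm (𝔸(Fin n; Y) ↘ Y) (dirIm M), U)) : secMap (diff M k) U s =
      resO (le_top : U ≤ ⊤) (AffineSpace.coord Y k) • s - secMap (invImMap (coordEnd M k)) U s := rfl

lemma invImMap_coordEnd_comm (k l : Fin n) :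
    invImMap (p := 𝔸(Fin n; Y) ↘ Y) (coordEnd M k) ≫ invImMap (coordEnd M l) =
      invImMap (coordEnd M l) ≫ invImMap (coordEnd M k) := by
  rw [invImMap_comp, invImMap_comp, coordEnd, coordEnd, fnEnd_comm]

variable {M}

lemma exists_isEval_diff (hW : IsAffineOpen W) (H : HasDualBasis (dirIm M) W) :
    ∃ Ψ, IsEval (fun k ↦ secMap (diff M k) ((𝔸(Fin n; Y) ↘ Y) ⁻¹ᵁ W))
      (eta (𝔸(Fin n; Y) ↘ Y) (dirIm M) (W := W)) Ψ ∧ Function.Bijective Ψ := by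
  obtain ⟨κ, _, e, c, H⟩ := H
  refine exists_isEval_of_dualBasis hW (eta (𝔸(Fin n; Y) ↘ Y) (dirIm M) (W := W)) (eta_smul _ _) e
    (fun k ↦ toFun.comp (ev (c k) le_rfl))
    (fun k ↦ { toFun := fun s ↦ toFun (ev (extend (𝔸(Fin n; Y) ↘ Y) (c k)) le_rfl s)
               map_add' := fun s t ↦ by rw [map_add, map_add]
               map_smul' := fun r s ↦ ev_smul (extend (𝔸(Fin n; Y) ↘ Y) (c k)) le_rfl r s })
    (fun k m ↦ ev_extend (c k) le_rfl m) (fun γ ↦ ?_) (fun m hm ↦ ?_)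
    (x := fun k ↦ secMap (coordEnd M k) W)
    (T := fun k ↦ secMap (invImMap (coordEnd M k)) ((𝔸(Fin n; Y) ↘ Y) ⁻¹ᵁ W))
    (fun k l m ↦ ?_) (fun k l γ ↦ ?_) (fun k l γ ↦ secMap_smul _ _ _)
    (fun k m ↦ (secMap_invImMap _ _).symm)
  · have := invIm_dualBasis H _ le_rfl γ
    simp only [res_self] at this
    exact this
  · rw [H W le_rfl m]
    refine Finset.sum_eq_zero fun k _ ↦ ?_
    have : toFun (ev (c k) le_rfl m) = 0 := hm k
    rw [this, zero_smul]
  · rw [← secMap_comp, ← secMap_comp, coordEnd, coordEnd, fnEnd_comm]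
  · rw [← secMap_comp, ← secMap_comp, invImMap_coordEnd_comm]

lemma extend_localPre {X' Y' : Scheme.{u}} {p : X' ⟶ Y'} {N N' : Y'.Modules} (φ : N' ⟶ N) {W : Y'.Opens}
    (c : localHom N (structureSheaf Y') W) :
    extend p (localPre φ _ c) = localPre (invImMap φ) _ (extend p c) :=
  invIm_localHom_ext' fun V hV s ↦ toFun_injective <| by
    rw [ev_extend _ hV, ev_localPre, ev_localPre]
    have e := secMap_invImMap (p := p) φ s
    refine (ev_extend c hV ((φ.app V).hom s)).symm.trans ?_
    exact congrArg (fun s ↦ toFun (ev (extend p c) (preimage_mono p hV) s)) e.symm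

/-- For functionals on the inverse image the coefficients are functionals on the direct image. The
argument is that of `exists_isEval_diff` with basis and coordinates exchanged, using that extension
of functionals commutes with transposes. -/
lemma exists_isEval_precomp_diff (hW : IsAffineOpen W) (H : HasDualBasis (dirIm M) W) :
    ∃ Ψ, IsEval (fun k ↦ secMap (precomp (diff M k) (structureSheaf _)) ((𝔸(Fin n; Y) ↘ Y) ⁻¹ᵁ W))
      (ofLocal.comp (extend (𝔸(Fin n; Y) ↘ Y) (N := dirIm M) (W₀ := W))) Ψ ∧ Function.Bijective Ψ := by
  obtain ⟨κ, _, e, c, H⟩ := H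
  let L := localHom (invIm (𝔸(Fin n; Y) ↘ Y) (dirIm M)) (structureSheaf _) ((𝔸(Fin n; Y) ↘ Y) ⁻¹ᵁ W)
  let T (k : Fin n) : L →+ L := ⟨⟨localPre (invImMap (coordEnd M k)) _, rfl⟩, fun _ _ ↦ rfl⟩
  have hT (k : Fin n) : (DistribSMul.toAddMonoidHom L (coordOn (n := n) W k) - T k : L →+ L) =
      secMap (precomp (diff M k) (structureSheaf _)) ((𝔸(Fin n; Y) ↘ Y) ⁻¹ᵁ W) := by
    refine AddMonoidHom.ext fun φ ↦ localHom_ext fun V hV s ↦ ?_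
    change resO hV (coordOn (n := n) W k) • ev φ hV s - ev φ hV (secMap (invImMap (coordEnd M k)) V s) =
      ev φ hV (secMap (diff M k) V s)
    rw [secMap_diff, map_sub, ev_smul]
    congr 2
    exact resO_resO _ _ _
  have key := exists_isEval_of_dualBasis (Γ := L) hW
    (extend (𝔸(Fin n; Y) ↘ Y) (N := dirIm M) (W₀ := W)) extend_smul c
    (fun k ↦ ⟨⟨fun c ↦ toFun (ev c le_rfl (e k)), rfl⟩, fun _ _ ↦ rfl⟩)
    (fun k ↦ { toFun := fun φ ↦ toFun (ev φ le_rfl (eta _ _ (e k)))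
               map_add' := fun s t ↦ rfl
               map_smul' := fun r s ↦ by
                 rw [ev_smul_left, resO_self]
                 rfl })
    (fun k m ↦ ev_extend m le_rfl (e k)) (fun γ ↦ ?_) (fun m hm ↦ ?_)
    (x := fun k ↦ ⟨⟨localPre (coordEnd M k) _, rfl⟩, fun _ _ ↦ rfl⟩) (T := T)
    (fun k l m ↦ ?_) (fun k l γ ↦ ?_) (fun k l γ ↦ rfl)
    (fun k m ↦ extend_localPre (coordEnd M k) m)
  · simp only [hT] at key
    exact key
  · refine localHom_ext fun V hV s ↦ ?_
    let e' : L →+ Γ(structureSheaf _, V) := ⟨⟨fun φ ↦ ev φ hV s, rfl⟩, fun _ _ ↦ rfl⟩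
    refine Eq.trans ?_ (map_sum e' _ Finset.univ).symm
    conv_lhs => rw [invIm_dualBasis H V hV s, map_sum]
    refine Finset.sum_congr rfl fun k _ ↦ ?_
    rw [ev_smul, ev_res γ le_rfl hV]
    exact mul_comm (toFun (ev (extend (𝔸(Fin n; Y) ↘ Y) (c k)) hV s))
      (toFun (res (structureSheaf 𝔸(Fin n; Y)) hV (ev γ le_rfl (eta _ _ (e k)))))
  · refine localHom_ext fun V hV s ↦ ?_
    refine Eq.trans ?_ (ev_zero hV s).symm
    rw [H V hV s, map_sum]
    refine Finset.sum_eq_zero fun k _ ↦ ?_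
    have h0 : ev m le_rfl (e k) = 0 := hm k
    rw [ev_smul, ev_res m le_rfl hV, h0, map_zero, smul_zero]
  · refine localHom_ext fun V hV s ↦ ?_
    change ev m hV (secMap (coordEnd M k ≫ coordEnd M l) V s) =
      ev m hV (secMap (coordEnd M l ≫ coordEnd M k) V s)
    rw [coordEnd, coordEnd, fnEnd_comm]
  · refine localHom_ext fun V hV s ↦ ?_
    change ev γ hV (secMap (invImMap (coordEnd M k) ≫ invImMap (coordEnd M l)) V s) =
      ev γ hV (secMap (invImMap (coordEnd M l) ≫ invImMap (coordEnd M k)) V s)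
    rw [invImMap_coordEnd_comm]

/-- Modulo the ranges `s` is a pulled back section `m`. The counit kills the ranges and sends the
pullback of `m` to `m`, which therefore vanishes. -/
lemma mem_opRange_of_counit (hW : IsAffineOpen W) (H : HasDualBasis (dirIm M) W)
    (s : Γ(invIm (𝔸(Fin n; Y) ↘ Y) (dirIm M), (𝔸(Fin n; Y) ↘ Y) ⁻¹ᵁ W))
    (hs : secMap (counit (𝔸(Fin n; Y) ↘ Y) M) _ s = 0) :
    s ∈ opRange (fun k ↦ secMap (diff M k) ((𝔸(Fin n; Y) ↘ Y) ⁻¹ᵁ W)) n := by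
  obtain ⟨Ψ, hΨ, hb⟩ := exists_isEval_diff hW H
  obtain ⟨m, hm⟩ := hΨ.exists_sub_mem hb s
  have h1 : opRange (fun k ↦ secMap (diff M k) ((𝔸(Fin n; Y) ↘ Y) ⁻¹ᵁ W)) n ≤
      (secMap (counit (𝔸(Fin n; Y) ↘ Y) M) ((𝔸(Fin n; Y) ↘ Y) ⁻¹ᵁ W)).ker :=
    opRange_le fun k _ ω ↦ by
      rw [AddMonoidHom.mem_ker, ← secMap_comp, diff, delta_counit]
      rfl
  have h2 := h1 hm
  rw [AddMonoidHom.mem_ker, map_sub, hs, secMap_counit, zero_sub, neg_eq_zero] at h2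
  rw [show m = 0 from dirSec_injective (h2.trans (map_zero _).symm), map_zero, sub_zero] at hm
  exact hm

end ExtendedModules

/-! ### The Koszul resolution of a gnat-family -/

section GnatResolution

variable {n : ℕ} {Y : Scheme.{0}} {f : Y ⟶ Spec (.of ℂ)}
  {G : Subgroup (Matrix.SpecialLinearGroup (Fin n) ℂ)}

lemma linearAct_over (g : G) :
    (linearAct f G g : 𝔸(Fin n; Y) ⟶ 𝔸(Fin n; Y)) ≫ (𝔸(Fin n; Y) ↘ Y) = 𝔸(Fin n; Y) ↘ Y :=
  matrixAct_over f g.1.1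

lemma linearAct_over' (g : G) : (linearAct f G g : 𝔸(Fin n; Y) ⟶ 𝔸(Fin n; Y)) ≫
    ((𝔸(Fin n; Y) ↘ Y) ≫ f) = (𝔸(Fin n; Y) ↘ Y) ≫ f := by
  rw [← Category.assoc, linearAct_over]

/-- The action on the linear forms. -/
def formRep (G : Subgroup (Matrix.SpecialLinearGroup (Fin n) ℂ)) :
    G →* Matrix (Fin n) (Fin n) ℂ where
  toFun g := (g⁻¹).1.1.transpose
  map_one' := by simp
  map_mul' g h := by simp [Matrix.transpose_mul]

lemma det_formRep (g : G) : (formRep G g).det = 1 :=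
  (Matrix.det_transpose _).trans (g⁻¹).1.2

lemma sum_formRep (g : G) (v : Fin n → ℂ) (j : Fin n) :
    ∑ k, (formRep G g).mulVec v k * g.1.1 k j = v j := by
  have e : g.1.1.transpose * formRep G g = 1 := by
    change g.1.1.transpose * ((g⁻¹).1.1).transpose = 1
    rw [← Matrix.transpose_mul]
    have : (g⁻¹).1.1 * g.1.1 = 1 := by
      have := congrArg (fun x : G ↦ x.1.1) (inv_mul_cancel g)
      exact this
    rw [this, Matrix.transpose_one]
  have e1 := congrArg (fun A : Matrix (Fin n) (Fin n) ℂ ↦ A.mulVec v j) e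
  simp only [← Matrix.mulVec_mulVec, Matrix.one_mulVec] at e1
  rw [← e1]
  exact Finset.sum_congr rfl fun k _ ↦ mul_comm _ _

variable (F : GSheaf (linearAct f G))

/-- The first term of the resolution of an equivariant sheaf. -/
def resG : GSheaf (linearAct f G) := invImG linearAct_over F

/-- The operators on the first term of the resolution. -/
def diffG (k : Fin n) : (resG F).sheaf ⟶ (resG F).sheaf := diff F.sheaf k

lemma pullTop_scalars (c : ℂ) : pullTop (𝔸(Fin n; Y) ↘ Y) (scalars f ⊤ c) =
    scalars ((𝔸(Fin n; Y) ↘ Y) ≫ f) ⊤ c := appTop_scalars (𝔸(Fin n; Y) ↘ Y) f _ rfl _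

lemma scale_pullTop_scalars (M : 𝔸(Fin n; Y).Modules) (c : ℂ) {U : 𝔸(Fin n; Y).Opens} (s : Γ(M, U)) :
    secMap (scale M (pullTop (𝔸(Fin n; Y) ↘ Y) (scalars f ⊤ c))) U s =
      scalars ((𝔸(Fin n; Y) ↘ Y) ≫ f) U c • s := by
  rw [secMap_scale, pullTop_scalars, resO_scalars]

lemma actTop_coord (g : G) (k : Fin n) : actTop (linearAct f G) g (AffineSpace.coord Y k) =
    ∑ j, pullTop (𝔸(Fin n; Y) ↘ Y) (scalars f ⊤ (g.1.1 k j)) * AffineSpace.coord Y j := by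
  refine (matrixAct_coord f g.1.1 k).trans (Finset.sum_congr rfl fun j _ ↦ ?_)
  congr 1
  exact (pullTop_scalars _).symm

lemma delta_sum {X Y : Scheme.{u}} {p : X ⟶ Y} (M : X.Modules) {ι : Type*} [Fintype ι]
    (r : ι → Γ(X, ⊤)) : delta p M (∑ i, r i) = ∑ i, delta p M (r i) :=
  map_sum (AddMonoidHom.mk' (fun r ↦ delta p M r) (delta_add M)) r Finset.univ

lemma invPull_diff (g : G) (k : Fin n) {U : 𝔸(Fin n; Y).Opens}
    (s : Γ(invIm (𝔸(Fin n; Y) ↘ Y) (dirIm F.sheaf), U)) :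
    invPull linearAct_over F g (secMap (diff F.sheaf k) U s) =
      ∑ j, scalars ((𝔸(Fin n; Y) ↘ Y) ≫ f) ((linearAct f G g) ⁻¹ᵁ U) (g.1.1 k j) • secMap (diff F.sheaf j) _
        (invPull linearAct_over F g s) := by
  have e : invPull linearAct_over F g (secMap (diff F.sheaf k) U s) =
      secMap (delta (𝔸(Fin n; Y) ↘ Y) F.sheaf (actTop (linearAct f G) g (AffineSpace.coord Y k)))
        ((linearAct f G g) ⁻¹ᵁ U) (invPull linearAct_over F g s) :=
    congrArg (fun φ ↦ secMap φ U s) (delta_act linearAct_over F g (AffineSpace.coord Y k))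
  rw [e, actTop_coord, delta_sum, secMap_sum]
  refine Finset.sum_congr rfl fun j _ ↦ ?_
  rw [delta_pullTop_mul, secMap_comp, scale_pullTop_scalars]
  rfl

/-- The operators transform by the matrix of `g` and the vector by its inverse transpose, so the
contraction of the two is invariant. This is the equivariance of the Koszul differential. -/
lemma cpull_opAt_diff (g : G) (U : 𝔸(Fin n; Y).Opens) (v : Fin n → ℂ)
    (x : CSec ((𝔸(Fin n; Y) ↘ Y) ≫ f) (resG F).sheaf U) :
    cpull linearAct_over' (resG F) g U (opAt (cops ((𝔸(Fin n; Y) ↘ Y) ≫ f) (diffG F) U)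
      ((formRep G g).mulVec v) x) = opAt (cops ((𝔸(Fin n; Y) ↘ Y) ≫ f) (diffG F)
        ((linearAct f G g) ⁻¹ᵁ U)) v (cpull linearAct_over' (resG F) g U x) := by
  rw [opAt_apply, opAt_apply, map_sum]
  have e (k : Fin n) : cpull linearAct_over' (resG F) g U
      (cops ((𝔸(Fin n; Y) ↘ Y) ≫ f) (diffG F) U k x) =
      ∑ j, g.1.1 k j • cops ((𝔸(Fin n; Y) ↘ Y) ≫ f) (diffG F) ((linearAct f G g) ⁻¹ᵁ U) j
        (cpull linearAct_over' (resG F) g U x) := invPull_diff F g k x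
  simp_rw [map_smul, e, Finset.smul_sum, smul_smul]
  rw [Finset.sum_comm]
  refine Finset.sum_congr rfl fun j _ ↦ ?_
  rw [← Finset.sum_smul, sum_formRep]

/-- The equivariant sheaf representing the dual of a family. -/
def dualG : GSheaf (linearAct f G) :=
  cokernel (GSheaf.homPre (koszG (P := resG F) (B := formRep G) linearAct_over' (cpull_opAt_diff F) 0)
    (structureGSheaf (linearAct f G)))

variable {F}

/-- Over the preimage of an affine open subset of `Y`, the polynomial descriptions of `p^* p_* F`
and of its dual supply both regular sequences, and the constant term computes the kernel of the
counit. -/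
lemma derivedDual_of_gnatFamily [Finite G] [LocallyOfFiniteType f]
    [HasDerivedCategory.{w} (GSheaf (linearAct f G))] (hF : IsGnatFamily F) :
    Nonempty ((derivedDual F)⟦(n : ℤ)⟧ ≅
      (DerivedCategory.Plus.singleFunctor (GSheaf (linearAct f G)) 0).obj (dualG F)) := by
  refine derivedDual_of_koszul linearAct_over' (fun k l ↦ delta_comm F.sheaf _ _)
    (cpull_opAt_diff F) (hB := det_formRep) (counitG linearAct_over F)
    (fun k ↦ delta_counit F.sheaf _) fun x ↦ ?_
  obtain ⟨_, ⟨W, hW, rfl⟩, hx, -⟩ := Y.isBasis_affineOpens.exists_subset_of_mem_open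
    (Set.mem_univ ((𝔸(Fin n; Y) ↘ Y) x)) isOpen_univ
  have H := hF.hasDualBasis hW
  obtain ⟨Ψ, hΨ, hb⟩ := exists_isEval_diff hW H
  obtain ⟨Ψ', hΨ', hb'⟩ := exists_isEval_precomp_diff hW H
  exact ⟨(𝔸(Fin n; Y) ↘ Y) ⁻¹ᵁ W, hx, isAffineOpen_preimage hW, hF.localizing hW, H.invIm,
    hΨ.regSeq hb, hΨ'.regSeq hb', fun t ↦ ⟨eta _ _ (secDir t), secMap_counit F.sheaf (secDir t)⟩,
    fun s hs ↦ mem_opRange_of_counit hW H s hs⟩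

end GnatResolution

/-! ### The first Koszul differential in terms of sections -/

section DegreeZero

variable {X : Scheme.{0}} {q : X ⟶ Spec (.of ℂ)} {n : ℕ} {G : Type} [Group G] {a : G →* End X}

/-- Forms of degree zero. -/
def zeroProj (q : X ⟶ Spec (.of ℂ)) (n : ℕ) (P : X.Modules) : altSheaf q n P 0 ⟶ P :=
  altProj P Fin.elim0

/-- Sections as forms of degree zero. -/
def zeroInj (q : X ⟶ Spec (.of ℂ)) (n : ℕ) (P : X.Modules) : P ⟶ altSheaf q n P 0 :=
  altInj P Fin.elim0

lemma zeroProj_zeroInj (P : X.Modules) : zeroProj q n P ≫ zeroInj q n P = 𝟙 _ := by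
  rw [← sum_altProj_altInj, Fintype.sum_unique]
  rfl

lemma zeroInj_zeroProj (P : X.Modules) : zeroInj q n P ≫ zeroProj q n P = 𝟙 P := by
  have h : Mono (zeroProj q n P) := mono_of_app_injective _ fun U ω ω' h ↦
    altSec_injective (AlternatingMap.ext fun v ↦ by
      have e : v = fun l ↦ Pi.single (Fin.elim0 l) 1 := Subsingleton.elim _ _
      rw [e]
      exact h)
  have e := zeroProj_zeroInj (q := q) (n := n) P
  have hs : IsSplitMono (zeroProj q n P) := ⟨⟨⟨_, e⟩⟩⟩
  have he : Epi (zeroProj q n P) := by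
    refine epi_of_locallyLifts _ fun U s x hx ↦ ⟨U, le_rfl, hx,
      secAlt (AlternatingMap.constOfIsEmpty ℂ (Fin n → ℂ) (Fin 0) (csec q s)), ?_⟩
    rw [res_self]
    rfl
  rw [← cancel_epi (zeroProj q n P), reassoc_of% e, Category.comp_id]

/-- Transposed, this puts the image of the dual differential inside the sum of the ranges of the
transposed operators. Conversely, `zeroProj_comp` factors each transposed operator through the dual
differential. -/
lemma kosz_wedge (P : X.Modules) (D : Fin n → (P ⟶ P)) :
    zeroInj q n P ≫ kosz D 0 = ∑ k, D k ≫ zeroInj q n P ≫ wedge P k 0 := by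
  rw [kosz_eq_sum, Preadditive.comp_sum]
  refine Finset.sum_congr rfl fun k _ ↦ ?_
  have e : wedge (q := q) P k 0 ≫ altPost (D k) 1 = altPost (D k) 0 ≫ wedge P k 0 :=
    altHom_ext fun U ω v ↦ by
      have e1 : altSec (secMap (wedge P k 0 ≫ altPost (D k) 1) U ω) v =
        cmap q (D k) U (wedgeCoord k (altSec ω) v) := rfl
      have e2 : altSec (secMap (altPost (D k) 0 ≫ wedge P k 0) U ω) v =
        wedgeCoord k ((cmap q (D k) U).compAlternatingMap (altSec ω)) v := rfl
      refine e1.trans (Eq.trans ?_ e2.symm)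
      rw [wedgeCoord_apply, wedgeCoord_apply, map_sum]
      refine Finset.sum_congr rfl fun i _ ↦ ?_
      simp
  rw [e, ← Category.assoc, zeroInj, altInj_altPost, Category.assoc]

lemma zeroProj_comp (P : X.Modules) (D : Fin n → (P ⟶ P)) (k : Fin n) :
    zeroProj q n P ≫ D k = kosz D 0 ≫ interior P k 0 ≫ zeroProj q n P := by
  rw [← Category.assoc, kosz_interior_zero]
  rfl

/-- The projection from forms of degree zero as a morphism of equivariant sheaves. -/
def zeroProjG (hq : ∀ g, (a g : X ⟶ X) ≫ q = q) (B : G →* Matrix (Fin n) (Fin n) ℂ) (P : GSheaf a) :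
    altG hq B P 0 ⟶ P :=
  GSheaf.Hom.mk (zeroProj q n P.sheaf) fun g ↦ modHom_ext fun U ω ↦ by
    refine congrArg (fun v ↦ cpull hq P g U (altSec ω v)) ?_
    exact Subsingleton.elim _ _

end DegreeZero

/-! ### Sections of the dual over preimages of affine open subsets -/

section DirectImageOfDual

variable {n : ℕ} {Y : Scheme.{0}} {f : Y ⟶ Spec (.of ℂ)}
  {G : Subgroup (Matrix.SpecialLinearGroup (Fin n) ℂ)} (F : GSheaf (linearAct f G))

/-- The projection onto the dual. -/
def rhoG : GSheaf.homObj (resG F) (structureGSheaf (linearAct f G)) ⟶ dualG F :=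
  GSheaf.homPre (zeroProjG linearAct_over' (formRep G) (resG F)) _ ≫ cokernel.π _

/-- The projection onto the dual as a homomorphism of sheaves. -/
def rho : sheafHom (invIm (𝔸(Fin n; Y) ↘ Y) (dirIm F.sheaf)) (structureSheaf 𝔸(Fin n; Y)) ⟶
    (dualG F).sheaf := (rhoG F).hom

/-- The projection from functionals on forms of degree zero. -/
def dualπ : sheafHom (altSheaf ((𝔸(Fin n; Y) ↘ Y) ≫ f) n (invIm (𝔸(Fin n; Y) ↘ Y) (dirIm F.sheaf)) 0)
    (structureSheaf 𝔸(Fin n; Y)) ⟶ (dualG F).sheaf :=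
  GSheaf.Hom.hom (cokernel.π (GSheaf.homPre (koszG (P := resG F) (B := formRep G) linearAct_over'
    (cpull_opAt_diff F) 0) (structureGSheaf (linearAct f G))))

/-- The transpose of the first Koszul differential. -/
def koszT : sheafHom (altSheaf ((𝔸(Fin n; Y) ↘ Y) ≫ f) n (invIm (𝔸(Fin n; Y) ↘ Y) (dirIm F.sheaf)) 1)
    (structureSheaf 𝔸(Fin n; Y)) ⟶
    sheafHom (altSheaf ((𝔸(Fin n; Y) ↘ Y) ≫ f) n (invIm (𝔸(Fin n; Y) ↘ Y) (dirIm F.sheaf)) 0)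
    (structureSheaf 𝔸(Fin n; Y)) := precomp (kosz (diff F.sheaf) 0) _

lemma koszT_dualπ : koszT F ≫ dualπ F = 0 := congrArg GSheaf.Hom.hom (cokernel.condition
  (GSheaf.homPre (koszG (P := resG F) (B := formRep G) linearAct_over'
    (cpull_opAt_diff F) 0) (structureGSheaf (linearAct f G))))

instance : Epi (dualπ F) := inferInstanceAs (Epi ((GSheaf.forget _).map (cokernel.π
  (GSheaf.homPre (koszG (P := resG F) (B := formRep G) linearAct_over'
    (cpull_opAt_diff F) 0) (structureGSheaf (linearAct f G))))))

lemma koszT_exact : (ShortComplex.mk (koszT F) (dualπ F) (koszT_dualπ F)).Exact :=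
  (ShortComplex.exact_cokernel (GSheaf.homPre (koszG (P := resG F) (B := formRep G) linearAct_over'
    (cpull_opAt_diff F) 0) (structureGSheaf (linearAct f G)))).map (GSheaf.forget _)

lemma rho_eq : rho F = precomp (zeroProj ((𝔸(Fin n; Y) ↘ Y) ≫ f) n _) _ ≫ dualπ F := rfl

lemma precomp_diff_rho (k : Fin n) : precomp (diff F.sheaf k) _ ≫ rho F = 0 := by
  rw [rho_eq, ← Category.assoc, ← precomp_comp, zeroProj_comp, precomp_comp, Category.assoc]
  exact (congrArg (precomp _ _ ≫ ·) (koszT_dualπ F)).trans comp_zero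

variable {F} {W : Y.Opens}

lemma localizing_dualG (hW : IsAffineOpen W) (H : HasDualBasis (dirIm F.sheaf) W) :
    Localizing (dualG F).sheaf ((𝔸(Fin n; Y) ↘ Y) ⁻¹ᵁ W) :=
  localizing_of_exact (koszT_exact F) (isAffineOpen_preimage hW)
    ((H.invIm.altSheaf _ _).hom.localizing (isAffineOpen_preimage hW))
    ((H.invIm.altSheaf _ _).hom.localizing (isAffineOpen_preimage hW))

/-- A section of the cokernel lifts over the affine preimage to a functional on `p^* p_* F`. Modulo
the transposed operators, which die in the cokernel, it is the extension of its constant term `c`.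
-/
lemma exists_rho_eq (hW : IsAffineOpen W) (H : HasDualBasis (dirIm F.sheaf) W)
    (s : Γ((dualG F).sheaf, (𝔸(Fin n; Y) ↘ Y) ⁻¹ᵁ W)) :
    ∃ c : localHom (dirIm F.sheaf) (structureSheaf Y) W,
      secMap (rho F) _ (ofLocal (extend (𝔸(Fin n; Y) ↘ Y) c)) = s := by
  obtain ⟨ψ, hψ⟩ := app_surjective_of_exact (koszT_exact F) (isAffineOpen_preimage hW)
    ((H.invIm.altSheaf _ _).hom.localizing (isAffineOpen_preimage hW))
    ((H.invIm.altSheaf _ _).hom.localizing (isAffineOpen_preimage hW)) s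
  have hψ' : secMap (dualπ F) ((𝔸(Fin n; Y) ↘ Y) ⁻¹ᵁ W) ψ = s := hψ
  let φ := secMap (precomp (zeroInj ((𝔸(Fin n; Y) ↘ Y) ≫ f) n
    (invIm (𝔸(Fin n; Y) ↘ Y) (dirIm F.sheaf))) (structureSheaf _)) ((𝔸(Fin n; Y) ↘ Y) ⁻¹ᵁ W) ψ
  have hφ : secMap (rho F) ((𝔸(Fin n; Y) ↘ Y) ⁻¹ᵁ W) φ = s := by
    have e : precomp (zeroInj ((𝔸(Fin n; Y) ↘ Y) ≫ f) n
      (invIm (𝔸(Fin n; Y) ↘ Y) (dirIm F.sheaf))) (structureSheaf _) ≫ rho F = dualπ F := by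
      rw [rho_eq, ← Category.assoc, ← precomp_comp, zeroProj_zeroInj, precomp_id, Category.id_comp]
    rw [← hψ', ← secMap_comp, e]
  obtain ⟨Ψ, hΨ, hb⟩ := exists_isEval_precomp_diff hW H
  obtain ⟨c, hc⟩ := hΨ.exists_sub_mem hb φ
  refine ⟨c, ?_⟩
  have h1 : opRange (fun k ↦ secMap (precomp (diff F.sheaf k) (structureSheaf _))
      ((𝔸(Fin n; Y) ↘ Y) ⁻¹ᵁ W)) n ≤ (secMap (rho F) ((𝔸(Fin n; Y) ↘ Y) ⁻¹ᵁ W)).ker :=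
    opRange_le fun k _ ω ↦ by
      rw [AddMonoidHom.mem_ker, ← secMap_comp, precomp_diff_rho]
      rfl
  have h2 := h1 hc
  rw [AddMonoidHom.mem_ker, map_sub, hφ] at h2
  exact (sub_eq_zero.1 h2).symm

/-- If the extension of `c` dies in the cokernel, it comes from the dual differential, hence lies in
the sum of the ranges of the transposed operators. A constant in that sum is zero. -/
lemma eq_zero_of_rho (hW : IsAffineOpen W) (H : HasDualBasis (dirIm F.sheaf) W)
    (c : localHom (dirIm F.sheaf) (structureSheaf Y) W)
    (hc : secMap (rho F) _ (ofLocal (extend (𝔸(Fin n; Y) ↘ Y) c)) = 0) : c = 0 := by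
  let φ : Γ(sheafHom (invIm (𝔸(Fin n; Y) ↘ Y) (dirIm F.sheaf)) (structureSheaf _),
    (𝔸(Fin n; Y) ↘ Y) ⁻¹ᵁ W) := ofLocal (extend (𝔸(Fin n; Y) ↘ Y) c)
  obtain ⟨χ, hχ⟩ := exists_lift_of_exact (koszT_exact F) (isAffineOpen_preimage hW)
    ((H.invIm.altSheaf _ _).hom.localizing (isAffineOpen_preimage hW))
    ((H.invIm.altSheaf _ _).hom.localizing (isAffineOpen_preimage hW))
    (secMap (precomp (zeroProj ((𝔸(Fin n; Y) ↘ Y) ≫ f) n _) _) _ φ) hc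
  have hχ' : secMap (koszT F) ((𝔸(Fin n; Y) ↘ Y) ⁻¹ᵁ W) χ =
    secMap (precomp (zeroProj ((𝔸(Fin n; Y) ↘ Y) ≫ f) n _) _) _ φ := hχ
  have e := congrArg (secMap (precomp (zeroInj ((𝔸(Fin n; Y) ↘ Y) ≫ f) n
    (invIm (𝔸(Fin n; Y) ↘ Y) (dirIm F.sheaf))) (structureSheaf _)) ((𝔸(Fin n; Y) ↘ Y) ⁻¹ᵁ W)) hχ'
  rw [← secMap_comp, ← secMap_comp, ← precomp_comp, zeroInj_zeroProj, koszT, ← precomp_comp,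
    kosz_wedge, precomp_sum, secMap_sum] at e
  obtain ⟨Ψ, hΨ, hb⟩ := exists_isEval_precomp_diff hW H
  refine hΨ.eq_zero_of_mem hb ?_
  have e' : φ = _ := e.symm
  change φ ∈ _
  rw [e']
  refine AddSubgroup.sum_mem _ fun k _ ↦ ?_
  rw [precomp_comp, secMap_comp]
  exact mem_opRange _ k k.2 _

end DirectImageOfDual

/-! ### Identification of the direct image of the dual with the dual of the direct image -/

section DirectImageIso

variable {n : ℕ} {Y : Scheme.{0}} {f : Y ⟶ Spec (.of ℂ)}
  {G : Subgroup (Matrix.SpecialLinearGroup (Fin n) ℂ)} (F : GSheaf (linearAct f G))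

/-- The dual of the direct image. -/
abbrev dirDual (M : 𝔸(Fin n; Y).Modules) : Y.Modules := sheafHom (dirIm M) (structureSheaf Y)

/-- The section of the dual given by a functional. -/
def dualSec {W : Y.Opens} : localHom (dirIm F.sheaf) (structureSheaf Y) W →+
    Γ((dualG F).sheaf, (𝔸(Fin n; Y) ↘ Y) ⁻¹ᵁ W) :=
  (secMap (rho F) ((𝔸(Fin n; Y) ↘ Y) ⁻¹ᵁ W)).comp (ofLocal.comp (extend (𝔸(Fin n; Y) ↘ Y)))

lemma dualSec_smul {W : Y.Opens} (r : Γ(Y, W)) (c : localHom (dirIm F.sheaf) (structureSheaf Y) W) :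
    dualSec F (r • c) = pullO (𝔸(Fin n; Y) ↘ Y) r • dualSec F c := by
  have e := secMap_smul (rho F) (pullO (𝔸(Fin n; Y) ↘ Y) r)
    (ofLocal (extend (𝔸(Fin n; Y) ↘ Y) c))
  exact (congrArg (fun φ ↦ secMap (rho F) _ (ofLocal φ)) (extend_smul r c)).trans e

lemma dualSec_res {V W : Y.Opens} (h : V ≤ W) (c : localHom (dirIm F.sheaf) (structureSheaf Y) W) :
    dualSec F (localRes _ _ h c) =
      res (dualG F).sheaf (preimage_mono (𝔸(Fin n; Y) ↘ Y) h) (dualSec F c) := by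
  have e := secMap_res (rho F) (preimage_mono (𝔸(Fin n; Y) ↘ Y) h)
    (ofLocal (extend (𝔸(Fin n; Y) ↘ Y) c))
  exact (congrArg (fun φ ↦ secMap (rho F) _ (ofLocal φ)) (extend_res h c)).trans e

/-- The comparison of the dual of the direct image with the direct image of the dual. -/
def dualComp : dirDual F.sheaf ⟶ dirIm (dualG F).sheaf :=
  mkHom (fun W c ↦ secDir (dualSec F (toLocal c)))
    (fun W c c' ↦ map_add (dualSec F) (toLocal c) (toLocal c'))
    (fun W r c ↦ dualSec_smul F r (toLocal c))
    (fun V W h c ↦ dualSec_res F h (toLocal c))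

lemma dirSec_dualComp {W : Y.Opens} (c : Γ(dirDual F.sheaf, W)) :
    dirSec (secMap (dualComp F) W c) = dualSec F (toLocal c) := rfl

lemma isIso_dualComp (H : ∀ W : Y.Opens, IsAffineOpen W → HasDualBasis (dirIm F.sheaf) W) :
    IsIso (dualComp F) := by
  have hx (x : Y) : ∃ U : Y.Opens, x ∈ U ∧ IsAffineOpen U := by
    obtain ⟨_, ⟨W, hW, rfl⟩, hx, -⟩ := Y.isBasis_affineOpens.exists_subset_of_mem_open
      (Set.mem_univ x) isOpen_univ
    exact ⟨W, hx, hW⟩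
  have h1 : Mono (dualComp F) := mono_of_affine _ fun x ↦ by
    obtain ⟨W, hx, hW⟩ := hx x
    exact ⟨W, hx, hW, (H W hW).hom.localizing hW, (localizing_dualG hW (H W hW)).pushforward,
      fun c hc ↦ eq_zero_of_rho hW (H W hW) (toLocal c) hc⟩
  have h2 : Epi (dualComp F) := epi_of_affine _ fun x ↦ by
    obtain ⟨W, hx, hW⟩ := hx x
    refine ⟨W, hx, hW, (localizing_dualG hW (H W hW)).pushforward, fun s ↦ ?_⟩
    obtain ⟨c, hc⟩ := exists_rho_eq hW (H W hW) (dirSec s)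
    exact ⟨ofLocal c, hc⟩
  exact isIso_of_mono_of_epi _

/-- The action on functionals on the inverse image. -/
def invAct (g : G) {U : 𝔸(Fin n; Y).Opens}
    (φ : localHom (invIm (𝔸(Fin n; Y) ↘ Y) (dirIm F.sheaf)) (structureSheaf _) U) :
    localHom (invIm (𝔸(Fin n; Y) ↘ Y) (dirIm F.sheaf)) (structureSheaf _) ((linearAct f G g) ⁻¹ᵁ U) :=
  GSheaf.localAct (N := structureGSheaf (linearAct f G)) (resG F) g φ

lemma ev_invAct (g : G) {U V : 𝔸(Fin n; Y).Opens} (h : V ≤ U)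
    (φ : localHom (invIm (𝔸(Fin n; Y) ↘ Y) (dirIm F.sheaf)) (structureSheaf _) U)
    (t : Γ(invIm (𝔸(Fin n; Y) ↘ Y) (dirIm F.sheaf), V)) :
    toFun (ev (invAct F g φ) (preimage_le _ g h) (invPull linearAct_over F g t)) =
      actO (linearAct f G) g (toFun (ev φ h t)) :=
  GSheaf.localAct_pull (F := resG F) (N := structureGSheaf (linearAct f G)) g φ h t

/-- Every pulled back section is a translate of the pullback of `t`, and the conjugation action is
known on translates. Functions from `Y` are invariant, so only the inverse action on the argument of
`c` remains. -/
lemma invAct_extend (g : G) {W : Y.Opens} (c : localHom (dirIm F.sheaf) (structureSheaf Y) W) :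
    localRes _ _ (preimage_act linearAct_over g W).ge (invAct F g (extend (𝔸(Fin n; Y) ↘ Y) c)) =
      extend (𝔸(Fin n; Y) ↘ Y) (localPre (gEnd linearAct_over F g⁻¹) _ c) :=
  invIm_localHom_ext' fun V hV s ↦ toFun_injective <| by
    let t := secMap (gEnd linearAct_over F g⁻¹) V s
    have ht : secMap (gEnd linearAct_over F g) V t = s := by
      rw [← secMap_comp, ← gEnd_mul, inv_mul_cancel, gEnd_one]
      rfl
    have e1 : eta (𝔸(Fin n; Y) ↘ Y) (dirIm F.sheaf) s =
        res _ (preimage_act linearAct_over g V).ge (invPull linearAct_over F g (eta _ _ t)) := by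
      rw [invPull_eta, ht, res_res, res_self]
    have e2 := ev_invAct F g (preimage_mono _ hV) (extend (𝔸(Fin n; Y) ↘ Y) c) (eta _ _ t)
    have e3 := ev_extend (p := 𝔸(Fin n; Y) ↘ Y) (localPre (gEnd linearAct_over F g⁻¹) _ c) hV s
    have e4 := ev_extend (p := 𝔸(Fin n; Y) ↘ Y) c hV t
    refine Eq.trans ?_ e3.symm
    rw [ev_localRes, e1]
    have e5 := ev_res (invAct F g (extend (𝔸(Fin n; Y) ↘ Y) c))
      (preimage_le _ g (preimage_mono (𝔸(Fin n; Y) ↘ Y) hV))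
      (preimage_act linearAct_over g V).ge (invPull linearAct_over F g (eta _ _ t))
    refine (congrArg toFun e5).trans ?_
    refine (congrArg (resO (preimage_act linearAct_over g V).ge)
      (e2.trans (congrArg (actO _ g) e4))).trans ?_
    rw [actO_pullO linearAct_over, resO_resO, resO_self]
    rfl

lemma pull_dualSec (g : G) {W : Y.Opens} (c : localHom (dirIm F.sheaf) (structureSheaf Y) W) :
    (dualG F).pull g (dualSec F c) = secMap (rho F) ((linearAct f G g) ⁻¹ᵁ ((𝔸(Fin n; Y) ↘ Y) ⁻¹ᵁ W))
      (ofLocal (invAct F g (extend (𝔸(Fin n; Y) ↘ Y) c))) :=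
  (congrArg (fun k ↦ (Scheme.Modules.Hom.app k ((𝔸(Fin n; Y) ↘ Y) ⁻¹ᵁ W)).hom
    (ofLocal (extend (𝔸(Fin n; Y) ↘ Y) c))) ((rhoG F).comm g)).symm

lemma dualComp_gEnd (g : G) : dualComp F ≫ gEnd linearAct_over (dualG F) g =
    precomp (gEnd linearAct_over F g⁻¹) (structureSheaf Y) ≫ dualComp F :=
  modHom_ext fun W c ↦ dirSec_injective <| by
    refine (dirSec_gEnd linearAct_over (dualG F) g (secMap (dualComp F) W c)).trans ?_
    rw [dirSec_dualComp, pull_dualSec, ← secMap_res]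
    exact congrArg (fun φ ↦ secMap (rho F) ((𝔸(Fin n; Y) ↘ Y) ⁻¹ᵁ W) (ofLocal φ))
      (invAct_extend F g (toLocal c))

/-- The functions whose actions agree under the comparison. -/
def Agrees (r : Γ(𝔸(Fin n; Y), ⊤)) : Prop :=
  dualComp F ≫ fnEnd _ (dualG F).sheaf r = precomp (fnEnd _ F.sheaf r) (structureSheaf Y) ≫ dualComp F

lemma fnEnd_add {X Y : Scheme.{u}} (p : X ⟶ Y) (M : X.Modules) (r s : Γ(X, ⊤)) :
    fnEnd p M (r + s) = fnEnd p M r + fnEnd p M s := modHom_ext fun W t ↦ dirSec_injective <| by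
  refine (dirSec_fnEnd M (r + s) t).trans ?_
  rw [map_add, add_smul]
  rfl

lemma fnEnd_mul {X Y : Scheme.{u}} (p : X ⟶ Y) (M : X.Modules) (r s : Γ(X, ⊤)) :
    fnEnd p M (r * s) = fnEnd p M r ≫ fnEnd p M s := modHom_ext fun W t ↦ dirSec_injective <| by
  refine (dirSec_fnEnd M (r * s) t).trans ?_
  refine Eq.trans ?_ (dirSec_fnEnd M s (secMap (fnEnd p M r) W t)).symm
  rw [dirSec_fnEnd, map_mul, mul_comm, mul_smul]

lemma fnEnd_pullTop {X Y : Scheme.{u}} (p : X ⟶ Y) (M : X.Modules) (c : Γ(Y, ⊤)) :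
    fnEnd p M (pullTop p c) = scale _ c := modHom_ext fun W t ↦ dirSec_injective <| by
  refine (dirSec_fnEnd M (pullTop p c) t).trans ?_
  rw [resO_pullTop]
  rfl

lemma precomp_scale {Y : Scheme.{u}} (N : Y.Modules) (c : Γ(Y, ⊤)) :
    precomp (scale N c) (structureSheaf Y) = scale _ c :=
  modHom_ext fun W φ ↦ toLocal_injective <| localHom_ext fun V h s ↦ by
    refine (ev_smul (toLocal φ) h (resO le_top c) s).trans ?_
    rw [← resO_resO h (le_top : W ≤ ⊤)]
    rfl

variable {F}

lemma Agrees.add {r s : Γ(𝔸(Fin n; Y), ⊤)} (hr : Agrees F r) (hs : Agrees F s) :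
    Agrees F (r + s) := by
  rw [Agrees, fnEnd_add, fnEnd_add, precomp_add, Preadditive.comp_add, Preadditive.add_comp, hr, hs]

lemma Agrees.mul {r s : Γ(𝔸(Fin n; Y), ⊤)} (hr : Agrees F r) (hs : Agrees F s) :
    Agrees F (r * s) := by
  -- Precomposition reverses the order of the factors, which is harmless because functions commute.
  rw [Agrees, fnEnd_mul, mul_comm, fnEnd_mul, precomp_comp, Category.assoc, ← hs,
    ← Category.assoc, hr, Category.assoc]

variable (F)

lemma agrees_pullTop (c : Γ(Y, ⊤)) : Agrees F (pullTop (𝔸(Fin n; Y) ↘ Y) c) := by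
  rw [Agrees, fnEnd_pullTop, fnEnd_pullTop, precomp_scale, scale_comp]

lemma precomp_diff_extend (k : Fin n) {W : Y.Opens}
    (c : localHom (dirIm F.sheaf) (structureSheaf Y) W) :
    secMap (precomp (diff F.sheaf k) (structureSheaf 𝔸(Fin n; Y))) ((𝔸(Fin n; Y) ↘ Y) ⁻¹ᵁ W)
      (ofLocal (extend (𝔸(Fin n; Y) ↘ Y) c)) =
    resO (le_top : (𝔸(Fin n; Y) ↘ Y) ⁻¹ᵁ W ≤ ⊤) (AffineSpace.coord Y k) •
      ofLocal (extend (𝔸(Fin n; Y) ↘ Y) c) -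
      ofLocal (extend (𝔸(Fin n; Y) ↘ Y) (localPre (coordEnd F.sheaf k) _ c)) := by
  rw [extend_localPre]
  refine toLocal_injective (localHom_ext fun V hV s ↦ ?_)
  change ev (extend (𝔸(Fin n; Y) ↘ Y) c) hV (secMap (diff F.sheaf k) V s) =
    resO hV (resO (le_top : (𝔸(Fin n; Y) ↘ Y) ⁻¹ᵁ W ≤ ⊤) (AffineSpace.coord Y k)) •
      ev (extend (𝔸(Fin n; Y) ↘ Y) c) hV s -
      ev (extend (𝔸(Fin n; Y) ↘ Y) c) hV (secMap (invImMap (coordEnd F.sheaf k)) V s)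
  rw [secMap_diff, map_sub, ev_smul, resO_resO]

/-- On an extended functional, the transposed difference operator is multiplication by the
coordinate minus the action of the coordinate on the argument. It vanishes in the cokernel, so there
the two actions coincide. -/
lemma dualSec_coord (k : Fin n) {W : Y.Opens}
    (c : localHom (dirIm F.sheaf) (structureSheaf Y) W) :
    resO (le_top : (𝔸(Fin n; Y) ↘ Y) ⁻¹ᵁ W ≤ ⊤) (AffineSpace.coord Y k) • dualSec F c =
      dualSec F (localPre (coordEnd F.sheaf k) _ c) := by
  have e0 : secMap (precomp (diff F.sheaf k) _ ≫ rho F) ((𝔸(Fin n; Y) ↘ Y) ⁻¹ᵁ W)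
      (ofLocal (extend (𝔸(Fin n; Y) ↘ Y) c)) = 0 := by rw [precomp_diff_rho]; rfl
  rw [secMap_comp, precomp_diff_extend, map_sub, secMap_smul] at e0
  exact sub_eq_zero.1 e0

lemma agrees_coord (k : Fin n) : Agrees F (AffineSpace.coord Y k) :=
  modHom_ext fun W c ↦ dirSec_injective <|
    (dirSec_fnEnd (dualG F).sheaf (AffineSpace.coord Y k) (secMap (dualComp F) W c)).trans
      (dualSec_coord F k (toLocal c))

lemma agrees_polyFun (r : MvPolynomial (Fin n) ℂ) : Agrees F (polyFun f r) := by
  induction r using MvPolynomial.induction_on with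
  | C c =>
    have e : polyFun f (MvPolynomial.C c) = pullTop (𝔸(Fin n; Y) ↘ Y) (scalars f ⊤ c) := by
      rw [pullTop_scalars]
      exact MvPolynomial.eval₂_C _ _ _
    rw [e]
    exact agrees_pullTop F _
  | add r s hr hs => rw [map_add]; exact hr.add hs
  | mul_X r k hr =>
    rw [map_mul]
    refine hr.mul ?_
    have e : polyFun f (MvPolynomial.X k) = AffineSpace.coord Y k := MvPolynomial.eval₂_X _ _ _
    rw [e]
    exact agrees_coord F k

/-- An isomorphism of the direct image of `D` with the dual of the direct image of `F`. -/
structure DualIso (F D : GSheaf (linearAct f G)) where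
  iso : dirIm D.sheaf ≅ dirDual F.sheaf
  group (g : G) : groupEnd D g ≫ iso.hom = iso.hom ≫ precomp (groupEnd F g⁻¹) (structureSheaf Y)
  poly (r : MvPolynomial (Fin n) ℂ) :
    polyEnd D r ≫ iso.hom = iso.hom ≫ precomp (polyEnd F r) (structureSheaf Y)

/-- The comparison as an isomorphism. -/
def dualIso (H : ∀ W : Y.Opens, IsAffineOpen W → HasDualBasis (dirIm F.sheaf) W) :
    DualIso F (dualG F) :=
  have := isIso_dualComp F H
  { iso := (asIso (dualComp F)).symm
    group := fun g ↦ by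
      -- `groupEnd` at `g` is `gEnd` at the inverse, so the comparison is taken at `g⁻¹`.
      have e : dualComp F ≫ groupEnd (dualG F) g =
        precomp (groupEnd F g⁻¹) (structureSheaf Y) ≫ dualComp F := dualComp_gEnd F g⁻¹
      rw [Iso.symm_hom, asIso_inv, IsIso.comp_inv_eq, Category.assoc, ← e, IsIso.inv_hom_id_assoc]
    poly := fun r ↦ by
      have e : dualComp F ≫ polyEnd (dualG F) r =
        precomp (polyEnd F r) (structureSheaf Y) ≫ dualComp F := agrees_polyFun F r
      rw [Iso.symm_hom, asIso_inv, IsIso.comp_inv_eq, Category.assoc, ← e, IsIso.inv_hom_id_assoc] }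

end DirectImageIso

/-! ### Finiteness and flatness are local on affine open subsets -/

section AffineLocality

variable {X : Scheme.{u}} {M : X.Modules} {U U' : X.Opens}

/-- This moves membership in a span from `U` to `U'` through a common basic open subset. The tuple
`m` is carried to `U` by clearing powers of `h`, written there in terms of `S`, and the generators
return to `U'` at the cost of powers of `g`. Tuples of length one serve finiteness, solutions of
linear equations serve flatness. -/
lemma exists_pow_smul_mem (hM : Localizing M U) (hM' : Localizing M U') (hU' : IsAffineOpen U')
    {h : Γ(X, U)} {g : Γ(X, U')} (e : X.basicOpen g = X.basicOpen h) {k : ℕ}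
    (S : Set (Fin k → Γ(M, U))) (L : Submodule Γ(X, U') (Fin k → Γ(M, U')))
    (hS : ∀ v ∈ S, ∃ (N : ℕ) (w : Fin k → Γ(M, U')), w ∈ L ∧ ∀ i,
      res M (X.basicOpen_le g) (w i) = resO (X.basicOpen_le g) g ^ N •
        res M (e.le.trans (X.basicOpen_le h)) (v i))
    (m : Fin k → Γ(M, U'))
    (hm : ∀ (v : Fin k → Γ(M, U)) (K : ℕ), (∀ i, res M (e.le.trans (X.basicOpen_le h)) (v i) =
      resO (e.le.trans (X.basicOpen_le h)) h ^ K • res M (X.basicOpen_le g) (m i)) →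
        ∃ l : ℕ, h ^ l • v ∈ Submodule.span Γ(X, U) S) : ∃ N : ℕ, g ^ N • m ∈ L := by
  set hV := e.le.trans (X.basicOpen_le h) with hhV
  set hV' := X.basicOpen_le g with hhV'
  have hO := localizing_structureSheaf hU'
  have hO' (r : Γ(X, X.basicOpen g)) : ∃ (j : ℕ) (b : Γ(X, U')), resO hV' b = resO hV' g ^ j * r :=
    hO.lift g (ofFun r)
  have key (v : Fin k → Γ(M, U)) (hv : v ∈ Submodule.span Γ(X, U) S) :
      ∃ (N : ℕ) (w : Fin k → Γ(M, U')), w ∈ L ∧ ∀ i,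
        res M hV' (w i) = resO hV' g ^ N • res M hV (v i) := by
    induction hv using Submodule.span_induction with
    | mem v hv => exact hS v hv
    | zero => exact ⟨0, 0, L.zero_mem, fun i ↦ by simp⟩
    | add v v' _ _ hv hv' =>
      obtain ⟨N, w, hw, e1⟩ := hv
      obtain ⟨N', w', hw', e2⟩ := hv'
      refine ⟨N + N', g ^ N' • w + g ^ N • w',
        L.add_mem (L.smul_mem _ hw) (L.smul_mem _ hw'), fun i ↦ ?_⟩
      rw [Pi.add_apply, Pi.smul_apply, Pi.smul_apply, Pi.add_apply, map_add, res_smul, res_smul, e1,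
        e2, map_pow, map_pow, smul_smul, smul_smul, map_add, smul_add, pow_add, mul_comm (_ ^ N')]
    | smul r v _ hv =>
      obtain ⟨N, w, hw, e1⟩ := hv
      obtain ⟨j, b, hb⟩ := hO' (resO hV r)
      refine ⟨j + N, b • w, L.smul_mem _ hw, fun i ↦ ?_⟩
      rw [Pi.smul_apply, Pi.smul_apply, res_smul, res_smul, e1, hb, smul_smul, smul_smul, pow_add]
      congr 1
      ring
  choose K v hv using fun i ↦ hM.lift h (res M (e.ge.trans hV') (m i))
  have hv' (i : Fin k) : res M hV (v i) = resO hV h ^ K i • res M hV' (m i) := by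
    have := congrArg (res M e.le) (hv i)
    rwa [res_res, res_smul, res_res, map_pow, resO_resO] at this
  obtain ⟨l, hl⟩ := hm (fun i ↦ h ^ (∑ i, K i - K i) • v i) (∑ i, K i) fun i ↦ by
    rw [res_smul, hv', map_pow, smul_smul, ← pow_add,
      Nat.sub_add_cancel (Finset.single_le_sum (fun _ _ ↦ Nat.zero_le _) (Finset.mem_univ i))]
  obtain ⟨N, w, hw, e1⟩ := key _ hl
  have e2 (i : Fin k) : res M hV' (w i) =
      resO hV' g ^ N • resO hV h ^ (l + ∑ i, K i) • res M hV' (m i) := by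
    rw [e1, Pi.smul_apply, res_smul, res_smul, hv', map_pow, map_pow, smul_smul (_ ^ (_ - _)), ← pow_add,
      Nat.sub_add_cancel (Finset.single_le_sum (fun _ _ ↦ Nat.zero_le _) (Finset.mem_univ i)),
      smul_smul (_ ^ l), ← pow_add]
  obtain ⟨u, hu⟩ := (isUnit_resO h e.le).pow (l + ∑ i, K i)
  obtain ⟨j, b, hb⟩ := hO' ↑u⁻¹
  have e3 (i : Fin k) : res M hV' (b • w i - g ^ (j + N) • m i) = 0 := by
    have e4 : resO hV' b * (resO hV' g ^ N * resO hV h ^ (l + ∑ i, K i)) = resO hV' g ^ (j + N) := by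
      have : resO hV h ^ (l + ∑ i, K i) = u := hu.symm
      rw [hb, this, pow_add]
      have hu1 : (↑u⁻¹ : Γ(X, X.basicOpen g)) * u = 1 := u.inv_mul
      linear_combination (resO hV' g ^ j * resO hV' g ^ N) * hu1
    rw [map_sub, res_smul, res_smul, e2, smul_smul, smul_smul, mul_assoc, e4, map_pow, sub_self]
  choose c hc using fun i ↦ hM'.zero g _ (e3 i)
  refine ⟨∑ i, c i + (j + N), ?_⟩
  have e5 : g ^ (∑ i, c i + (j + N)) • m = g ^ (∑ i, c i) • b • w := funext fun i ↦ by
    have e6 : g ^ (∑ i, c i) • (b • w i - g ^ (j + N) • m i) = 0 := by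
      rw [← Nat.sub_add_cancel (Finset.single_le_sum (f := c) (fun _ _ ↦ Nat.zero_le _) (Finset.mem_univ i)),
        pow_add, mul_smul, hc, smul_zero]
    rw [smul_sub, sub_eq_zero] at e6
    rw [Pi.smul_apply, Pi.smul_apply, Pi.smul_apply, e6, pow_add, mul_smul]
  rw [e5]
  exact L.smul_mem _ (L.smul_mem _ hw)

lemma finite_of_localizing (hM : ∀ U : X.Opens, IsAffineOpen U → Localizing M U)
    (hx : ∀ x : X, ∃ U : X.Opens, x ∈ U ∧ IsAffineOpen U ∧ Module.Finite Γ(X, U) Γ(M, U))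
    (hU' : IsAffineOpen U') : Module.Finite Γ(X, U') Γ(M, U') := by
  classical
  let P (g : Γ(X, U')) : Prop := ∃ T : Finset (Fin 1 → Γ(M, U')), ∀ m, ∃ N : ℕ,
    g ^ N • m ∈ Submodule.span Γ(X, U') (T : Set (Fin 1 → Γ(M, U')))
  have hS : Ideal.span {g | P g} = ⊤ := span_eq_top_of_forall hU' P fun x hxU' ↦ by
    obtain ⟨U, hxU, hU, hf⟩ := hx x
    obtain ⟨h, g, e, hxh⟩ := exists_basicOpen_le_affine_inter hU hU' x ⟨hxU, hxU'⟩
    refine ⟨g, ?_, e ▸ hxh⟩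
    obtain ⟨S, hS⟩ := (inferInstance : Module.Finite Γ(X, U) (Fin 1 → Γ(M, U))).fg_top
    have hl (v : Fin 1 → Γ(M, U)) : ∃ (N : ℕ) (w : Fin 1 → Γ(M, U')), ∀ i,
      res M (X.basicOpen_le g) (w i) = resO (X.basicOpen_le g) g ^ N •
        res M (e.ge.trans (X.basicOpen_le h)) (v i) := by
      obtain ⟨N, w, hw⟩ := (hM U' hU').lift g (res M (e.ge.trans (X.basicOpen_le h)) (v 0))
      exact ⟨N, fun _ ↦ w, fun i ↦ by rw [hw, Subsingleton.elim i 0]⟩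
    choose N w hw using hl
    refine ⟨S.image w, fun m ↦ exists_pow_smul_mem (hM U hU) (hM U' hU') hU' e.symm S _
      (fun v hv ↦ ⟨N v, w v, Submodule.subset_span (Finset.mem_coe.2 (Finset.mem_image_of_mem w hv)),
        hw v⟩) m fun v K _ ↦ ⟨0, by rw [hS]; trivial⟩⟩
  obtain ⟨A, hA, hA1⟩ := Ideal.span_eq_top_iff_finite _ |>.1 hS
  choose! T hT using fun g (hg : g ∈ A) ↦ hA hg
  have : Module.Finite Γ(X, U') (Fin 1 → Γ(M, U')) := by
    refine ⟨⟨A.biUnion T, top_le_iff.1 fun m _ ↦ eq_zero_of_span hA1 _ m fun g hg ↦ ?_⟩⟩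
    obtain ⟨N, hN⟩ := hT g hg m
    exact ⟨N, Submodule.span_mono (Finset.coe_subset.2 (Finset.subset_biUnion_of_mem T hg)) hN⟩
  exact Module.Finite.equiv (LinearEquiv.funUnique (Fin 1) Γ(X, U') Γ(M, U'))

section Relations

variable {A B E : Type*} [CommRing A] [CommRing B] [AddCommGroup E] [Module B E] (φ : A →+* B)

/-- The trivial solutions of the linear equation with coefficients `a`. -/
def relSpan (E : Type*) [AddCommGroup E] [Module B E] {k : ℕ} (a : Fin k → A) :
    Submodule B (Fin k → E) :=
  Submodule.span B {v | ∃ b : Fin k → A, ∑ i, a i * b i = 0 ∧ ∃ y : E, v = fun i ↦ φ (b i) • y}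

variable {φ}

/-- This is the equational criterion. Multiples of trivial solutions by elements of `B` are again
trivial, so the criterion becomes membership in a `B`-submodule, which can be tested after inverting
functions that generate the unit ideal. -/
lemma flatVia_iff : FlatVia φ E ↔ ∀ (k : ℕ) (a : Fin k → A) (m : Fin k → E),
    ∑ i, φ (a i) • m i = 0 → m ∈ relSpan φ E a := by
  letI : Module A E := Module.compHom E φ
  have hs (r : A) (x : E) : r • x = φ r • x := rfl
  refine (Module.Flat.iff_forall_isTrivialRelation (R := A) (M := E)).trans ?_
  constructor
  · intro H k a m hm
    obtain ⟨l, b, y, h1, h2⟩ := H (f := a) (x := m) hm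
    have e : m = ∑ j, fun i ↦ φ (b i j) • y j := funext fun i ↦ by
      rw [h1, Finset.sum_apply]
      rfl
    rw [e]
    exact Submodule.sum_mem _ fun j _ ↦ Submodule.subset_span ⟨fun i ↦ b i j, h2 j, y j, rfl⟩
  · intro H k a m hm
    have hm' := H k a m hm
    clear hm
    induction hm' using Submodule.span_induction with
    | mem v hv =>
      obtain ⟨b, hb, y, rfl⟩ := hv
      exact ⟨1, fun i _ ↦ b i, fun _ ↦ y, fun i ↦ by simp [hs], fun _ ↦ hb⟩
    | zero => exact ⟨0, fun _ j ↦ j.elim0, fun j ↦ j.elim0, fun i ↦ by simp, fun j ↦ j.elim0⟩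
    | add v v' _ _ hv hv' =>
      obtain ⟨l, b, y, h1, h2⟩ := hv
      obtain ⟨l', b', y', h1', h2'⟩ := hv'
      refine ⟨l + l', fun i ↦ Fin.append (b i) (b' i), Fin.append y y', fun i ↦ ?_, fun j ↦ ?_⟩
      · rw [Fin.sum_univ_add, Pi.add_apply, h1, h1']
        simp
      · refine Fin.addCases (fun j ↦ ?_) (fun j ↦ ?_) j
        · simpa using h2 j
        · simpa using h2' j
    | smul r v _ hv =>
      obtain ⟨l, b, y, h1, h2⟩ := hv
      refine ⟨l, b, fun j ↦ r • y j, fun i ↦ ?_, h2⟩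
      rw [Pi.smul_apply, h1, Finset.smul_sum]
      refine Finset.sum_congr rfl fun j _ ↦ ?_
      rw [hs, hs, smul_comm]

end Relations

/-- Flatness over `Y` is demanded on every affine open subset lying over `W`, whereas for the dual
it is known on the full preimage of `W`; this lemma passes from one to the other. -/
lemma flatVia_of_localizing {A : Type u} [CommRing A] (hM' : Localizing M U')
    (hU' : IsAffineOpen U') (φ' : A →+* Γ(X, U'))
    (H : ∀ x ∈ U', ∃ (U : X.Opens) (φ : A →+* Γ(X, U)), x ∈ U ∧ IsAffineOpen U ∧ Localizing M U ∧
      FlatVia φ Γ(M, U) ∧ ∀ (V : X.Opens) (h : V ≤ U) (h' : V ≤ U') (c : A),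
        resO h (φ c) = resO h' (φ' c)) : FlatVia φ' Γ(M, U') := by
  rw [flatVia_iff]
  intro k a m hm
  let P (g : Γ(X, U')) : Prop := ∃ N : ℕ, g ^ N • m ∈ relSpan φ' Γ(M, U') a
  refine eq_zero_of_span (span_eq_top_of_forall hU' P fun x hxU' ↦ ?_) _ m fun g hg ↦ hg
  obtain ⟨U, φ, hxU, hU, hM, hfl, hφ⟩ := H x hxU'
  obtain ⟨h, g, e, hxh⟩ := exists_basicOpen_le_affine_inter hU hU' x ⟨hxU, hxU'⟩
  refine ⟨g, ?_, e ▸ hxh⟩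
  have hV : X.basicOpen g ≤ U := e.ge.trans (X.basicOpen_le h)
  refine exists_pow_smul_mem hM hM' hU' e.symm
    {v | ∃ b : Fin k → A, ∑ i, a i * b i = 0 ∧ ∃ y : Γ(M, U), v = fun i ↦ φ (b i) • y} _
    (fun v hv ↦ ?_) m fun v K hv ↦ ?_
  rotate_right
  · have e1 : res M (X.basicOpen_le h) (∑ i, φ (a i) • v i) = 0 := by
      have e2 : res M hV (∑ i, φ (a i) • v i) = 0 := by
        have e3 := congrArg (fun s ↦ resO hV h ^ K • res M (X.basicOpen_le g) s) hm
        simp only [map_zero, smul_zero, map_sum, Finset.smul_sum] at e3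
        rw [map_sum, ← e3]
        refine Finset.sum_congr rfl fun i _ ↦ ?_
        rw [res_smul, res_smul, hv, hφ _ hV (X.basicOpen_le g), smul_comm]
      have := congrArg (res M e.le) e2
      rwa [res_res, map_zero] at this
    obtain ⟨l, hl⟩ := hM.zero h _ e1
    refine ⟨l, flatVia_iff.1 hfl k a _ ?_⟩
    rw [← hl, Finset.smul_sum]
    exact Finset.sum_congr rfl fun i _ ↦ by rw [Pi.smul_apply, smul_comm]
  · obtain ⟨b, hb, y, rfl⟩ := hv
    obtain ⟨N, σ, hσ⟩ := hM'.lift g (res M hV y)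
    refine ⟨N, fun i ↦ φ' (b i) • σ, Submodule.subset_span ⟨b, hb, σ, rfl⟩, fun i ↦ ?_⟩
    rw [res_smul, res_smul, hσ, ← hφ _ hV (X.basicOpen_le g), smul_comm]

end AffineLocality

/-! ### Perfect pairings and their specialization to fibres -/

section Pairing

section ModFibre

variable {A P N : Type} [CommRing A] [AddCommGroup P] [Module A P] [AddCommGroup N] [Module A N]
  {ε : A →+* ℂ} (b : P →ₗ[A] N →ₗ[A] A)

/-- Dual bases for a pairing of modules. -/
def HasDualBases : Prop :=
  ∃ (κ : Type) (_ : Fintype κ) (e : κ → N) (c : κ → P),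
    (∀ s, s = ∑ k, b (c k) s • e k) ∧ ∀ p, p = ∑ k, b p (e k) • c k

variable {b}

lemma HasDualBases.finite (H : HasDualBases b) : Module.Finite A P := by
  classical
  obtain ⟨κ, _, e, c, -, h⟩ := H
  refine ⟨⟨Finset.univ.image c, top_le_iff.1 fun p _ ↦ ?_⟩⟩
  rw [h p]
  exact Submodule.sum_mem _ fun k _ ↦ Submodule.smul_mem _ _ (Submodule.subset_span (by simp))

lemma HasDualBases.projective (H : HasDualBases b) : Module.Projective A P := by
  obtain ⟨κ, _, e, c, -, h⟩ := H
  refine Module.Projective.of_split (LinearMap.pi fun k ↦ b.flip (e k))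
    (Fintype.linearCombination A c) (LinearMap.ext fun p ↦ ?_)
  rw [LinearMap.comp_apply, Fintype.linearCombination_apply]
  exact (h p).symm

/-- The pairing of fibres is defined as the sum of products of specialized coordinates. Since dual
bases specialize, it reproduces the original pairing and is again perfect. -/
lemma HasDualBases.exists_fibre_pairing (H : HasDualBases b) (hs : Function.Surjective ε) :
    ∃ β : ModFibre P ε →ₗ[ℂ] (ModFibre N ε →ₗ[ℂ] ℂ), Function.Bijective β ∧
      ∀ p s, β (fibreMk ε p) (fibreMk ε s) = ε (b p s) := by
  obtain ⟨κ, _, e, c, h1, h2⟩ := H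
  choose x hx using fun k ↦ exists_fibre_lift (M := P) hs
    { toFun := fun p ↦ ε (b p (e k))
      map_add' := fun p p' ↦ by rw [map_add, LinearMap.add_apply, map_add]
      map_smul' := fun r p ↦ by rw [map_smul, LinearMap.smul_apply, smul_eq_mul, map_mul]; rfl }
  choose y hy using fun k ↦ exists_fibre_lift (M := N) hs
    { toFun := fun s ↦ ε (b (c k) s)
      map_add' := fun p p' ↦ by rw [map_add, map_add]
      map_smul' := fun r p ↦ by rw [map_smul, smul_eq_mul, map_mul]; rfl }
  have hβ (p : P) (s : N) :
      (∑ k, (x k).smulRight (y k)) (fibreMk ε p) (fibreMk ε s) = ε (b p s) := by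
    rw [LinearMap.sum_apply, LinearMap.sum_apply]
    conv_rhs => rw [h1 s, map_sum, map_sum]
    refine Finset.sum_congr rfl fun k _ ↦ ?_
    rw [LinearMap.smulRight_apply, LinearMap.smul_apply, hx, hy, map_smul, smul_eq_mul, smul_eq_mul,
      map_mul, mul_comm]
    rfl
  refine ⟨∑ k, (x k).smulRight (y k), ⟨?_, fun χ ↦ ?_⟩, hβ⟩
  · rw [injective_iff_map_eq_zero]
    intro z hz
    obtain ⟨p, rfl⟩ := fibreMk_surjective hs z
    rw [h2 p, map_sum]
    refine Finset.sum_eq_zero fun k _ ↦ ?_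
    rw [LinearMap.map_smulₛₗ, ← hβ, hz, LinearMap.zero_apply, zero_smul]
  · choose r hr using fun k ↦ hs (χ (fibreMk ε (e k)))
    refine ⟨fibreMk ε (∑ k, r k • c k), LinearMap.ext fun z ↦ ?_⟩
    obtain ⟨s, rfl⟩ := fibreMk_surjective hs z
    rw [hβ]
    conv_rhs => rw [h1 s, map_sum, map_sum]
    rw [map_sum, LinearMap.sum_apply, map_sum]
    refine Finset.sum_congr rfl fun k _ ↦ ?_
    rw [map_smul, LinearMap.smul_apply, smul_eq_mul, map_mul, hr, LinearMap.map_smulₛₗ, map_smul,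
      smul_eq_mul, mul_comm]

end ModFibre

variable {Y : Scheme.{0}} {N N' E E' : Y.Modules} {W : Y.Opens} {ε : Γ(Y, W) →+* ℂ}

/-- The value of a section in a fibre. -/
def fibreVal (ε : Γ(Y, W) →+* ℂ) (s : Γ(N, W)) : Fibre N ε := fibreMk ε s

lemma fibreVal_surjective (hs : Function.Surjective ε) :
    Function.Surjective (fibreVal (N := N) ε) := fibreMk_surjective hs

lemma fibreMap_val (φ : N ⟶ N') (s : Γ(N, W)) :
    fibreMap φ ε (fibreVal ε s) = fibreVal ε (secMap φ W s) := rfl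

/-- The pairing of sections given by an isomorphism with the dual. -/
def secPairing (ι : E ≅ sheafHom N (structureSheaf Y)) (W : Y.Opens) :
    Γ(E, W) →ₗ[Γ(Y, W)] Γ(N, W) →ₗ[Γ(Y, W)] Γ(Y, W) :=
  LinearMap.mk₂ _ (fun p s ↦ toFun (ev (toLocal (secMap ι.hom W p)) le_rfl s))
    (fun p p' s ↦ by rw [map_add]; rfl)
    (fun r p s ↦ by
      rw [secMap_smul]
      change toFun (ev (r • toLocal (secMap ι.hom W p)) le_rfl s) = _
      rw [ev_smul_left, resO_self]
      rfl)
    (fun p s s' ↦ by rw [map_add, map_add])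
    (fun r p s ↦ by rw [ev_smul]; rfl)

lemma secPairing_apply (ι : E ≅ sheafHom N (structureSheaf Y)) (p : Γ(E, W)) (s : Γ(N, W)) :
    secPairing ι W p s = toFun (ev (toLocal (secMap ι.hom W p)) le_rfl s) := rfl

lemma secPairing_comm (ι : E ≅ sheafHom N (structureSheaf Y)) {φ : E ⟶ E} {ψ : N ⟶ N}
    (h : φ ≫ ι.hom = ι.hom ≫ precomp ψ (structureSheaf Y)) (p : Γ(E, W)) (s : Γ(N, W)) :
    secPairing ι W (secMap φ W p) s = secPairing ι W p (secMap ψ W s) := by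
  have e : secMap ι.hom W (secMap φ W p) = secMap (precomp ψ (structureSheaf Y)) W (secMap ι.hom W p) :=
    congrArg (fun k ↦ secMap k W p) h
  rw [secPairing_apply, e]
  rfl

lemma hasDualBases_secPairing (ι : E ≅ sheafHom N (structureSheaf Y)) (H : HasDualBasis N W) :
    HasDualBases (secPairing ι W) := by
  obtain ⟨κ, _, e, c, h⟩ := H
  have h1 (p : Γ(sheafHom N (structureSheaf Y), W)) : secMap ι.hom W (secMap ι.inv W p) = p :=
    congrArg (fun k ↦ secMap k W p) ι.inv_hom_id
  have h2 (p : Γ(E, W)) : secMap ι.inv W (secMap ι.hom W p) = p :=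
    congrArg (fun k ↦ secMap k W p) ι.hom_inv_id
  refine ⟨κ, ‹_›, e, fun k ↦ secMap ι.inv W (ofLocal (c k)), fun s ↦ ?_, fun p ↦ ?_⟩
  · conv_lhs => rw [h W le_rfl s]
    refine Finset.sum_congr rfl fun k _ ↦ ?_
    rw [secPairing_apply, h1, res_self]
    rfl
  · rw [← h2 (∑ k, _)]
    conv_lhs => rw [← h2 p]
    congr 1
    refine toLocal_injective (localHom_ext fun V hV s ↦ ?_)
    simp_rw [map_sum, secMap_smul, h1]
    have e1 : toLocal (∑ k, secPairing ι W p (e k) • (ofLocal (c k) :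
        Γ(sheafHom N (structureSheaf Y), W))) = ∑ k, secPairing ι W p (e k) • c k := rfl
    have e2 (S : Finset κ) : ev (∑ k ∈ S, secPairing ι W p (e k) • c k) hV s =
        ∑ k ∈ S, resO hV (secPairing ι W p (e k)) • ev (c k) hV s := by
      classical
      induction S using Finset.induction_on with
      | empty => rfl
      | insert k S hk ih => rw [Finset.sum_insert hk, Finset.sum_insert hk, ev_add, ih, ev_smul_left]
    refine Eq.trans ?_ ((congrArg (fun φ ↦ ev φ hV s) e1).trans (e2 Finset.univ)).symm
    conv_lhs => rw [h V hV s]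
    rw [map_sum]
    refine Finset.sum_congr rfl fun k _ ↦ ?_
    rw [ev_smul, ev_res _ le_rfl hV]
    exact mul_comm (toFun (ev (c k) hV s)) (resO hV (secPairing ι W p (e k)))

lemma exists_fibre_secPairing (ι : E ≅ sheafHom N (structureSheaf Y)) (H : HasDualBasis N W)
    (hs : Function.Surjective ε) :
    ∃ β : Fibre E ε →ₗ[ℂ] (Fibre N ε →ₗ[ℂ] ℂ), Function.Bijective β ∧
      ∀ (φ : E ⟶ E) (ψ : N ⟶ N), φ ≫ ι.hom = ι.hom ≫ precomp ψ (structureSheaf Y) →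
        ∀ x y, β (fibreMap φ ε x) y = β x (fibreMap ψ ε y) := by
  obtain ⟨β, hβ, h⟩ := (hasDualBases_secPairing ι H).exists_fibre_pairing hs
  have h' (p : Γ(E, W)) (s : Γ(N, W)) : (show Fibre E ε →ₗ[ℂ] (Fibre N ε →ₗ[ℂ] ℂ) from β)
    (fibreVal ε p) (fibreVal ε s) = ε (secPairing ι W p s) := h p s
  refine ⟨β, hβ, fun φ ψ hφ x y ↦ ?_⟩
  obtain ⟨p, rfl⟩ := fibreVal_surjective hs x
  obtain ⟨s, rfl⟩ := fibreVal_surjective hs y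
  rw [fibreMap_val, fibreMap_val]
  exact (h' _ _).trans ((congrArg ε (secPairing_comm ι hφ p s)).trans (h' _ _).symm)

end Pairing

/-! ### The dual of a gnat-family is a gnat-family -/

section DualGnat

variable {n : ℕ} {Y : Scheme.{0}} {f : Y ⟶ Spec (.of ℂ)}
  {G : Subgroup (Matrix.SpecialLinearGroup (Fin n) ℂ)} {F D : GSheaf (linearAct f G)}

/-- The dual of a regular representation is regular: a functional is sent to its values on the basis
of group elements, which `g` permutes by left translation. -/
lemma DualIso.regular (d : DualIso F D) {W : Y.Opens} (H : HasDualBasis (dirIm F.sheaf) W)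
    [Finite G] {ε : Γ(Y, W) →+* ℂ} (hs : Function.Surjective ε)
    (e : Fibre (dirIm F.sheaf) ε ≃ₗ[ℂ] (G →₀ ℂ))
    (he : ∀ g x, e (fibreMap (groupEnd F g) ε x) = Finsupp.mapDomain (g * ·) (e x)) :
    ∃ e : Fibre (dirIm D.sheaf) ε ≃ₗ[ℂ] (G →₀ ℂ),
      ∀ g x, e (fibreMap (groupEnd D g) ε x) = Finsupp.mapDomain (g * ·) (e x) := by
  obtain ⟨β, hβ, h⟩ := exists_fibre_secPairing d.iso H hs
  let e' : Fibre (dirIm D.sheaf) ε ≃ₗ[ℂ] (G →₀ ℂ) :=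
    ((LinearEquiv.ofBijective β hβ).trans (LinearEquiv.arrowCongr e (LinearEquiv.refl ℂ ℂ))).trans
      ((Finsupp.llift ℂ ℂ ℂ G).symm.trans (Finsupp.linearEquivFunOnFinite ℂ ℂ G).symm)
  have he' (x) (k : G) : e' x k = β x (e.symm (Finsupp.single k 1)) := rfl
  refine ⟨e', fun g x ↦ Finsupp.ext fun k ↦ ?_⟩
  have hg : e.symm (Finsupp.single (g⁻¹ * k) 1) =
      fibreMap (groupEnd F g⁻¹) ε (e.symm (Finsupp.single k 1)) := by
    rw [LinearEquiv.symm_apply_eq, he, LinearEquiv.apply_symm_apply, Finsupp.mapDomain_single]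
  have hk := Finsupp.mapDomain_apply (mul_right_injective g) (e' x) (g⁻¹ * k)
  rw [mul_inv_cancel_left] at hk
  rw [hk, he', he', hg]
  exact h _ _ (d.group g) _ _

/-- A polynomial acts on the fibre of the dual by its transpose under a perfect pairing, so the
annihilators, and with them the supports, coincide. -/
lemma DualIso.fibreMap_eq_zero_iff (d : DualIso F D) {W : Y.Opens}
    (H : HasDualBasis (dirIm F.sheaf) W) {ε : Γ(Y, W) →+* ℂ} (hs : Function.Surjective ε)
    (r : MvPolynomial (Fin n) ℂ) :
    fibreMap (polyEnd D r) ε = 0 ↔ fibreMap (polyEnd F r) ε = 0 := by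
  obtain ⟨β, hβ, h⟩ := exists_fibre_secPairing d.iso H hs
  have h' := h _ _ (d.poly r)
  constructor
  · refine fun e ↦ LinearMap.ext fun y ↦ ?_
    refine (Module.forall_dual_apply_eq_zero_iff ℂ _).1 fun χ ↦ ?_
    obtain ⟨x, rfl⟩ := hβ.2 χ
    rw [← h', e, LinearMap.zero_apply, map_zero, LinearMap.zero_apply]
  · refine fun e ↦ LinearMap.ext fun x ↦ hβ.1 (LinearMap.ext fun y ↦ ?_)
    rw [h', e, LinearMap.zero_apply, LinearMap.zero_apply, map_zero, map_zero, LinearMap.zero_apply]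

lemma finite_preimage {M : 𝔸(Fin n; Y).Modules} {W : Y.Opens}
    (h : Module.Finite Γ(Y, W) Γ(dirIm M, W)) :
    Module.Finite Γ(𝔸(Fin n; Y), (𝔸(Fin n; Y) ↘ Y) ⁻¹ᵁ W) Γ(M, (𝔸(Fin n; Y) ↘ Y) ⁻¹ᵁ W) := by
  obtain ⟨S, hS⟩ := h.fg_top
  refine ⟨⟨S, top_le_iff.1 fun m _ ↦ ?_⟩⟩
  have hm : secDir m ∈ Submodule.span Γ(Y, W) (S : Set Γ(dirIm M, W)) := hS ▸ trivial
  have key (s : Γ(dirIm M, W)) (hs : s ∈ Submodule.span Γ(Y, W) (S : Set Γ(dirIm M, W))) :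
      dirSec s ∈ Submodule.span Γ(𝔸(Fin n; Y), (𝔸(Fin n; Y) ↘ Y) ⁻¹ᵁ W)
        (show Set Γ(M, (𝔸(Fin n; Y) ↘ Y) ⁻¹ᵁ W) from (S : Set Γ(dirIm M, W))) := by
    induction hs using Submodule.span_induction with
    | mem s hs => exact Submodule.subset_span hs
    | zero => exact Submodule.zero_mem _
    | add s t _ _ hs ht => rw [map_add]; exact Submodule.add_mem _ hs ht
    | smul r s _ hs => rw [dirSec_smul]; exact Submodule.smul_mem _ _ hs
  exact key _ hm

lemma DualIso.isGnatFamily (d : DualIso F D) (hF : IsGnatFamily F) [Finite G]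
    (H : ∀ W : Y.Opens, IsAffineOpen W → HasDualBasis (dirIm F.sheaf) W)
    (hD : ∀ W : Y.Opens, IsAffineOpen W → Localizing D.sheaf ((𝔸(Fin n; Y) ↘ Y) ⁻¹ᵁ W)) :
    IsGnatFamily D := by
  have hx (x : 𝔸(Fin n; Y)) : ∃ W : Y.Opens, x ∈ (𝔸(Fin n; Y) ↘ Y) ⁻¹ᵁ W ∧ IsAffineOpen W := by
    obtain ⟨_, ⟨W, hW, rfl⟩, hx, -⟩ := Y.isBasis_affineOpens.exists_subset_of_mem_open
      (Set.mem_univ ((𝔸(Fin n; Y) ↘ Y) x)) isOpen_univ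
    exact ⟨W, hx, hW⟩
  have hq : D.sheaf.IsQuasicoherent := isQuasicoherent_of_localizing fun x ↦ by
    obtain ⟨W, hxW, hW⟩ := hx x
    exact ⟨_, hxW, isAffineOpen_preimage hW, hD W hW⟩
  have hL (U : 𝔸(Fin n; Y).Opens) (hU : IsAffineOpen U) : Localizing D.sheaf U :=
    localizing_of_isQuasicoherent hU
  have hs {W : Y.Opens} {ε : Γ(Y, W) →+* ℂ} (hε : ε.comp (scalars f W) = RingHom.id ℂ) :
      Function.Surjective ε := fun c ↦ ⟨scalars f W c, RingHom.congr_fun hε c⟩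
  have hb (W : Y.Opens) (hW : IsAffineOpen W) := hasDualBases_secPairing d.iso (H W hW)
  refine ⟨⟨hq, fun U hU ↦ finite_of_localizing hL (fun x ↦ ?_) hU⟩, fun W U h hW hU ↦ ?_,
    fun W hW ε hε ↦ ?_, fun W hW ε hε ↦ ?_⟩
  · obtain ⟨W, hxW, hW⟩ := hx x
    exact ⟨_, hxW, isAffineOpen_preimage hW, finite_preimage (hb W hW).finite⟩
  · refine flatVia_of_localizing (hL U hU) hU _ fun x hxU ↦ ⟨(𝔸(Fin n; Y) ↘ Y) ⁻¹ᵁ W,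
      pullO (𝔸(Fin n; Y) ↘ Y), h hxU, isAffineOpen_preimage hW, hD W hW, ?_, fun V h1 h2 c ↦ ?_⟩
    · have := (hb W hW).projective
      exact (inferInstance : Module.Flat Γ(Y, W) Γ(dirIm D.sheaf, W))
    · refine Eq.trans ?_ (resO_resO h2 h (pullO (𝔸(Fin n; Y) ↘ Y) c)).symm
      rfl
  · obtain ⟨e, he⟩ := hF.regular W hW ε hε
    exact d.regular (H W hW) (hs hε) e he
  · obtain ⟨v, hv⟩ := hF.orbit W hW ε hε
    refine ⟨v, ?_⟩
    rw [← hv]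
    simp only [d.fibreMap_eq_zero_iff (H W hW) (hs hε)]

lemma isDualFamily_dualG (hF : IsGnatFamily F) [Finite G] [LocallyOfFiniteType f] :
    IsDualFamily F (dualG F) :=
  have d := dualIso F fun _ hW ↦ hF.hasDualBasis hW
  ⟨d.isGnatFamily hF (fun _ hW ↦ hF.hasDualBasis hW)
    fun _ hW ↦ localizing_dualG hW (hF.hasDualBasis hW), ⟨d.iso, d.group, d.poly⟩⟩

end DualGnat

/-! ### Recovering an equivariant sheaf from its direct image -/

section Reconstruction

lemma invImMap_id {X Y : Scheme.{u}} {p : X ⟶ Y} (N : Y.Modules) : invImMap (p := p) (𝟙 N) = 𝟙 _ :=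
  invIm_hom_ext fun _ s ↦ secMap_invImMap (p := p) (𝟙 N) s

/-- The inverse image of an equivariant morphism of direct images. -/
def invImMapG {X Y : Scheme.{u}} {p : X ⟶ Y} {G : Type} [Group G] {a : G →* End X}
    (hp : ∀ g, (a g : X ⟶ X) ≫ p = p) {D D' : GSheaf a}
    (φ : (Scheme.Modules.pushforward p).obj D.sheaf ⟶ (Scheme.Modules.pushforward p).obj D'.sheaf)
    (h : ∀ g, gEnd hp D g ≫ φ = φ ≫ gEnd hp D' g) : invImG hp D ⟶ invImG hp D' :=
  GSheaf.Hom.mk (invImMap φ) fun g ↦ invIm_hom_ext fun W s ↦ by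
    have e1 : secMap (invImMap (p := p) φ) ((a g) ⁻¹ᵁ (p ⁻¹ᵁ W)) (invPull hp D g (eta p _ s)) =
        invPull hp D' g (secMap (invImMap (p := p) φ) (p ⁻¹ᵁ W) (eta p _ s)) := by
      rw [invPull_eta, secMap_res, secMap_invImMap, secMap_invImMap, invPull_eta, ← secMap_comp, h,
        secMap_comp]
    exact e1

variable {n : ℕ} {Y : Scheme.{0}} {f : Y ⟶ Spec (.of ℂ)}
  {G : Subgroup (Matrix.SpecialLinearGroup (Fin n) ℂ)}

lemma exists_affine_preimage (x : 𝔸(Fin n; Y)) :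
    ∃ W : Y.Opens, x ∈ (𝔸(Fin n; Y) ↘ Y) ⁻¹ᵁ W ∧ IsAffineOpen W := by
  obtain ⟨_, ⟨W, hW, rfl⟩, hx, -⟩ := Y.isBasis_affineOpens.exists_subset_of_mem_open
    (Set.mem_univ ((𝔸(Fin n; Y) ↘ Y) x)) isOpen_univ
  exact ⟨W, hx, hW⟩

lemma epi_counit {M : 𝔸(Fin n; Y).Modules}
    (hM : ∀ W : Y.Opens, IsAffineOpen W → Localizing M ((𝔸(Fin n; Y) ↘ Y) ⁻¹ᵁ W)) :
    Epi (counit (𝔸(Fin n; Y) ↘ Y) M) :=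
  epi_of_affine _ fun x ↦ by
    obtain ⟨W, hx, hW⟩ := exists_affine_preimage x
    exact ⟨_, hx, isAffineOpen_preimage hW, hM W hW, fun s ↦
      ⟨eta _ _ (secDir s), secMap_counit M (secDir s)⟩⟩

/-- After clearing denominators, a section killed by the counit lies, over the preimage of an affine
open subset, in the sum of the ranges of the difference operators, which `ψ` kills. -/
lemma secMap_eq_zero_of_counit {M E : 𝔸(Fin n; Y).Modules}
    (hM : ∀ W : Y.Opens, IsAffineOpen W → Localizing M ((𝔸(Fin n; Y) ↘ Y) ⁻¹ᵁ W))
    (H : ∀ W : Y.Opens, IsAffineOpen W → HasDualBasis (dirIm M) W)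
    {ψ : invIm (𝔸(Fin n; Y) ↘ Y) (dirIm M) ⟶ E} (hψ : ∀ k, diff M k ≫ ψ = 0)
    {U : 𝔸(Fin n; Y).Opens} (s : Γ(invIm (𝔸(Fin n; Y) ↘ Y) (dirIm M), U))
    (hs : secMap (counit (𝔸(Fin n; Y) ↘ Y) M) U s = 0) : secMap ψ U s = 0 := by
  refine res_eq_of_local _ fun x hx ↦ ?_
  obtain ⟨W, hxW, hW⟩ := exists_affine_preimage x
  have hU₀ := isAffineOpen_preimage (n := n) hW
  obtain ⟨h, hh, hxh⟩ := exists_basicOpen hU₀ hx hxW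
  obtain ⟨m, σ, hσ⟩ := ((H W hW).invIm.localizing hU₀).lift h (res _ hh s)
  obtain ⟨l, hl⟩ := (hM W hW).zero h (secMap (counit (𝔸(Fin n; Y) ↘ Y) M) _ σ) (by
    rw [← secMap_res, hσ, secMap_smul, secMap_res, hs, map_zero, smul_zero])
  rw [← secMap_smul] at hl
  have h1 := mem_opRange_of_counit hW (H W hW) _ hl
  have h2 : opRange (fun k ↦ secMap (diff M k) ((𝔸(Fin n; Y) ↘ Y) ⁻¹ᵁ W)) n ≤
      (secMap ψ ((𝔸(Fin n; Y) ↘ Y) ⁻¹ᵁ W)).ker := opRange_le fun k _ ω ↦ by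
    rw [AddMonoidHom.mem_ker, ← secMap_comp, hψ]
    rfl
  have h3 : secMap ψ _ (h ^ l • σ) = 0 := h2 h1
  refine ⟨_, hh, hxh, smul_cancel (isUnit_resO h le_rfl) (l + m) ?_⟩
  rw [map_zero, smul_zero, ← secMap_res, pow_add, mul_smul, ← secMap_smul, ← hσ, ← secMap_smul,
    ← map_pow, ← res_smul, secMap_res, h3, map_zero]

lemma diff_invImMap {M E : 𝔸(Fin n; Y).Modules} {φ : dirIm M ⟶ dirIm E} {k : Fin n}
    (h : coordEnd M k ≫ φ = φ ≫ coordEnd E k) :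
    diff M k ≫ invImMap φ = invImMap φ ≫ diff E k := by
  have e (N : 𝔸(Fin n; Y).Modules) : diff N k =
    scale _ (AffineSpace.coord Y k) - invImMap (coordEnd N k) := rfl
  rw [e, e, Preadditive.sub_comp, Preadditive.comp_sub, scale_comp, invImMap_comp, invImMap_comp, h]

variable {D D' : GSheaf (linearAct f G)}

/-- The counit presents `D` as the quotient of the inverse image of its direct image by the
difference operators. A map of direct images that commutes with the coordinates carries these
operators to each other and so descends. -/
lemma exists_hom_of_dirIm
    (hD : ∀ W : Y.Opens, IsAffineOpen W → Localizing D.sheaf ((𝔸(Fin n; Y) ↘ Y) ⁻¹ᵁ W))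
    (H : ∀ W : Y.Opens, IsAffineOpen W → HasDualBasis (dirIm D.sheaf) W)
    (φ : dirIm D.sheaf ⟶ dirIm D'.sheaf)
    (hg : ∀ g, gEnd linearAct_over D g ≫ φ = φ ≫ gEnd linearAct_over D' g)
    (hk : ∀ k, coordEnd D.sheaf k ≫ φ = φ ≫ coordEnd D'.sheaf k) :
    ∃ θ : D ⟶ D', counitG linearAct_over D ≫ θ =
      invImMapG linearAct_over φ hg ≫ counitG linearAct_over D' := by
  have := epi_counit hD
  have : Epi (counitG linearAct_over D) := (GSheaf.forget _).epi_of_epi_map this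
  refine ⟨Abelian.epiDesc (counitG linearAct_over D) _ (GSheaf.hom_ext (modHom_ext fun U s ↦ ?_)),
    Abelian.comp_epiDesc _ _ _⟩
  have hψ (k : Fin n) : diff D.sheaf k ≫ invImMap φ ≫ counit (𝔸(Fin n; Y) ↘ Y) D'.sheaf = 0 := by
    rw [← Category.assoc, diff_invImMap (hk k), Category.assoc, diff, delta_counit, comp_zero]
  exact secMap_eq_zero_of_counit hD H hψ
    (secMap (kernel.ι (counitG linearAct_over D)).hom U s)
    (congrArg (fun k ↦ secMap k U s)
      (congrArg GSheaf.Hom.hom (kernel.condition (counitG linearAct_over D))))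

lemma nonempty_iso_of_dirIm
    (hD : ∀ W : Y.Opens, IsAffineOpen W → Localizing D.sheaf ((𝔸(Fin n; Y) ↘ Y) ⁻¹ᵁ W))
    (H : ∀ W : Y.Opens, IsAffineOpen W → HasDualBasis (dirIm D.sheaf) W)
    (hD' : ∀ W : Y.Opens, IsAffineOpen W → Localizing D'.sheaf ((𝔸(Fin n; Y) ↘ Y) ⁻¹ᵁ W))
    (H' : ∀ W : Y.Opens, IsAffineOpen W → HasDualBasis (dirIm D'.sheaf) W)
    (e : dirIm D.sheaf ≅ dirIm D'.sheaf)
    (hg : ∀ g, gEnd linearAct_over D g ≫ e.hom = e.hom ≫ gEnd linearAct_over D' g)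
    (hk : ∀ k, coordEnd D.sheaf k ≫ e.hom = e.hom ≫ coordEnd D'.sheaf k) : Nonempty (D ≅ D') := by
  have hg' (g : G) : gEnd linearAct_over D' g ≫ e.inv = e.inv ≫ gEnd linearAct_over D g := by
    rw [Iso.comp_inv_eq, Category.assoc, hg, e.inv_hom_id_assoc]
  have hk' (k : Fin n) : coordEnd D'.sheaf k ≫ e.inv = e.inv ≫ coordEnd D.sheaf k := by
    rw [Iso.comp_inv_eq, Category.assoc, hk, e.inv_hom_id_assoc]
  obtain ⟨θ, hθ⟩ := exists_hom_of_dirIm hD H e.hom hg hk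
  obtain ⟨θ', hθ'⟩ := exists_hom_of_dirIm hD' H' e.inv hg' hk'
  have := epi_counit hD
  have := epi_counit hD'
  have : Epi (counitG linearAct_over D) := (GSheaf.forget _).epi_of_epi_map ‹_›
  have : Epi (counitG linearAct_over D') := (GSheaf.forget _).epi_of_epi_map ‹_›
  have h1 : invImMapG linearAct_over e.hom hg ≫ invImMapG linearAct_over e.inv hg' = 𝟙 _ :=
    GSheaf.hom_ext (((invImMap_comp (p := 𝔸(Fin n; Y) ↘ Y) e.hom e.inv).trans
      (congrArg invImMap e.hom_inv_id)).trans (invImMap_id _))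
  have h2 : invImMapG linearAct_over e.inv hg' ≫ invImMapG linearAct_over e.hom hg = 𝟙 _ :=
    GSheaf.hom_ext (((invImMap_comp (p := 𝔸(Fin n; Y) ↘ Y) e.inv e.hom).trans
      (congrArg invImMap e.inv_hom_id)).trans (invImMap_id _))
  refine ⟨⟨θ, θ', ?_, ?_⟩⟩
  · rw [← cancel_epi (counitG linearAct_over D), reassoc_of% hθ, hθ', reassoc_of% h1,
      Category.comp_id]
  · rw [← cancel_epi (counitG linearAct_over D'), reassoc_of% hθ', hθ, reassoc_of% h2,
      Category.comp_id]

/-- Both direct images are identified with the same dual, with the same actions, so the composite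
identification commutes with `G` and with the coordinates. -/
lemma IsGnatFamily.nonempty_iso [Finite G] [LocallyOfFiniteType f] {F : GSheaf (linearAct f G)}
    (hD : IsGnatFamily D) (hD' : IsGnatFamily D') (d : DualIso F D) (d' : DualIso F D') :
    Nonempty (D ≅ D') := by
  have key {x : dirIm D.sheaf ⟶ dirIm D.sheaf} {x' : dirIm D'.sheaf ⟶ dirIm D'.sheaf}
      {y : dirDual F.sheaf ⟶ dirDual F.sheaf} (h : x ≫ d.iso.hom = d.iso.hom ≫ y)
      (h' : x' ≫ d'.iso.hom = d'.iso.hom ≫ y) :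
      x ≫ (d.iso ≪≫ d'.iso.symm).hom = (d.iso ≪≫ d'.iso.symm).hom ≫ x' := by
    rw [Iso.trans_hom, Iso.symm_hom, ← Category.assoc, h, Category.assoc, Category.assoc,
      Iso.cancel_iso_hom_left, Iso.comp_inv_eq, Category.assoc, h', d'.iso.inv_hom_id_assoc]
  refine nonempty_iso_of_dirIm (fun W hW ↦ hD.localizing hW) (fun W hW ↦ hD.hasDualBasis hW)
    (fun W hW ↦ hD'.localizing hW) (fun W hW ↦ hD'.hasDualBasis hW) (d.iso ≪≫ d'.iso.symm)
    (fun g ↦ ?_) fun k ↦ ?_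
  · have e (E : GSheaf (linearAct f G)) : gEnd linearAct_over E g = groupEnd E g⁻¹ :=
      congrArg (gEnd linearAct_over E) (inv_inv g).symm
    rw [e, e]
    exact key (d.group g⁻¹) (d'.group g⁻¹)
  · have e (E : GSheaf (linearAct f G)) : coordEnd E.sheaf k = polyEnd E (.X k) :=
      congrArg (fnEnd (𝔸(Fin n; Y) ↘ Y) E.sheaf) (MvPolynomial.eval₂_X _ _ _).symm
    rw [e, e]
    exact key (d.poly _) (d'.poly _)

end Reconstruction

end
end EquivSheaf

/-! ### The proposition -/

theorem proposition2p1 (n : ℕ) (Y : Scheme.{0}) (f : Y ⟶ Spec (.of ℂ))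
    [SmoothOfRelativeDimension n f] [IsSeparated f] [LocallyOfFiniteType f] [QuasiCompact f]
    (G : Subgroup (Matrix.SpecialLinearGroup (Fin n) ℂ)) [Finite G]
    [HasDerivedCategory.{w} (EquivSheaf.GSheaf (EquivSheaf.linearAct f G))]
    (F : EquivSheaf.GSheaf (EquivSheaf.linearAct f G)) (hF : EquivSheaf.IsGnatFamily F) :
    (∃ D : EquivSheaf.GSheaf (EquivSheaf.linearAct f G), EquivSheaf.IsDualFamily F D) ∧
    ∀ D : EquivSheaf.GSheaf (EquivSheaf.linearAct f G), EquivSheaf.IsDualFamily F D →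
      Nonempty ((EquivSheaf.derivedDual F)⟦(n : ℤ)⟧ ≅
        (DerivedCategory.Plus.singleFunctor
          (EquivSheaf.GSheaf (EquivSheaf.linearAct f G)) 0).obj D) := by
  have hD := EquivSheaf.isDualFamily_dualG hF
  refine ⟨⟨_, hD⟩, fun D ⟨hD', e, hg, hr⟩ ↦ ?_⟩
  obtain ⟨e', hg', hr'⟩ := hD.dual
  -- The derived dual has been computed for the particular dual `dualG F`; uniqueness of dual
  -- families carries the result to `D`.
  obtain ⟨i⟩ := hD.gnat.nonempty_iso hD' ⟨e', hg', hr'⟩ ⟨e, hg, hr⟩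
  obtain ⟨j⟩ := EquivSheaf.derivedDual_of_gnatFamily hF
  exact ⟨j ≪≫ (DerivedCategory.Plus.singleFunctor _ 0).mapIso i⟩
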